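/- Let $n\ge 2$, let $\omega\subset\mathbb{R}^{n-1}$ be a bounded domain (in particular, any bounded domain with Lipschitz boundary is allowed), and let $H_\pm$ be real Lipschitz functions on $\overline\omega$. For $h>0$ let $$\Omega^h=\{x=(y,z)\in\mathbb{R}^{n-1}\times\mathbb{R}:\ \eta=h^{-1}y\in\omega,\ \pm z<1+hH_\pm(\eta)\},$$ $$\Gamma^h_\pm=\{x:\ \eta\in\omega,\ \pm z=1+hH_\pm(\eta)\},\qquad \Sigma^h=\partial\Omega^h\setminus\overline{\Gamma^h_+\cup\Gamma^h_-},$$ and let $$\Pi_\pm=\{\xi=(\eta,\zeta):\ \eta\in\omega,\ \zeta>-H_\pm(\eta)\},\quad \Gamma_\pm=\{\xi:\ \eta\in\omega,\ \zeta=-H_\pm(\eta)\},\quad \Sigma_\pm=\partial\Pi_\pm\setminus\overline{\Gamma_\pm}.$$ For an open set $G$ and $S\subset\partial G$, $\mathring H^1(G;S)$ denotes the closure in $H^1(G)$ of the restrictions to $G$ of compactly supported smooth functions vanishing in a neighbourhood of $\overline S$. All functions are real valued, and $(\cdot,\cdot)_G$ is the inner product of $L^2(G)$. Consider the thin-cylinder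 problem $$(\nabla u^h,\nabla v)_{\Omega^h}=\lambda^h(u^h,v)_{\Omega^h}\quad\forall v\in\mathring H^1(\Omega^h;\Sigma^h),\qquad u^h\in\mathring H^1(\Omega^h;\Sigma^h)\setminus\{0\},$$ whose eigenvalues, repeated according to multiplicity, are $\lambda^h_1\le\lambda^h_2\le\dots\to+\infty$, and the two limit problems $$(\nabla U,\nabla V)_{\Pi_\pm}=\Lambda(U,V)_{\Pi_\pm}\quad\forall V\in\mathring H^1(\Pi_\pm;\Sigma_\pm),\qquad U\in\mathring H^1(\Pi_\pm;\Sigma_\pm)\setminus\{0\}.$$ Let $\mu_1$ be the first eigenvalue of the Dirichlet Laplacian in $\omega$, let $\delta_1>0$, and let $$0<\Lambda^{(1)}\le\dots\le\Lambda^{(N)}\le\mu_1-\delta_1$$ be the list of all eigenvalues $\le\mu_1-\delta_1$ of the two limit problems taken together, repeated according to multiplicity. The entry $\Lambda^{(k)}$ comes from the problem in $\Pi_{s_k}$, $s_k\in\{+,-\}$, with eigenfunction $U^{(k)}$, and the eigenfunctions belonging to the same semi-cylinder are orthonormal in $L^2$. Let $\Lambda^{(p)}$ be an eigenvalue of multiplicity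 $\varkappa\ge1$, that is, $p+\varkappa-1\le N$ and $$\Lambda^{(p-1)}<\Lambda^{(p)}=\dots=\Lambda^{(p+\varkappa-1)}<\Lambda^{(p+\varkappa)},$$ where the first (last) inequality is void if $p=1$ (if $p+\varkappa-1=N$). Let $\chi\in C^\infty(\mathbb{R})$ satisfy $0\le\chi\le1$, $\chi(t)=1$ for $t\le\frac13$ and $\chi(t)=0$ for $t\ge\frac23$, and put $$v^h_k(x)=h^{-1/2}\,\chi(1\mp z)\,U^{(k)}\bigl(h^{-1}y,\,h^{-1}(1\mp z)\bigr),\qquad \pm=s_k .$$ Theorem. For every $\tau\in\bigl(0,(\mu_1-\Lambda^{(p)})^{1/2}\bigr)$ there are $c>0$ and $h_0>0$ such that, for every $h\in(0,h_0]$ and every choice of eigenfunctions $u^h_1,u^h_2,\dots$ corresponding to $\lambda^h_1,\lambda^h_2,\dots$ with $(u^h_j,u^h_k)_{\Omega^h}=\delta_{j,k}$, the following two assertions hold. 1. There is an orthogonal $\varkappa\times\varkappa$ matrix $b^h=(b_l^{hr})_{l,r=p}^{p+\varkappa-1}$ such that, for $l=p,\dots,p+\varkappa-1$, the function $u^h_l-h^{-(n-1)/2}\sum_{r=p}^{p+\varkappa-1}b^{hr}_l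 v^h_r$ belongs to $\mathring H^1(\Omega^h;\Sigma^h)$ and $$\Bigl\|u^h_l-h^{-(n-1)/2}\sum_{r=p}^{p+\varkappa-1}b^{hr}_l v^h_r\Bigr\|_{h,\Omega^h}\le c\,h^{-2}\exp\Bigl(-\frac{\tau}{3h}\Bigr),$$ where $\|w\|^2_{h,G}=\|\nabla w\|^2_{L^2(G)}+h^{-2}\|w\|^2_{L^2(G)}$. 2. The eigenfunctions are exponentially localized near the ends: for $l=p,\dots,p+\varkappa-1$ and every $t\in(0,\frac13]$, $$\|u^h_l\|_{h,\,\Omega^h\cap\{|z|<1-t\}}\le c\,h^{-2}\exp\Bigl(-\frac{\tau t}{h}\Bigr).$$ -/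

import Mathlib

open MeasureTheory Filter Topology

noncomputable section

namespace ThinCylinder

/-! ### Sobolev spaces with a Dirichlet condition on a part of the boundary -/

section Sobolev

variable {F : Type*} [NormedAddCommGroup F] [InnerProductSpace ℝ F] [FiniteDimensional ℝ F]
  [MeasurableSpace F] [BorelSpace F]

/-- `G` is a square integrable weak gradient of `u` in the open set `Ω`. -/
def IsWeakGradient (Ω : Set F) (u : F → ℝ) (G : F → F) : Prop :=
  MemLp G 2 (volume.restrict Ω) ∧
    ∀ φ : F → ℝ, ContDiff ℝ (⊤ : ℕ∞) φ → HasCompactSupport φ → tsupport φ ⊆ Ω →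
      ∫ x in Ω, u x • gradient φ x = -∫ x in Ω, φ x • G x

/-- The Sobolev space `H¹(Ω)`. -/
def MemH1 (Ω : Set F) (u : F → ℝ) : Prop :=
  MemLp u 2 (volume.restrict Ω) ∧ ∃ G : F → F, IsWeakGradient Ω u G

open Classical in
/-- The weak gradient of a function of class `H¹(Ω)`; it is unique up to equality a.e. in `Ω`. -/
def weakGrad (Ω : Set F) (u : F → ℝ) : F → F :=
  if hu : ∃ G : F → F, IsWeakGradient Ω u G then hu.choose else 0

/-- The inner product of `L²(Ω)`. -/
def l2Inner (Ω : Set F) (u v : F → ℝ) : ℝ :=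
  ∫ x in Ω, u x * v x

/-- The Dirichlet form `(∇u, ∇v)_Ω`. -/
def dirichletForm (Ω : Set F) (u v : F → ℝ) : ℝ :=
  ∫ x in Ω, inner ℝ (weakGrad Ω u x) (weakGrad Ω v x)

/-- The space `H̊¹(Ω; S)` of functions of class `H¹(Ω)` which vanish on the part `S` of the
boundary: the closure in `H¹(Ω)` of the set of (restrictions to `Ω` of) compactly supported smooth
functions which vanish in a neighbourhood of `S`. -/
def MemH10 (Ω S : Set F) (u : F → ℝ) : Prop :=
  MemH1 Ω u ∧ ∀ ε : ℝ, 0 < ε → ∃ φ : F → ℝ,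
    ContDiff ℝ (⊤ : ℕ∞) φ ∧ HasCompactSupport φ ∧ Disjoint (tsupport φ) (closure S) ∧
      ∫ x in Ω, ((u x - φ x) ^ 2 + ‖weakGrad Ω u x - gradient φ x‖ ^ 2) < ε

/-- `(lam, u)` is an eigenpair of the variational problem
`(∇u, ∇v)_Ω = lam (u, v)_Ω` for all `v ∈ H̊¹(Ω; S)`, i.e. of the Laplace operator with the
Dirichlet condition on `S` and the Neumann condition on the rest of the boundary. -/
def IsEigenpair (Ω S : Set F) (lam : ℝ) (u : F → ℝ) : Prop :=
  MemH10 Ω S u ∧ ¬ (u =ᵐ[volume.restrict Ω] 0) ∧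
    ∀ v : F → ℝ, MemH10 Ω S v → dirichletForm Ω u v = lam * l2Inner Ω u v

/-- `mu1` is the first eigenvalue of the Dirichlet problem in `ω`. -/
def IsFirstDirichletEigenvalue (ω : Set F) (mu1 : ℝ) : Prop :=
  IsLeast {mu : ℝ | ∃ φ : F → ℝ, IsEigenpair ω (frontier ω) mu φ} mu1

/-- `lam 0 ≤ lam 1 ≤ …` is the sequence of all eigenvalues of the problem, repeated according to
multiplicity, and `u 0, u 1, …` are corresponding eigenfunctions which are orthonormal in `L²(Ω)`.
-/
structure IsEigenSystem (Ω S : Set F) (lam : ℕ → ℝ) (u : ℕ → F → ℝ) : Prop where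
  eigenpair : ∀ j, IsEigenpair Ω S (lam j) (u j)
  mono : Monotone lam
  tendsto : Tendsto lam atTop atTop
  orthonormal : ∀ j k, l2Inner Ω (u j) (u k) = if j = k then 1 else 0
  complete : ∀ (mu : ℝ) (w : F → ℝ), IsEigenpair Ω S mu w →
    ∃ (J : Finset ℕ) (a : ℕ → ℝ), (∀ j ∈ J, lam j = mu) ∧
      w =ᵐ[volume.restrict Ω] fun x => ∑ j ∈ J, a j * u j x

/-- The norm given by `‖w‖² = ‖∇w‖²_{L²(Ω)} + h⁻² ‖w‖²_{L²(Ω)}`. -/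
def hNorm (h : ℝ) (Ω : Set F) (w : F → ℝ) : ℝ :=
  Real.sqrt (dirichletForm Ω w w + (h ^ 2)⁻¹ * l2Inner Ω w w)

end Sobolev

/-! ### The thin cylinder and the semi-infinite cylinders -/

/-- The space `ℝᵈ × ℝ` of points `(y, z)`, with the Euclidean norm and Lebesgue measure. -/
abbrev Space (d : ℕ) : Type := WithLp 2 (EuclideanSpace ℝ (Fin d) × ℝ)

/-- The two ends of the cylinder. -/
inductive Side : Type
  | plus : Side
  | minus : Side

/-- The sign `±1` of an end. -/
def Side.sgn : Side → ℝ
  | Side.plus => 1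
  | Side.minus => -1

variable {d : ℕ}

/-- The thin cylinder: `h⁻¹ y ∈ ω` and `± z < 1 + h H_±(h⁻¹ y)`. -/
def thinCyl (ω : Set (EuclideanSpace ℝ (Fin d))) (H : Side → EuclideanSpace ℝ (Fin d) → ℝ)
    (h : ℝ) : Set (Space d) :=
  {x | h⁻¹ • x.fst ∈ ω ∧ ∀ s : Side, s.sgn * x.snd < 1 + h * H s (h⁻¹ • x.fst)}

/-- The curved ends of the thin cylinder. -/
def thinEnd (ω : Set (EuclideanSpace ℝ (Fin d))) (H : Side → EuclideanSpace ℝ (Fin d) → ℝ)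
    (h : ℝ) (s : Side) : Set (Space d) :=
  {x | h⁻¹ • x.fst ∈ ω ∧ s.sgn * x.snd = 1 + h * H s (h⁻¹ • x.fst)}

/-- The lateral side of the thin cylinder. -/
def thinLat (ω : Set (EuclideanSpace ℝ (Fin d))) (H : Side → EuclideanSpace ℝ (Fin d) → ℝ)
    (h : ℝ) : Set (Space d) :=
  frontier (thinCyl ω H h) \
    closure (thinEnd ω H h Side.plus ∪ thinEnd ω H h Side.minus)

/-- The semi-infinite cylinder `η ∈ ω`, `ζ > -H(η)`. -/
def semiCyl (ω : Set (EuclideanSpace ℝ (Fin d))) (H : EuclideanSpace ℝ (Fin d) → ℝ) :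
    Set (Space d) :=
  {ξ | ξ.fst ∈ ω ∧ -H ξ.fst < ξ.snd}

/-- The curved end of the semi-infinite cylinder. -/
def semiEnd (ω : Set (EuclideanSpace ℝ (Fin d))) (H : EuclideanSpace ℝ (Fin d) → ℝ) :
    Set (Space d) :=
  {ξ | ξ.fst ∈ ω ∧ ξ.snd = -H ξ.fst}

/-- The lateral side of the semi-infinite cylinder. -/
def semiLat (ω : Set (EuclideanSpace ℝ (Fin d))) (H : EuclideanSpace ℝ (Fin d) → ℝ) :
    Set (Space d) :=
  frontier (semiCyl ω H) \ closure (semiEnd ω H)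

/-- `Lam 0 ≤ … ≤ Lam (N - 1)` is the list of all eigenvalues in `(0, mu1 - δ]` of the two limit
problems in the semi-infinite cylinders, repeated according to multiplicity; the entry number `k`
comes from the problem at the end `side k` with the eigenfunction `U k`, and the eigenfunctions
which belong to the same semi-infinite cylinder are orthonormal. -/
structure IsLimitEigenList (ω : Set (EuclideanSpace ℝ (Fin d)))
    (H : Side → EuclideanSpace ℝ (Fin d) → ℝ) (mu1 δ : ℝ) (N : ℕ)
    (Lam : ℕ → ℝ) (side : ℕ → Side) (U : ℕ → Space d → ℝ) : Prop where
  eigenpair : ∀ k < N,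
    IsEigenpair (semiCyl ω (H (side k))) (semiLat ω (H (side k))) (Lam k) (U k)
  pos : ∀ k < N, 0 < Lam k
  le : ∀ k < N, Lam k ≤ mu1 - δ
  mono : ∀ j k, j ≤ k → k < N → Lam j ≤ Lam k
  orthonormal : ∀ j < N, ∀ k < N, side j = side k →
    l2Inner (semiCyl ω (H (side k))) (U j) (U k) = if j = k then 1 else 0
  complete : ∀ (s : Side) (M : ℝ) (W : Space d → ℝ),
    IsEigenpair (semiCyl ω (H s)) (semiLat ω (H s)) M W → M ≤ mu1 - δ →
      ∃ (J : Finset ℕ) (a : ℕ → ℝ), (∀ j ∈ J, j < N ∧ side j = s ∧ Lam j = M) ∧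
        W =ᵐ[volume.restrict (semiCyl ω (H s))] fun ξ => ∑ j ∈ J, a j * U j ξ

/-- A smooth cut-off function on the line: `1` on `(-∞, 1/3]`, `0` on `[2/3, ∞)`. -/
structure IsCutoff (χ : ℝ → ℝ) : Prop where
  smooth : ContDiff ℝ (⊤ : ℕ∞) χ
  eq_one : ∀ t, t ≤ 1 / 3 → χ t = 1
  eq_zero : ∀ t, 2 / 3 ≤ t → χ t = 0
  nonneg : ∀ t, 0 ≤ χ t
  le_one : ∀ t, χ t ≤ 1

/-- The cut-off, rescaled trapped mode
`v(y, z) = h^{-1/2} χ(1 ∓ z) U(h⁻¹ y, h⁻¹ (1 ∓ z))`. -/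
def cutMode (χ : ℝ → ℝ) (h : ℝ) (s : Side) (U : Space d → ℝ) : Space d → ℝ := fun x =>
  h ^ (-(1 / 2) : ℝ) * χ (1 - s.sgn * x.snd) *
    U (WithLp.toLp 2 (h⁻¹ • x.fst, h⁻¹ * (1 - s.sgn * x.snd)))

end ThinCylinder

end

/-!
Multiply a function in the thin cylinder by a cut-off near the end `s` and stretch it by `h⁻¹`: it
becomes a function in the semi-infinite cylinder, and `h² λʰ` becomes a spectral parameter of the
limit problem. The proof compares the two problems at this level. A function `u` of class `H¹` is
encoded as the pair `(u, h ∇u)`, extended by zero to the whole space, so that all problems become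
weak eigenvalue problems `⟪x.2, y.2⟫ = μ ⟪x.1, y.1⟫` on a closed subspace `formDomain h Ω S` of
`L² × L²` (`isWeakEig_lift`, `isEigenpair_of_isWeakEig`), and `h ‖u‖_{h, Ω}` is the norm of the
pair.

*Abstract part.* `exists_orthogonal_quasimodes`: suppose that the form exceeds
`(Λ + g) ‖x.1‖²` up to finitely many squares `⟪Φ k, x⟫²`, and that the `Φ k` are orthonormal and
satisfy the eigenvalue equation with the parameters `Λ k`, both up to an error `ε`. Then there are
as many eigenvalues below `Λ + g / 2` as there are vectors `Φ k`; the eigenvectors which correspond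
to the cluster at `Λ` are within `O(ε)` of combinations of the corresponding `Φ k`, and
orthogonalizing the matrix of coefficients costs again `O(ε)`. No convergence of the eigenvalues
themselves has to be proved beforehand.

*The gap.* On a cross-section of a cylinder which misses the curved ends every function in the form
domain vanishes on the whole boundary, hence the form controls `μ₁` times the square of the norm
there (`slice_poincare`). In a semi-infinite cylinder what remains is a bounded piece, on which
Rellich's theorem `exists_rellich_formDomain` gives control up to finitely many functionals. Near the
curved end the cylinder may be irregular, since `ω` is an arbitrary bounded domain, so the trace of a
function at the end is not used: `layer_estimate` bounds the mass in a thin layer along the end by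
the energy, and the rest of the piece lies away from it, where extension by zero is harmless. The
resulting inequality (`semi_gap`) makes the spectrum below `μ₁` discrete, and `semi_limit_gap` turns
it into a gap above `Λ` modulo the trapped modes. A partition of unity transports the gap to the
thin cylinder (`thin_gap`).

*Decay.* Testing the eigenvalue equation with `e^{2W} u`, where `|h ∇W| ≤ τ`, and using the same
Poincaré inequality where `W` is large gives `‖e^W u‖ ≤ C` as long as `λ + τ² < μ₁`
(`agmon_estimate`). In the semi-infinite cylinders this makes the cut-off modes quasimodes with an
error `O(e^{-τ/(3h)})` (`exists_quasimodes`), because the cut-off function is constant up to the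
height `1/(3h)`; in the thin cylinder it is the second assertion (`thin_decay`).
-/

set_option linter.unusedSectionVars false

noncomputable section

namespace ThinCylinder

open scoped RealInnerProductSpace ENNReal

/-! ### Weak eigenpairs of a closed quadratic form -/

section Abstract

variable {L M : Type*} [NormedAddCommGroup L] [InnerProductSpace ℝ L]
  [NormedAddCommGroup M] [InnerProductSpace ℝ M]

/-- Weak eigenpairs of a quadratic form, given by its domain `K`: an element of `K` is a pair
`x = (x.1, x.2)` of a function and its gradient, and the form is `‖x.2‖²`. -/
structure IsWeakEig (K : Submodule ℝ (L × M)) (μ : ℝ) (x : L × M) : Prop where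
  mem : x ∈ K
  ne_zero : x.1 ≠ 0
  eq : ∀ y ∈ K, ⟪x.2, y.2⟫ = μ * ⟪x.1, y.1⟫

lemma fst_sum_smul {J : Type*} (s : Finset J) (a : J → ℝ) (e : J → L × M) :
    (∑ j ∈ s, a j • e j).1 = ∑ j ∈ s, a j • (e j).1 := by
  simp [Prod.fst_sum]

lemma snd_sum_smul {J : Type*} (s : Finset J) (a : J → ℝ) (e : J → L × M) :
    (∑ j ∈ s, a j • e j).2 = ∑ j ∈ s, a j • (e j).2 := by
  simp [Prod.snd_sum]

lemma norm_add_sq_expand {V : Type*} [NormedAddCommGroup V] [InnerProductSpace ℝ V] (x y : V)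
    (t : ℝ) : ‖x + t • y‖ ^ 2 = ‖x‖ ^ 2 + 2 * t * ⟪x, y⟫ + t ^ 2 * ‖y‖ ^ 2 := by
  rw [norm_add_sq_real, inner_smul_right, norm_smul, mul_pow, Real.norm_eq_abs, sq_abs]
  ring

/-- The constrained minimum of the Rayleigh quotient on the orthogonal complement of eigenvectors
is an eigenvalue: the Lagrange multipliers of the constraints vanish. -/
lemma isWeakEig_of_isMin {K : Submodule ℝ (L × M)} {J : Type*} [Fintype J] [DecidableEq J]
    {e : J → L × M} {l : J → ℝ} (he : ∀ j, IsWeakEig K (l j) (e j))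
    (ho : ∀ i j, ⟪(e i).1, (e j).1⟫ = if i = j then (1 : ℝ) else 0)
    {μ : ℝ} {x : L × M} (hx : x ∈ K) (hx1 : x.1 ≠ 0) (hxe : ∀ j, ⟪(e j).1, x.1⟫ = 0)
    (hxμ : ‖x.2‖ ^ 2 = μ * ‖x.1‖ ^ 2)
    (hmin : ∀ y ∈ K, (∀ j, ⟪(e j).1, y.1⟫ = 0) → μ * ‖y.1‖ ^ 2 ≤ ‖y.2‖ ^ 2) :
    IsWeakEig K μ x := by
  -- First variation: a non-negative quadratic polynomial in `t` which vanishes at `0` has no linear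
  -- term.
  have key : ∀ y ∈ K, (∀ j, ⟪(e j).1, y.1⟫ = 0) → ⟪x.2, y.2⟫ = μ * ⟪x.1, y.1⟫ := by
    intro y hy hye
    have h1 : ∀ t : ℝ, 0 ≤ (‖y.2‖ ^ 2 - μ * ‖y.1‖ ^ 2) * (t * t)
        + (2 * (⟪x.2, y.2⟫ - μ * ⟪x.1, y.1⟫)) * t + 0 := by
      intro t
      have := hmin (x + t • y) (K.add_mem hx (K.smul_mem t hy)) (fun j => by
        simp [inner_add_right, inner_smul_right, hxe, hye])
      simp only [Prod.fst_add, Prod.snd_add, Prod.smul_fst, Prod.smul_snd,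
        norm_add_sq_expand] at this
      nlinarith
    have := discrim_le_zero h1
    unfold discrim at this
    nlinarith [sq_nonneg (⟪x.2, y.2⟫ - μ * ⟪x.1, y.1⟫)]
  refine ⟨hx, hx1, fun y hy => ?_⟩
  -- Split off the components along the given eigenvectors; both sides of the equation vanish on
  -- them.
  set z : L × M := ∑ j, ⟪(e j).1, y.1⟫ • e j with hz
  have hzK : z ∈ K := K.sum_mem fun j _ => K.smul_mem _ (he j).mem
  have h2 : ⟪x.2, (y - z).2⟫ = μ * ⟪x.1, (y - z).1⟫ := by
    refine key _ (K.sub_mem hy hzK) fun j => ?_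
    rw [hz, Prod.fst_sub, fst_sum_smul, inner_sub_right, inner_sum]
    simp [inner_smul_right, ho]
  have h3 : ⟪x.2, z.2⟫ = 0 := by
    rw [hz, snd_sum_smul, inner_sum]
    refine Finset.sum_eq_zero fun j _ => ?_
    rw [inner_smul_right, real_inner_comm (e j).2 x.2, (he j).eq x hx, hxe j]; simp
  have h4 : ⟪x.1, z.1⟫ = 0 := by
    rw [hz, fst_sum_smul, inner_sum]
    refine Finset.sum_eq_zero fun j _ => ?_
    rw [inner_smul_right, real_inner_comm (e j).1 x.1, hxe j]; simp
  simp only [Prod.fst_sub, Prod.snd_sub, inner_sub_right, h3, h4, sub_zero] at h2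
  exact h2

/-- A minimizing sequence of normalized vectors, along which the finitely many functionals of a
spectral gap inequality converge, is a Cauchy sequence by the parallelogram law. -/
lemma cauchySeq_of_minimizing {K : Submodule ℝ (L × M)} {ι : Type*} [Fintype ι]
    {ψ : ι → L} {C M₀ μ : ℝ}
    (hgap : ∀ x ∈ K, M₀ * ‖x.1‖ ^ 2 - C * ∑ i, ⟪ψ i, x.1⟫ ^ 2 ≤ ‖x.2‖ ^ 2)
    (hμ : μ < M₀) {x : ℕ → L × M} (hx : ∀ n, x n ∈ K) (hx1 : ∀ n, ‖(x n).1‖ = 1)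
    (hmin : ∀ n m, μ * ‖(x n + x m).1‖ ^ 2 ≤ ‖(x n + x m).2‖ ^ 2)
    (hlim : Tendsto (fun n => ‖(x n).2‖ ^ 2) atTop (𝓝 μ))
    {t : ι → ℝ} (ht : ∀ i, Tendsto (fun n => ⟪ψ i, (x n).1⟫) atTop (𝓝 (t i))) :
    CauchySeq x := by
  set R : ℕ × ℕ → ℝ := fun q => C * ∑ i, (⟪ψ i, (x q.1).1⟫ - ⟪ψ i, (x q.2).1⟫) ^ 2
    with hR
  set S : ℕ × ℕ → ℝ := fun q => 2 * (‖(x q.1).2‖ ^ 2 - μ) + 2 * (‖(x q.2).2‖ ^ 2 - μ) with hS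
  have h1 : Tendsto (Prod.fst : ℕ × ℕ → ℕ) atTop atTop := by
    rw [← prod_atTop_atTop_eq]; exact tendsto_fst
  have h2 : Tendsto (Prod.snd : ℕ × ℕ → ℕ) atTop atTop := by
    rw [← prod_atTop_atTop_eq]; exact tendsto_snd
  have hRlim : Tendsto R atTop (𝓝 0) := by
    have : Tendsto R atTop (𝓝 (C * ∑ i, (t i - t i) ^ 2)) := by
      refine Tendsto.const_mul _ (tendsto_finsetSum _ fun i _ => Tendsto.pow ?_ 2)
      exact ((ht i).comp h1).sub ((ht i).comp h2)
    simpa using this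
  have hSlim : Tendsto S atTop (𝓝 0) := by
    have : Tendsto S atTop (𝓝 (2 * (μ - μ) + 2 * (μ - μ))) :=
      (((hlim.comp h1).sub_const μ).const_mul 2).add (((hlim.comp h2).sub_const μ).const_mul 2)
    simpa using this
  -- The parallelogram law in both components, with minimality applied to the sum.
  have hpar : ∀ q : ℕ × ℕ, ‖(x q.1 - x q.2).2‖ ^ 2 ≤ μ * ‖(x q.1 - x q.2).1‖ ^ 2 + S q := by
    intro q
    have e1 := parallelogram_law_with_norm ℝ (x q.1).2 (x q.2).2
    have e2 := parallelogram_law_with_norm ℝ (x q.1).1 (x q.2).1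
    have e3 := hmin q.1 q.2
    simp only [Prod.fst_add, Prod.snd_add, Prod.fst_sub, Prod.snd_sub, hx1, hS] at e1 e2 e3 ⊢
    linear_combination e1 + e3 - μ * e2
  have hd1 : Tendsto (fun q : ℕ × ℕ => ‖(x q.1 - x q.2).1‖ ^ 2) atTop (𝓝 0) := by
    have hb : Tendsto (fun q => (M₀ - μ)⁻¹ * (R q + S q)) atTop (𝓝 0) := by
      simpa using (hRlim.add hSlim).const_mul (M₀ - μ)⁻¹
    refine squeeze_zero (fun q => by positivity) (fun q => ?_) hb
    have e1 := hgap (x q.1 - x q.2) (K.sub_mem (hx _) (hx _))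
    have e2 := hpar q
    have e3 : 0 < M₀ - μ := sub_pos.2 hμ
    simp only [Prod.fst_sub, Prod.snd_sub, inner_sub_right] at e1 e2 ⊢
    rw [← div_eq_inv_mul, le_div_iff₀ e3]
    simp only [hR]
    linarith
  have hd2 : Tendsto (fun q : ℕ × ℕ => ‖(x q.1 - x q.2).2‖ ^ 2) atTop (𝓝 0) := by
    have hb : Tendsto (fun q => μ * ‖(x q.1 - x q.2).1‖ ^ 2 + S q) atTop (𝓝 0) := by
      simpa using (hd1.const_mul μ).add hSlim
    exact squeeze_zero (fun q => by positivity) hpar hb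
  rw [cauchySeq_iff_tendsto_dist_atTop_0]
  have e1 := (Real.continuous_sqrt.tendsto 0).comp hd1
  have e2 := (Real.continuous_sqrt.tendsto 0).comp hd2
  simp only [Real.sqrt_zero, Function.comp_def, Real.sqrt_sq (norm_nonneg _)] at e1 e2
  have e3 := e1.max e2
  simp only [max_self] at e3
  refine e3.congr fun q => ?_
  rw [dist_eq_norm, Prod.norm_def]

/-- If a closed form is bounded below by `M₀ > m` up to finitely many functionals, then on the
orthogonal complement of given eigenvectors either there is an eigenvalue which is at most `m`, or
the form is bounded below by a number greater than `m`. -/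
lemma exists_isWeakEig_or_gap [CompleteSpace L] [CompleteSpace M] {K : Submodule ℝ (L × M)}
    (hK : IsClosed (K : Set (L × M)))
    {ι : Type*} [Fintype ι] {ψ : ι → L} {C M₀ m : ℝ}
    (hgap : ∀ x ∈ K, M₀ * ‖x.1‖ ^ 2 - C * ∑ i, ⟪ψ i, x.1⟫ ^ 2 ≤ ‖x.2‖ ^ 2) (hm : m < M₀)
    {J : Type*} [Fintype J] [DecidableEq J]
    {e : J → L × M} {l : J → ℝ} (he : ∀ j, IsWeakEig K (l j) (e j))
    (ho : ∀ i j, ⟪(e i).1, (e j).1⟫ = if i = j then (1 : ℝ) else 0) :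
    (∃ μ ≤ m, ∃ y, IsWeakEig K μ y ∧ ∀ j, ⟪(e j).1, y.1⟫ = 0) ∨
    (∃ ε > 0, ∀ x ∈ K, (∀ j, ⟪(e j).1, x.1⟫ = 0) → (m + ε) * ‖x.1‖ ^ 2 ≤ ‖x.2‖ ^ 2) := by
  set S : Set ℝ := {r | ∃ x ∈ K, (∀ j, ⟪(e j).1, x.1⟫ = 0) ∧ ‖x.1‖ = 1 ∧ r = ‖x.2‖ ^ 2} with hS
  have hbdd : BddBelow S := ⟨0, by rintro r ⟨x, -, -, -, rfl⟩; positivity⟩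
  -- By homogeneity a lower bound on the normalized vectors is a bound for the quadratic form.
  have hlow : ∀ c : ℝ, (∀ r ∈ S, c ≤ r) → ∀ x ∈ K, (∀ j, ⟪(e j).1, x.1⟫ = 0) →
      c * ‖x.1‖ ^ 2 ≤ ‖x.2‖ ^ 2 := by
    intro c hc x hx hxe
    by_cases h0 : x.1 = 0
    · simp only [h0, norm_zero]; nlinarith [sq_nonneg ‖x.2‖]
    have hn : ‖x.1‖ ≠ 0 := norm_ne_zero_iff.2 h0
    have := hc (‖(‖x.1‖⁻¹ • x).2‖ ^ 2) ⟨‖x.1‖⁻¹ • x, K.smul_mem _ hx, fun j => by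
      simp [inner_smul_right, hxe], by simp [norm_smul, hn], rfl⟩
    rw [Prod.smul_snd, norm_smul, mul_pow, norm_inv, norm_norm, inv_pow, ← div_eq_inv_mul,
      le_div_iff₀ (by positivity)] at this
    exact this
  by_cases hne : S.Nonempty
  swap
  · right
    refine ⟨1, one_pos, hlow _ fun r hr => (hne ⟨r, hr⟩).elim⟩
  by_cases hμ : sInf S ≤ m
  swap
  · right
    refine ⟨sInf S - m, by linarith [not_le.1 hμ], hlow _ fun r hr => ?_⟩
    rw [add_sub_cancel]; exact csInf_le hbdd hr
  left
  set μ := sInf S with hμdef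
  have hmin : ∀ x ∈ K, (∀ j, ⟪(e j).1, x.1⟫ = 0) → μ * ‖x.1‖ ^ 2 ≤ ‖x.2‖ ^ 2 :=
    hlow _ fun r hr => csInf_le hbdd hr
  -- Take a minimizing sequence, and a subsequence along which the functionals `ψ i` converge.
  obtain ⟨r, -, hr1, hr2⟩ := exists_seq_tendsto_sInf hne hbdd
  choose x hxK hxe hx1 hxr using hr2
  have hbd : Bornology.IsBounded (Metric.closedBall (0 : ι → ℝ) (∑ i, ‖ψ i‖)) :=
    Metric.isBounded_closedBall
  obtain ⟨t, -, φ, hφ, hφt⟩ := tendsto_subseq_of_bounded hbd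
    (x := fun n i => ⟪ψ i, (x n).1⟫) (fun n => by
      rw [mem_closedBall_zero_iff, pi_norm_le_iff_of_nonneg (by positivity)]
      intro i
      refine (norm_inner_le_norm _ _).trans ?_
      rw [hx1, mul_one]
      exact Finset.single_le_sum (f := fun i => ‖ψ i‖) (fun _ _ => norm_nonneg _)
        (Finset.mem_univ i))
  have hc : CauchySeq (fun n => x (φ n)) := by
    refine cauchySeq_of_minimizing hgap (hμ.trans_lt hm) (fun n => hxK _) (fun n => hx1 _)
      (fun n k => hmin _ (K.add_mem (hxK _) (hxK _)) fun j => ?_) ?_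
      (t := t) fun i => (tendsto_pi_nhds.1 hφt) i
    · simp [inner_add_right, hxe]
    · have := hr1.comp hφ.tendsto_atTop
      refine this.congr fun n => ?_
      simp [hxr]
  obtain ⟨y, hy⟩ := cauchySeq_tendsto_of_complete hc
  have hyK : y ∈ K := hK.mem_of_tendsto hy (Eventually.of_forall fun n => hxK _)
  have hy1 : Tendsto (fun n => (x (φ n)).1) atTop (𝓝 y.1) := (continuous_fst.tendsto y).comp hy
  have hy2 : Tendsto (fun n => (x (φ n)).2) atTop (𝓝 y.2) := (continuous_snd.tendsto y).comp hy
  have hn1 : ‖y.1‖ = 1 := tendsto_nhds_unique hy1.norm (by simp [hx1])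
  have hye : ∀ j, ⟪(e j).1, y.1⟫ = 0 := fun j =>
    tendsto_nhds_unique
    ((tendsto_const_nhds (x := (e j).1)).inner hy1) (by simp [hxe])
  have hn2 : ‖y.2‖ ^ 2 = μ := by
    refine tendsto_nhds_unique (hy2.norm.pow 2) ?_
    refine (hr1.comp hφ.tendsto_atTop).congr fun n => ?_
    simp [hxr]
  refine ⟨μ, hμ, y, isWeakEig_of_isMin he ho hyK ?_ hye ?_ hmin, hye⟩
  · rw [← norm_ne_zero_iff, hn1]; exact one_ne_zero
  · rw [hn1, hn2]; ring

lemma snd_norm_sq_sum {K : Submodule ℝ (L × M)} {J : Type*} [DecidableEq J] (s : Finset J)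
    {e : J → L × M} {l : J → ℝ} (he : ∀ j, IsWeakEig K (l j) (e j))
    (ho : ∀ i j, ⟪(e i).1, (e j).1⟫ = if i = j then (1 : ℝ) else 0) (a : J → ℝ) :
    ‖(∑ j ∈ s, a j • e j).1‖ ^ 2 = ∑ j ∈ s, a j ^ 2 ∧
    ‖(∑ j ∈ s, a j • e j).2‖ ^ 2 = ∑ j ∈ s, l j * a j ^ 2 := by
  have h1 : ∀ i j, ⟪(e i).2, (e j).2⟫ = l i * if i = j then (1 : ℝ) else 0 := fun i j => by
    rw [(he i).eq _ (he j).mem, ho]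
  constructor
  · rw [← real_inner_self_eq_norm_sq, fst_sum_smul, sum_inner]
    refine Finset.sum_congr rfl fun i hi => ?_
    rw [inner_sum]
    simp [inner_smul_left, inner_smul_right, ho, hi, sq]
  · rw [← real_inner_self_eq_norm_sq, snd_sum_smul, sum_inner]
    refine Finset.sum_congr rfl fun i hi => ?_
    rw [inner_sum]
    simp [inner_smul_left, inner_smul_right, h1, hi]
    ring

/-- A form which is bounded below by `M₀` up to `n` functionals has at most `n` eigenvalues
below `M₀`. -/
lemma lt_of_gap {K : Submodule ℝ (L × M)} {n : ℕ} {ψ : Fin n → L} {C M₀ m : ℝ}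
    (hgap : ∀ x ∈ K, M₀ * ‖x.1‖ ^ 2 - C * ∑ i, ⟪ψ i, x.1⟫ ^ 2 ≤ ‖x.2‖ ^ 2) (hm : m < M₀)
    {e : ℕ → L × M} {l : ℕ → ℝ} (hl : Monotone l) (he : ∀ j, IsWeakEig K (l j) (e j))
    (ho : ∀ i j, ⟪(e i).1, (e j).1⟫ = if i = j then (1 : ℝ) else 0) : m < l n := by
  by_contra! hle
  -- A combination of `n + 1` eigenvectors is annihilated by all the `n` functionals.
  let T : (Fin (n + 1) → ℝ) →ₗ[ℝ] (Fin n → ℝ) :=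
    LinearMap.pi fun i => ∑ j : Fin (n + 1), ⟪ψ i, (e j).1⟫ • LinearMap.proj j
  obtain ⟨a, ha, ha0⟩ := (Submodule.ne_bot_iff _).1
    (LinearMap.ker_ne_bot_of_finrank_lt (f := T) (by simp))
  rw [LinearMap.mem_ker] at ha
  have hT : ∀ i, ∑ j : Fin (n + 1), ⟪ψ i, (e j).1⟫ * a j = 0 := fun i => by
    have := congrFun ha i
    simpa [T] using this
  have ho' : ∀ i j : Fin (n + 1), ⟪(e i).1, (e j).1⟫ = if i = j then (1 : ℝ) else 0 :=
    fun i j => by rw [ho]; simp [Fin.ext_iff]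
  obtain ⟨h1, h2⟩ := snd_norm_sq_sum Finset.univ (fun j : Fin (n + 1) => he j) ho' a
  have h3 := hgap (∑ j : Fin (n + 1), a j • e j) (K.sum_mem fun j _ => K.smul_mem _ (he j).mem)
  have h4 : ∀ i, ⟪ψ i, (∑ j : Fin (n + 1), a j • e j).1⟫ = 0 := fun i => by
    rw [fst_sum_smul, inner_sum, ← hT i]
    refine Finset.sum_congr rfl fun j _ => ?_
    rw [inner_smul_right, mul_comm]
  simp only [h4, h1, h2] at h3
  have h5 : ∑ j : Fin (n + 1), l j * a j ^ 2 ≤ m * ∑ j, a j ^ 2 := by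
    rw [Finset.mul_sum]
    refine Finset.sum_le_sum fun j _ => mul_le_mul_of_nonneg_right ?_ (sq_nonneg _)
    exact (hl (Nat.lt_succ_iff.1 j.2)).trans hle
  have h6 : 0 < ∑ j, a j ^ 2 := by
    obtain ⟨j, hj⟩ := Function.ne_iff.1 ha0
    exact Finset.sum_pos' (fun _ _ => sq_nonneg _) ⟨j, Finset.mem_univ _, by
      have : a j ≠ 0 := hj
      positivity⟩
  simp at h3
  nlinarith

end Abstract

/-! ### Orthogonal approximation of eigenvectors by quasimodes -/

lemma abs_one_sub_inv_sqrt_le {D : ℝ} (hD : 1 / 2 ≤ D) : |1 - (√D)⁻¹| ≤ |D - 1| := by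
  have h0 : 0 < √D := Real.sqrt_pos.2 (by linarith)
  have h1 : √D * √D = D := Real.mul_self_sqrt (by linarith)
  have h2 : 1 / 2 ≤ √D := by nlinarith
  have h3 : (1 - (√D)⁻¹) * (D + √D) = D - 1 := by
    have h4 : (√D)⁻¹ * √D = 1 := inv_mul_cancel₀ h0.ne'
    linear_combination -h4 + (√D)⁻¹ * h1 - h4 * √D
  rw [← h3, abs_mul, abs_of_pos (a := D + √D) (by linarith)]
  nlinarith [abs_nonneg (1 - (√D)⁻¹)]

/-- A quadratic form whose matrix has entries of size at most `η` is at most `η` times the dimension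
times the square of the norm. -/
lemma abs_sum_sum_le {J : Type*} [Fintype J] {E : J → J → ℝ} {η : ℝ} (hE : ∀ i j, |E i j| ≤ η)
    (a : J → ℝ) : |∑ i, ∑ j, a i * a j * E i j| ≤ η * (Fintype.card J * ∑ i, a i ^ 2) := by
  have h1 : |∑ i, ∑ j, a i * a j * E i j| ≤ ∑ i, ∑ j, |a i| * |a j| * η := by
    refine (Finset.abs_sum_le_sum_abs _ _).trans (Finset.sum_le_sum fun i _ => ?_)
    refine (Finset.abs_sum_le_sum_abs _ _).trans (Finset.sum_le_sum fun j _ => ?_)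
    rw [abs_mul, abs_mul]
    exact mul_le_mul_of_nonneg_left (hE i j) (by positivity)
  have h2 : ∑ i, ∑ j, |a i| * |a j| * η = η * (∑ i, |a i|) ^ 2 := by
    rw [sq, Finset.sum_mul_sum, Finset.mul_sum]
    refine Finset.sum_congr rfl fun i _ => ?_
    rw [Finset.mul_sum]
    exact Finset.sum_congr rfl fun j _ => by ring
  have h3 : (∑ i, |a i|) ^ 2 ≤ Fintype.card J * ∑ i, a i ^ 2 := by
    have := sq_sum_le_card_mul_sum_sq (s := Finset.univ) (f := fun i => |a i|)
    simpa [sq_abs] using this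
  rcases isEmpty_or_nonempty J with hJ | ⟨⟨j⟩⟩
  · simp
  have h4 : 0 ≤ η := (abs_nonneg _).trans (hE j j)
  rw [h2] at h1
  exact h1.trans (mul_le_mul_of_nonneg_left h3 h4)

/-- A square matrix whose rows are almost orthonormal is close to an orthogonal matrix, namely to
the orthogonal factor of its polar decomposition. -/
lemma exists_orthogonal_near {κ : ℕ} (A : Matrix (Fin κ) (Fin κ) ℝ) {η : ℝ}
    (hη : κ * η ≤ 1 / 2) (hA : ∀ i j, |(A * A.transpose - 1) i j| ≤ η) :
    ∃ O ∈ Matrix.orthogonalGroup (Fin κ) ℝ, ∀ i j, |A i j - O i j| ≤ 2 * κ ^ 2 * η := by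
  have hS : (A * A.transpose).IsHermitian := by
    rw [← Matrix.conjTranspose_eq_transpose_of_trivial]
    exact Matrix.isHermitian_mul_conjTranspose_self A
  set V : Matrix (Fin κ) (Fin κ) ℝ := (hS.eigenvectorUnitary : Matrix (Fin κ) (Fin κ) ℝ) with hV
  have hV1 : V * V.transpose = 1 := by
    have := Matrix.mem_orthogonalGroup_iff (Fin κ) ℝ |>.1 hS.eigenvectorUnitary.2
    simpa [Matrix.star_eq_conjTranspose] using this
  have hV2 : V.transpose * V = 1 := mul_eq_one_comm.1 hV1
  set D : Fin κ → ℝ := hS.eigenvalues with hD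
  have hsp : A * A.transpose = V * Matrix.diagonal D * V.transpose := by
    have := hS.spectral_theorem
    rw [Unitary.conjStarAlgAut_apply] at this
    simpa [Matrix.star_eq_conjTranspose, Function.comp_def] using this
  have hsp' : V.transpose * (A * A.transpose) * V = Matrix.diagonal D := by
    rw [hsp]
    calc V.transpose * (V * Matrix.diagonal D * V.transpose) * V
        = (V.transpose * V) * Matrix.diagonal D * (V.transpose * V) := by
          simp only [Matrix.mul_assoc]
      _ = _ := by rw [hV2]; simp
  have hcol : ∀ i, ∑ j, V j i ^ 2 = 1 := fun i => by
    have := congrFun (congrFun hV2 i) i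
    simpa [Matrix.mul_apply, sq] using this
  have hD1 : ∀ i, |D i - 1| ≤ κ * η := fun i => by
    have h1 : V.transpose * (A * A.transpose - 1) * V = Matrix.diagonal D - 1 := by
      rw [Matrix.mul_sub, Matrix.sub_mul, hsp', Matrix.mul_one, hV2]
    have h2 := congrFun (congrFun h1 i) i
    have h3 : D i - 1 = ∑ k, ∑ j, V k i * V j i * (A * A.transpose - 1) j k := by
      rw [Matrix.sub_apply, Matrix.diagonal_apply_eq, Matrix.one_apply_eq] at h2
      rw [← h2, Matrix.mul_apply]
      refine Finset.sum_congr rfl fun k _ => ?_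
      rw [Matrix.mul_apply, Finset.sum_mul]
      exact Finset.sum_congr rfl fun j _ => by rw [Matrix.transpose_apply]; ring
    rw [h3]
    have := abs_sum_sum_le (E := fun k j => (A * A.transpose - 1) j k) (fun k j => hA j k)
      (fun k => V k i)
    rw [hcol, mul_one, Fintype.card_fin] at this
    linarith
  have hD2 : ∀ i, 1 / 2 ≤ D i := fun i => by have := (abs_le.1 (hD1 i)).1; linarith
  have hD3 : ∀ i, D i ≤ 3 / 2 := fun i => by have := (abs_le.1 (hD1 i)).2; linarith
  -- `V * Q * Vᵀ` is the inverse square root of `A * Aᵀ`, and its product with `A` is the orthogonal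
  -- factor.
  set Q : Matrix (Fin κ) (Fin κ) ℝ := Matrix.diagonal fun i => (√(D i))⁻¹ with hQ
  have hQD : Q * Matrix.diagonal D * Q = 1 := by
    rw [hQ, Matrix.diagonal_mul_diagonal, Matrix.diagonal_mul_diagonal, ← Matrix.diagonal_one]
    congr 1
    funext i
    have h0 : √(D i) ≠ 0 := (Real.sqrt_pos.2 (by linarith [hD2 i])).ne'
    have h1 : D i = √(D i) * √(D i) := (Real.mul_self_sqrt (by linarith [hD2 i])).symm
    rw [h1, Real.sqrt_mul_self (Real.sqrt_nonneg _)]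
    field_simp
  refine ⟨V * Q * (V.transpose * A), ?_, fun i j => ?_⟩
  · rw [Matrix.mem_orthogonalGroup_iff, Matrix.transpose_mul, Matrix.transpose_mul,
      Matrix.transpose_mul, Matrix.transpose_transpose, hQ, Matrix.diagonal_transpose, ← hQ]
    calc V * Q * (V.transpose * A) * (A.transpose * V * (Q * V.transpose))
        = V * (Q * (V.transpose * (A * A.transpose) * V) * Q) * V.transpose := by
          simp only [Matrix.mul_assoc]
      _ = 1 := by rw [hsp', hQD, Matrix.mul_one, hV1]
  · have h1 : A - V * Q * (V.transpose * A) = V * ((1 - Q) * (V.transpose * A)) := by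
      rw [Matrix.sub_mul, Matrix.mul_sub, Matrix.one_mul, ← Matrix.mul_assoc V V.transpose A, hV1,
        Matrix.one_mul, Matrix.mul_assoc]
    have h2 := congrFun (congrFun h1 i) j
    rw [Matrix.sub_apply] at h2
    rw [h2, Matrix.mul_apply]
    have hterm : ∀ k, |V i k * ((1 - Q) * (V.transpose * A)) k j| ≤ κ * η * 2 := fun k => by
      have e1 : ((1 - Q) * (V.transpose * A)) k j
          = (1 - (√(D k))⁻¹) * (V.transpose * A) k j := by
        rw [hQ, ← Matrix.diagonal_one, Matrix.diagonal_sub, Matrix.diagonal_mul]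
      have e2 : |V i k| ≤ 1 := by
        have : V i k ^ 2 ≤ 1 := by
          rw [← hcol k]
          exact Finset.single_le_sum (f := fun j => V j k ^ 2) (fun _ _ => sq_nonneg _)
            (Finset.mem_univ i)
        exact abs_le_one_iff_mul_self_le_one.2 (by nlinarith)
      have e3 : |(V.transpose * A) k j| ≤ 2 := by
        have h3 : ∑ j, (V.transpose * A) k j ^ 2 = D k := by
          have : (V.transpose * A) * (V.transpose * A).transpose = Matrix.diagonal D := by
            rw [Matrix.transpose_mul, Matrix.transpose_transpose, ← hsp']
            simp only [Matrix.mul_assoc]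
          have := congrFun (congrFun this k) k
          rw [Matrix.diagonal_apply_eq, Matrix.mul_apply] at this
          rw [← this]
          exact Finset.sum_congr rfl fun j _ => by rw [Matrix.transpose_apply]; ring
        have h4 : (V.transpose * A) k j ^ 2 ≤ D k := by
          rw [← h3]
          exact Finset.single_le_sum (f := fun j => (V.transpose * A) k j ^ 2)
            (fun _ _ => sq_nonneg _) (Finset.mem_univ j)
        refine abs_le_of_sq_le_sq (by nlinarith [hD3 k]) (by norm_num)
      have e4 : |1 - (√(D k))⁻¹| ≤ κ * η := (abs_one_sub_inv_sqrt_le (hD2 k)).trans (hD1 k)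
      have e5 : 0 ≤ κ * η := (abs_nonneg _).trans e4
      rw [e1, abs_mul, abs_mul]
      calc _ ≤ 1 * (κ * η * 2) := by gcongr
        _ = _ := one_mul _
    refine (Finset.abs_sum_le_sum_abs _ _).trans ((Finset.sum_le_sum fun k _ => hterm k).trans ?_)
    rw [Finset.sum_const, Finset.card_univ, Fintype.card_fin, nsmul_eq_mul]
    exact le_of_eq (by ring)

section Quasimodes

variable {L M : Type*} [NormedAddCommGroup L] [InnerProductSpace ℝ L]
  [NormedAddCommGroup M] [InnerProductSpace ℝ M]

/-- The Rayleigh quotient on the span of quasimodes. -/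
lemma rayleigh_le_of_quasimodes {K : Submodule ℝ (L × M)} {J : Type*} [Fintype J] [DecidableEq J]
    {Φ : J → L × M} (hΦ : ∀ k, Φ k ∈ K) {Lam : J → ℝ} {Ls g ε : ℝ} (hg : 0 < g)
    (hLam0 : ∀ k, 0 ≤ Lam k) (hLam : ∀ k, Lam k ≤ Ls) (hLs : 0 ≤ Ls) (hε0 : 0 ≤ ε)
    (hnear : ∀ j k, |⟪(Φ j).1, (Φ k).1⟫ - if j = k then (1 : ℝ) else 0| ≤ ε)
    (hres : ∀ k, ∀ v ∈ K, |⟪(Φ k).2, v.2⟫ - Lam k * ⟪(Φ k).1, v.1⟫| ≤ ε * (‖v.1‖ + ‖v.2‖))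
    (hε1 : ε * Fintype.card J ≤ 1 / 2)
    (hε : ε * Fintype.card J * (3 * Ls + 2 + g) ≤ g / 2) {a : J → ℝ} (ha : a ≠ 0) :
    (∑ k, a k • Φ k).1 ≠ 0 ∧
      ‖(∑ k, a k • Φ k).2‖ ^ 2 ≤ (Ls + g / 2) * ‖(∑ k, a k • Φ k).1‖ ^ 2 := by
  set w := ∑ k, a k • Φ k with hw
  have hwK : w ∈ K := K.sum_mem fun k _ => K.smul_mem _ (hΦ k)
  set s2 := ∑ k, a k ^ 2 with hs2
  obtain ⟨j0, hj0⟩ := Function.ne_iff.1 ha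
  have hs2pos : 0 < s2 := Finset.sum_pos' (fun _ _ => sq_nonneg _) ⟨j0, Finset.mem_univ _, by
    have : a j0 ≠ 0 := hj0
    positivity⟩
  set N : ℝ := (Fintype.card J : ℝ) with hN
  have hN1 : 1 ≤ N := by
    have : 1 ≤ Fintype.card J := Fintype.card_pos_iff.2 ⟨j0⟩
    rw [hN]; exact_mod_cast this
  have hΦw : ∀ k, ⟪(Φ k).1, w.1⟫ = ∑ j, a j * ⟪(Φ k).1, (Φ j).1⟫ := fun k => by
    rw [hw, fst_sum_smul, inner_sum]
    exact Finset.sum_congr rfl fun j _ => by rw [inner_smul_right]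
  have hdiag : ∀ c : J → ℝ, ∑ k, ∑ j, a k * a j * (c k * if k = j then (1 : ℝ) else 0)
      = ∑ k, c k * a k ^ 2 := fun c => by
    refine Finset.sum_congr rfl fun k _ => ?_
    simp; ring
  -- The Gram matrix is close to the identity.
  have h1 : |‖w.1‖ ^ 2 - s2| ≤ ε * (N * s2) := by
    have : ‖w.1‖ ^ 2 - s2
        = ∑ k, ∑ j, a k * a j * (⟪(Φ k).1, (Φ j).1⟫ - if k = j then (1 : ℝ) else 0) := by
      have hd := hdiag fun _ => 1
      simp only [one_mul] at hd
      rw [hs2, ← hd, ← real_inner_self_eq_norm_sq]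
      conv_lhs => enter [1, 2]; rw [hw, fst_sum_smul]
      rw [sum_inner, ← Finset.sum_sub_distrib]
      refine Finset.sum_congr rfl fun k _ => ?_
      rw [real_inner_smul_left, hΦw, Finset.mul_sum, ← Finset.sum_sub_distrib]
      exact Finset.sum_congr rfl fun j _ => by ring
    rw [this]
    exact abs_sum_sum_le (fun k j => hnear k j) a
  have h2 : ∑ k, a k * (Lam k * ⟪(Φ k).1, w.1⟫) ≤ Ls * s2 + Ls * ε * (N * s2) := by
    have e1 : ∑ k, a k * (Lam k * ⟪(Φ k).1, w.1⟫) = ∑ k, Lam k * a k ^ 2 +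
        ∑ k, ∑ j, a k * a j *
          (Lam k * (⟪(Φ k).1, (Φ j).1⟫ - if k = j then (1 : ℝ) else 0)) := by
      rw [← hdiag, ← Finset.sum_add_distrib]
      refine Finset.sum_congr rfl fun k _ => ?_
      rw [hΦw, Finset.mul_sum, Finset.mul_sum, ← Finset.sum_add_distrib]
      exact Finset.sum_congr rfl fun j _ => by ring
    have e2 := abs_sum_sum_le (η := Ls * ε)
      (E := fun k j => Lam k * (⟪(Φ k).1, (Φ j).1⟫ - if k = j then (1 : ℝ) else 0))
      (fun k j => by
        rw [abs_mul, abs_of_nonneg (hLam0 k)]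
        exact mul_le_mul (hLam k) (hnear k j) (abs_nonneg _) hLs) a
    have e3 : ∑ k, Lam k * a k ^ 2 ≤ Ls * s2 := by
      rw [hs2, Finset.mul_sum]
      exact Finset.sum_le_sum fun k _ => mul_le_mul_of_nonneg_right (hLam k) (sq_nonneg _)
    rw [e1]
    exact add_le_add e3 ((le_abs_self _).trans e2)
  set s := ∑ k, |a k| with hs
  have hsN : s ^ 2 ≤ N * s2 := by
    have := sq_sum_le_card_mul_sum_sq (s := Finset.univ) (f := fun i => |a i|)
    simpa [sq_abs] using this
  -- Test the residuals of the quasimodes with `w` itself.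
  have h3 : ‖w.2‖ ^ 2 ≤ Ls * s2 + Ls * ε * (N * s2) + s * (ε * (‖w.1‖ + ‖w.2‖)) := by
    have e1 : ‖w.2‖ ^ 2 = ∑ k, a k * ⟪(Φ k).2, w.2⟫ := by
      rw [← real_inner_self_eq_norm_sq]
      conv_lhs => enter [2]; rw [hw, snd_sum_smul]
      rw [sum_inner]
      exact Finset.sum_congr rfl fun k _ => by rw [real_inner_smul_left]
    have e2 : ∑ k, a k * ⟪(Φ k).2, w.2⟫ ≤ ∑ k, a k * (Lam k * ⟪(Φ k).1, w.1⟫)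
        + ∑ k, |a k| * (ε * (‖w.1‖ + ‖w.2‖)) := by
      rw [← Finset.sum_add_distrib]
      refine Finset.sum_le_sum fun k _ => ?_
      have := hres k w hwK
      have e4 : a k * (⟪(Φ k).2, w.2⟫ - Lam k * ⟪(Φ k).1, w.1⟫)
          ≤ |a k| * (ε * (‖w.1‖ + ‖w.2‖)) := by
        refine (le_abs_self _).trans ?_
        rw [abs_mul]
        exact mul_le_mul_of_nonneg_left this (abs_nonneg _)
      linarith
    rw [← Finset.sum_mul] at e2
    linarith
  have h4 := abs_le.1 h1
  set X := ‖w.1‖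
  set Y := ‖w.2‖
  have h5 : s * (ε * (X + Y)) ≤ ε * (N * s2) + ε * (X ^ 2 + Y ^ 2) / 2 := by
    have : s * (X + Y) ≤ s ^ 2 + (X ^ 2 + Y ^ 2) / 2 := by
      nlinarith [sq_nonneg (s - X), sq_nonneg (s - Y)]
    nlinarith
  set t := ε * N with ht
  have ht0 : 0 ≤ t := by positivity
  have hεt : ε ≤ t := by rw [ht]; nlinarith
  have hX1 : (1 - t) * s2 ≤ X ^ 2 := by rw [ht]; linarith [h4.1]
  have hX2 : X ^ 2 ≤ (1 + t) * s2 := by rw [ht]; linarith [h4.2]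
  have hXpos : 0 < X ^ 2 := lt_of_lt_of_le (by nlinarith) hX1
  refine ⟨fun h0 => by simp [X, h0] at hXpos, ?_⟩
  have h6 : (1 - ε / 2) * Y ^ 2 ≤ (Ls + t * (Ls + 2)) * s2 := by
    have a1 : ε * X ^ 2 ≤ t * (2 * s2) := by
      have : X ^ 2 ≤ 2 * s2 := by nlinarith
      exact mul_le_mul hεt this (sq_nonneg _) ht0
    have a2 : ε * (N * s2) = t * s2 := by rw [ht]; ring
    have a3 : Ls * ε * (N * s2) = t * Ls * s2 := by rw [ht]; ring
    rw [a2] at h5; rw [a3] at h3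
    nlinarith
  have h7 : (Ls + t * (Ls + 2)) * s2 ≤ (1 - ε / 2) * ((Ls + g / 2) * X ^ 2) := by
    have b1 : (1 - 2 * t) * s2 ≤ (1 - ε / 2) * X ^ 2 := by
      have : (1 - ε / 2) * ((1 - t) * s2) ≤ (1 - ε / 2) * X ^ 2 :=
        mul_le_mul_of_nonneg_left hX1 (by linarith)
      have c1 : (1 - 2 * t) * s2 ≤ (1 - ε / 2) * ((1 - t) * s2) := by
        have c2 : 1 - 2 * t ≤ (1 - ε / 2) * (1 - t) := by nlinarith
        have := mul_le_mul_of_nonneg_right c2 hs2pos.le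
        linarith
      linarith
    have b2 : Ls + t * (Ls + 2) ≤ (Ls + g / 2) * (1 - 2 * t) := by nlinarith
    calc (Ls + t * (Ls + 2)) * s2 ≤ ((Ls + g / 2) * (1 - 2 * t)) * s2 :=
          mul_le_mul_of_nonneg_right b2 hs2pos.le
      _ = (Ls + g / 2) * ((1 - 2 * t) * s2) := by ring
      _ ≤ (Ls + g / 2) * ((1 - ε / 2) * X ^ 2) := mul_le_mul_of_nonneg_left b1 (by linarith)
      _ = _ := by ring
  have h8 : 0 < 1 - ε / 2 := by linarith
  exact le_of_mul_le_mul_left (h6.trans h7) h8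

/-- Upper bound for the `m`-th eigenvalue through `m + 1` quasimodes. -/
lemma eigenvalue_le_of_quasimodes [CompleteSpace L] [CompleteSpace M]
    {K : Submodule ℝ (L × M)} (hK : IsClosed (K : Set (L × M)))
    {l : ℕ → ℝ} {e : ℕ → L × M} (hl : Monotone l) (he : ∀ j, IsWeakEig K (l j) (e j))
    (ho : ∀ i j, ⟪(e i).1, (e j).1⟫ = if i = j then (1 : ℝ) else 0)
    (hcomp : ∀ μ y, IsWeakEig K μ y → ∃ j, l j = μ ∧ ⟪(e j).1, y.1⟫ ≠ 0)
    {ι : Type*} [Fintype ι] {ψ : ι → L} {C M₀ : ℝ}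
    (hgap : ∀ x ∈ K, M₀ * ‖x.1‖ ^ 2 - C * ∑ i, ⟪ψ i, x.1⟫ ^ 2 ≤ ‖x.2‖ ^ 2)
    {m : ℕ} {Φ : ℕ → L × M} (hΦ : ∀ k ≤ m, Φ k ∈ K) {Lam : ℕ → ℝ} {Ls g ε : ℝ} (hg : 0 < g)
    (hLam0 : ∀ k ≤ m, 0 ≤ Lam k) (hLam : ∀ k ≤ m, Lam k ≤ Ls) (hε0 : 0 ≤ ε)
    (hnear : ∀ j ≤ m, ∀ k ≤ m, |⟪(Φ j).1, (Φ k).1⟫ - if j = k then (1 : ℝ) else 0| ≤ ε)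
    (hres : ∀ k ≤ m, ∀ v ∈ K,
      |⟪(Φ k).2, v.2⟫ - Lam k * ⟪(Φ k).1, v.1⟫| ≤ ε * (‖v.1‖ + ‖v.2‖))
    (hε1 : ε * (m + 1) ≤ 1 / 2) (hε : ε * (m + 1) * (3 * Ls + 2 + g) ≤ g / 2)
    (hM : Ls + g / 2 < M₀) : l m ≤ Ls + g / 2 := by
  by_contra! hlt
  have hLs : 0 ≤ Ls := (hLam0 0 (Nat.zero_le _)).trans (hLam 0 (Nat.zero_le _))
  have hk : ∀ k : Fin (m + 1), (k : ℕ) ≤ m := fun k => Nat.lt_succ_iff.1 k.2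
  -- Among the combinations of `m + 1` quasimodes there is one which is orthogonal to the first `m`
  -- eigenvectors.
  let T : (Fin (m + 1) → ℝ) →ₗ[ℝ] (Fin m → ℝ) :=
    LinearMap.pi fun i => ∑ j : Fin (m + 1), ⟪(e i).1, (Φ j).1⟫ • LinearMap.proj j
  obtain ⟨a, ha, ha0⟩ := (Submodule.ne_bot_iff _).1
    (LinearMap.ker_ne_bot_of_finrank_lt (f := T) (by simp))
  rw [LinearMap.mem_ker] at ha
  have hT : ∀ i : Fin m, ∑ j : Fin (m + 1), ⟪(e i).1, (Φ j).1⟫ * a j = 0 := fun i => by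
    have := congrFun ha i
    simpa [T] using this
  obtain ⟨h1, h2⟩ := rayleigh_le_of_quasimodes (K := K) (Φ := fun k : Fin (m + 1) => Φ k)
    (fun k => hΦ k (hk k)) (Lam := fun k => Lam k) hg (fun k => hLam0 k (hk k))
    (fun k => hLam k (hk k)) hLs hε0
    (fun j k => by
      have := hnear j (hk j) k (hk k)
      simpa [Fin.ext_iff] using this)
    (fun k => hres k (hk k)) (by simpa using hε1) (by simpa using hε) ha0
  set w := ∑ k : Fin (m + 1), a k • Φ k with hw
  have hwK : w ∈ K := K.sum_mem fun k _ => K.smul_mem _ (hΦ k (hk k))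
  have hwe : ∀ i : Fin m, ⟪(e i).1, w.1⟫ = 0 := fun i => by
    rw [hw, fst_sum_smul, inner_sum, ← hT i]
    exact Finset.sum_congr rfl fun j _ => by rw [inner_smul_right, mul_comm]
  rcases exists_isWeakEig_or_gap hK hgap hM (e := fun j : Fin m => e j) (fun j => he j)
    (fun i j => by rw [ho]; simp [Fin.ext_iff]) with ⟨μ, hμ, y, hy, hye⟩ | ⟨ε', hε', hlow⟩
  · obtain ⟨j, rfl, hjy⟩ := hcomp μ y hy
    rcases lt_or_ge j m with hj | hj
    · exact hjy (hye ⟨j, hj⟩)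
    · linarith [hl hj]
  · have := hlow w hwK hwe
    have h3 : 0 < ‖w.1‖ ^ 2 := by
      have := norm_pos_iff.2 h1
      positivity
    nlinarith

/-- The arithmetic of `quasimode_remainder_le`: `X` and `Y` are the squared norms of the two
components of the spectral part above `Ls`, and `X'` and `Y'` those of the part below. -/
lemma add_le_of_residual_le {Ls g ε v1 v2 X Y X' Y' : ℝ} (hg : 0 < g) (hLs : 0 ≤ Ls)
    (hε0 : 0 ≤ ε) (hv10 : 0 ≤ v1) (hv20 : 0 ≤ v2) (hX' : 0 ≤ X')
    (n1 : v1 ^ 2 = X + X') (n2 : v2 ^ 2 = Y + Y') (hlow : Y' ≤ (Ls - g / 2) * X')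
    (hhigh : (Ls + g / 2) * X ≤ Y) (hr : Y - Y' - Ls * (X - X') ≤ ε * (v1 + v2)) :
    v1 + v2 ≤ ε * (2 * (2 * Ls + g + 2) / g) := by
  have k1 : g * (v1 ^ 2 + v2 ^ 2) ≤ (2 * Ls + g + 2) * (ε * (v1 + v2)) := by
    have a1 : (2 * Ls + 2) * ((Ls + g / 2) * X) ≤ (2 * Ls + 2) * Y :=
      mul_le_mul_of_nonneg_left hhigh (by linarith)
    have a2 : (2 * Ls + g + 2 + g) * Y' ≤ (2 * Ls + g + 2 + g) * ((Ls - g / 2) * X') :=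
      mul_le_mul_of_nonneg_left hlow (by linarith)
    have a3 := mul_nonneg (sq_nonneg g) hX'
    have : g * (v1 ^ 2 + v2 ^ 2) ≤ (2 * Ls + g + 2) * (Y - Y' - Ls * (X - X')) := by
      rw [n1, n2]
      linear_combination a1 + a2 + a3
    exact this.trans (mul_le_mul_of_nonneg_left hr (by linarith))
  have k3 : (v1 + v2) * (g * (v1 + v2)) ≤ (v1 + v2) * (2 * (2 * Ls + g + 2) * ε) := by
    have : g * (v1 + v2) ^ 2 ≤ g * (2 * (v1 ^ 2 + v2 ^ 2)) :=
      mul_le_mul_of_nonneg_left (by nlinarith [sq_nonneg (v1 - v2)]) hg.le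
    linear_combination this + 2 * k1
  rcases eq_or_lt_of_le (add_nonneg hv10 hv20) with h0 | h0
  · rw [← h0]; positivity
  · have := le_of_mul_le_mul_left k3 h0
    rw [mul_div_assoc', le_div_iff₀ hg]; linarith

/-- The part of a quasimode which is orthogonal to the eigenvectors with eigenvalue close to `Ls`
is controlled by the residual: test the residual with the difference of its spectral parts above
and below `Ls`. -/
lemma quasimode_remainder_le {K : Submodule ℝ (L × M)}
    {l : ℕ → ℝ} {e : ℕ → L × M} (he : ∀ j, IsWeakEig K (l j) (e j))
    (ho : ∀ i j, ⟪(e i).1, (e j).1⟫ = if i = j then (1 : ℝ) else 0)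
    {p n : ℕ} (hpn : p ≤ n) {Ls g ε : ℝ} (hg : 0 < g) (hLs : 0 ≤ Ls) (hε0 : 0 ≤ ε)
    (hlow : ∀ k < p, l k ≤ Ls - g / 2)
    (hhigh : ∀ x ∈ K, (∀ j < n, ⟪(e j).1, x.1⟫ = 0) → (Ls + g / 2) * ‖x.1‖ ^ 2 ≤ ‖x.2‖ ^ 2)
    {Φ : L × M} (hΦ : Φ ∈ K)
    (hres : ∀ v ∈ K, |⟪Φ.2, v.2⟫ - Ls * ⟪Φ.1, v.1⟫| ≤ ε * (‖v.1‖ + ‖v.2‖)) :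
    ‖(Φ - ∑ j ∈ Finset.Ico p n, ⟪(e j).1, Φ.1⟫ • e j).1‖ ≤ ε * (2 * (2 * Ls + g + 2) / g) ∧
    ‖(Φ - ∑ j ∈ Finset.Ico p n, ⟪(e j).1, Φ.1⟫ • e j).2‖ ≤ ε * (2 * (2 * Ls + g + 2) / g) := by
  -- The spectral parts of the quasimode: `P` in the cluster, `A` below it and `B` above it.
  set P := ∑ j ∈ Finset.Ico p n, ⟪(e j).1, Φ.1⟫ • e j with hP
  set A := ∑ j ∈ Finset.range p, ⟪(e j).1, Φ.1⟫ • e j with hA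
  set B := Φ - P - A with hB
  have hAK : A ∈ K := K.sum_mem fun j _ => K.smul_mem _ (he j).mem
  have hPK : P ∈ K := K.sum_mem fun j _ => K.smul_mem _ (he j).mem
  have hBK : B ∈ K := K.sub_mem (K.sub_mem hΦ hPK) hAK
  have hPA : P + A = ∑ j ∈ Finset.range n, ⟪(e j).1, Φ.1⟫ • e j := by
    rw [hP, hA, add_comm, Finset.range_eq_Ico, Finset.range_eq_Ico,
      Finset.sum_Ico_consecutive _ (Nat.zero_le _) hpn]
  have hBe : ∀ j < n, ⟪(e j).1, B.1⟫ = 0 := fun j hj => by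
    have : B = Φ - ∑ j ∈ Finset.range n, ⟪(e j).1, Φ.1⟫ • e j := by rw [hB, ← hPA]; abel
    rw [this, Prod.fst_sub, fst_sum_smul, inner_sub_right, inner_sum]
    simp [inner_smul_right, ho, hj]
  have hBe2 : ∀ j < n, ⟪(e j).2, B.2⟫ = 0 := fun j hj => by
    rw [(he j).eq B hBK, hBe j hj, mul_zero]
  have horth : ∀ s : Finset ℕ, (∀ j ∈ s, j < n) → ∀ a : ℕ → ℝ,
      ⟪(∑ j ∈ s, a j • e j).1, B.1⟫ = 0 ∧ ⟪(∑ j ∈ s, a j • e j).2, B.2⟫ = 0 := by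
    intro s hs a
    rw [fst_sum_smul, snd_sum_smul, sum_inner, sum_inner]
    constructor <;> refine Finset.sum_eq_zero fun j hj => ?_
    · rw [real_inner_smul_left, hBe j (hs j hj), mul_zero]
    · rw [real_inner_smul_left, hBe2 j (hs j hj), mul_zero]
  obtain ⟨hPB1, hPB2⟩ := horth (Finset.Ico p n) (fun j hj => (Finset.mem_Ico.1 hj).2)
    (fun j => ⟪(e j).1, Φ.1⟫)
  obtain ⟨hAB1, hAB2⟩ := horth (Finset.range p) (fun j hj => by
    have := Finset.mem_range.1 hj; omega) (fun j => ⟪(e j).1, Φ.1⟫)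
  rw [← hP] at hPB1 hPB2; rw [← hA] at hAB1 hAB2
  have hPe : ∀ j < p, ⟪(e j).1, P.1⟫ = 0 := fun j hj => by
    rw [hP, fst_sum_smul, inner_sum]
    refine Finset.sum_eq_zero fun i hi => ?_
    have := (Finset.mem_Ico.1 hi).1
    rw [inner_smul_right, ho, if_neg (by omega), mul_zero]
  have hPA1 : ⟪P.1, A.1⟫ = 0 := by
    rw [congrArg Prod.fst hA, fst_sum_smul (Finset.range p), inner_sum]
    refine Finset.sum_eq_zero fun j hj => ?_
    rw [inner_smul_right, real_inner_comm (e j).1 P.1, hPe j (Finset.mem_range.1 hj), mul_zero]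
  have hPA2 : ⟪P.2, A.2⟫ = 0 := by
    rw [congrArg Prod.snd hA, snd_sum_smul (Finset.range p), inner_sum]
    refine Finset.sum_eq_zero fun j hj => ?_
    rw [inner_smul_right, real_inner_comm (e j).2 P.2, (he j).eq P hPK, hPe j (Finset.mem_range.1 hj)]
    simp
  obtain ⟨hA1, hA2⟩ := snd_norm_sq_sum (Finset.range p) he ho (fun j => ⟪(e j).1, Φ.1⟫)
  rw [← hA] at hA1 hA2
  have hAlow : ‖A.2‖ ^ 2 ≤ (Ls - g / 2) * ‖A.1‖ ^ 2 := by
    rw [hA1, hA2, Finset.mul_sum]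
    exact Finset.sum_le_sum fun j hj =>
      mul_le_mul_of_nonneg_right (hlow j (Finset.mem_range.1 hj)) (sq_nonneg _)
  have hBhigh := hhigh B hBK hBe
  have hΦeq : Φ = P + A + B := by rw [hB]; abel
  have hD : Φ - P = A + B := by rw [hB]; abel
  have hr := hres (B - A) (K.sub_mem hBK hAK)
  have e1 : ⟪Φ.2, (B - A).2⟫ = ‖B.2‖ ^ 2 - ‖A.2‖ ^ 2 := by
    conv_lhs => rw [hΦeq]
    simp only [Prod.snd_add, Prod.snd_sub, inner_add_left, inner_sub_right, hPB2, hPA2, hAB2,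
      real_inner_comm A.2 B.2, real_inner_self_eq_norm_sq]
    ring
  have e2 : ⟪Φ.1, (B - A).1⟫ = ‖B.1‖ ^ 2 - ‖A.1‖ ^ 2 := by
    conv_lhs => rw [hΦeq]
    simp only [Prod.fst_add, Prod.fst_sub, inner_add_left, inner_sub_right, hPB1, hPA1, hAB1,
      real_inner_comm A.1 B.1, real_inner_self_eq_norm_sq]
    ring
  have n1 : ‖(B - A).1‖ ^ 2 = ‖B.1‖ ^ 2 + ‖A.1‖ ^ 2 := by
    rw [Prod.fst_sub, norm_sub_sq_real, real_inner_comm, hAB1]; ring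
  have n2 : ‖(B - A).2‖ ^ 2 = ‖B.2‖ ^ 2 + ‖A.2‖ ^ 2 := by
    rw [Prod.snd_sub, norm_sub_sq_real, real_inner_comm, hAB2]; ring
  have n3 : ‖(Φ - P).1‖ ^ 2 = ‖B.1‖ ^ 2 + ‖A.1‖ ^ 2 := by
    rw [hD, Prod.fst_add, norm_add_sq_real, hAB1]; ring
  have n4 : ‖(Φ - P).2‖ ^ 2 = ‖B.2‖ ^ 2 + ‖A.2‖ ^ 2 := by
    rw [hD, Prod.snd_add, norm_add_sq_real, hAB2]; ring
  rw [e1, e2] at hr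
  set v1 := ‖(B - A).1‖ with hv1
  set v2 := ‖(B - A).2‖ with hv2
  have hv10 : 0 ≤ v1 := norm_nonneg _
  have hv20 : 0 ≤ v2 := norm_nonneg _
  have k2 : v1 + v2 ≤ ε * (2 * (2 * Ls + g + 2) / g) :=
    add_le_of_residual_le hg hLs hε0 hv10 hv20 (sq_nonneg _) n1 n2 hAlow hBhigh
      ((le_abs_self _).trans hr)
  have m1 : ‖(Φ - P).1‖ = v1 := by
    rw [← Real.sqrt_sq (norm_nonneg (Φ - P).1), n3, ← n1, Real.sqrt_sq hv10]
  have m2 : ‖(Φ - P).2‖ = v2 := by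
    rw [← Real.sqrt_sq (norm_nonneg (Φ - P).2), n4, ← n2, Real.sqrt_sq hv20]
  rw [m1, m2]
  exact ⟨by linarith, by linarith⟩

/-- The error of an orthogonal combination of quasimodes: `B` is the distance of the coefficients to
an orthogonal matrix, and `d` are the remainders of the quasimodes. -/
lemma norm_sum_smul_sub_le {V : Type*} [NormedAddCommGroup V] [NormedSpace ℝ V] {κ : ℕ}
    {w : Fin κ → ℝ} {B : Fin κ → Fin κ → ℝ} {f d : Fin κ → V} {β S ρ : ℝ}
    (hw : ∀ r, |w r| ≤ 1) (hB : ∀ r m, |B r m| ≤ β) (hf : ∀ m, ‖f m‖ ≤ S)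
    (hd : ∀ r, ‖d r‖ ≤ ρ) :
    ‖∑ r, w r • ∑ m, B r m • f m - ∑ r, w r • d r‖ ≤ κ * (κ * (β * S)) + κ * ρ := by
  have t1 : ‖∑ r, w r • ∑ m, B r m • f m‖ ≤ ∑ _r : Fin κ, (1 * ∑ _m : Fin κ, β * S) := by
    refine norm_sum_le_of_le _ fun r _ => ?_
    rw [norm_smul]
    refine mul_le_mul (hw r) (norm_sum_le_of_le _ fun m _ => ?_) (norm_nonneg _) zero_le_one
    rw [norm_smul]
    exact mul_le_mul (hB r m) (hf m) (norm_nonneg _) ((abs_nonneg _).trans (hB r m))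
  have t2 : ‖∑ r, w r • d r‖ ≤ ∑ _r : Fin κ, 1 * ρ := by
    refine norm_sum_le_of_le _ fun r _ => ?_
    rw [norm_smul]
    exact mul_le_mul (hw r) (hd r) (norm_nonneg _) zero_le_one
  simp only [Finset.sum_const, Finset.card_univ, Fintype.card_fin, nsmul_eq_mul, one_mul] at t1 t2
  exact (norm_sub_le _ _).trans (add_le_add t1 t2)

/-- Eigenvectors are approximated by orthogonal combinations of quasimodes: the group of the
eigenvalues number `p, …, p + κ - 1`, close to `Ls` and separated by gaps from the other ones. -/
lemma exists_orthogonal_quasimodes [CompleteSpace L] [CompleteSpace M] (p κ : ℕ)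
    {Ls g : ℝ} (hg : 0 < g) (hLs : 0 ≤ Ls) :
    ∃ C₀ > 0, ∃ ε₀ > 0, ∀ (K : Submodule ℝ (L × M)), IsClosed (K : Set (L × M)) →
    ∀ (l : ℕ → ℝ) (e : ℕ → L × M), Monotone l → (∀ j, IsWeakEig K (l j) (e j)) →
    (∀ i j, ⟪(e i).1, (e j).1⟫ = if i = j then (1 : ℝ) else 0) →
    (∀ μ y, IsWeakEig K μ y → ∃ j, l j = μ ∧ ⟪(e j).1, y.1⟫ ≠ 0) →
    ∀ (Φ : ℕ → L × M) (Lam : ℕ → ℝ) (C : ℝ),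
    (∀ x ∈ K, (Ls + g) * ‖x.1‖ ^ 2 - C * ∑ i : Fin (p + κ), ⟪(Φ i).1, x.1⟫ ^ 2 ≤ ‖x.2‖ ^ 2) →
    (∀ k < p + κ, Φ k ∈ K) → (∀ k < p + κ, 0 ≤ Lam k) → (∀ k < p, Lam k ≤ Ls - g) →
    (∀ k, p ≤ k → k < p + κ → Lam k = Ls) →
    ∀ ε, 0 ≤ ε → ε ≤ ε₀ →
    (∀ j < p + κ, ∀ k < p + κ, |⟪(Φ j).1, (Φ k).1⟫ - if j = k then (1 : ℝ) else 0| ≤ ε) →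
    (∀ k < p + κ, ∀ v ∈ K,
      |⟪(Φ k).2, v.2⟫ - Lam k * ⟪(Φ k).1, v.1⟫| ≤ ε * (‖v.1‖ + ‖v.2‖)) →
    (∀ k < p + κ, l k ≤ Ls + g / 2) ∧ ∃ b ∈ Matrix.orthogonalGroup (Fin κ) ℝ, ∀ i : Fin κ,
      ‖(e (p + i) - ∑ r : Fin κ, b i r • Φ (p + r)).1‖ ≤ C₀ * ε ∧
      ‖(e (p + i) - ∑ r : Fin κ, b i r • Φ (p + r)).2‖ ≤ C₀ * ε := by
  set R : ℝ := 2 * (2 * Ls + g + 2) / g with hR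
  have hR0 : 0 < R := by positivity
  set S : ℝ := Ls + g / 2 + 1 with hS
  have hS1 : 1 ≤ S := by rw [hS]; linarith
  set C₀ : ℝ := κ * (κ * (2 * κ ^ 2 * (1 + R ^ 2))) * S + κ * R + 1 with hC₀
  set n : ℕ := p + κ with hn
  set ε₀ : ℝ := min (1 / (2 * ((n + 1) * (1 + R ^ 2)))) (g / 2 / ((n + 1) * (3 * Ls + 2 + g)))
    with hε₀
  refine ⟨C₀, by positivity, ε₀, by positivity, ?_⟩
  intro K hK l e hl he ho hcomp Φ Lam C hgap hΦ hLam0 hLamp hLamn ε hε0 hεε hnear hres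
  have hεa : ε * ((n + 1) * (1 + R ^ 2)) ≤ 1 / 2 := by
    have := hεε.trans (min_le_left _ _)
    rw [le_div_iff₀ (by positivity)] at this
    linarith
  have hεb : ε * ((n + 1) * (3 * Ls + 2 + g)) ≤ g / 2 := by
    have := hεε.trans (min_le_right _ _)
    rwa [le_div_iff₀ (by positivity)] at this
  have hεn : ε * (n + 1) ≤ 1 / 2 := by
    have : ε * (n + 1) * 1 ≤ ε * (n + 1) * (1 + R ^ 2) :=
      mul_le_mul_of_nonneg_left (by nlinarith) (by positivity)
    linarith
  have hεle : ε ≤ 1 := by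
    have : ε * 1 ≤ ε * (n + 1) := mul_le_mul_of_nonneg_left (by simp) hε0
    linarith
  -- the `m`-th eigenvalue exceeds the `m`-th limit eigenvalue at most by `g / 2`
  have hupper : ∀ m < n, ∀ Ls' ≤ Ls, (∀ k ≤ m, Lam k ≤ Ls') → l m ≤ Ls' + g / 2 := by
    intro m hm Ls' hLs' hLam
    have hLs'0 : 0 ≤ Ls' := (hLam0 m hm).trans (hLam m le_rfl)
    have hmn : (m : ℝ) + 1 ≤ n + 1 := by
      have : (m : ℝ) ≤ n := by exact_mod_cast hm.le
      linarith
    refine eigenvalue_le_of_quasimodes hK hl he ho hcomp hgap (Φ := Φ) (Lam := Lam) (ε := ε)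
      (fun k hk => hΦ k (by omega)) hg (fun k hk => hLam0 k (by omega)) hLam hε0
      (fun j hj k hk => hnear j (by omega) k (by omega)) (fun k hk => hres k (by omega)) ?_ ?_ ?_
    · exact (mul_le_mul_of_nonneg_left hmn hε0).trans hεn
    · refine le_trans ?_ hεb
      rw [← mul_assoc]
      gcongr
    · linarith
  have hll : ∀ k < n, l k ≤ Ls + g / 2 := fun k hk => by
    refine hupper k hk Ls le_rfl fun j hj => ?_
    rcases lt_or_ge j p with h | h
    · linarith [hLamp j h]
    · exact (hLamn j h (by omega)).le
  refine ⟨hll, ?_⟩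
  have hlp : ∀ k < p, l k ≤ Ls - g / 2 := fun k hk => by
    have := hupper k (by omega) (Ls - g) (by linarith) fun j hj => hLamp j (by omega)
    linarith
  -- There are exactly `n` eigenvalues up to `Ls + g / 2`: the inequality `hgap` allows no more.
  have hnext : Ls + g / 2 < l n := lt_of_gap hgap (by linarith) hl he ho
  have hhigh : ∀ x ∈ K, (∀ j < n, ⟪(e j).1, x.1⟫ = 0) →
      (Ls + g / 2) * ‖x.1‖ ^ 2 ≤ ‖x.2‖ ^ 2 := by
    intro x hx hxe
    rcases exists_isWeakEig_or_gap hK hgap (m := Ls + g / 2) (by linarith)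
      (e := fun j : Fin n => e j) (fun j => he j)
      (fun i j => by rw [ho]; simp [Fin.ext_iff]) with ⟨μ, hμ, y, hy, hye⟩ | ⟨ε', hε', hlow⟩
    · obtain ⟨j, rfl, hjy⟩ := hcomp μ y hy
      rcases lt_or_ge j n with hj | hj
      · exact (hjy (hye ⟨j, hj⟩)).elim
      · linarith [hl hj]
    · have := hlow x hx fun j => hxe j j.2
      nlinarith [mul_nonneg hε'.le (sq_nonneg ‖x.1‖)]
  -- Expand the quasimodes in the eigenvectors of the cluster; the remainders are small.
  set D : Fin κ → L × M := fun r => Φ (p + r) -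
    ∑ j ∈ Finset.Ico p n, ⟪(e j).1, (Φ (p + r)).1⟫ • e j with hD
  have hDle : ∀ r, ‖(D r).1‖ ≤ ε * R ∧ ‖(D r).2‖ ≤ ε * R := fun r => by
    refine quasimode_remainder_le he ho (by omega) hg hLs hε0 hlp hhigh (hΦ _ (by omega)) ?_
    have := hres (p + r) (by omega)
    rwa [hLamn _ (by omega) (by omega)] at this
  set A : Matrix (Fin κ) (Fin κ) ℝ := fun r m => ⟪(e (p + m)).1, (Φ (p + r)).1⟫ with hA
  have hΦD : ∀ r : Fin κ, Φ (p + r) = ∑ m : Fin κ, A r m • e (p + m) + D r := fun r => by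
    have : ∑ j ∈ Finset.Ico p n, ⟪(e j).1, (Φ (p + r)).1⟫ • e j
        = ∑ m : Fin κ, A r m • e (p + m) := by
      have hnp : n - p = κ := by omega
      rw [Finset.sum_Ico_eq_sum_range, hnp, ← Fin.sum_univ_eq_sum_range
        (fun m => ⟪(e (p + m)).1, (Φ (p + r)).1⟫ • e (p + m))]
    rw [← this, hD]; simp
  have hDe : ∀ r m : Fin κ, ⟪(e (p + m)).1, (D r).1⟫ = 0 := fun r m => by
    have h1 := congrArg (fun x : L × M => ⟪(e (p + m)).1, x.1⟫) (hΦD r)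
    simp only [Prod.fst_add, fst_sum_smul, inner_add_right, inner_sum, inner_smul_right, ho,
      add_right_inj, Fin.val_inj] at h1
    simpa [hA] using h1
  -- `A * Aᵀ` is the Gram matrix of the quasimodes minus that of the remainders.
  have hAA : ∀ r s, |(A * A.transpose - 1) r s| ≤ ε * (1 + R ^ 2) := fun r s => by
    have h1 : ⟪(Φ (p + r)).1, (Φ (p + s)).1⟫ = (A * A.transpose) r s + ⟪(D r).1, (D s).1⟫ := by
      have h2 : ⟪(Φ (p + r)).1, (D s).1⟫ = ⟪(D r).1, (D s).1⟫ := by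
        rw [hΦD r]
        simp [inner_add_left, sum_inner, real_inner_smul_left, hDe, Prod.fst_sum]
      have h3 : ⟪(Φ (p + r)).1, (Φ (p + s)).1⟫ =
          ⟪(Φ (p + r)).1, (∑ m : Fin κ, A s m • e (p + m) + D s).1⟫ := by rw [← hΦD s]
      rw [h3, Prod.fst_add, inner_add_right, h2, fst_sum_smul, inner_sum, Matrix.mul_apply]
      congr 1
      refine Finset.sum_congr rfl fun m _ => ?_
      rw [inner_smul_right, real_inner_comm, Matrix.transpose_apply, mul_comm]
    have h2 := hnear (p + r) (by omega) (p + s) (by omega)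
    have h3 : |⟪(D r).1, (D s).1⟫| ≤ ε * R ^ 2 := by
      refine (abs_real_inner_le_norm _ _).trans ?_
      calc _ ≤ (ε * R) * (ε * R) := mul_le_mul (hDle r).1 (hDle s).1 (norm_nonneg _) (by positivity)
        _ = ε * (ε * R ^ 2) := by ring
        _ ≤ 1 * (ε * R ^ 2) := mul_le_mul_of_nonneg_right hεle (by positivity)
        _ = _ := one_mul _
    have h4 : (A * A.transpose - 1) r s = (⟪(Φ (p + r)).1, (Φ (p + s)).1⟫ -
        if p + (r : ℕ) = p + s then (1 : ℝ) else 0) - ⟪(D r).1, (D s).1⟫ := by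
      rw [h1, Matrix.sub_apply, Matrix.one_apply]
      simp only [add_right_inj, Fin.val_inj]
      ring
    rw [h4]
    refine (abs_sub _ _).trans ?_
    linarith
  have hκn : (κ : ℝ) ≤ n + 1 := by
    have : κ ≤ n + 1 := by omega
    exact_mod_cast this
  obtain ⟨O, hO, hOA⟩ := exists_orthogonal_near A (η := ε * (1 + R ^ 2)) (by
    refine le_trans ?_ hεa
    calc _ ≤ (n + 1) * (ε * (1 + R ^ 2)) := by gcongr
      _ = _ := by ring) hAA
  have hOO : O.transpose * O = 1 := by
    have := (Matrix.mem_orthogonalGroup_iff' (Fin κ) ℝ).1 hO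
    simpa [Matrix.star_eq_conjTranspose] using this
  have hO1 : ∀ r i, |O r i| ≤ 1 := fun r i => by
    have h1 := congrFun (congrFun hOO i) i
    rw [Matrix.mul_apply, Matrix.one_apply_eq] at h1
    have h2 : O r i ^ 2 ≤ 1 := by
      rw [← h1]
      have := Finset.single_le_sum (f := fun r => O.transpose i r * O r i)
        (fun r _ => mul_self_nonneg (O r i)) (Finset.mem_univ r)
      simpa [sq] using this
    exact abs_le_one_iff_mul_self_le_one.2 (by nlinarith)
  refine ⟨O.transpose, ?_, fun i => ?_⟩
  · rw [Matrix.mem_orthogonalGroup_iff]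
    simpa [Matrix.star_eq_conjTranspose] using hOO
  -- Since `Oᵀ * O = 1`, the eigenvector is the combination of the rows of `O`, which are close to
  -- the rows of `A`.
  have hdecomp : e (p + i) - ∑ r : Fin κ, O.transpose i r • Φ (p + r) =
      ∑ r : Fin κ, O r i • (∑ m : Fin κ, (O r m - A r m) • e (p + m)) -
        ∑ r : Fin κ, O r i • D r := by
    have h1 : e (p + i) = ∑ r : Fin κ, O r i • ∑ m : Fin κ, O r m • e (p + m) := by
      simp_rw [Finset.smul_sum, smul_smul]
      rw [Finset.sum_comm]
      simp_rw [← Finset.sum_smul]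
      have h2 : ∀ m, ∑ r, O r i * O r m = if i = m then 1 else 0 := fun m => by
        have := congrFun (congrFun hOO i) m
        rw [Matrix.mul_apply, Matrix.one_apply] at this
        simpa using this
      simp [h2]
    conv_lhs => rw [h1]
    rw [← Finset.sum_sub_distrib, ← Finset.sum_sub_distrib]
    refine Finset.sum_congr rfl fun r _ => ?_
    rw [hΦD r, Matrix.transpose_apply]
    simp_rw [sub_smul]
    rw [Finset.sum_sub_distrib]
    module
  have he1 : ∀ j, ‖(e j).1‖ ^ 2 = 1 := fun j => by
    rw [← real_inner_self_eq_norm_sq, ho, if_pos rfl]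
  have he2 : ∀ j, ‖(e j).2‖ ^ 2 = l j := fun j => by
    rw [← real_inner_self_eq_norm_sq, (he j).eq _ (he j).mem, ho, if_pos rfl, mul_one]
  rw [hdecomp]
  simp only [Prod.fst_sub, Prod.snd_sub, fst_sum_smul, snd_sum_smul]
  have hfin : κ * (κ * (2 * κ ^ 2 * (ε * (1 + R ^ 2)) * S)) + κ * (ε * R) ≤ C₀ * ε := by
    rw [hC₀]; linarith
  have hOA' : ∀ r m, |O r m - A r m| ≤ 2 * κ ^ 2 * (ε * (1 + R ^ 2)) := fun r m => by
    rw [abs_sub_comm]; exact hOA r m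
  refine ⟨(norm_sum_smul_sub_le (hO1 · i) hOA' (fun m => ?_) fun r => (hDle r).1).trans hfin,
    (norm_sum_smul_sub_le (hO1 · i) hOA' (fun m => ?_) fun r => (hDle r).2).trans hfin⟩
  · refine (pow_le_pow_iff_left₀ (norm_nonneg _) (by linarith) two_ne_zero).1 ?_
    rw [he1]; nlinarith
  · refine (pow_le_pow_iff_left₀ (norm_nonneg _) (by linarith) two_ne_zero).1 ?_
    rw [he2]
    have := hll (p + m) (by omega)
    nlinarith

end Quasimodes

/-! ### Form domains of mixed boundary value problems -/

section FormDomain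

variable {F : Type*} [NormedAddCommGroup F] [InnerProductSpace ℝ F] [FiniteDimensional ℝ F]

lemma continuous_gradient {φ : F → ℝ} (hφ : ContDiff ℝ (⊤ : ℕ∞) φ) : Continuous (gradient φ) :=
  (InnerProductSpace.toDual ℝ F).symm.continuous.comp (hφ.continuous_fderiv (by simp))

lemma tsupport_gradient_subset (φ : F → ℝ) : tsupport (gradient φ) ⊆ tsupport φ := by
  refine (closure_mono fun x hx => ?_).trans (tsupport_fderiv_subset ℝ (f := φ))
  rw [Function.mem_support] at hx ⊢
  intro h
  exact hx (by rw [gradient, h, map_zero])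

lemma hasCompactSupport_gradient {φ : F → ℝ} (hc : HasCompactSupport φ) :
    HasCompactSupport (gradient φ) :=
  IsCompact.of_isClosed_subset hc (isClosed_tsupport _) (tsupport_gradient_subset φ)

lemma gradient_add' {φ ψ : F → ℝ} {x : F} (hφ : DifferentiableAt ℝ φ x)
    (hψ : DifferentiableAt ℝ ψ x) :
    gradient (φ + ψ) x = gradient φ x + gradient ψ x := by
  simp only [gradient]
  rw [fderiv_add hφ hψ, map_add]

lemma gradient_const_smul' {φ : F → ℝ} {x : F} (c : ℝ) (hφ : DifferentiableAt ℝ φ x) :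
    gradient (c • φ) x = c • gradient φ x := by
  simp only [gradient]
  rw [fderiv_const_smul hφ, map_smulₛₗ]
  simp

lemma gradient_mul' {φ ψ : F → ℝ} {x : F} (hφ : DifferentiableAt ℝ φ x)
    (hψ : DifferentiableAt ℝ ψ x) :
    gradient (fun y => φ y * ψ y) x = φ x • gradient ψ x + ψ x • gradient φ x := by
  refine ext_inner_right ℝ fun v => ?_
  rw [inner_gradient_left, fderiv_fun_mul hφ hψ, inner_add_left, real_inner_smul_left,
    real_inner_smul_left, inner_gradient_left, inner_gradient_left]
  simp

/-- The space of compactly supported smooth functions which vanish near `S`. -/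
def testSpace (S : Set F) : Submodule ℝ (F → ℝ) where
  carrier := {φ | ContDiff ℝ (⊤ : ℕ∞) φ ∧ HasCompactSupport φ ∧ Disjoint (tsupport φ) (closure S)}
  add_mem' := by
    rintro φ ψ ⟨h1, h2, h3⟩ ⟨k1, k2, k3⟩
    refine ⟨h1.add k1, h2.add k2, ?_⟩
    exact Disjoint.mono_left (tsupport_add φ ψ) (Set.disjoint_union_left.2 ⟨h3, k3⟩)
  zero_mem' := by
    refine ⟨contDiff_const, HasCompactSupport.zero, ?_⟩
    simp [tsupport]
  smul_mem' := by
    rintro c φ ⟨h1, h2, h3⟩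
    refine ⟨contDiff_const.smul h1, h2.smul_left, ?_⟩
    refine Disjoint.mono_left (closure_mono ?_) h3
    exact Function.support_const_smul_subset c φ

lemma differentiable_of_mem_testSpace {S : Set F} {φ : F → ℝ} (hφ : φ ∈ testSpace S) :
    Differentiable ℝ φ := hφ.1.differentiable (by simp)

variable [MeasurableSpace F] [BorelSpace F]

/-- The space `L²(F)` of real functions. -/
abbrev L2 (F : Type*) [NormedAddCommGroup F] [InnerProductSpace ℝ F] [FiniteDimensional ℝ F]
    [MeasurableSpace F] [BorelSpace F] : Type _ := Lp ℝ 2 (volume : Measure F)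

/-- The space `L²(F; F)` of vector fields. -/
abbrev L2V (F : Type*) [NormedAddCommGroup F] [InnerProductSpace ℝ F] [FiniteDimensional ℝ F]
    [MeasurableSpace F] [BorelSpace F] : Type _ := Lp F 2 (volume : Measure F)

/-- The pairs `(φ, h ∇φ)`, restricted to `Ω` and extended by zero, of test functions `φ`. -/
def preDomain (h : ℝ) (Ω S : Set F) : Submodule ℝ (L2 F × L2V F) where
  carrier := {x | ∃ φ ∈ testSpace S, x.1 =ᵐ[volume] Ω.indicator φ ∧
    x.2 =ᵐ[volume] Ω.indicator fun y => h • gradient φ y}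
  add_mem' := by
    rintro x y ⟨φ, hφ, h1, h2⟩ ⟨ψ, hψ, k1, k2⟩
    refine ⟨φ + ψ, (testSpace S).add_mem hφ hψ, ?_, ?_⟩
    · filter_upwards [Lp.coeFn_add x.1 y.1, h1, k1] with z e1 e2 e3
      rw [Prod.fst_add, e1, Pi.add_apply, e2, e3]
      by_cases hz : z ∈ Ω <;> simp [hz]
    · filter_upwards [Lp.coeFn_add x.2 y.2, h2, k2] with z e1 e2 e3
      rw [Prod.snd_add, e1, Pi.add_apply, e2, e3]
      by_cases hz : z ∈ Ω
      · simp [hz, gradient_add' (differentiable_of_mem_testSpace hφ z)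
          (differentiable_of_mem_testSpace hψ z)]
      · simp [hz]
  zero_mem' := by
    refine ⟨0, (testSpace S).zero_mem, ?_, ?_⟩
    · filter_upwards [Lp.coeFn_zero ℝ 2 (volume : Measure F)] with z e1
      rw [Prod.fst_zero, e1]
      by_cases hz : z ∈ Ω <;> simp [hz]
    · filter_upwards [Lp.coeFn_zero F 2 (volume : Measure F)] with z e1
      rw [Prod.snd_zero, e1]
      have : gradient (0 : F → ℝ) z = 0 := by simp [gradient]
      by_cases hz : z ∈ Ω <;> simp [hz, this]
  smul_mem' := by
    rintro c x ⟨φ, hφ, h1, h2⟩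
    refine ⟨c • φ, (testSpace S).smul_mem c hφ, ?_, ?_⟩
    · filter_upwards [Lp.coeFn_smul c x.1, h1] with z e1 e2
      rw [Prod.smul_fst, e1, Pi.smul_apply, e2]
      by_cases hz : z ∈ Ω <;> simp [hz]
    · filter_upwards [Lp.coeFn_smul c x.2, h2] with z e1 e2
      rw [Prod.smul_snd, e1, Pi.smul_apply, e2]
      by_cases hz : z ∈ Ω
      · simp [hz, gradient_const_smul' c (differentiable_of_mem_testSpace hφ z), smul_comm c h]
      · simp [hz]

/-- The space `H̊¹(Ω; S)` as a closed subspace of `L²(F) × L²(F; F)`: the closure of the pairs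
`(φ, h ∇φ)` of test functions, restricted to `Ω` and extended by zero to the whole space. With the
scale `h` the form `‖x.2‖²` is `h²` times the Dirichlet form. -/
def formDomain (h : ℝ) (Ω S : Set F) : Submodule ℝ (L2 F × L2V F) :=
  (preDomain h Ω S).topologicalClosure

lemma isClosed_formDomain (h : ℝ) (Ω S : Set F) :
    IsClosed (formDomain h Ω S : Set (L2 F × L2V F)) :=
  Submodule.isClosed_topologicalClosure _

/-- A closed condition holds on the form domain if it holds for the test functions. -/
lemma formDomain_induction {h : ℝ} {Ω S : Set F} {P : L2 F × L2V F → Prop}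
    (hP : IsClosed {x | P x}) (hpre : ∀ x ∈ preDomain h Ω S, P x) :
    ∀ x ∈ formDomain h Ω S, P x := fun _ hx =>
  (closure_minimal (s := (preDomain h Ω S : Set (L2 F × L2V F))) (t := {x | P x}) hpre hP) hx

/-- A test function as an element of the form domain. -/
lemma exists_mem_formDomain {h : ℝ} {Ω S : Set F} (hΩ : MeasurableSet Ω) {φ : F → ℝ}
    (hφ : φ ∈ testSpace S) : ∃ x ∈ preDomain h Ω S, x.1 =ᵐ[volume] Ω.indicator φ ∧
      x.2 =ᵐ[volume] Ω.indicator fun y => h • gradient φ y := by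
  have h1 : MemLp (Ω.indicator φ) 2 volume :=
    (hφ.1.continuous.memLp_of_hasCompactSupport hφ.2.1).indicator hΩ
  have h2 : MemLp (Ω.indicator fun y => h • gradient φ y) 2 volume :=
    (((continuous_gradient hφ.1).memLp_of_hasCompactSupport
      (hasCompactSupport_gradient hφ.2.1)).const_smul h).indicator hΩ
  exact ⟨(h1.toLp, h2.toLp), ⟨φ, hφ, h1.coeFn_toLp, h2.coeFn_toLp⟩, h1.coeFn_toLp,
    h2.coeFn_toLp⟩

variable {V W : Type*} [NormedAddCommGroup V] [InnerProductSpace ℝ V]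
  [NormedAddCommGroup W] [InnerProductSpace ℝ W]

lemma L2_norm_sq (f : Lp V 2 (volume : Measure F)) : ‖f‖ ^ 2 = ∫ x, ‖f x‖ ^ 2 := by
  rw [← real_inner_self_eq_norm_sq, L2.inner_def]
  simp

lemma L2_integrable_sq (f : Lp V 2 (volume : Measure F)) : Integrable fun x => ‖f x‖ ^ 2 :=
  (Lp.memLp f).integrable_norm_pow (by norm_num)

lemma memLp_weighted_comp {Ψ : F → F} {c : ℝ≥0∞} (hc : c ≠ ⊤)
    (hΨ : MeasurePreserving Ψ volume (c • (volume : Measure F))) {A : F → V →L[ℝ] W}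
    (hA : StronglyMeasurable A) {C : ℝ} (hC : ∀ x, ‖A x‖ ≤ C)
    (f : Lp V 2 (volume : Measure F)) : MemLp (fun x => A x (f (Ψ x))) 2 volume := by
  have h1 : MemLp (fun x => f (Ψ x)) 2 volume :=
    ((Lp.memLp f).smul_measure hc).comp_measurePreserving hΨ
  refine h1.of_le_mul (c := C) ?_ (Eventually.of_forall fun x => ?_)
  · exact (ContinuousLinearMap.id ℝ (V →L[ℝ] W)).aestronglyMeasurable_comp₂
      hA.aestronglyMeasurable h1.1
  · exact ((A x).le_opNorm _).trans (mul_le_mul_of_nonneg_right (hC x) (norm_nonneg _))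

/-- Composition with a map which changes the volume by a constant factor, followed by a bounded
multiplier, is a bounded operator of `L²`. -/
lemma exists_weighted_comp {Ψ : F → F} {c : ℝ≥0∞} (hc : c ≠ ⊤)
    (hΨ : MeasurePreserving Ψ volume (c • (volume : Measure F))) {A : F → V →L[ℝ] W}
    (hA : StronglyMeasurable A) {C : ℝ} (hC : ∀ x, ‖A x‖ ≤ C) :
    ∃ T : Lp V 2 (volume : Measure F) →L[ℝ] Lp W 2 (volume : Measure F),
      ∀ f, T f =ᵐ[volume] fun x => A x (f (Ψ x)) := by
  have hq : ∀ {f g : F → V}, f =ᵐ[volume] g → (fun x => f (Ψ x)) =ᵐ[volume] fun x => g (Ψ x) :=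
    fun hfg => hΨ.quasiMeasurePreserving.ae_eq_comp (Measure.ae_smul_measure hfg c)
  let T₀ : Lp V 2 (volume : Measure F) →ₗ[ℝ] Lp W 2 (volume : Measure F) :=
    { toFun := fun f => (memLp_weighted_comp hc hΨ hA hC f).toLp
      map_add' := fun f g => by
        rw [← MemLp.toLp_add]
        refine MemLp.toLp_congr _ _ ?_
        filter_upwards [hq (Lp.coeFn_add f g)] with x hx
        rw [hx, Pi.add_apply, Pi.add_apply, map_add]
      map_smul' := fun r f => by
        rw [RingHom.id_apply, ← MemLp.toLp_const_smul]
        refine MemLp.toLp_congr _ _ ?_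
        filter_upwards [hq (Lp.coeFn_smul r f)] with x hx
        rw [hx, Pi.smul_apply, Pi.smul_apply, map_smul] }
  refine ⟨T₀.mkContinuous (C * (c ^ (1 / (2 : ℝ≥0∞)).toReal).toReal) fun f => ?_, fun f =>
    (memLp_weighted_comp hc hΨ hA hC f).coeFn_toLp⟩
  have hC0 : 0 ≤ C := (norm_nonneg _).trans (hC 0)
  change ‖(memLp_weighted_comp hc hΨ hA hC f).toLp‖ ≤ _
  rw [Lp.norm_toLp]
  have h1 : eLpNorm (fun x => A x (f (Ψ x))) 2 volume
      ≤ ENNReal.ofReal C * eLpNorm (fun x => f (Ψ x)) 2 volume :=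
    eLpNorm_le_mul_eLpNorm_of_ae_le_mul (Eventually.of_forall fun x =>
      ((A x).le_opNorm _).trans (mul_le_mul_of_nonneg_right (hC x) (norm_nonneg _))) 2
  have h2 : eLpNorm (fun x => f (Ψ x)) 2 volume
      = c ^ (1 / (2 : ℝ≥0∞)).toReal * eLpNorm f 2 volume := by
    have := eLpNorm_comp_measurePreserving (p := 2) (g := f) (f := Ψ)
      ((Lp.memLp f).smul_measure hc).1 hΨ
    rw [eLpNorm_smul_measure_of_ne_top (by norm_num)] at this
    exact this
  rw [h2] at h1
  have hfin : ENNReal.ofReal C * (c ^ (1 / (2 : ℝ≥0∞)).toReal * eLpNorm f 2 volume) ≠ ⊤ :=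
    ENNReal.mul_ne_top ENNReal.ofReal_ne_top
      (ENNReal.mul_ne_top (ENNReal.rpow_ne_top_of_nonneg (by positivity) hc) (Lp.memLp f).2.ne)
  refine (ENNReal.toReal_mono hfin h1).trans (le_of_eq ?_)
  rw [ENNReal.toReal_mul, ENNReal.toReal_mul, ENNReal.toReal_ofReal hC0, Lp.norm_def, mul_assoc]

lemma exists_mul_op {g : F → ℝ} (hg : Measurable g) {C : ℝ} (hC : ∀ x, |g x| ≤ C) (V : Type*)
    [NormedAddCommGroup V] [InnerProductSpace ℝ V] :
    ∃ T : Lp V 2 (volume : Measure F) →L[ℝ] Lp V 2 (volume : Measure F),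
      ∀ f, T f =ᵐ[volume] fun x => g x • f x := by
  have h1 : MeasurePreserving id volume ((1 : ℝ≥0∞) • (volume : Measure F)) := by
    rw [one_smul]; exact MeasurePreserving.id _
  obtain ⟨T, hT⟩ := exists_weighted_comp (W := V) ENNReal.one_ne_top h1
    (A := fun x => g x • ContinuousLinearMap.id ℝ V)
    (hg.stronglyMeasurable.smul_const _) (C := C) fun x => by
      rw [norm_smul, Real.norm_eq_abs]
      exact (mul_le_of_le_one_right (abs_nonneg _) ContinuousLinearMap.norm_id_le).trans (hC x)
  exact ⟨T, fun f => (hT f).trans (by simp)⟩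

open Classical in
/-- Multiplication by a bounded measurable function, as an operator of `L²(F; V)`. -/
def mulL2 (g : F → ℝ) : Lp V 2 (volume : Measure F) →L[ℝ] Lp V 2 (volume : Measure F) :=
  if h : ∃ T : Lp V 2 (volume : Measure F) →L[ℝ] Lp V 2 (volume : Measure F),
    ∀ f, T f =ᵐ[volume] fun x => g x • f x then h.choose else 0

lemma mulL2_coe {g : F → ℝ} (hg : Measurable g) {C : ℝ} (hC : ∀ x, |g x| ≤ C)
    (f : Lp V 2 (volume : Measure F)) : mulL2 g f =ᵐ[volume] fun x => g x • f x := by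
  have h := exists_mul_op hg hC V
  rw [mulL2, dif_pos h]
  exact h.choose_spec f

lemma mulL2_norm_sq {g : F → ℝ} (hg : Measurable g) {C : ℝ} (hC : ∀ x, |g x| ≤ C)
    (f : Lp V 2 (volume : Measure F)) : ‖mulL2 g f‖ ^ 2 = ∫ x, g x ^ 2 * ‖f x‖ ^ 2 := by
  rw [L2_norm_sq]
  refine integral_congr_ae ?_
  filter_upwards [mulL2_coe hg hC f] with x hx
  rw [hx, norm_smul, mul_pow, Real.norm_eq_abs, sq_abs]

end FormDomain

/-! ### The form domain and the Sobolev space -/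

section Bridge

variable {F : Type*} [NormedAddCommGroup F] [InnerProductSpace ℝ F] [FiniteDimensional ℝ F]
  [MeasurableSpace F] [BorelSpace F]
variable {V : Type*} [NormedAddCommGroup V] [InnerProductSpace ℝ V]

open Classical in
/-- The class in `L²(F; V)` of a square integrable function, and `0` for other functions. -/
def toL2 (f : F → V) : Lp V 2 (volume : Measure F) :=
  if h : MemLp f 2 volume then h.toLp else 0

lemma toL2_coe {f : F → V} (hf : MemLp f 2 volume) : toL2 f =ᵐ[volume] f := by
  rw [toL2, dif_pos hf]; exact hf.coeFn_toLp

lemma toL2_indicator_coe {Ω : Set F} (hΩ : MeasurableSet Ω) {f : F → V}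
    (hf : MemLp f 2 (volume.restrict Ω)) : toL2 (Ω.indicator f) =ᵐ[volume] Ω.indicator f :=
  toL2_coe ((memLp_indicator_iff_restrict hΩ).2 hf)

lemma inner_of_ae_indicator {Ω : Set F} (hΩ : MeasurableSet Ω) {x y : Lp V 2 (volume : Measure F)}
    {f g : F → V} (hx : x =ᵐ[volume] Ω.indicator f) (hy : y =ᵐ[volume] Ω.indicator g) :
    ⟪x, y⟫ = ∫ z in Ω, ⟪f z, g z⟫ := by
  rw [L2.inner_def, ← integral_indicator hΩ]
  refine integral_congr_ae ?_
  filter_upwards [hx, hy] with z e1 e2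
  rw [e1, e2]
  by_cases hz : z ∈ Ω <;> simp [hz]

lemma norm_sq_of_ae_indicator {Ω : Set F} (hΩ : MeasurableSet Ω)
    {x : Lp V 2 (volume : Measure F)} {f : F → V} (hx : x =ᵐ[volume] Ω.indicator f) :
    ‖x‖ ^ 2 = ∫ z in Ω, ‖f z‖ ^ 2 := by
  rw [← real_inner_self_eq_norm_sq, inner_of_ae_indicator hΩ hx hx]
  simp

/-- A function of class `H¹(Ω)`, paired with `h` times its gradient and extended by zero. -/
def lift (h : ℝ) (Ω : Set F) (u : F → ℝ) : L2 F × L2V F :=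
  (toL2 (Ω.indicator u), toL2 (Ω.indicator fun y => h • weakGrad Ω u y))

lemma weakGrad_spec {Ω : Set F} {u : F → ℝ} (hu : ∃ G, IsWeakGradient Ω u G) :
    IsWeakGradient Ω u (weakGrad Ω u) := by
  rw [weakGrad, dif_pos hu]; exact hu.choose_spec

lemma integrable_smul_of_memLp {Ω : Set F} {φ : F → ℝ} (hφ : ContDiff ℝ (⊤ : ℕ∞) φ)
    (hc : HasCompactSupport φ) {G : F → V} (hG : MemLp G 2 (volume.restrict Ω)) :
    Integrable (fun x => φ x • G x) (volume.restrict Ω) :=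
  (hG.locallyIntegrable (by norm_num)).integrable_smul_left_of_hasCompactSupport hφ.continuous hc

/-- The weak gradient is unique. -/
lemma IsWeakGradient.ae_eq {Ω : Set F} (hΩ : IsOpen Ω) {u : F → ℝ} {G₁ G₂ : F → F}
    (h₁ : IsWeakGradient Ω u G₁) (h₂ : IsWeakGradient Ω u G₂) :
    G₁ =ᵐ[volume.restrict Ω] G₂ := by
  have h := hΩ.ae_eq_zero_of_integral_contDiff_smul_eq_zero (μ := volume.restrict Ω)
    (f := fun x => G₁ x - G₂ x)
    (((h₁.1.sub h₂.1).locallyIntegrable (by norm_num)).locallyIntegrableOn Ω)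
    (fun φ hφ hc hs => by
      have e := (h₁.2 φ hφ hc hs).symm.trans (h₂.2 φ hφ hc hs)
      simp_rw [smul_sub]
      rw [integral_sub (integrable_smul_of_memLp hφ hc h₁.1) (integrable_smul_of_memLp hφ hc h₂.1),
        neg_injective e, sub_self])
  filter_upwards [h, ae_restrict_mem hΩ.measurableSet] with x hx hm
  exact sub_eq_zero.1 (hx hm)

lemma IsWeakGradient.mono {Ω Ω' : Set F} (hΩ : MeasurableSet Ω)
    (hsub : Ω' ⊆ Ω) {u : F → ℝ} {G : F → F}
    (h : IsWeakGradient Ω u G) : IsWeakGradient Ω' u G := by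
  refine ⟨h.1.mono_measure (Measure.restrict_mono hsub le_rfl), fun φ hφ hc hs => ?_⟩
  have key := h.2 φ hφ hc (hs.trans hsub)
  rw [setIntegral_eq_of_subset_of_forall_sdiff_eq_zero hΩ hsub,
    setIntegral_eq_of_subset_of_forall_sdiff_eq_zero hΩ hsub] at key
  · exact key
  · intro x hx
    rw [image_eq_zero_of_notMem_tsupport fun hm => hx.2 (hs hm), zero_smul]
  · intro x hx
    rw [image_eq_zero_of_notMem_tsupport fun hm => hx.2 (hs (tsupport_gradient_subset φ hm)),
      smul_zero]

lemma IsWeakGradient.congr {Ω : Set F} {u v : F → ℝ} {G : F → F}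
    (huv : u =ᵐ[volume.restrict Ω] v) (h : IsWeakGradient Ω u G) : IsWeakGradient Ω v G := by
  refine ⟨h.1, fun φ hφ hc hs => ?_⟩
  rw [← h.2 φ hφ hc hs]
  refine integral_congr_ae ?_
  filter_upwards [huv] with x hx
  rw [hx]

section Lift

variable {h : ℝ} {Ω S : Set F} {u v : F → ℝ}

lemma lift_fst_coe (hΩ : MeasurableSet Ω) (hu : MemH1 Ω u) :
    (lift h Ω u).1 =ᵐ[volume] Ω.indicator u := toL2_indicator_coe hΩ hu.1

lemma lift_snd_coe (hΩ : MeasurableSet Ω) (hu : MemH1 Ω u) :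
    (lift h Ω u).2 =ᵐ[volume] Ω.indicator fun y => h • weakGrad Ω u y :=
  toL2_indicator_coe hΩ ((weakGrad_spec hu.2).1.const_smul h)

lemma inner_lift_fst (hΩ : MeasurableSet Ω) (hu : MemH1 Ω u) (hv : MemH1 Ω v) :
    ⟪(lift h Ω u).1, (lift h Ω v).1⟫ = l2Inner Ω u v := by
  rw [inner_of_ae_indicator hΩ (lift_fst_coe hΩ hu) (lift_fst_coe hΩ hv), l2Inner]
  simp [mul_comm]

lemma inner_lift_snd (hΩ : MeasurableSet Ω) (hu : MemH1 Ω u) (hv : MemH1 Ω v) :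
    ⟪(lift h Ω u).2, (lift h Ω v).2⟫ = h ^ 2 * dirichletForm Ω u v := by
  rw [inner_of_ae_indicator hΩ (lift_snd_coe hΩ hu) (lift_snd_coe hΩ hv), dirichletForm,
    ← integral_const_mul]
  refine integral_congr_ae (Eventually.of_forall fun x => ?_)
  simp only [real_inner_smul_left, real_inner_smul_right]
  ring

/-- The distance to a test function in `H¹(Ω)` is, up to the scale of the gradient, the distance of
the corresponding pairs; this identifies the two notions of closure. -/
lemma integral_approx_eq (hΩ : MeasurableSet Ω) (h0 : h ≠ 0) {x y : L2 F × L2V F} {G : F → F}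
    {φ : F → ℝ} (hx1 : x.1 =ᵐ[volume] Ω.indicator u)
    (hx2 : x.2 =ᵐ[volume] Ω.indicator fun z => h • G z) (hy1 : y.1 =ᵐ[volume] Ω.indicator φ)
    (hy2 : y.2 =ᵐ[volume] Ω.indicator fun z => h • gradient φ z) :
    ∫ z in Ω, ((u z - φ z) ^ 2 + ‖G z - gradient φ z‖ ^ 2)
      = ‖(x - y).1‖ ^ 2 + (h ^ 2)⁻¹ * ‖(x - y).2‖ ^ 2 := by
  have e1 : (x - y).1 =ᵐ[volume] Ω.indicator fun z => u z - φ z := by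
    filter_upwards [Lp.coeFn_sub x.1 y.1, hx1, hy1] with z a1 a2 a3
    rw [Prod.fst_sub, a1, Pi.sub_apply, a2, a3]
    by_cases hz : z ∈ Ω <;> simp [hz]
  have e2 : (x - y).2 =ᵐ[volume] Ω.indicator fun z => h • (G z - gradient φ z) := by
    filter_upwards [Lp.coeFn_sub x.2 y.2, hx2, hy2] with z a1 a2 a3
    rw [Prod.snd_sub, a1, Pi.sub_apply, a2, a3]
    by_cases hz : z ∈ Ω <;> simp [hz, smul_sub]
  have i1 : IntegrableOn (fun z => ‖u z - φ z‖ ^ 2) Ω := by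
    have := L2_integrable_sq (x - y).1
    rw [← integrable_indicator_iff hΩ]
    refine this.congr ?_
    filter_upwards [e1] with z hz
    rw [hz]
    by_cases hz : z ∈ Ω <;> simp [hz]
  have i2 : IntegrableOn (fun z => ‖h • (G z - gradient φ z)‖ ^ 2) Ω := by
    have := L2_integrable_sq (x - y).2
    rw [← integrable_indicator_iff hΩ]
    refine this.congr ?_
    filter_upwards [e2] with z hz
    rw [hz]
    by_cases hz : z ∈ Ω <;> simp [hz]
  have hh : ∀ w : F, ‖w‖ ^ 2 = (h ^ 2)⁻¹ * ‖h • w‖ ^ 2 := fun w => by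
    rw [norm_smul, mul_pow, Real.norm_eq_abs, sq_abs, ← mul_assoc,
      inv_mul_cancel₀ (pow_ne_zero 2 h0), one_mul]
  rw [norm_sq_of_ae_indicator hΩ e1, norm_sq_of_ae_indicator hΩ e2, ← integral_const_mul,
    ← integral_add i1 (i2.const_mul _)]
  refine integral_congr_ae (Eventually.of_forall fun z => ?_)
  simp only
  rw [hh (G z - gradient φ z), Real.norm_eq_abs, sq_abs]

/-- A function of `H̊¹(Ω; S)` gives an element of the form domain. -/
lemma lift_mem_formDomain (hΩ : MeasurableSet Ω) (h0 : h ≠ 0) (hu : MemH10 Ω S u) :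
    lift h Ω u ∈ formDomain h Ω S := by
  change lift h Ω u ∈ closure (preDomain h Ω S : Set (L2 F × L2V F))
  rw [Metric.mem_closure_iff]
  intro ε hε
  have hδ : 0 < min (ε ^ 2) ((h ^ 2)⁻¹ * ε ^ 2) := by positivity
  obtain ⟨φ, hφ1, hφ2, hφ3, hφ4⟩ := hu.2 _ hδ
  obtain ⟨y, hy, hy1, hy2⟩ := exists_mem_formDomain (h := h) (S := S) hΩ
    (φ := φ) ⟨hφ1, hφ2, hφ3⟩
  refine ⟨y, hy, ?_⟩
  rw [integral_approx_eq hΩ h0 (lift_fst_coe hΩ hu.1) (lift_snd_coe hΩ hu.1) hy1 hy2,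
    lt_min_iff] at hφ4
  rw [dist_eq_norm, Prod.norm_def, max_lt_iff]
  have hp : 0 < (h ^ 2)⁻¹ := by positivity
  constructor
  · refine lt_of_pow_lt_pow_left₀ 2 hε.le (lt_of_le_of_lt ?_ hφ4.1)
    have := mul_nonneg hp.le (sq_nonneg ‖(lift h Ω u - y).2‖)
    linarith
  · refine lt_of_pow_lt_pow_left₀ 2 hε.le ?_
    have h1 := sq_nonneg ‖(lift h Ω u - y).1‖
    refine lt_of_mul_lt_mul_left (lt_of_le_of_lt ?_ hφ4.2) hp.le
    linarith

/-- The elements of the form domain vanish outside `Ω`. -/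
lemma ae_eq_indicator_of_mem (hΩ : MeasurableSet Ω) {x : L2 F × L2V F}
    (hx : x ∈ formDomain h Ω S) :
    x.1 =ᵐ[volume] Ω.indicator x.1 ∧ x.2 =ᵐ[volume] Ω.indicator x.2 := by
  have hg : Measurable (Ω.indicator fun _ => (1 : ℝ)) := measurable_const.indicator hΩ
  have hC : ∀ z, |Ω.indicator (fun _ => (1 : ℝ)) z| ≤ 1 := fun z => by
    by_cases hz : z ∈ Ω <;> simp [hz]
  have key : mulL2 (Ω.indicator fun _ => (1 : ℝ)) x.1 = x.1 ∧
      mulL2 (Ω.indicator fun _ => (1 : ℝ)) x.2 = x.2 := by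
    refine formDomain_induction (P := fun x => mulL2 (Ω.indicator fun _ => (1 : ℝ)) x.1 = x.1 ∧
      mulL2 (Ω.indicator fun _ => (1 : ℝ)) x.2 = x.2) ?_ ?_ x hx
    · exact (isClosed_eq (by fun_prop) (by fun_prop)).inter
        (isClosed_eq (by fun_prop) (by fun_prop))
    · rintro y ⟨φ, hφ, hy1, hy2⟩
      constructor
      · refine Lp.ext ?_
        filter_upwards [mulL2_coe hg hC y.1, hy1] with z e1 e2
        rw [e1, e2]
        by_cases hz : z ∈ Ω <;> simp [hz]
      · refine Lp.ext ?_
        filter_upwards [mulL2_coe hg hC y.2, hy2] with z e1 e2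
        rw [e1, e2]
        by_cases hz : z ∈ Ω <;> simp [hz]
  constructor
  · filter_upwards [mulL2_coe hg hC x.1] with z e1
    rw [key.1] at e1
    by_cases hz : z ∈ Ω <;> simp [hz] at e1 ⊢
    exact e1
  · filter_upwards [mulL2_coe hg hC x.2] with z e1
    rw [key.2] at e1
    by_cases hz : z ∈ Ω <;> simp [hz] at e1 ⊢
    exact e1

/-- Integration by parts, which holds for the test functions, passes to their closure: the second
component of an element of the form domain is `h` times the weak gradient of the first one. -/
lemma isWeakGradient_of_mem (hΩ : MeasurableSet Ω) (h0 : h ≠ 0) {x : L2 F × L2V F}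
    (hx : x ∈ formDomain h Ω S) : IsWeakGradient Ω x.1 fun z => h⁻¹ • x.2 z := by
  refine ⟨((Lp.memLp x.2).const_smul h⁻¹).restrict Ω, fun ψ hψ hc hs => ?_⟩
  refine ext_inner_right ℝ fun v => ?_
  set a : F → ℝ := fun z => ⟪gradient ψ z, v⟫ with ha
  set b : F → F := fun z => ψ z • v with hb
  have hac : HasCompactSupport a :=
    (hasCompactSupport_gradient hc).comp_left (g := fun w => ⟪w, v⟫) (by simp)
  have haL : MemLp a 2 (volume.restrict Ω) :=
    ((((continuous_gradient hψ).inner continuous_const).memLp_of_hasCompactSupport hac)).restrict Ω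
  have hbL : MemLp b 2 (volume.restrict Ω) :=
    ((hψ.continuous.smul continuous_const).memLp_of_hasCompactSupport hc.smul_right).restrict Ω
  have hP : ⟪x.1, toL2 (Ω.indicator a)⟫ = -(h⁻¹ * ⟪x.2, toL2 (Ω.indicator b)⟫) := by
    refine formDomain_induction (P := fun x : L2 F × L2V F =>
      ⟪x.1, toL2 (Ω.indicator a)⟫ = -(h⁻¹ * ⟪x.2, toL2 (Ω.indicator b)⟫)) ?_ ?_ x hx
    · exact isClosed_eq (by fun_prop) (by fun_prop)
    · rintro y ⟨φ, hφ, hy1, hy2⟩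
      rw [inner_of_ae_indicator hΩ hy1 (toL2_indicator_coe hΩ haL),
        inner_of_ae_indicator hΩ hy2 (toL2_indicator_coe hΩ hbL)]
      have e1 : ∫ z in Ω, ⟪φ z, a z⟫ = ∫ z, φ z * fderiv ℝ ψ z v := by
        rw [setIntegral_eq_integral_of_forall_compl_eq_zero]
        · refine integral_congr_ae (Eventually.of_forall fun z => ?_)
          simp [ha, inner_gradient_left, mul_comm]
        · intro z hz
          have : gradient ψ z = 0 :=
            image_eq_zero_of_notMem_tsupport fun hm => hz (hs (tsupport_gradient_subset ψ hm))
          simp only [ha, this, inner_zero_left, inner_zero_right]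
      have e2 : ∫ z in Ω, ⟪h • gradient φ z, b z⟫ = h * ∫ z, fderiv ℝ φ z v * ψ z := by
        rw [setIntegral_eq_integral_of_forall_compl_eq_zero, ← integral_const_mul]
        · refine integral_congr_ae (Eventually.of_forall fun z => ?_)
          simp only [hb, real_inner_smul_left, real_inner_smul_right, inner_gradient_left]
          ring
        · intro z hz
          have : ψ z = 0 := image_eq_zero_of_notMem_tsupport fun hm => hz (hs hm)
          simp [hb, this]
      have hψ1 : Continuous fun z => fderiv ℝ ψ z v :=
        (hψ.continuous_fderiv (by simp)).clm_apply continuous_const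
      have hφ1 : Continuous fun z => fderiv ℝ φ z v :=
        (hφ.1.continuous_fderiv (by simp)).clm_apply continuous_const
      rw [e1, e2, ← mul_assoc, inv_mul_cancel₀ h0, one_mul,
        integral_mul_fderiv_eq_neg_fderiv_mul_of_integrable]
      · exact (hφ1.mul hψ.continuous).integrable_of_hasCompactSupport hc.mul_left
      · exact (hφ.1.continuous.mul hψ1).integrable_of_hasCompactSupport hφ.2.1.mul_right
      · exact (hφ.1.continuous.mul hψ.continuous).integrable_of_hasCompactSupport hc.mul_left
      · exact fun z _ => differentiable_of_mem_testSpace hφ z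
      · exact fun z _ => hψ.differentiable (by simp) z
  obtain ⟨hx1, hx2⟩ := ae_eq_indicator_of_mem hΩ hx
  rw [inner_of_ae_indicator hΩ hx1 (toL2_indicator_coe hΩ haL),
    inner_of_ae_indicator hΩ hx2 (toL2_indicator_coe hΩ hbL)] at hP
  have i1 : IntegrableOn (fun z => x.1 z • gradient ψ z) Ω := by
    have h1 : MemLp (gradient ψ) 2 (volume.restrict Ω) :=
      ((continuous_gradient hψ).memLp_of_hasCompactSupport (hasCompactSupport_gradient hc)).restrict
        Ω
    exact memLp_one_iff_integrable.1 (h1.smul ((Lp.memLp x.1).restrict Ω) (r := 1))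
  have i2 : IntegrableOn (fun z => ψ z • h⁻¹ • x.2 z) Ω :=
    integrable_smul_of_memLp hψ hc (((Lp.memLp x.2).const_smul h⁻¹).restrict Ω)
  rw [inner_neg_left, real_inner_comm, ← integral_inner i1, real_inner_comm, ← integral_inner i2]
  have e3 : ∫ z in Ω, ⟪v, x.1 z • gradient ψ z⟫ = ∫ z in Ω, ⟪x.1 z, a z⟫ := by
    refine integral_congr_ae (Eventually.of_forall fun z => ?_)
    simp [ha, real_inner_smul_right, mul_comm, real_inner_comm v]
  have e4 : ∫ z in Ω, ⟪v, ψ z • h⁻¹ • x.2 z⟫ = h⁻¹ * ∫ z in Ω, ⟪x.2 z, b z⟫ := by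
    rw [← integral_const_mul]
    refine integral_congr_ae (Eventually.of_forall fun z => ?_)
    simp only [hb, real_inner_smul_right, real_inner_comm v]
    ring
  rw [e3, e4, hP]

/-- The elements of the form domain are the lifts of the functions of `H̊¹(Ω; S)`. -/
lemma memH10_of_mem (hΩ : IsOpen Ω) (h0 : h ≠ 0) {x : L2 F × L2V F}
    (hx : x ∈ formDomain h Ω S) (hu : u =ᵐ[volume.restrict Ω] x.1) :
    MemH10 Ω S u ∧ lift h Ω u = x := by
  have hm := hΩ.measurableSet
  have hw := (isWeakGradient_of_mem hm h0 hx).congr hu.symm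
  have hH1 : MemH1 Ω u := ⟨((Lp.memLp x.1).restrict Ω).ae_eq hu.symm, _, hw⟩
  have hwg := (weakGrad_spec hH1.2).ae_eq hΩ hw
  obtain ⟨hx1, hx2⟩ := ae_eq_indicator_of_mem hm hx
  have hlift : lift h Ω u = x := by
    refine Prod.ext (Lp.ext ?_) (Lp.ext ?_)
    · filter_upwards [lift_fst_coe (h := h) hm hH1, hx1, (ae_restrict_iff' hm).1 hu]
        with z e1 e2 e3
      rw [e1, e2]
      by_cases hz : z ∈ Ω <;> simp [hz]
      exact e3 hz
    · filter_upwards [lift_snd_coe (h := h) hm hH1, hx2, (ae_restrict_iff' hm).1 hwg]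
        with z e1 e2 e3
      rw [e1, e2]
      by_cases hz : z ∈ Ω <;> simp [hz]
      rw [e3 hz, smul_smul, mul_inv_cancel₀ h0, one_smul]
  refine ⟨⟨hH1, fun ε hε => ?_⟩, hlift⟩
  have hx' : x ∈ closure (preDomain h Ω S : Set (L2 F × L2V F)) := hx
  rw [Metric.mem_closure_iff] at hx'
  set c : ℝ := 1 + (h ^ 2)⁻¹ with hc
  have hc0 : 0 < c := by positivity
  obtain ⟨y, ⟨φ, hφ, hy1, hy2⟩, hd⟩ := hx' (Real.sqrt (ε / c)) (by positivity)
  refine ⟨φ, hφ.1, hφ.2.1, hφ.2.2, ?_⟩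
  rw [integral_approx_eq hm h0 (lift_fst_coe hm hH1) (lift_snd_coe hm hH1) hy1 hy2, hlift]
  rw [dist_eq_norm, Prod.norm_def, max_lt_iff] at hd
  have hs : Real.sqrt (ε / c) ^ 2 = ε / c := Real.sq_sqrt (by positivity)
  have b1 : ‖(x - y).1‖ ^ 2 < ε / c := by
    rw [← hs]; exact pow_lt_pow_left₀ hd.1 (norm_nonneg _) two_ne_zero
  have b2 : ‖(x - y).2‖ ^ 2 < ε / c := by
    rw [← hs]; exact pow_lt_pow_left₀ hd.2 (norm_nonneg _) two_ne_zero
  have hp : 0 < (h ^ 2)⁻¹ := by positivity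
  calc ‖(x - y).1‖ ^ 2 + (h ^ 2)⁻¹ * ‖(x - y).2‖ ^ 2
      < ε / c + (h ^ 2)⁻¹ * (ε / c) := add_lt_add b1 (mul_lt_mul_of_pos_left b2 hp)
    _ = c * (ε / c) := by rw [hc]; ring
    _ = ε := mul_div_cancel₀ ε hc0.ne'

/-- An eigenpair of the boundary value problem is an eigenvector of the form, whose spectral
parameter is rescaled by `h²`. -/
lemma isWeakEig_lift (hΩ : IsOpen Ω) (h0 : h ≠ 0) {lam : ℝ} (hu : IsEigenpair Ω S lam u) :
    IsWeakEig (formDomain h Ω S) (h ^ 2 * lam) (lift h Ω u) := by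
  have hm := hΩ.measurableSet
  refine ⟨lift_mem_formDomain hm h0 hu.1, fun h1 => hu.2.1 ?_, fun y hy => ?_⟩
  · have h2 := lift_fst_coe (h := h) hm hu.1.1
    rw [h1] at h2
    refine (ae_restrict_iff' hm).2 ?_
    filter_upwards [h2, Lp.coeFn_zero ℝ 2 (volume : Measure F)] with z e1 e2 hz
    rw [e2, Set.indicator_of_mem hz] at e1
    exact e1.symm
  · obtain ⟨hv, hlv⟩ := memH10_of_mem hΩ h0 hy (u := y.1) (Filter.EventuallyEq.refl _ _)
    rw [← hlv, inner_lift_snd hm hu.1.1 hv.1, inner_lift_fst hm hu.1.1 hv.1, hu.2.2 _ hv]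
    ring

/-- The converse of `isWeakEig_lift`: every eigenvector of the form comes from an eigenfunction. -/
lemma isEigenpair_of_isWeakEig (hΩ : IsOpen Ω) (h0 : h ≠ 0) {μ : ℝ} {x : L2 F × L2V F}
    (hx : IsWeakEig (formDomain h Ω S) μ x) :
    IsEigenpair Ω S ((h ^ 2)⁻¹ * μ) x.1 ∧ lift h Ω x.1 = x := by
  have hm := hΩ.measurableSet
  obtain ⟨hu, hlu⟩ := memH10_of_mem hΩ h0 hx.mem (u := x.1) (Filter.EventuallyEq.refl _ _)
  refine ⟨⟨hu, fun hz => hx.ne_zero (Lp.ext ?_), fun v hv => ?_⟩, hlu⟩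
  · filter_upwards [(ae_eq_indicator_of_mem hm hx.mem).1, (ae_restrict_iff' hm).1 hz,
      Lp.coeFn_zero ℝ 2 (volume : Measure F)] with z e1 e2 e3
    rw [e1, e3]
    by_cases hz : z ∈ Ω
    · rw [Set.indicator_of_mem hz, e2 hz]
    · simp [hz]
  · have h1 := hx.eq _ (lift_mem_formDomain hm h0 hv)
    have h2 := inner_lift_snd (h := h) hm hu.1 hv.1
    have h3 := inner_lift_fst (h := h) hm hu.1 hv.1
    rw [hlu] at h2 h3
    rw [h2, h3] at h1
    rw [mul_assoc, ← h1, ← mul_assoc, inv_mul_cancel₀ (pow_ne_zero 2 h0), one_mul]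

end Lift
end Bridge

/-! ### Multiplication, rescaling and the weighted energy estimate -/

section Transfer

variable {F : Type*} [NormedAddCommGroup F] [InnerProductSpace ℝ F] [FiniteDimensional ℝ F]
  [MeasurableSpace F] [BorelSpace F]

/-- A similarity of ratio `|ρ|` changes the volume by a constant factor. -/
lemma measurePreserving_similarity {ρ : ℝ} (hρ : ρ ≠ 0) (R : F ≃ₗᵢ[ℝ] F) (c : F) :
    MeasurePreserving (fun x => c + ρ • R x) (volume : Measure F)
      (ENNReal.ofReal |(ρ ^ Module.finrank ℝ F)⁻¹| • (volume : Measure F)) := by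
  have h1 : MeasurePreserving (fun x : F => ρ • x) volume
      (ENNReal.ofReal |(ρ ^ Module.finrank ℝ F)⁻¹| • (volume : Measure F)) :=
    ⟨measurable_const_smul ρ, Measure.map_addHaar_smul volume hρ⟩
  have h2 : MeasurePreserving (fun x : F => c + x)
      (ENNReal.ofReal |(ρ ^ Module.finrank ℝ F)⁻¹| • (volume : Measure F))
      (ENNReal.ofReal |(ρ ^ Module.finrank ℝ F)⁻¹| • (volume : Measure F)) :=
    (measurePreserving_add_left (volume : Measure F) c).smul_measure _
  exact h2.comp (h1.comp R.measurePreserving)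

lemma gradient_comp_similarity {φ : F → ℝ} (hφ : Differentiable ℝ φ) {ρ : ℝ} (R : F ≃ₗᵢ[ℝ] F)
    (c x : F) :
    gradient (fun y => φ (c + ρ • R y)) x = ρ • R.symm (gradient φ (c + ρ • R x)) := by
  refine ext_inner_right ℝ fun v => ?_
  have h1 : HasFDerivAt (fun y => c + ρ • R y)
      (ρ • (R.toContinuousLinearEquiv : F →L[ℝ] F)) x :=
    ((R.toContinuousLinearEquiv.hasFDerivAt).const_smul ρ).const_add c
  have h2 : HasFDerivAt (fun y => φ (c + ρ • R y)) _ x := (hφ (c + ρ • R x)).hasFDerivAt.comp x h1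
  rw [inner_gradient_left, h2.fderiv, real_inner_smul_left]
  have h3 : ⟪R.symm (gradient φ (c + ρ • R x)), v⟫ = ⟪gradient φ (c + ρ • R x), R v⟫ := by
    rw [← R.inner_map_map, R.apply_symm_apply]
  rw [h3, inner_gradient_left]
  simp

/-- Composition with a similarity, followed by multiplication by a smooth cut-off, maps one form
domain into another one; the scales of the two forms differ by the ratio of the similarity. -/
lemma transfer_mem {h₁ h₂ ρ : ℝ} (hρ : ρ ≠ 0) (hh : h₂ * ρ = h₁) (R : F ≃ₗᵢ[ℝ] F) (c : F)
    {θ : F → ℝ} (hθ : ContDiff ℝ (⊤ : ℕ∞) θ) {C : ℝ} (hC : ∀ x, |θ x| ≤ C)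
    (hC' : ∀ x, ‖gradient θ x‖ ≤ C) {Ω₁ S₁ Ω₂ S₂ : Set F}
    (hΩ : ∀ x ∈ tsupport θ, x ∈ Ω₂ ↔ c + ρ • R x ∈ Ω₁)
    (hS : ∀ x ∈ tsupport θ, x ∈ closure S₂ → c + ρ • R x ∈ closure S₁)
    {x : L2 F × L2V F} (hx : x ∈ formDomain h₁ Ω₁ S₁) :
    ∃ y ∈ formDomain h₂ Ω₂ S₂,
      (y.1 =ᵐ[volume] fun z => θ z * x.1 (c + ρ • R z)) ∧
      (y.2 =ᵐ[volume] fun z => θ z • R.symm (x.2 (c + ρ • R z)) +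
        (h₂ * x.1 (c + ρ • R z)) • gradient θ z) := by
  have hΨ := measurePreserving_similarity hρ R c
  have hC0 : 0 ≤ C := (abs_nonneg _).trans (hC 0)
  -- The three terms of the product rule as bounded operators on `L²`.
  obtain ⟨T₁, hT₁⟩ := exists_weighted_comp ENNReal.ofReal_ne_top hΨ
    (A := fun z => θ z • ContinuousLinearMap.id ℝ ℝ)
    (hθ.continuous.stronglyMeasurable.smul_const _) (C := C) fun z => by
      rw [norm_smul, Real.norm_eq_abs]
      exact (mul_le_of_le_one_right (abs_nonneg _) ContinuousLinearMap.norm_id_le).trans (hC z)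
  obtain ⟨T₂, hT₂⟩ := exists_weighted_comp ENNReal.ofReal_ne_top hΨ
    (A := fun z => θ z • (R.symm.toContinuousLinearEquiv : F →L[ℝ] F))
    (hθ.continuous.stronglyMeasurable.smul_const _)
    (C := C * ‖(R.symm.toContinuousLinearEquiv : F →L[ℝ] F)‖) fun z => by
      rw [norm_smul, Real.norm_eq_abs]
      exact mul_le_mul_of_nonneg_right (hC z) (norm_nonneg _)
  obtain ⟨T₃, hT₃⟩ := exists_weighted_comp (V := ℝ) (W := F) ENNReal.ofReal_ne_top hΨ
    (A := fun z => ContinuousLinearMap.toSpanSingleton ℝ (h₂ • gradient θ z))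
    (by
      refine Continuous.stronglyMeasurable ?_
      have : Continuous fun z => h₂ • gradient θ z :=
        continuous_const.smul (continuous_gradient hθ)
      exact (ContinuousLinearMap.toSpanSingletonCLE (𝕜 := ℝ) (E := F)).continuous.comp this)
    (C := |h₂| * C) fun z => by
      rw [ContinuousLinearMap.norm_toSpanSingleton, norm_smul, Real.norm_eq_abs]
      exact mul_le_mul_of_nonneg_left (hC' z) (abs_nonneg _)
  have hq : ∀ {W : Type _} {f g : F → W}, f =ᵐ[volume] g →
      (fun z => f (c + ρ • R z)) =ᵐ[volume] fun z => g (c + ρ • R z) :=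
    fun hfg => hΨ.quasiMeasurePreserving.ae_eq_comp (Measure.ae_smul_measure hfg _)
  have hqV : ∀ {f g : F → F}, f =ᵐ[volume] g →
      (fun z => f (c + ρ • R z)) =ᵐ[volume] fun z => g (c + ρ • R z) :=
    fun hfg => hΨ.quasiMeasurePreserving.ae_eq_comp (Measure.ae_smul_measure hfg _)
  have hT1 : ∀ f : L2 F, T₁ f =ᵐ[volume] fun z => θ z * f (c + ρ • R z) := fun f => by
    simpa using hT₁ f
  have hT23 : ∀ x : L2 F × L2V F, (T₂ x.2 + T₃ x.1 : L2V F) =ᵐ[volume] fun z =>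
      θ z • R.symm (x.2 (c + ρ • R z)) + (h₂ * x.1 (c + ρ • R z)) • gradient θ z := fun x => by
    filter_upwards [Lp.coeFn_add (T₂ x.2) (T₃ x.1), hT₂ x.2, hT₃ x.1] with z e1 e2 e3
    rw [e1, Pi.add_apply, e2, e3]
    simp [smul_smul, mul_comm]
  let T : L2 F × L2V F → L2 F × L2V F := fun x => (T₁ x.1, T₂ x.2 + T₃ x.1)
  have hTc : Continuous T := by fun_prop
  refine ⟨T x, ?_, hT1 x.1, hT23 x⟩
  have hx' : x ∈ closure (preDomain h₁ Ω₁ S₁ : Set (L2 F × L2V F)) := hx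
  -- By continuity it suffices to treat test functions.
  refine map_mem_closure (t := (preDomain h₂ Ω₂ S₂ : Set (L2 F × L2V F))) hTc hx' ?_
  rintro y ⟨φ, hφ, hy1, hy2⟩
  have hΨs : ContDiff ℝ (⊤ : ℕ∞) fun z => c + ρ • R z :=
    contDiff_const.add (contDiff_const.smul R.contDiff)
  have hφΨ : ContDiff ℝ (⊤ : ℕ∞) fun z => φ (c + ρ • R z) := hφ.1.comp hΨs
  have hsupp : tsupport (fun z => φ (c + ρ • R z)) ⊆ (fun z => c + ρ • R z) ⁻¹' tsupport φ :=
    tsupport_comp_subset_preimage φ hΨs.continuous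
  have hcomp : HasCompactSupport fun z => φ (c + ρ • R z) := by
    let e : F ≃ₜ F := R.toHomeomorph.trans
      ((Homeomorph.smulOfNeZero ρ hρ).trans (Homeomorph.addLeft c))
    exact hφ.2.1.comp_homeomorph e
  refine ⟨fun z => θ z * φ (c + ρ • R z), ⟨hθ.mul hφΨ, hcomp.mul_left, ?_⟩, ?_, ?_⟩
  · rw [Set.disjoint_left]
    intro z hz hzS
    have h1 : z ∈ tsupport θ := tsupport_mul_subset_left hz
    have h2 : z ∈ tsupport fun z => φ (c + ρ • R z) := tsupport_mul_subset_right hz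
    exact Set.disjoint_left.1 hφ.2.2 (hsupp h2) (hS z h1 hzS)
  · filter_upwards [hT1 y.1, hq hy1] with z e1 e2
    rw [e1, e2]
    by_cases hz : z ∈ tsupport θ
    · by_cases hz2 : z ∈ Ω₂
      · rw [Set.indicator_of_mem hz2, Set.indicator_of_mem ((hΩ z hz).1 hz2)]
      · rw [Set.indicator_of_notMem hz2, Set.indicator_of_notMem fun h => hz2 ((hΩ z hz).2 h),
          mul_zero]
    · have h0 : θ z = 0 := image_eq_zero_of_notMem_tsupport hz
      simp [Set.indicator, h0]
  · filter_upwards [hT23 y, hq hy1, hqV hy2] with z e1 e2 e3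
    change (T₂ y.2 + T₃ y.1 : L2V F) z = _
    rw [e1, e2, e3]
    by_cases hz : z ∈ tsupport θ
    · by_cases hz2 : z ∈ Ω₂
      · rw [Set.indicator_of_mem hz2, Set.indicator_of_mem ((hΩ z hz).1 hz2),
          Set.indicator_of_mem ((hΩ z hz).1 hz2), gradient_mul' (hθ.differentiable (by simp) z)
          (hφΨ.differentiable (by simp) z),
          gradient_comp_similarity (differentiable_of_mem_testSpace hφ), ← hh]
        simp only [map_smul]
        module
      · rw [Set.indicator_of_notMem hz2, Set.indicator_of_notMem fun h => hz2 ((hΩ z hz).2 h),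
          Set.indicator_of_notMem fun h => hz2 ((hΩ z hz).2 h)]
        simp
    · have h0 : θ z = 0 := image_eq_zero_of_notMem_tsupport hz
      have h1 : gradient θ z = 0 := image_eq_zero_of_notMem_tsupport fun hm =>
        hz (tsupport_gradient_subset θ hm)
      have h2 : gradient (fun z => θ z * φ (c + ρ • R z)) z = 0 := by
        rw [gradient_mul' (hθ.differentiable (by simp) z) (hφΨ.differentiable (by simp) z), h0, h1]
        simp
      simp [Set.indicator, h0, h1, h2]

/-- Multiplication by a smooth function. -/
lemma mul_mem_formDomain {h : ℝ} {θ : F → ℝ} (hθ : ContDiff ℝ (⊤ : ℕ∞) θ) {C : ℝ}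
    (hC : ∀ x, |θ x| ≤ C) (hC' : ∀ x, ‖gradient θ x‖ ≤ C) {Ω S S' : Set F}
    (hS : ∀ x ∈ tsupport θ, x ∈ closure S' → x ∈ closure S)
    {x : L2 F × L2V F} (hx : x ∈ formDomain h Ω S) :
    ∃ y ∈ formDomain h Ω S', (y.1 =ᵐ[volume] fun z => θ z * x.1 z) ∧
      (y.2 =ᵐ[volume] fun z => θ z • x.2 z + (h * x.1 z) • gradient θ z) := by
  obtain ⟨y, hy, h1, h2⟩ := transfer_mem (h₁ := h) (h₂ := h) one_ne_zero (mul_one h)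
    (LinearIsometryEquiv.refl ℝ F) 0 hθ hC hC' (Ω₁ := Ω) (Ω₂ := Ω) (S₁ := S) (S₂ := S')
    (by simp) (by simpa using hS) hx
  have hid : ∀ z : F, 0 + (1 : ℝ) • LinearIsometryEquiv.refl ℝ F z = z := fun z => by simp
  have hid' : ∀ z : F, (LinearIsometryEquiv.refl ℝ F).symm z = z := fun _ => rfl
  simp only [hid, hid'] at h1 h2
  exact ⟨y, hy, h1, h2⟩

variable {V W W' : Type*} [NormedAddCommGroup V] [InnerProductSpace ℝ V]
  [NormedAddCommGroup W] [InnerProductSpace ℝ W] [NormedAddCommGroup W'] [InnerProductSpace ℝ W']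

lemma norm_sq_le_of_ae {f : Lp V 2 (volume : Measure F)} {g : Lp W 2 (volume : Measure F)}
    {k : Lp W' 2 (volume : Measure F)} {a b : ℝ}
    (h : ∀ᵐ x, ‖f x‖ ^ 2 ≤ a * ‖g x‖ ^ 2 + b * ‖k x‖ ^ 2) :
    ‖f‖ ^ 2 ≤ a * ‖g‖ ^ 2 + b * ‖k‖ ^ 2 := by
  rw [L2_norm_sq, L2_norm_sq, L2_norm_sq, ← integral_const_mul, ← integral_const_mul,
    ← integral_add ((L2_integrable_sq g).const_mul a) ((L2_integrable_sq k).const_mul b)]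
  exact integral_mono_ae (L2_integrable_sq f)
    (((L2_integrable_sq g).const_mul a).add ((L2_integrable_sq k).const_mul b)) h

/-- The function with value `1` on `A` and `0` elsewhere. -/
abbrev one (A : Set F) : F → ℝ := A.indicator fun _ => 1

lemma measurable_one {A : Set F} (hA : MeasurableSet A) : Measurable (one A) :=
  measurable_const.indicator hA

lemma abs_one_le (A : Set F) (x : F) : |one A x| ≤ 1 := by
  by_cases hx : x ∈ A <;> simp [hx]

lemma mulL2_one_coe {A : Set F} (hA : MeasurableSet A) (f : Lp V 2 (volume : Measure F)) :
    mulL2 (one A) f =ᵐ[volume] fun x => one A x • f x :=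
  mulL2_coe (measurable_one hA) (abs_one_le A) f

lemma norm_mulL2_one_le {A : Set F} (hA : MeasurableSet A) (f : Lp V 2 (volume : Measure F)) :
    ‖mulL2 (one A) f‖ ^ 2 ≤ ‖f‖ ^ 2 := by
  have := norm_sq_le_of_ae (f := mulL2 (one A) f) (g := f) (k := f) (a := 1) (b := 0) (by
    filter_upwards [mulL2_one_coe hA f] with x hx
    rw [hx]
    by_cases hx : x ∈ A <;> simp [hx])
  simpa using this

/-- Exponential decay of eigenfunctions (the method of Agmon): if the form is bounded below by `m`
on the part `A` and `m` exceeds the eigenvalue by more than `a²`, the eigenfunction may be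
multiplied by a weight `E` of logarithmic slope at most `a`, and its norm remains bounded in terms
of the values of the weight outside `A`. -/
lemma agmon_estimate {h lam m a C₀ : ℝ} {Ω S A : Set F} (h0 : 0 ≤ h)
    {x : L2 F × L2V F} (hx : IsWeakEig (formDomain h Ω S) lam x)
    {E : F → ℝ} (hE : ContDiff ℝ (⊤ : ℕ∞) E) (hE0 : ∀ z, 0 ≤ E z) {C : ℝ} (hC : ∀ z, |E z| ≤ C)
    (hC' : ∀ z, ‖gradient E z‖ ≤ C) (hEa : ∀ z, h * ‖gradient E z‖ ≤ a * E z)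
    (hA : MeasurableSet A)
    (hP : ∀ y ∈ formDomain h Ω S, m * ‖mulL2 (one A) y.1‖ ^ 2 ≤ ‖mulL2 (one A) y.2‖ ^ 2)
    (hm : 0 < m - lam - a ^ 2) (hm0 : 0 ≤ m) (hEA : ∀ z ∉ A, E z ≤ C₀) :
    ∃ y ∈ formDomain h Ω S, (y.1 =ᵐ[volume] fun z => E z * x.1 z) ∧
      (y.2 =ᵐ[volume] fun z => E z • x.2 z + (h * x.1 z) • gradient E z) ∧
      ‖y.1‖ ^ 2 ≤ m * C₀ ^ 2 / (m - lam - a ^ 2) * ‖x.1‖ ^ 2 ∧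
      ‖y.2‖ ^ 2 ≤ (lam + a ^ 2) * ‖y.1‖ ^ 2 := by
  obtain ⟨y, hy, hy1, hy2⟩ := mul_mem_formDomain hE hC hC' (S' := S) (fun _ _ h => h) hx.mem
  -- The test vector is obtained by multiplying twice with the weight.
  obtain ⟨z, hz, hz1, hz2⟩ := mul_mem_formDomain hE hC hC' (S' := S) (fun _ _ h => h) hy
  have e1 : ⟪x.1, z.1⟫ = ‖y.1‖ ^ 2 := by
    rw [L2_norm_sq, L2.inner_def]
    refine integral_congr_ae ?_
    filter_upwards [hy1, hz1] with t a1 a2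
    rw [a2, a1, Real.norm_eq_abs, sq_abs]
    simp; ring
  -- The commutator identity `|∇(E x)|² - ∇x · ∇(E² x) = x² |∇E|²`.
  have e2 : ‖y.2‖ ^ 2 - ⟪x.2, z.2⟫ ≤ a ^ 2 * ‖y.1‖ ^ 2 := by
    rw [L2_norm_sq, L2_norm_sq, L2.inner_def, ← integral_const_mul,
      ← integral_sub (L2_integrable_sq y.2) (L2.integrable_inner x.2 z.2)]
    refine integral_mono_ae ((L2_integrable_sq y.2).sub (L2.integrable_inner x.2 z.2))
      ((L2_integrable_sq y.1).const_mul _) ?_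
    filter_upwards [hy1, hy2, hz2] with t a1 a2 a3
    have b1 : (h * ‖gradient E t‖) ^ 2 ≤ (a * E t) ^ 2 :=
      pow_le_pow_left₀ (by positivity) (hEa t) 2
    have b2 : ‖y.2 t‖ ^ 2 - ⟪x.2 t, z.2 t⟫ = (x.1 t) ^ 2 * (h * ‖gradient E t‖) ^ 2 := by
      rw [a3, a2, a1, ← real_inner_self_eq_norm_sq]
      have : ‖gradient E t‖ ^ 2 = ⟪gradient E t, gradient E t⟫ :=
        (real_inner_self_eq_norm_sq _).symm
      rw [mul_pow, this]
      simp only [inner_add_left, inner_add_right, real_inner_smul_left, real_inner_smul_right,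
        real_inner_comm (x.2 t) (gradient E t)]
      ring
    change ‖y.2 t‖ ^ 2 - ⟪x.2 t, z.2 t⟫ ≤ a ^ 2 * ‖y.1 t‖ ^ 2
    rw [b2, a1, Real.norm_eq_abs, sq_abs]
    nlinarith [mul_le_mul_of_nonneg_left b1 (sq_nonneg (x.1 t))]
  have e3 : ⟪x.2, z.2⟫ = lam * ‖y.1‖ ^ 2 := by rw [hx.eq z hz, e1]
  have e4 : ‖y.2‖ ^ 2 ≤ (lam + a ^ 2) * ‖y.1‖ ^ 2 := by linarith
  -- On `A` the Poincaré inequality is used, and off `A` the weight is at most `C₀`.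
  have e5 : ‖y.1‖ ^ 2 ≤ 1 * ‖mulL2 (one A) y.1‖ ^ 2 + C₀ ^ 2 * ‖x.1‖ ^ 2 := by
    refine norm_sq_le_of_ae ?_
    filter_upwards [hy1, mulL2_one_coe hA y.1] with t a1 a2
    rw [a2]
    by_cases ht : t ∈ A
    · simp only [one, Set.indicator_of_mem ht, one_smul, one_mul]
      nlinarith [mul_nonneg (sq_nonneg C₀) (sq_nonneg ‖x.1 t‖)]
    · simp only [one, Set.indicator_of_notMem ht, zero_smul, norm_zero]
      rw [a1, norm_mul, mul_pow, Real.norm_eq_abs, sq_abs]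
      have := pow_le_pow_left₀ (hE0 t) (hEA t ht) 2
      nlinarith [sq_nonneg ‖x.1 t‖]
  refine ⟨y, hy, hy1, hy2, ?_, e4⟩
  have e6 := (hP y hy).trans (norm_mulL2_one_le hA y.2)
  rw [div_mul_eq_mul_div, le_div_iff₀ hm]
  nlinarith

end Transfer

/-! ### A Rellich theorem for functions which vanish on the boundary -/

section Rellich

lemma sq_intervalIntegral_le {g : ℝ → ℝ} (hg : Continuous g) :
    (∫ t in (0 : ℝ)..1, g t) ^ 2 ≤ ∫ t in (0 : ℝ)..1, g t ^ 2 := by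
  set m := ∫ t in (0 : ℝ)..1, g t with hm
  have h1 : 0 ≤ ∫ t in (0 : ℝ)..1, (g t - m) ^ 2 :=
    intervalIntegral.integral_nonneg zero_le_one fun t _ => sq_nonneg _
  have h2 : ∫ t in (0 : ℝ)..1, (g t - m) ^ 2
      = (∫ t in (0 : ℝ)..1, g t ^ 2) - 2 * m * (∫ t in (0 : ℝ)..1, g t) + m ^ 2 := by
    have e : (fun t => (g t - m) ^ 2) = fun t => (g t ^ 2 - 2 * m * g t) + m ^ 2 := by
      funext t; ring
    rw [e, intervalIntegral.integral_add, intervalIntegral.integral_sub,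
      intervalIntegral.integral_const_mul, intervalIntegral.integral_const]
    · simp
    all_goals exact Continuous.intervalIntegrable (by fun_prop) _ _
  rw [h2, ← hm] at h1
  nlinarith

variable {F : Type*} [NormedAddCommGroup F] [InnerProductSpace ℝ F] [FiniteDimensional ℝ F]
  [MeasurableSpace F] [BorelSpace F]

lemma hasDerivAt_line {w : F → ℝ} (hw : ContDiff ℝ (⊤ : ℕ∞) w) (x v : F) (t : ℝ) :
    HasDerivAt (fun t : ℝ => w (x + t • v)) ⟪gradient w (x + t • v), v⟫ t := by
  have h1 : HasDerivAt (fun t : ℝ => x + t • v) v t := by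
    simpa using ((hasDerivAt_id t).smul_const v).const_add x
  have h2 := ((hw.differentiable (by simp)) (x + t • v)).hasFDerivAt.comp_hasDerivAt t h1
  rwa [← inner_gradient_left] at h2

lemma continuous_inner_gradient_line {w : F → ℝ} (hw : ContDiff ℝ (⊤ : ℕ∞) w) (x v : F) :
    Continuous fun t : ℝ => ⟪gradient w (x + t • v), v⟫ :=
  ((continuous_gradient hw).comp (by fun_prop)).inner continuous_const

lemma sub_sq_le_integral {w : F → ℝ} (hw : ContDiff ℝ (⊤ : ℕ∞) w) (x v : F) :
    (w (x + v) - w x) ^ 2 ≤ ‖v‖ ^ 2 * ∫ t in (0 : ℝ)..1, ‖gradient w (x + t • v)‖ ^ 2 := by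
  have h1 : ∫ t in (0 : ℝ)..1, ⟪gradient w (x + t • v), v⟫ = w (x + v) - w x := by
    rw [intervalIntegral.integral_eq_sub_of_hasDerivAt (fun t _ => hasDerivAt_line hw x v t)
      ((continuous_inner_gradient_line hw x v).intervalIntegrable _ _)]
    simp
  rw [← h1, ← intervalIntegral.integral_const_mul]
  refine (sq_intervalIntegral_le (continuous_inner_gradient_line hw x v)).trans ?_
  have hc : Continuous fun t : ℝ => gradient w (x + t • v) :=
    (continuous_gradient hw).comp (by fun_prop)
  refine intervalIntegral.integral_mono_on zero_le_one
    (((continuous_inner_gradient_line hw x v).pow 2).intervalIntegrable _ _)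
    ((continuous_const.mul (hc.norm.pow 2)).intervalIntegrable _ _) fun t _ => ?_
  rw [← mul_pow, mul_comm]
  exact sq_le_sq.2 (by
    rw [abs_of_nonneg (a := ‖_‖ * ‖_‖) (by positivity)]; exact abs_real_inner_le_norm _ _)

/-- The translation estimate `‖w(· + v) - w‖ ≤ ‖v‖ ‖∇w‖` in `L²`. -/
lemma lintegral_translate_sub_sq_le {w : F → ℝ} (hw : ContDiff ℝ (⊤ : ℕ∞) w) (v : F) :
    ∫⁻ x, ENNReal.ofReal ((w (x + v) - w x) ^ 2)
      ≤ ENNReal.ofReal (‖v‖ ^ 2) * ∫⁻ x, ENNReal.ofReal (‖gradient w x‖ ^ 2) := by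
  have hc : Continuous fun p : F × ℝ => ‖gradient w (p.1 + p.2 • v)‖ ^ 2 :=
    ((continuous_gradient hw).comp (by fun_prop)).norm.pow 2
  have h1 : ∀ x, ENNReal.ofReal ((w (x + v) - w x) ^ 2) ≤ ENNReal.ofReal (‖v‖ ^ 2) *
      ∫⁻ t in Set.Ioc (0 : ℝ) 1, ENNReal.ofReal (‖gradient w (x + t • v)‖ ^ 2) := fun x => by
    refine (ENNReal.ofReal_le_ofReal (sub_sq_le_integral hw x v)).trans (le_of_eq ?_)
    rw [ENNReal.ofReal_mul (by positivity), intervalIntegral.integral_of_le zero_le_one,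
      ofReal_integral_eq_lintegral_ofReal]
    · exact (Continuous.integrableOn_Icc (hc.comp (by fun_prop : Continuous fun t : ℝ =>
        ((x, t) : F × ℝ)))).mono_set Set.Ioc_subset_Icc_self
    · exact Eventually.of_forall fun t => by positivity
  refine (lintegral_mono h1).trans ?_
  rw [lintegral_const_mul' _ _ ENNReal.ofReal_ne_top]
  refine mul_le_mul_right ?_ _
  have hm : AEMeasurable (Function.uncurry fun (x : F) (t : ℝ) =>
      ENNReal.ofReal (‖gradient w (x + t • v)‖ ^ 2))
      (volume.prod (volume.restrict (Set.Ioc (0 : ℝ) 1))) :=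
    (ENNReal.continuous_ofReal.comp hc).aemeasurable
  rw [lintegral_lintegral_swap hm]
  have h2 : ∀ t : ℝ, ∫⁻ x, ENNReal.ofReal (‖gradient w (x + t • v)‖ ^ 2)
      = ∫⁻ x, ENNReal.ofReal (‖gradient w x‖ ^ 2) := fun t =>
    lintegral_add_right_eq_self (fun x => ENNReal.ofReal (‖gradient w x‖ ^ 2)) (t • v)
  simp_rw [h2]
  simp

/-- The grid cell of a point, with respect to an orthonormal basis and a mesh size. -/
def cellIndex (ℓ : ℝ) (x : F) : Fin (Module.finrank ℝ F) → ℤ :=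
  fun i => ⌊⟪stdOrthonormalBasis ℝ F i, x⟫ / ℓ⌋

/-- The grid cell with a given index. -/
def cell (ℓ : ℝ) (k : Fin (Module.finrank ℝ F) → ℤ) : Set F := {x | cellIndex ℓ x = k}

lemma measurableSet_cell (ℓ : ℝ) (k : Fin (Module.finrank ℝ F) → ℤ) :
    MeasurableSet (cell ℓ k : Set F) := by
  have : Measurable (cellIndex ℓ : F → _) := by
    refine measurable_pi_lambda _ fun i => ?_
    exact Int.measurable_floor.comp (by fun_prop)
  exact this (measurableSet_singleton k)

lemma norm_sq_le_of_coord {x : F} {ℓ : ℝ}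
    (h : ∀ i, |⟪stdOrthonormalBasis ℝ F i, x⟫| ≤ ℓ) :
    ‖x‖ ^ 2 ≤ Module.finrank ℝ F * ℓ ^ 2 := by
  rw [← (stdOrthonormalBasis ℝ F).sum_sq_inner_right x]
  calc ∑ i, ⟪stdOrthonormalBasis ℝ F i, x⟫ ^ 2 ≤ ∑ _i : Fin (Module.finrank ℝ F), ℓ ^ 2 :=
        Finset.sum_le_sum fun i _ => sq_le_sq' (abs_le.1 (h i)).1 (abs_le.1 (h i)).2
    _ = _ := by simp

lemma coord_sub_of_mem_cell {ℓ : ℝ} (hℓ : 0 < ℓ) {k : Fin (Module.finrank ℝ F) → ℤ} {x v : F}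
    (hx : x ∈ cell ℓ k) (hy : x + v ∈ cell ℓ k) (i : Fin (Module.finrank ℝ F)) :
    |⟪stdOrthonormalBasis ℝ F i, v⟫| < ℓ := by
  have h1 : ⌊⟪stdOrthonormalBasis ℝ F i, x⟫ / ℓ⌋ = ⌊⟪stdOrthonormalBasis ℝ F i, x + v⟫ / ℓ⌋ :=
    (congrFun hx i).trans (congrFun hy i).symm
  have h2 := Int.abs_sub_lt_one_of_floor_eq_floor h1
  rw [inner_add_right, ← sub_div, abs_div, abs_of_pos hℓ, div_lt_one hℓ, abs_sub_comm] at h2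
  simpa using h2

lemma volume_cell (ℓ : ℝ) (hℓ : ℓ ≠ 0) (k : Fin (Module.finrank ℝ F) → ℤ) :
    volume (cell ℓ k : Set F) = volume (cell ℓ 0 : Set F) := by
  set v : F := ∑ i, ((k i : ℝ) * ℓ) • stdOrthonormalBasis ℝ F i with hv
  have hvi : ∀ i, ⟪stdOrthonormalBasis ℝ F i, v⟫ = k i * ℓ := fun i => by
    rw [hv, (stdOrthonormalBasis ℝ F).orthonormal.inner_right_fintype]
  have h1 : (fun x : F => x + v) ⁻¹' cell ℓ k = cell ℓ 0 := by
    ext x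
    simp only [cell, cellIndex, Set.mem_preimage, Set.mem_ofPred_eq, funext_iff, inner_add_right,
      hvi, add_div, mul_div_cancel_right₀ _ hℓ, Int.floor_add_intCast, Pi.zero_apply]
    exact forall_congr' fun i => by omega
  rw [← h1, measure_preimage_add_right]

lemma volume_cell_ne_top {ℓ : ℝ} (hℓ : 0 < ℓ) (k : Fin (Module.finrank ℝ F) → ℤ) :
    volume (cell ℓ k : Set F) ≠ ⊤ := by
  rw [volume_cell ℓ hℓ.ne']
  refine ((Metric.isBounded_closedBall (x := (0 : F))
    (r := Real.sqrt (Module.finrank ℝ F * ℓ ^ 2))).subset fun x hx => ?_).measure_lt_top.ne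
  rw [mem_closedBall_zero_iff]
  refine Real.le_sqrt_of_sq_le (norm_sq_le_of_coord fun i => ?_)
  have h0 : (0 : F) ∈ cell ℓ 0 := by ext i; simp [cellIndex]
  have := coord_sub_of_mem_cell hℓ h0 (v := x) (by simpa using hx) i
  exact this.le

lemma volume_cell_ne_zero {ℓ : ℝ} (hℓ : 0 < ℓ) : volume (cell ℓ 0 : Set F) ≠ 0 := by
  intro h0
  have h1 : (Set.univ : Set F) = ⋃ k, cell ℓ k := by
    ext x; simp [cell]
  have h2 : volume (Set.univ : Set F) = 0 := by
    rw [h1]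
    exact measure_iUnion_null fun k => by rw [volume_cell ℓ hℓ.ne', h0]
  exact (isOpen_univ.measure_pos volume ⟨(0 : F), trivial⟩).ne' h2

/-- The differences of the points of a cell. -/
def diffCell (F : Type*) [NormedAddCommGroup F] [InnerProductSpace ℝ F] [FiniteDimensional ℝ F]
    (ℓ : ℝ) : Set F := {v | ∀ i, |⟪stdOrthonormalBasis ℝ F i, v⟫| < ℓ}

lemma measurableSet_diffCell (ℓ : ℝ) : MeasurableSet (diffCell F ℓ) := by
  have : diffCell F ℓ = ⋂ i, {v | |⟪stdOrthonormalBasis ℝ F i, v⟫| < ℓ} := by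
    ext; simp [diffCell]
  rw [this]
  exact MeasurableSet.iInter fun i => measurableSet_lt (by fun_prop) measurable_const

lemma volume_diffCell_le {ℓ : ℝ} (hℓ : 0 < ℓ) :
    volume (diffCell F ℓ) ≤ 2 ^ Module.finrank ℝ F * volume (cell ℓ 0 : Set F) := by
  set s : Finset (Fin (Module.finrank ℝ F) → ℤ) := Fintype.piFinset fun _ => {-1, 0} with hs
  have h1 : diffCell F ℓ ⊆ ⋃ k ∈ s, cell ℓ k := by
    intro v hv
    simp only [Set.mem_iUnion]
    refine ⟨cellIndex ℓ v, ?_, rfl⟩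
    rw [hs, Fintype.mem_piFinset]
    intro i
    obtain ⟨a, b⟩ := abs_lt.1 (hv i)
    have a' : -1 ≤ ⌊⟪stdOrthonormalBasis ℝ F i, v⟫ / ℓ⌋ := by
      rw [Int.le_floor, le_div_iff₀ hℓ]; push_cast; linarith
    have b' : ⌊⟪stdOrthonormalBasis ℝ F i, v⟫ / ℓ⌋ < 1 := by
      rw [Int.floor_lt, div_lt_iff₀ hℓ]; push_cast; linarith
    simp only [cellIndex, Finset.mem_insert, Finset.mem_singleton]
    omega
  refine (measure_mono h1).trans ((measure_biUnion_finset_le s _).trans (le_of_eq ?_))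
  rw [Finset.sum_congr rfl fun k _ => volume_cell ℓ hℓ.ne' k, Finset.sum_const, hs,
    Fintype.card_piFinset]
  simp

/-- The oscillation of a function on the cells of a grid is controlled by the gradient: the
difference of two points of a cell lies in `diffCell`, to which the translation estimate applies. -/
lemma sum_lintegral_cells_le {w : F → ℝ} (hw : ContDiff ℝ (⊤ : ℕ∞) w) {ℓ : ℝ} (hℓ : 0 < ℓ)
    (s : Finset (Fin (Module.finrank ℝ F) → ℤ)) :
    ∑ k ∈ s, ∫⁻ x in cell ℓ k, ∫⁻ y in cell ℓ k, ENNReal.ofReal ((w y - w x) ^ 2)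
      ≤ ENNReal.ofReal (Module.finrank ℝ F * ℓ ^ 2) *
        (2 ^ Module.finrank ℝ F * volume (cell ℓ 0 : Set F)) *
        ∫⁻ x, ENNReal.ofReal (‖gradient w x‖ ^ 2) := by
  set g : F → ℝ≥0∞ := fun x => ∫⁻ v in diffCell F ℓ, ENNReal.ofReal ((w (x + v) - w x) ^ 2)
    with hg
  have hwc := hw.continuous
  have h1 : ∀ k, ∀ x ∈ cell ℓ k,
      ∫⁻ y in cell ℓ k, ENNReal.ofReal ((w y - w x) ^ 2) ≤ g x := by
    intro k x hx
    rw [← lintegral_indicator (measurableSet_cell ℓ k)]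
    change _ ≤ ∫⁻ v in diffCell F ℓ, ENNReal.ofReal ((w (x + v) - w x) ^ 2)
    rw [← lintegral_indicator (measurableSet_diffCell ℓ),
      ← lintegral_add_left_eq_self
        ((cell ℓ k).indicator fun y => ENNReal.ofReal ((w y - w x) ^ 2)) x]
    refine lintegral_mono fun v => ?_
    by_cases hv : x + v ∈ cell ℓ k
    · rw [Set.indicator_of_mem hv, Set.indicator_of_mem]
      exact fun i => coord_sub_of_mem_cell hℓ hx hv i
    · rw [Set.indicator_of_notMem hv]; exact zero_le
  have h2 : ∑ k ∈ s, ∫⁻ x in cell ℓ k, ∫⁻ y in cell ℓ k, ENNReal.ofReal ((w y - w x) ^ 2)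
      ≤ ∫⁻ x, g x := by
    calc _ ≤ ∑ k ∈ s, ∫⁻ x in cell ℓ k, g x := Finset.sum_le_sum fun k _ =>
          setLIntegral_mono' (measurableSet_cell ℓ k) (h1 k)
      _ = ∫⁻ x in ⋃ k ∈ s, cell ℓ k, g x := by
          rw [lintegral_biUnion_finset _ fun k _ => measurableSet_cell ℓ k]
          intro k _ k' _ hkk'
          exact Set.disjoint_left.2 fun x hx hx' => hkk' (hx.symm.trans hx')
      _ ≤ _ := setLIntegral_le_lintegral _ _
  refine h2.trans ?_
  rw [hg, lintegral_lintegral_swap (by fun_prop)]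
  calc _ ≤ ∫⁻ v in diffCell F ℓ, ENNReal.ofReal (Module.finrank ℝ F * ℓ ^ 2) *
        ∫⁻ x, ENNReal.ofReal (‖gradient w x‖ ^ 2) := by
        refine setLIntegral_mono' (measurableSet_diffCell ℓ) fun v hv => ?_
        refine (lintegral_translate_sub_sq_le hw v).trans (mul_le_mul_left ?_ _)
        exact ENNReal.ofReal_le_ofReal (norm_sq_le_of_coord fun i => (hv i).le)
    _ = ENNReal.ofReal (Module.finrank ℝ F * ℓ ^ 2) * volume (diffCell F ℓ) *
        ∫⁻ x, ENNReal.ofReal (‖gradient w x‖ ^ 2) := by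
        rw [setLIntegral_const]; ring
    _ ≤ _ := by gcongr; exact volume_diffCell_le hℓ

lemma setIntegral_sub_const_sq {w : F → ℝ} {Q : Set F} (hQ : volume Q ≠ ⊤)
    (h1 : IntegrableOn w Q) (h2 : IntegrableOn (fun x => w x ^ 2) Q) (c : ℝ) :
    IntegrableOn (fun y => (w y - c) ^ 2) Q ∧ ∫ y in Q, (w y - c) ^ 2
      = (∫ y in Q, w y ^ 2) - 2 * c * (∫ y in Q, w y) + volume.real Q * c ^ 2 := by
  have e : (fun y => (w y - c) ^ 2) = fun y => (w y ^ 2 - 2 * c * w y) + c ^ 2 := by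
    funext t; ring
  have i1 : IntegrableOn (fun y => 2 * c * w y) Q := h1.const_mul _
  have i2 : IntegrableOn (fun y => w y ^ 2 - 2 * c * w y) Q := h2.sub i1
  have i3 : IntegrableOn (fun _ : F => c ^ 2) Q := integrableOn_const hQ
  rw [e]
  refine ⟨i2.add i3, ?_⟩
  rw [integral_add i2 i3, integral_sub h2 i1, integral_const_mul, setIntegral_const, smul_eq_mul]

/-- The variance identity on a set of finite measure. -/
lemma integral_integral_sub_sq {w : F → ℝ} {Q : Set F} (hQ : volume Q ≠ ⊤)
    (h1 : IntegrableOn w Q) (h2 : IntegrableOn (fun x => w x ^ 2) Q) :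
    IntegrableOn (fun x => ∫ y in Q, (w y - w x) ^ 2) Q ∧ ∫ x in Q, ∫ y in Q, (w y - w x) ^ 2
      = 2 * (volume.real Q) * (∫ x in Q, w x ^ 2) - 2 * (∫ x in Q, w x) ^ 2 := by
  set A := ∫ y in Q, w y ^ 2
  set B := ∫ y in Q, w y with hB
  have e1 : (fun x => ∫ y in Q, (w y - w x) ^ 2)
      = fun x => (A - 2 * B * w x) + volume.real Q * w x ^ 2 := by
    funext x
    rw [(setIntegral_sub_const_sq hQ h1 h2 (w x)).2]
    ring
  have i0 : IntegrableOn (fun _ : F => A) Q := integrableOn_const hQ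
  have i1 : IntegrableOn (fun x => 2 * B * w x) Q := h1.const_mul _
  have i2 : IntegrableOn (fun x => A - 2 * B * w x) Q := i0.sub i1
  have i3 : IntegrableOn (fun x => volume.real Q * w x ^ 2) Q := h2.const_mul _
  rw [e1]
  refine ⟨i2.add i3, ?_⟩
  rw [integral_add i2 i3, integral_sub i0 i1, integral_const_mul, integral_const_mul,
    setIntegral_const, smul_eq_mul, ← hB]
  ring

lemma lintegral_lintegral_sub_sq {w : F → ℝ} {Q : Set F} (hQ : volume Q ≠ ⊤)
    (h1 : IntegrableOn w Q) (h2 : IntegrableOn (fun x => w x ^ 2) Q) :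
    ∫⁻ x in Q, ∫⁻ y in Q, ENNReal.ofReal ((w y - w x) ^ 2)
      = ENNReal.ofReal (2 * (volume.real Q) * (∫ x in Q, w x ^ 2) - 2 * (∫ x in Q, w x) ^ 2) := by
  rw [← (integral_integral_sub_sq hQ h1 h2).2, ofReal_integral_eq_lintegral_ofReal
    (integral_integral_sub_sq hQ h1 h2).1
    (Eventually.of_forall fun x => integral_nonneg fun y => sq_nonneg _)]
  refine lintegral_congr fun x => ?_
  rw [ofReal_integral_eq_lintegral_ofReal (setIntegral_sub_const_sq hQ h1 h2 (w x)).1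
    (Eventually.of_forall fun y => sq_nonneg _)]

lemma integrable_gradient_sq {w : F → ℝ} (hw : ContDiff ℝ (⊤ : ℕ∞) w) (hc : HasCompactSupport w) :
    Integrable fun x => ‖gradient w x‖ ^ 2 := by
  refine ((continuous_gradient hw).norm.pow 2).integrable_of_hasCompactSupport
    ((hasCompactSupport_gradient hc).mono fun x hx => ?_)
  rw [Function.mem_support] at hx ⊢
  intro h0
  exact hx (by simp [h0])

lemma integrable_sq_of_test {w : F → ℝ} (hw : ContDiff ℝ (⊤ : ℕ∞) w) (hc : HasCompactSupport w) :
    Integrable fun x => w x ^ 2 := by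
  refine (hw.continuous.pow 2).integrable_of_hasCompactSupport (hc.mono fun x hx => ?_)
  rw [Function.mem_support] at hx ⊢
  intro h0
  exact hx (by simp [h0])

/-- The Poincaré inequality on the cells of a grid, in total. -/
lemma sum_cells_le {w : F → ℝ} (hw : ContDiff ℝ (⊤ : ℕ∞) w) (hc : HasCompactSupport w) {ℓ : ℝ}
    (hℓ : 0 < ℓ) (s : Finset (Fin (Module.finrank ℝ F) → ℤ)) :
    2 * volume.real (cell ℓ 0 : Set F) * (∑ k ∈ s, ∫ x in cell ℓ k, w x ^ 2)
        - 2 * ∑ k ∈ s, (∫ x in cell ℓ k, w x) ^ 2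
      ≤ Module.finrank ℝ F * ℓ ^ 2 * (2 ^ Module.finrank ℝ F * volume.real (cell ℓ 0 : Set F)) *
        ∫ x, ‖gradient w x‖ ^ 2 := by
  have hw2 := integrable_sq_of_test hw hc
  have hw1 : Integrable w := hw.continuous.integrable_of_hasCompactSupport hc
  have key := sum_lintegral_cells_le hw hℓ s
  have hV : ∀ k, volume.real (cell ℓ k : Set F) = volume.real (cell ℓ 0 : Set F) := fun k => by
    rw [measureReal_def, measureReal_def, volume_cell ℓ hℓ.ne']
  have hnn : ∀ k ∈ s, 0 ≤ 2 * (volume.real (cell ℓ k : Set F)) * (∫ x in cell ℓ k, w x ^ 2)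
      - 2 * (∫ x in cell ℓ k, w x) ^ 2 := fun k _ => by
    rw [← (integral_integral_sub_sq (volume_cell_ne_top hℓ k) hw1.integrableOn
      hw2.integrableOn).2]
    exact integral_nonneg fun x => integral_nonneg fun y => sq_nonneg _
  rw [Finset.sum_congr rfl fun k _ => lintegral_lintegral_sub_sq (volume_cell_ne_top hℓ k)
    hw1.integrableOn hw2.integrableOn, ← ENNReal.ofReal_sum_of_nonneg hnn,
    ← ofReal_integral_eq_lintegral_ofReal (integrable_gradient_sq hw hc)
      (Eventually.of_forall fun x => by positivity)] at key
  have e2 : (2 : ℝ≥0∞) ^ Module.finrank ℝ F * volume (cell ℓ 0 : Set F)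
      = ENNReal.ofReal (2 ^ Module.finrank ℝ F * volume.real (cell ℓ 0 : Set F)) := by
    rw [ENNReal.ofReal_mul (by positivity), ofReal_measureReal (volume_cell_ne_top hℓ 0),
      ENNReal.ofReal_pow (by norm_num)]
    simp
  have hG : 0 ≤ ∫ x, ‖gradient w x‖ ^ 2 := integral_nonneg fun x => by positivity
  rw [e2, ← ENNReal.ofReal_mul (by positivity), ← ENNReal.ofReal_mul (by positivity),
    ENNReal.ofReal_le_ofReal_iff (by positivity)] at key
  refine le_trans (le_of_eq ?_) key
  rw [Finset.sum_sub_distrib, Finset.mul_sum, Finset.mul_sum]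
  simp only [hV]

/-- A quantitative form of Rellich's theorem: up to finitely many mean values, the `L²` norm on a
ball is a small multiple of the norm of the gradient. -/
lemma exists_rellich (R : ℝ) {ε : ℝ} (hε : 0 < ε) :
    ∃ (ι : Type) (_ : Fintype ι) (Q : ι → Set F) (C : ℝ), (∀ i, MeasurableSet (Q i)) ∧
      (∀ i, volume (Q i) ≠ ⊤) ∧ ∀ w : F → ℝ, ContDiff ℝ (⊤ : ℕ∞) w → HasCompactSupport w →
      ∫ x in Metric.closedBall 0 R, w x ^ 2
        ≤ ε * (∫ x, ‖gradient w x‖ ^ 2) + C * ∑ i, (∫ x in Q i, w x) ^ 2 := by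
  set n := Module.finrank ℝ F with hn
  -- The Poincaré constant of the cells is of the order of the square of the mesh size `ℓ`.
  obtain ⟨ℓ, hℓ, hℓε⟩ : ∃ ℓ : ℝ, 0 < ℓ ∧ n * ℓ ^ 2 * 2 ^ n ≤ ε := by
    refine ⟨Real.sqrt (ε / (n * 2 ^ n + 1)), by positivity, ?_⟩
    rw [Real.sq_sqrt (by positivity)]
    have : (n : ℝ) * 2 ^ n / (n * 2 ^ n + 1) ≤ 1 := by
      rw [div_le_one (by positivity)]; linarith
    calc _ = ε * ((n : ℝ) * 2 ^ n / (n * 2 ^ n + 1)) := by ring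
      _ ≤ ε * 1 := mul_le_mul_of_nonneg_left this hε.le
      _ = ε := mul_one ε
  set V₀ := volume.real (cell ℓ 0 : Set F) with hV₀
  have hV0 : 0 < V₀ :=
    ENNReal.toReal_pos (volume_cell_ne_zero hℓ) (volume_cell_ne_top hℓ 0)
  set s : Finset (Fin n → ℤ) := Fintype.piFinset fun _ => Finset.Icc ⌊-R / ℓ⌋ ⌊R / ℓ⌋ with hs
  refine ⟨s, inferInstance, fun k => cell ℓ k.1, V₀⁻¹, fun k => measurableSet_cell ℓ _,
    fun k => volume_cell_ne_top hℓ _, fun w hw hc => ?_⟩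
  have hw2 := integrable_sq_of_test hw hc
  have hcover : Metric.closedBall (0 : F) R ⊆ ⋃ k ∈ s, cell ℓ k := by
    intro x hx
    rw [mem_closedBall_zero_iff] at hx
    simp only [Set.mem_iUnion]
    refine ⟨cellIndex ℓ x, ?_, rfl⟩
    rw [hs, Fintype.mem_piFinset]
    intro i
    have h1 : |⟪stdOrthonormalBasis ℝ F i, x⟫| ≤ R := by
      refine (abs_real_inner_le_norm _ _).trans ?_
      rw [(stdOrthonormalBasis ℝ F).norm_eq_one, one_mul]; exact hx
    obtain ⟨a, b⟩ := abs_le.1 h1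
    rw [Finset.mem_Icc]
    exact ⟨Int.floor_le_floor (by gcongr), Int.floor_le_floor (by gcongr)⟩
  have h1 : ∫ x in Metric.closedBall 0 R, w x ^ 2 ≤ ∑ k ∈ s, ∫ x in cell ℓ k, w x ^ 2 := by
    rw [← integral_biUnion_finset s (fun k _ => measurableSet_cell ℓ k)
      (fun k _ k' _ hkk' => Set.disjoint_left.2 fun x hx hx' => hkk' (hx.symm.trans hx'))
      fun k _ => hw2.integrableOn]
    exact setIntegral_mono_set hw2.integrableOn (Eventually.of_forall fun x => sq_nonneg _)
      (Eventually.of_forall hcover)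
  have h2 := sum_cells_le hw hc hℓ s
  simp only [← hV₀] at h2
  set G := ∫ x, ‖gradient w x‖ ^ 2
  have hG : 0 ≤ G := integral_nonneg fun x => by positivity
  have h4 : ∑ i : s, (∫ x in cell ℓ i.1, w x) ^ 2 = ∑ k ∈ s, (∫ x in cell ℓ k, w x) ^ 2 :=
    Finset.sum_coe_sort s fun k => (∫ x in cell ℓ k, w x) ^ 2
  rw [h4]
  set A := ∑ k ∈ s, ∫ x in cell ℓ k, w x ^ 2
  set B := ∑ k ∈ s, (∫ x in cell ℓ k, w x) ^ 2
  refine h1.trans ?_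
  have h5 : V₀ * A ≤ V₀ * (ε * G + V₀⁻¹ * B) := by
    have : V₀ * (V₀⁻¹ * B) = B := by rw [← mul_assoc, mul_inv_cancel₀ hV0.ne', one_mul]
    rw [mul_add, this]
    have h6 : n * ℓ ^ 2 * (2 ^ n * V₀) * G ≤ ε * (V₀ * G) := by
      calc _ = n * ℓ ^ 2 * 2 ^ n * (V₀ * G) := by ring
        _ ≤ _ := mul_le_mul_of_nonneg_right hℓε (by positivity)
    have h7 : 0 ≤ ε * (V₀ * G) := by positivity
    linarith
  exact le_of_mul_le_mul_left h5 hV0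

open Classical in
/-- A test function which vanishes near the whole boundary remains smooth when it is restricted to
`Ω` and extended by zero. -/
lemma contDiff_indicator {Ω : Set F} (hΩ : IsOpen Ω) {φ : F → ℝ} (hφ : φ ∈ testSpace (frontier Ω)) :
    ContDiff ℝ (⊤ : ℕ∞) (Ω.indicator φ) ∧ HasCompactSupport (Ω.indicator φ) ∧
      gradient (Ω.indicator φ) = Ω.indicator (gradient φ) := by
  have hloc : ∀ x, (x ∈ Ω ∧ Ω.indicator φ =ᶠ[𝓝 x] φ) ∨
      (Ω.indicator φ =ᶠ[𝓝 x] 0 ∧ (x ∈ Ω → gradient φ x = 0)) := by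
    intro x
    by_cases hx : x ∈ Ω
    · left
      refine ⟨hx, ?_⟩
      filter_upwards [hΩ.mem_nhds hx] with y hy
      exact Set.indicator_of_mem hy _
    right
    refine ⟨?_, fun h => (hx h).elim⟩
    by_cases hx' : x ∈ closure Ω
    · have hf : x ∈ frontier Ω := ⟨hx', by rwa [hΩ.interior_eq]⟩
      have ht : x ∉ tsupport φ := fun h =>
        Set.disjoint_left.1 hφ.2.2 h (subset_closure hf)
      filter_upwards [(isClosed_tsupport φ).isOpen_compl.mem_nhds ht] with y hy
      rw [Set.indicator_apply]
      split_ifs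
      · exact image_eq_zero_of_notMem_tsupport hy
      · rfl
    · filter_upwards [isClosed_closure.isOpen_compl.mem_nhds hx'] with y hy
      rw [Set.indicator_of_notMem fun h => hy (subset_closure h)]; rfl
  refine ⟨contDiff_iff_contDiffAt.2 fun x => ?_, hφ.2.1.mono fun x hx => ?_, funext fun x => ?_⟩
  · rcases hloc x with ⟨-, h⟩ | ⟨h, -⟩
    · exact hφ.1.contDiffAt.congr_of_eventuallyEq h
    · exact contDiffAt_const.congr_of_eventuallyEq h
  · rw [Function.mem_support] at hx ⊢
    intro h0
    exact hx (by simp [Set.indicator, h0])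
  · rcases hloc x with ⟨hx, h⟩ | ⟨h, hx⟩
    · rw [Set.indicator_of_mem hx]; simp only [gradient]; rw [h.fderiv_eq]
    · have : gradient (Ω.indicator φ) x = 0 := by
        simp only [gradient]; rw [h.fderiv_eq]; simp
      rw [this, Set.indicator_apply]
      split_ifs with hm
      · exact (hx hm).symm
      · rfl

/-- Rellich's theorem for functions with the Dirichlet condition on the whole boundary. -/
lemma exists_rellich_formDomain (R : ℝ) {ε : ℝ} (hε : 0 < ε) {Ω : Set F} (hΩ : IsOpen Ω) :
    ∃ (ι : Type) (_ : Fintype ι) (ψ : ι → L2 F) (C : ℝ), ∀ x ∈ formDomain 1 Ω (frontier Ω),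
      ‖mulL2 (one (Metric.closedBall 0 R)) x.1‖ ^ 2
        ≤ ε * ‖x.2‖ ^ 2 + C * ∑ i, ⟪ψ i, x.1⟫ ^ 2 := by
  obtain ⟨ι, hι, Q, C, hQm, hQt, key⟩ := exists_rellich (F := F) R hε
  refine ⟨ι, hι, fun i => indicatorConstLp 2 (hQm i) (hQt i) 1, C, ?_⟩
  refine formDomain_induction ?_ ?_
  · exact isClosed_le (by fun_prop) (by fun_prop)
  rintro x ⟨φ, hφ, hx1, hx2⟩
  obtain ⟨hw, hc, hg⟩ := contDiff_indicator hΩ hφ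
  have h1 := key _ hw hc
  have hB : MeasurableSet (Metric.closedBall (0 : F) R) := measurableSet_closedBall
  have e1 : ‖mulL2 (one (Metric.closedBall 0 R)) x.1‖ ^ 2
      = ∫ z in Metric.closedBall 0 R, Ω.indicator φ z ^ 2 := by
    rw [mulL2_norm_sq (measurable_one hB) (abs_one_le _), ← integral_indicator hB]
    refine integral_congr_ae ?_
    filter_upwards [hx1] with z hz
    rw [hz]
    by_cases hzB : z ∈ Metric.closedBall (0 : F) R <;> simp [one, Set.indicator, hzB]
  have e2 : ‖x.2‖ ^ 2 = ∫ z, ‖gradient (Ω.indicator φ) z‖ ^ 2 := by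
    rw [L2_norm_sq]
    refine integral_congr_ae ?_
    filter_upwards [hx2] with z hz
    rw [hz, hg]
    simp [Set.indicator]
  have e3 : ∀ i, ⟪(indicatorConstLp 2 (hQm i) (hQt i) (1 : ℝ) : L2 F), x.1⟫
      = ∫ z in Q i, Ω.indicator φ z := fun i => by
    rw [L2.inner_indicatorConstLp_one]
    exact integral_congr_ae (ae_restrict_of_ae hx1)
  simp only [e3]
  rw [e1, e2]
  exact h1

end Rellich

/-! ### Poincaré inequalities on cross-sections -/

section Poincare

variable {F : Type*} [NormedAddCommGroup F] [InnerProductSpace ℝ F] [FiniteDimensional ℝ F]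
  [MeasurableSpace F] [BorelSpace F]

/-- The first Dirichlet eigenvalue is the best constant in the Poincaré inequality: below it there
is no spectrum, by Rellich's theorem. -/
lemma first_eigenvalue_le {ω : Set F} (hω : IsOpen ω) (hb : Bornology.IsBounded ω) {mu1 : ℝ}
    (hmu : IsFirstDirichletEigenvalue ω mu1) :
    ∀ x ∈ formDomain 1 ω (frontier ω), mu1 * ‖x.1‖ ^ 2 ≤ ‖x.2‖ ^ 2 := by
  obtain ⟨R, hR⟩ := hb.subset_closedBall (0 : F)
  -- For `m < mu1`, either there is an eigenvalue which is at most `m`, which is impossible, or `m`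
  -- is a lower bound.
  have key : ∀ m < mu1, ∀ x ∈ formDomain 1 ω (frontier ω), m * ‖x.1‖ ^ 2 ≤ ‖x.2‖ ^ 2 := by
    intro m hm
    obtain ⟨ι, hι, ψ, C, hψ⟩ := exists_rellich_formDomain R
      (inv_pos.2 (by positivity : 0 < |m| + 1)) hω
    have hgap : ∀ x ∈ formDomain 1 ω (frontier ω),
        (|m| + 1) * ‖x.1‖ ^ 2 - ((|m| + 1) * C) * ∑ i, ⟪ψ i, x.1⟫ ^ 2 ≤ ‖x.2‖ ^ 2 := by
      intro x hx
      have h1 := hψ x hx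
      have h2 : mulL2 (one (Metric.closedBall 0 R)) x.1 = x.1 := by
        refine Lp.ext ?_
        filter_upwards [mulL2_one_coe measurableSet_closedBall x.1,
          (ae_eq_indicator_of_mem hω.measurableSet hx).1] with z e1 e2
        rw [e1]
        by_cases hz : z ∈ ω
        · simp [hR hz]
        · rw [e2, Set.indicator_of_notMem hz, smul_zero]
      rw [h2] at h1
      have h3 := mul_le_mul_of_nonneg_left h1 (by positivity : 0 ≤ |m| + 1)
      rw [mul_add, ← mul_assoc, mul_inv_cancel₀ (by positivity), one_mul] at h3
      linarith
    have hm' : m < |m| + 1 := (le_abs_self m).trans_lt (lt_add_one _)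
    -- The minimization is unconstrained: the family of given eigenvectors is empty.
    let e : Fin 0 → L2 F × L2V F := fun j => j.elim0
    let l : Fin 0 → ℝ := fun j => j.elim0
    have he : ∀ j, IsWeakEig (formDomain 1 ω (frontier ω)) (l j) (e j) := fun j => j.elim0
    have ho : ∀ i j, ⟪(e i).1, (e j).1⟫ = if i = j then (1 : ℝ) else 0 := fun j => j.elim0
    have key := exists_isWeakEig_or_gap (isClosed_formDomain 1 ω (frontier ω)) hgap hm' he ho
    rcases key with ⟨μ, hμ, y, hy, -⟩ | ⟨ε, hε, h⟩
    · have h1 := (isEigenpair_of_isWeakEig hω one_ne_zero hy).1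
      have h2 := hmu.2 ⟨_, h1⟩
      simp only [one_pow, inv_one, one_mul] at h2
      linarith
    · intro x hx
      have := h x hx fun j => j.elim0
      nlinarith [sq_nonneg ‖x.1‖]
  intro x hx
  have hc : Tendsto (fun m => m * ‖x.1‖ ^ 2) (𝓝[<] mu1) (𝓝 (mu1 * ‖x.1‖ ^ 2)) :=
    ((continuous_mul_const _).tendsto _).mono_left nhdsWithin_le_nhds
  exact le_of_tendsto hc (eventually_nhdsWithin_of_forall fun m hm => key m hm x hx)

/-- The Poincaré inequality of `ω`, transported to the scaled domain `h • ω`. -/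
lemma first_eigenvalue_le_scaled {ω : Set F} (hω : IsOpen ω) (hb : Bornology.IsBounded ω) {mu1 : ℝ}
    (hmu : IsFirstDirichletEigenvalue ω mu1) {h : ℝ} (h0 : 0 < h) {f : F → ℝ}
    (hf : ContDiff ℝ (⊤ : ℕ∞) f) (hc : HasCompactSupport f)
    (hS : ∀ η ∈ frontier ω, h • η ∉ tsupport f) :
    mu1 * ∫ y, ω.indicator 1 (h⁻¹ • y) * f y ^ 2
      ≤ ∫ y, ω.indicator 1 (h⁻¹ • y) * ‖h • gradient f y‖ ^ 2 := by
  set g : F → ℝ := fun η => f (h • η) with hg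
  have hcl : IsClosedMap fun η : F => h • η := isClosedMap_smul_of_ne_zero h0.ne'
  have hsupp : tsupport g ⊆ (fun η => h • η) ⁻¹' tsupport f := by
    refine closure_minimal (fun η hη => subset_closure hη) ?_
    exact (isClosed_tsupport f).preimage (by fun_prop)
  have hgt : g ∈ testSpace (frontier ω) := by
    refine ⟨hf.comp (by fun_prop), ?_, ?_⟩
    · exact hc.comp_homeomorph (Homeomorph.smulOfNeZero h h0.ne')
    · rw [isClosed_frontier.closure_eq]
      exact Set.disjoint_left.2 fun η h1 h2 => hS η h2 (hsupp h1)
  obtain ⟨x, hx, hx1, hx2⟩ := exists_mem_formDomain (h := 1) hω.measurableSet hgt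
  have key := first_eigenvalue_le hω hb hmu x (Submodule.le_topologicalClosure _ hx)
  have hgrad : ∀ η, gradient g η = h • gradient f (h • η) := fun η => by
    refine ext_inner_right ℝ fun v => ?_
    have h1 : HasFDerivAt g ((fderiv ℝ f (h • η)).comp (h • ContinuousLinearMap.id ℝ F)) η :=
      ((hf.differentiable (by simp)) (h • η)).hasFDerivAt.comp η
        ((h • ContinuousLinearMap.id ℝ F).hasFDerivAt)
    rw [inner_gradient_left, h1.fderiv, real_inner_smul_left, inner_gradient_left]
    simp
  have e1 : ‖x.1‖ ^ 2 = ∫ η, ω.indicator 1 (h⁻¹ • (h • η)) * f (h • η) ^ 2 := by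
    rw [L2_norm_sq]
    refine integral_congr_ae ?_
    filter_upwards [hx1] with η hη
    rw [hη, inv_smul_smul₀ h0.ne']
    by_cases hm : η ∈ ω <;> simp [hm, hg]
  have e2 : ‖x.2‖ ^ 2 = ∫ η, ω.indicator 1 (h⁻¹ • (h • η)) * ‖h • gradient f (h • η)‖ ^ 2 := by
    rw [L2_norm_sq]
    refine integral_congr_ae ?_
    filter_upwards [hx2] with η hη
    rw [hη, inv_smul_smul₀ h0.ne']
    by_cases hm : η ∈ ω <;> simp [hm, hgrad]
  rw [e1, e2, Measure.integral_comp_smul volume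
      (fun y => ω.indicator 1 (h⁻¹ • y) * f y ^ 2) h,
    Measure.integral_comp_smul volume
      (fun y => ω.indicator 1 (h⁻¹ • y) * ‖h • gradient f y‖ ^ 2) h, smul_eq_mul, smul_eq_mul] at key
  have hpos : 0 < |(h ^ Module.finrank ℝ F)⁻¹| := by positivity
  rw [mul_left_comm] at key
  exact le_of_mul_le_mul_left key hpos

end Poincare

section Slices

variable {d : ℕ}

/-- The point with the coordinates `(y, z)`. -/
abbrev pt (y : EuclideanSpace ℝ (Fin d)) (z : ℝ) : Space d := WithLp.toLp 2 (y, z)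

lemma continuous_pt : Continuous fun q : EuclideanSpace ℝ (Fin d) × ℝ => pt q.1 q.2 :=
  (WithLp.prodContinuousLinearEquiv 2 ℝ (EuclideanSpace ℝ (Fin d)) ℝ).symm.continuous

lemma measurePreserving_pt :
    MeasurePreserving (fun q : EuclideanSpace ℝ (Fin d) × ℝ => pt q.1 q.2)
      (volume.prod volume) volume :=
  WithLp.volume_preserving_toLp _ _

lemma measurableEmbedding_pt :
    MeasurableEmbedding fun q : EuclideanSpace ℝ (Fin d) × ℝ => pt q.1 q.2 :=
  (WithLp.prodContinuousLinearEquiv 2 ℝ (EuclideanSpace ℝ (Fin d))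
    ℝ).symm.toHomeomorph.measurableEmbedding

lemma integrable_pt {G : Space d → ℝ} (hG : Integrable G) :
    Integrable (fun q : EuclideanSpace ℝ (Fin d) × ℝ => G (pt q.1 q.2)) (volume.prod volume) :=
  (measurePreserving_pt.integrable_comp_emb measurableEmbedding_pt).2 hG

lemma integral_pt (G : Space d → ℝ) :
    ∫ x, G x = ∫ q : EuclideanSpace ℝ (Fin d) × ℝ, G (pt q.1 q.2) ∂(volume.prod volume) :=
  (measurePreserving_pt.integral_comp measurableEmbedding_pt G).symm

/-- Comparison of integrals over horizontal slices. -/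
lemma integral_le_of_slices {G₁ G₂ : Space d → ℝ} (h₁ : Integrable G₁) (h₂ : Integrable G₂)
    {c : ℝ} (h : ∀ z, c * ∫ y, G₁ (pt y z) ≤ ∫ y, G₂ (pt y z)) :
    c * ∫ x, G₁ x ≤ ∫ x, G₂ x := by
  rw [integral_pt, integral_pt, integral_prod_symm _ (integrable_pt h₁),
    integral_prod_symm _ (integrable_pt h₂), ← integral_const_mul]
  exact integral_mono ((integrable_pt h₁).integral_prod_right.const_mul c)
    (integrable_pt h₂).integral_prod_right h

/-- Comparison of integrals over vertical lines. -/
lemma integral_le_of_lines {G₁ G₂ : Space d → ℝ} (h₁ : Integrable G₁) (h₂ : Integrable G₂)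
    (h : ∀ y, ∫ z, G₁ (pt y z) ≤ ∫ z, G₂ (pt y z)) : ∫ x, G₁ x ≤ ∫ x, G₂ x := by
  rw [integral_pt, integral_pt, integral_prod _ (integrable_pt h₁),
    integral_prod _ (integrable_pt h₂)]
  exact integral_mono (integrable_pt h₁).integral_prod_left (integrable_pt h₂).integral_prod_left h

lemma norm_fst_le (x : Space d) : ‖x.fst‖ ≤ ‖x‖ := by
  rw [WithLp.prod_norm_eq_of_L2]
  exact Real.le_sqrt_of_sq_le (by nlinarith [sq_nonneg ‖x.snd‖])

lemma norm_snd_le (x : Space d) : |x.snd| ≤ ‖x‖ := by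
  rw [WithLp.prod_norm_eq_of_L2, ← Real.norm_eq_abs]
  exact Real.le_sqrt_of_sq_le (by nlinarith [sq_nonneg ‖x.fst‖])

lemma hasCompactSupport_slice {φ : Space d → ℝ} (hc : HasCompactSupport φ) (z : ℝ) :
    HasCompactSupport fun y => φ (pt y z) := by
  obtain ⟨R, hR⟩ := hc.isCompact.isBounded.subset_closedBall 0
  refine HasCompactSupport.of_support_subset_isCompact (isCompact_closedBall 0 R) fun y hy => ?_
  have h1 := hR (subset_tsupport φ hy)
  rw [mem_closedBall_zero_iff] at h1 ⊢
  exact (norm_fst_le (pt y z)).trans h1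

lemma hasCompactSupport_line {φ : Space d → ℝ} (hc : HasCompactSupport φ)
    (y : EuclideanSpace ℝ (Fin d)) : HasCompactSupport fun z => φ (pt y z) := by
  obtain ⟨R, hR⟩ := hc.isCompact.isBounded.subset_closedBall 0
  refine HasCompactSupport.of_support_subset_isCompact (isCompact_closedBall 0 R) fun z hz => ?_
  have h1 := hR (subset_tsupport φ hz)
  rw [mem_closedBall_zero_iff] at h1 ⊢
  exact (norm_snd_le (pt y z)).trans h1

lemma contDiff_slice {φ : Space d → ℝ} (hφ : ContDiff ℝ (⊤ : ℕ∞) φ) (z : ℝ) :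
    ContDiff ℝ (⊤ : ℕ∞) fun y => φ (pt y z) :=
  hφ.comp ((WithLp.prodContinuousLinearEquiv 2 ℝ (EuclideanSpace ℝ (Fin d)) ℝ).symm.contDiff.comp
    (contDiff_id.prodMk contDiff_const))

lemma contDiff_line {φ : Space d → ℝ} (hφ : ContDiff ℝ (⊤ : ℕ∞) φ)
    (y : EuclideanSpace ℝ (Fin d)) : ContDiff ℝ (⊤ : ℕ∞) fun z => φ (pt y z) :=
  hφ.comp ((WithLp.prodContinuousLinearEquiv 2 ℝ (EuclideanSpace ℝ (Fin d)) ℝ).symm.contDiff.comp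
    (contDiff_const.prodMk contDiff_id))

lemma gradient_slice {φ : Space d → ℝ} (hφ : ContDiff ℝ (⊤ : ℕ∞) φ)
    (y : EuclideanSpace ℝ (Fin d)) (z : ℝ) :
    gradient (fun y => φ (pt y z)) y = (gradient φ (pt y z)).fst := by
  refine ext_inner_right ℝ fun v => ?_
  have h0 : HasFDerivAt (fun y : EuclideanSpace ℝ (Fin d) => pt y z)
      ((WithLp.prodContinuousLinearEquiv 2 ℝ (EuclideanSpace ℝ (Fin d))
        ℝ).symm.toContinuousLinearMap.comp (ContinuousLinearMap.inl ℝ _ ℝ)) y :=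
    (WithLp.prodContinuousLinearEquiv 2 ℝ (EuclideanSpace ℝ (Fin d)) ℝ).symm.hasFDerivAt.comp y
      (hasFDerivAt_prodMk_left y z)
  have h1 := ((hφ.differentiable (by simp)) (pt y z)).hasFDerivAt.comp y h0
  rw [inner_gradient_left, show fderiv ℝ (fun y => φ (pt y z)) y = _ from h1.fderiv]
  change fderiv ℝ φ (pt y z) (pt v 0) = _
  rw [← inner_gradient_left, WithLp.prod_inner_apply]
  simp

lemma hasDerivAt_vert {φ : Space d → ℝ} (hφ : ContDiff ℝ (⊤ : ℕ∞) φ)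
    (y : EuclideanSpace ℝ (Fin d)) (z : ℝ) :
    HasDerivAt (fun z => φ (pt y z)) (gradient φ (pt y z)).snd z := by
  have h0 : ∀ t : ℝ, pt y 0 + t • pt 0 1 = pt y t := fun t => by
    rw [← WithLp.toLp_smul, ← WithLp.toLp_add]; simp
  have h1 := hasDerivAt_line hφ (pt y 0) (pt 0 1) z
  simp only [h0] at h1
  rw [WithLp.prod_inner_apply] at h1
  simpa using h1

/-- The Poincaré inequality in the part of a cylinder which consists of full cross-sections. -/
lemma slice_poincare {ω : Set (EuclideanSpace ℝ (Fin d))} (hω : IsOpen ω)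
    (hb : Bornology.IsBounded ω) {mu1 : ℝ} (hmu : IsFirstDirichletEigenvalue ω mu1) {h : ℝ}
    (h0 : 0 < h) {Ω S : Set (Space d)} {A : Set ℝ}
    (hΩ : ∀ z ∈ A, ∀ y, pt y z ∈ Ω ↔ h⁻¹ • y ∈ ω)
    (hS : ∀ z ∈ A, ∀ η ∈ frontier ω, pt (h • η) z ∈ closure S)
    {w : ℝ → ℝ} (hw : Measurable w) {C : ℝ} (hC : ∀ z, |w z| ≤ C) (hwA : ∀ z ∉ A, w z = 0) :
    ∀ x ∈ formDomain h Ω S, mu1 * ‖mulL2 (fun ξ : Space d => w ξ.snd) x.1‖ ^ 2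
      ≤ ‖mulL2 (fun ξ : Space d => w ξ.snd) x.2‖ ^ 2 := by
  have hW : Measurable fun ξ : Space d => w ξ.snd :=
    hw.comp (WithLp.sndL 2 ℝ (EuclideanSpace ℝ (Fin d)) ℝ).continuous.measurable
  refine formDomain_induction ?_ ?_
  · exact isClosed_le (by fun_prop) (by fun_prop)
  rintro x ⟨φ, hφ, hx1, hx2⟩
  have hG1 : (fun ξ => ‖mulL2 (fun ξ : Space d => w ξ.snd) x.1 ξ‖ ^ 2) =ᵐ[volume]
      fun ξ => w ξ.snd ^ 2 * (Ω.indicator 1 ξ * φ ξ ^ 2) := by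
    filter_upwards [hx1, mulL2_coe hW (fun ξ => hC _) x.1] with ξ e1 e2
    rw [e2, e1]
    by_cases hm : ξ ∈ Ω <;> simp [hm, mul_pow]
  have hG2 : (fun ξ => ‖mulL2 (fun ξ : Space d => w ξ.snd) x.2 ξ‖ ^ 2) =ᵐ[volume]
      fun ξ => w ξ.snd ^ 2 * (Ω.indicator 1 ξ * ‖h • gradient φ ξ‖ ^ 2) := by
    filter_upwards [hx2, mulL2_coe hW (fun ξ => hC _) x.2] with ξ e1 e2
    rw [e2, e1]
    by_cases hm : ξ ∈ Ω
    · simp only [hm, Set.indicator_of_mem, norm_smul, mul_pow, Pi.one_apply, Real.norm_eq_abs,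
        sq_abs]; ring
    · simp [hm]
  rw [L2_norm_sq, L2_norm_sq, integral_congr_ae hG1, integral_congr_ae hG2]
  refine integral_le_of_slices ((L2_integrable_sq _).congr hG1) ((L2_integrable_sq _).congr hG2)
    fun z => ?_
  by_cases hz : z ∈ A
  swap
  · simp [hwA z hz]
  have hind : ∀ y, Ω.indicator (1 : Space d → ℝ) (pt y z) = ω.indicator 1 (h⁻¹ • y) := fun y => by
    by_cases hm : h⁻¹ • y ∈ ω
    · rw [Set.indicator_of_mem hm, Set.indicator_of_mem ((hΩ z hz y).2 hm)]; rfl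
    · rw [Set.indicator_of_notMem hm, Set.indicator_of_notMem (mt (hΩ z hz y).1 hm)]
  -- The slices at the heights in `A` vanish near the boundary of the cross-section.
  have hsl := first_eigenvalue_le_scaled hω hb hmu h0 (contDiff_slice hφ.1 z)
    (hasCompactSupport_slice hφ.2.1 z) (fun η hη hm => by
      have hcl : IsClosed ((fun y => pt y z) ⁻¹' tsupport φ) :=
        (isClosed_tsupport φ).preimage
          (continuous_pt.comp (continuous_id.prodMk continuous_const))
      have hsub : Function.support (fun y => φ (pt y z)) ⊆ (fun y => pt y z) ⁻¹' tsupport φ :=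
        fun y hy => subset_tsupport φ hy
      have h1 : h • η ∈ (fun y => pt y z) ⁻¹' tsupport φ := closure_minimal hsub hcl hm
      exact Set.disjoint_left.1 hφ.2.2 h1 (hS z hz η hη))
  simp only [hind]
  change mu1 * ∫ y, w z ^ 2 * (ω.indicator 1 (h⁻¹ • y) * φ (pt y z) ^ 2)
    ≤ ∫ y, w z ^ 2 * (ω.indicator 1 (h⁻¹ • y) * ‖h • gradient φ (pt y z)‖ ^ 2)
  rw [integral_const_mul, integral_const_mul]
  -- Drop the derivative in the direction of the axis.
  have hint : ∀ y, ω.indicator 1 (h⁻¹ • y) * ‖h • gradient (fun y => φ (pt y z)) y‖ ^ 2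
      ≤ ω.indicator 1 (h⁻¹ • y) * ‖h • gradient φ (pt y z)‖ ^ 2 := fun y => by
    rw [gradient_slice hφ.1, norm_smul, norm_smul]
    have := norm_fst_le (gradient φ (pt y z))
    have h2 : (0 : ℝ) ≤ ω.indicator 1 (h⁻¹ • y) := Set.indicator_nonneg (fun _ _ => zero_le_one) _
    gcongr
  have hmeas : Measurable fun y => ω.indicator (1 : EuclideanSpace ℝ (Fin d) → ℝ) (h⁻¹ • y) :=
    (measurable_const.indicator hω.measurableSet).comp (by fun_prop)
  have hbd : ∀ y, ‖ω.indicator (1 : EuclideanSpace ℝ (Fin d) → ℝ) (h⁻¹ • y)‖ ≤ 1 := fun y => by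
    by_cases hm : h⁻¹ • y ∈ ω <;> simp [hm]
  have i1 : Integrable fun y => ω.indicator 1 (h⁻¹ • y) *
      ‖h • gradient (fun y => φ (pt y z)) y‖ ^ 2 := by
    refine Integrable.bdd_mul ?_ hmeas.aestronglyMeasurable (Eventually.of_forall hbd)
    simpa [norm_smul, mul_pow] using (integrable_gradient_sq (contDiff_slice hφ.1 z)
      (hasCompactSupport_slice hφ.2.1 z)).const_mul (h ^ 2)
  have i2 : Integrable fun y => ω.indicator 1 (h⁻¹ • y) * ‖h • gradient φ (pt y z)‖ ^ 2 := by
    refine Integrable.bdd_mul ?_ hmeas.aestronglyMeasurable (Eventually.of_forall hbd)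
    have hcs := hasCompactSupport_slice (φ := fun ξ => ‖h • gradient φ ξ‖ ^ 2) (by
      refine (hasCompactSupport_gradient hφ.2.1).mono fun ξ hξ => ?_
      rw [Function.mem_support] at hξ ⊢
      intro h0
      exact hξ (by simp [h0])) z
    refine Continuous.integrable_of_hasCompactSupport ?_ hcs
    exact ((((continuous_gradient hφ.1).comp (continuous_pt.comp
      (continuous_id.prodMk continuous_const))).const_smul h).norm.pow 2)
  have h3 := hsl.trans (integral_mono i1 i2 hint)
  calc _ = w z ^ 2 * (mu1 * ∫ y, ω.indicator 1 (h⁻¹ • y) * φ (pt y z) ^ 2) := by ring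
    _ ≤ _ := mul_le_mul_of_nonneg_left h3 (sq_nonneg _)

end Slices

/-! ### Geometry of the cylinders -/

section Geometry

variable {X Y : Type*} [TopologicalSpace X] [TopologicalSpace Y]

lemma isOpen_of_continuousOn {D : Set X} (hD : IsOpen D) {ι : Type*} [Finite ι] {f : ι → X → ℝ}
    (hf : ∀ i, ContinuousOn (f i) D) : IsOpen {x | x ∈ D ∧ ∀ i, 0 < f i x} := by
  have : {x | x ∈ D ∧ ∀ i, 0 < f i x} = D ∩ ⋂ i, (D ∩ f i ⁻¹' Set.Ioi 0) := by
    ext x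
    simp only [Set.mem_ofPred_eq, Set.mem_inter_iff, Set.mem_iInter, Set.mem_preimage, Set.mem_Ioi]
    exact ⟨fun h => ⟨h.1, fun i => ⟨h.1, h.2 i⟩⟩, fun h => ⟨h.1, fun i => (h.2 i).2⟩⟩
  rw [this]
  exact hD.inter (isOpen_iInter_of_finite fun i => (hf i).isOpen_inter_preimage hD isOpen_Ioi)

/-- The closure of the lateral surface of a domain which is bounded by a cylinder and by the graphs
`f i = 0`. -/
lemma closure_lateral {D : Set X} (hD : IsOpen D) {ι : Type*} [Finite ι] {f : ι → X → ℝ}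
    (hf : ∀ i, ContinuousOn (f i) (closure D))
    (hd : ∀ x ∈ frontier D, (∀ i, 0 ≤ f i x) → x ∈ closure {x | x ∈ frontier D ∧ ∀ i, 0 < f i x}) :
    closure (frontier {x | x ∈ D ∧ ∀ i, 0 < f i x} \ closure (⋃ i, {x | x ∈ D ∧ f i x = 0}))
      = {x | x ∈ frontier D ∧ ∀ i, 0 ≤ f i x} := by
  have hopen := isOpen_of_continuousOn hD fun i => (hf i).mono subset_closure
  have hge : IsClosed {x | x ∈ closure D ∧ ∀ i, 0 ≤ f i x} := by
    have : {x | x ∈ closure D ∧ ∀ i, 0 ≤ f i x}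
        = closure D ∩ ⋂ i, (closure D ∩ f i ⁻¹' Set.Ici 0) := by
      ext x
      simp only [Set.mem_ofPred_eq, Set.mem_inter_iff, Set.mem_iInter, Set.mem_preimage, Set.mem_Ici]
      exact ⟨fun h => ⟨h.1, fun i => ⟨h.1, h.2 i⟩⟩, fun h => ⟨h.1, fun i => (h.2 i).2⟩⟩
    rw [this]
    exact isClosed_closure.inter (isClosed_iInter fun i =>
      (hf i).preimage_isClosed_of_isClosed isClosed_closure isClosed_Ici)
  have heq : IsClosed (⋃ i, (closure D ∩ f i ⁻¹' {0})) :=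
    isClosed_iUnion_of_finite fun i =>
      (hf i).preimage_isClosed_of_isClosed isClosed_closure isClosed_singleton
  refine Set.Subset.antisymm (closure_minimal ?_ ?_) ?_
  · rintro x ⟨hx1, hx2⟩
    have h1 : x ∈ closure D ∧ ∀ i, 0 ≤ f i x :=
      closure_minimal (t := {x | x ∈ closure D ∧ ∀ i, 0 ≤ f i x})
        (fun y hy => ⟨subset_closure hy.1, fun i => (hy.2 i).le⟩) hge hx1.1
    have h2 : ¬ (x ∈ D ∧ ∀ i, 0 < f i x) := by
      have := hx1.2
      rwa [hopen.interior_eq] at this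
    refine ⟨⟨h1.1, fun hm => ?_⟩, h1.2⟩
    rw [hD.interior_eq] at hm
    have h3 : ∃ i, ¬ 0 < f i x := by
      by_contra! h
      exact h2 ⟨hm, h⟩
    obtain ⟨i, hi⟩ := h3
    exact hx2 (subset_closure (Set.mem_iUnion.2 ⟨i, hm, le_antisymm (not_lt.1 hi) (h1.2 i)⟩))
  · have : {x | x ∈ frontier D ∧ ∀ i, 0 ≤ f i x}
        = frontier D ∩ {x | x ∈ closure D ∧ ∀ i, 0 ≤ f i x} := by
      ext x
      exact ⟨fun h => ⟨h.1, h.1.1, h.2⟩, fun h => ⟨h.1, h.2.2⟩⟩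
    rw [this]
    exact isClosed_frontier.inter hge
  · rintro x ⟨hx, hfx⟩
    refine closure_mono ?_ (hd x hx hfx)
    rintro y ⟨hy, hfy⟩
    have hyD : y ∉ D := by
      have := hy.2
      rwa [hD.interior_eq] at this
    refine ⟨⟨?_, fun h => ?_⟩, fun h => ?_⟩
    · rw [mem_closure_iff_frequently]
      have h1 : ∃ᶠ z in 𝓝 y, z ∈ D := mem_closure_iff_frequently.1 hy.1
      have h2 : ∀ᶠ z in 𝓝 y, z ∈ D → ∀ i, 0 < f i z := by
        have : ∀ i, ∀ᶠ z in 𝓝 y, z ∈ closure D → 0 < f i z := fun i =>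
          eventually_nhdsWithin_iff.1 (((hf i) y hy.1).eventually_const_lt (hfy i))
        filter_upwards [eventually_all.2 this] with z hz hzD i
        exact hz i (subset_closure hzD)
      exact (h1.and_eventually h2).mono fun z hz => ⟨hz.1, hz.2 hz.1⟩
    · rw [hopen.interior_eq] at h
      exact hyD h.1
    · have hsub : (⋃ i, {x | x ∈ D ∧ f i x = 0}) ⊆ ⋃ i, (closure D ∩ f i ⁻¹' {0}) :=
        Set.iUnion_mono fun i z hz => ⟨subset_closure hz.1, hz.2⟩
      have h1 : y ∈ ⋃ i, (closure D ∩ f i ⁻¹' {0}) := closure_minimal hsub heq h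
      obtain ⟨i, hi⟩ := Set.mem_iUnion.1 h1
      exact (hfy i).ne' hi.2

variable {d : ℕ} {ω : Set (EuclideanSpace ℝ (Fin d))}

lemma continuous_fst' : Continuous fun x : Space d => x.fst :=
  (WithLp.fstL 2 ℝ (EuclideanSpace ℝ (Fin d)) ℝ).continuous

lemma continuous_snd' : Continuous fun x : Space d => x.snd :=
  (WithLp.sndL 2 ℝ (EuclideanSpace ℝ (Fin d)) ℝ).continuous

lemma measurable_snd' : Measurable fun x : Space d => x.snd := continuous_snd'.measurable

lemma isOpenMap_smul_fst {h : ℝ} (h0 : h ≠ 0) : IsOpenMap fun x : Space d => h • x.fst :=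
  (isOpenMap_smul₀ h0).comp (isOpenMap_fst.comp
    (WithLp.prodContinuousLinearEquiv 2 ℝ (EuclideanSpace ℝ (Fin d)) ℝ).toHomeomorph.isOpenMap)

lemma continuous_smul_fst (h : ℝ) : Continuous fun x : Space d => h • x.fst :=
  continuous_fst'.const_smul h

instance : DecidableEq Side
  | .plus, .plus => isTrue rfl
  | .plus, .minus => isFalse nofun
  | .minus, .plus => isFalse nofun
  | .minus, .minus => isTrue rfl

instance : Fintype Side := ⟨{Side.plus, Side.minus}, fun s => by cases s <;> simp⟩

lemma Side.sgn_mul_self (s : Side) : s.sgn * s.sgn = 1 := by cases s <;> norm_num [Side.sgn]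

lemma Side.abs_sgn (s : Side) : |s.sgn| = 1 := by cases s <;> norm_num [Side.sgn]

section Semi

variable {H : EuclideanSpace ℝ (Fin d) → ℝ}

lemma semiCyl_eq : semiCyl ω H = {x : Space d | x ∈ (fun x : Space d => (1 : ℝ) • x.fst) ⁻¹' ω ∧
    ∀ _i : Unit, 0 < x.snd + H x.fst} := by
  ext x
  simp only [semiCyl, Set.mem_ofPred_eq, Set.mem_preimage, one_smul, forall_const]
  exact and_congr_right fun _ => by constructor <;> intro h <;> linarith

lemma continuousOn_semi (hH : ContinuousOn H (closure ω)) :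
    ContinuousOn (fun x : Space d => x.snd + H x.fst)
      (closure ((fun x : Space d => (1 : ℝ) • x.fst) ⁻¹' ω)) := by
  rw [← (isOpenMap_smul_fst one_ne_zero).preimage_closure_eq_closure_preimage
    (continuous_smul_fst 1)]
  refine continuous_snd'.continuousOn.add (hH.comp continuous_fst'.continuousOn fun x hx => ?_)
  simpa using hx

lemma isOpen_semiCyl (hω : IsOpen ω) (hH : ContinuousOn H (closure ω)) : IsOpen (semiCyl ω H) := by
  rw [semiCyl_eq]
  exact isOpen_of_continuousOn (hω.preimage (continuous_smul_fst 1)) fun _ =>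
    (continuousOn_semi hH).mono subset_closure

/-- The points of the closed lateral surface of the semi-infinite cylinder: those on its bottom edge
are limits of points moved upwards. -/
lemma mem_closure_semiLat (hω : IsOpen ω) (hH : ContinuousOn H (closure ω)) {x : Space d} :
    x ∈ closure (semiLat ω H) ↔ x.fst ∈ frontier ω ∧ -H x.fst ≤ x.snd := by
  have hfr : ∀ y : Space d, y ∈ frontier ((fun x : Space d => (1 : ℝ) • x.fst) ⁻¹' ω)
      ↔ y.fst ∈ frontier ω := fun y => by
    rw [← (isOpenMap_smul_fst one_ne_zero).preimage_frontier_eq_frontier_preimage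
      (continuous_smul_fst 1)]
    simp
  have h1 := closure_lateral (hω.preimage (continuous_smul_fst 1)) (ι := Unit)
    (fun _ => continuousOn_semi hH) (fun x hx hfx => ?_)
  · have h2 : semiEnd ω H = ⋃ _i : Unit, {x : Space d |
        x ∈ (fun x : Space d => (1 : ℝ) • x.fst) ⁻¹' ω ∧ x.snd + H x.fst = 0} := by
      ext x
      simp only [semiEnd, Set.mem_ofPred_eq, Set.mem_iUnion, Set.mem_preimage, one_smul,
        exists_const]
      exact and_congr_right fun _ => by constructor <;> intro h <;> linarith
    rw [semiLat, semiCyl_eq, h2, h1, Set.mem_ofPred_eq, hfr, forall_const]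
    exact and_congr_right fun _ => by constructor <;> intro h <;> linarith
  · simp only [hfr] at hx ⊢
    have hc : Continuous fun t : ℝ => pt x.fst (x.snd + t) :=
      continuous_pt.comp (continuous_const.prodMk (continuous_const.add continuous_id))
    have ht : Tendsto (fun t : ℝ => pt x.fst (x.snd + t)) (𝓝[>] 0) (𝓝 x) := by
      have := (hc.tendsto 0).mono_left (nhdsWithin_le_nhds (s := Set.Ioi 0))
      rwa [add_zero] at this
    refine mem_closure_of_tendsto ht (eventually_nhdsWithin_of_forall fun t (ht : 0 < t) => ?_)
    have := hfx ()
    exact ⟨hx, fun _ => by change 0 < (x.snd + t) + H x.fst; linarith⟩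

end Semi

section Thin

variable {H : Side → EuclideanSpace ℝ (Fin d) → ℝ} {h : ℝ}

lemma thinCyl_eq : thinCyl ω H h = {x : Space d | x ∈ (fun x : Space d => h⁻¹ • x.fst) ⁻¹' ω ∧
    ∀ s : Side, 0 < 1 + h * H s (h⁻¹ • x.fst) - s.sgn * x.snd} := by
  ext x
  simp only [thinCyl, Set.mem_ofPred_eq, Set.mem_preimage, sub_pos]

lemma continuousOn_thin (h0 : h ≠ 0) (hH : ∀ s, ContinuousOn (H s) (closure ω)) (s : Side) :
    ContinuousOn (fun x : Space d => 1 + h * H s (h⁻¹ • x.fst) - s.sgn * x.snd)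
      (closure ((fun x : Space d => h⁻¹ • x.fst) ⁻¹' ω)) := by
  rw [← (isOpenMap_smul_fst (inv_ne_zero h0)).preimage_closure_eq_closure_preimage
    (continuous_smul_fst _)]
  refine ContinuousOn.sub (continuousOn_const.add (continuousOn_const.mul
    ((hH s).comp (continuous_smul_fst _).continuousOn fun x hx => hx)))
    (continuous_const.mul continuous_snd').continuousOn

lemma isOpen_thinCyl (hω : IsOpen ω) (h0 : h ≠ 0) (hH : ∀ s, ContinuousOn (H s) (closure ω)) :
    IsOpen (thinCyl ω H h) := by
  rw [thinCyl_eq]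
  exact isOpen_of_continuousOn (hω.preimage (continuous_smul_fst _)) fun s =>
    (continuousOn_thin h0 hH s).mono subset_closure

/-- The points of the closed lateral surface of the thin cylinder: those on its edges are limits of
points moved towards the middle cross-section. -/
lemma mem_closure_thinLat (hω : IsOpen ω) (h0 : h ≠ 0) (hH : ∀ s, ContinuousOn (H s) (closure ω))
    (hpos : ∀ s, ∀ η ∈ closure ω, 0 < 1 + h * H s η) {x : Space d} :
    x ∈ closure (thinLat ω H h) ↔ h⁻¹ • x.fst ∈ frontier ω ∧
      ∀ s : Side, s.sgn * x.snd ≤ 1 + h * H s (h⁻¹ • x.fst) := by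
  have hfr : ∀ y : Space d, y ∈ frontier ((fun x : Space d => h⁻¹ • x.fst) ⁻¹' ω)
      ↔ h⁻¹ • y.fst ∈ frontier ω := fun y => by
    rw [← (isOpenMap_smul_fst (inv_ne_zero h0)).preimage_frontier_eq_frontier_preimage
      (continuous_smul_fst _)]
    simp
  have h1 := closure_lateral (hω.preimage (continuous_smul_fst h⁻¹))
    (continuousOn_thin h0 hH) (fun x hx hfx => ?_)
  · have h2 : thinEnd ω H h Side.plus ∪ thinEnd ω H h Side.minus = ⋃ s : Side, {x : Space d |
        x ∈ (fun x : Space d => h⁻¹ • x.fst) ⁻¹' ω ∧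
          1 + h * H s (h⁻¹ • x.fst) - s.sgn * x.snd = 0} := by
      ext x
      have e : ∀ s, x ∈ thinEnd ω H h s ↔ x ∈ {x : Space d |
          x ∈ (fun x : Space d => h⁻¹ • x.fst) ⁻¹' ω ∧
          1 + h * H s (h⁻¹ • x.fst) - s.sgn * x.snd = 0} := fun s => by
        simp only [thinEnd, Set.mem_ofPred_eq, Set.mem_preimage]
        exact and_congr_right fun _ => by constructor <;> intro h <;> linarith
      rw [Set.mem_iUnion, Set.mem_union, e, e]
      refine ⟨fun h => h.elim (fun h => ⟨_, h⟩) fun h => ⟨_, h⟩, ?_⟩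
      rintro ⟨s, hs⟩
      cases s
      · exact Or.inl hs
      · exact Or.inr hs
    rw [thinLat, thinCyl_eq, h2, h1, Set.mem_ofPred_eq, hfr]
    simp only [sub_nonneg]
  · simp only [hfr] at hx ⊢
    have hc : Continuous fun t : ℝ => pt x.fst ((1 - t) * x.snd) :=
      continuous_pt.comp
        (continuous_const.prodMk ((continuous_const.sub continuous_id).mul continuous_const))
    have ht : Tendsto (fun t : ℝ => pt x.fst ((1 - t) * x.snd)) (𝓝[>] 0) (𝓝 x) := by
      have := (hc.tendsto 0).mono_left (nhdsWithin_le_nhds (s := Set.Ioi 0))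
      rwa [sub_zero, one_mul] at this
    refine mem_closure_of_tendsto ht ?_
    filter_upwards [Ioo_mem_nhdsGT (zero_lt_one' ℝ)] with t ht
    refine ⟨hx, fun s => ?_⟩
    have h3 := hfx s
    have h4 := hpos s _ hx.1
    have h5 := ht.1
    have h6 := ht.2
    change 0 < 1 + h * H s (h⁻¹ • x.fst) - s.sgn * ((1 - t) * x.snd)
    nlinarith [mul_pos h5 h4, mul_nonneg (sub_nonneg.2 h6.le) h3]

end Thin

end Geometry

section SemiGap

variable {d : ℕ} {ω : Set (EuclideanSpace ℝ (Fin d))} {H : EuclideanSpace ℝ (Fin d) → ℝ}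

/-- The one-dimensional trace inequality: the value at a point is bounded by the `H¹` norm on the
half-line, since `-(f²)' ≤ f² + f'²`. -/
lemma sq_le_integral_Ioi {f : ℝ → ℝ} (hf : ContDiff ℝ (⊤ : ℕ∞) f) (hc : HasCompactSupport f)
    {a t : ℝ} (ht : a ≤ t) : f t ^ 2 ≤ ∫ s in Set.Ioi a, (f s ^ 2 + deriv f s ^ 2) := by
  have hsq : HasCompactSupport fun s => f s ^ 2 := by
    refine hc.mono fun x hx => ?_
    rw [Function.mem_support] at hx ⊢
    intro h0
    exact hx (by simp [h0])
  have hdc : Continuous (deriv f) := hf.continuous_deriv (by simp)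
  have hsqd : HasCompactSupport fun s => deriv f s ^ 2 := by
    refine hc.deriv.mono fun x hx => ?_
    rw [Function.mem_support] at hx ⊢
    intro h0
    exact hx (by simp [h0])
  have hint : Integrable fun s => f s ^ 2 + deriv f s ^ 2 :=
    ((hf.continuous.pow 2).integrable_of_hasCompactSupport hsq).add
      ((hdc.pow 2).integrable_of_hasCompactSupport hsqd)
  have hf2 : ContDiff ℝ 1 fun s => f s ^ 2 := (hf.pow 2).of_le (by exact_mod_cast le_top)
  have h1 := hsq.integral_Ioi_deriv_eq hf2 t
  have h2 : f t ^ 2 = ∫ s in Set.Ioi t, -deriv (fun s => f s ^ 2) s := by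
    rw [integral_neg, h1, neg_neg]
  have hder : ∀ s, deriv (fun s => f s ^ 2) s = 2 * f s * deriv f s := fun s => by
    have := ((hf.differentiable (by simp)) s).hasDerivAt.pow 2
    have h3 := this.deriv
    simp only [Nat.cast_ofNat, Nat.add_one_sub_one, pow_one] at h3
    exact h3
  rw [h2]
  calc _ ≤ ∫ s in Set.Ioi t, (f s ^ 2 + deriv f s ^ 2) := by
        refine setIntegral_mono ?_ hint.integrableOn fun s => ?_
        · exact ((hf2.continuous_deriv le_rfl).integrable_of_hasCompactSupport
            hsq.deriv).neg.integrableOn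
        · simp only [hder]
          nlinarith [sq_nonneg (f s + deriv f s)]
    _ ≤ _ := setIntegral_mono_set hint.integrableOn
        (Eventually.of_forall fun s => by positivity)
        (Eventually.of_forall (Set.Ioi_subset_Ioi ht))

/-- The norm in a thin layer at the end of the semi-infinite cylinder is small. -/
lemma layer_estimate (hω : IsOpen ω) (hH : ContinuousOn H (closure ω)) (S : Set (Space d)) {σ : ℝ}
    (hσ : 0 < σ) {Λ : Set (Space d)} (hΛm : MeasurableSet Λ)
    (hΛ : ∀ x ∈ Λ, x ∈ semiCyl ω H ∧ x.snd < -H x.fst + σ) :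
    ∀ x ∈ formDomain 1 (semiCyl ω H) S,
      ‖mulL2 (one Λ) x.1‖ ^ 2 ≤ σ * (‖x.1‖ ^ 2 + ‖x.2‖ ^ 2) := by
  have hΩm := (isOpen_semiCyl hω hH).measurableSet
  refine formDomain_induction ?_ ?_
  · exact isClosed_le (by fun_prop) (by fun_prop)
  rintro x ⟨φ, hφ, hx1, hx2⟩
  have hG1 : (fun ξ => ‖mulL2 (one Λ) x.1 ξ‖ ^ 2) =ᵐ[volume] Λ.indicator fun ξ => φ ξ ^ 2 := by
    filter_upwards [hx1, mulL2_one_coe hΛm x.1] with ξ e1 e2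
    rw [e2, e1]
    by_cases hm : ξ ∈ Λ
    · simp [hm, (hΛ ξ hm).1]
    · simp [hm]
  have hG2 : (fun ξ => σ * (‖x.1 ξ‖ ^ 2 + ‖x.2 ξ‖ ^ 2)) =ᵐ[volume]
      (semiCyl ω H).indicator fun ξ => σ * (φ ξ ^ 2 + ‖gradient φ ξ‖ ^ 2) := by
    filter_upwards [hx1, hx2] with ξ e1 e2
    rw [e2, e1]
    by_cases hm : ξ ∈ semiCyl ω H <;> simp [hm]
  have i2 : Integrable fun ξ => σ * (‖x.1 ξ‖ ^ 2 + ‖x.2 ξ‖ ^ 2) :=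
    ((L2_integrable_sq x.1).add (L2_integrable_sq x.2)).const_mul σ
  rw [L2_norm_sq, L2_norm_sq, L2_norm_sq, ← integral_add (L2_integrable_sq _) (L2_integrable_sq _),
    ← integral_const_mul, integral_congr_ae hG1, integral_congr_ae hG2]
  refine integral_le_of_lines ((L2_integrable_sq _).congr hG1) (i2.congr hG2) fun y => ?_
  by_cases hy : y ∈ ω
  swap
  · have e1 : ∀ z, Λ.indicator (fun ξ => φ ξ ^ 2) (pt y z) = 0 := fun z =>
      Set.indicator_of_notMem (fun hm => hy (hΛ (pt y z) hm).1.1) _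
    simp only [e1, integral_zero]
    exact integral_nonneg fun z => Set.indicator_nonneg (fun _ _ => by positivity) _
  set f : ℝ → ℝ := fun z => φ (pt y z) with hf
  have hfs : ContDiff ℝ (⊤ : ℕ∞) f := contDiff_line hφ.1 y
  have hfc : HasCompactSupport f := hasCompactSupport_line hφ.2.1 y
  have hmem : ∀ z, pt y z ∈ semiCyl ω H ↔ z ∈ Set.Ioi (-H y) := fun z =>
    ⟨fun h => h.2, fun h => ⟨hy, h⟩⟩
  have e2 : ∀ z, (semiCyl ω H).indicator (fun ξ => σ * (φ ξ ^ 2 + ‖gradient φ ξ‖ ^ 2)) (pt y z)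
      = (Set.Ioi (-H y)).indicator
        (fun z => σ * (f z ^ 2 + ‖gradient φ (pt y z)‖ ^ 2)) z := fun z => by
    by_cases hm : z ∈ Set.Ioi (-H y)
    · rw [Set.indicator_of_mem hm, Set.indicator_of_mem ((hmem z).2 hm)]
    · rw [Set.indicator_of_notMem hm, Set.indicator_of_notMem (mt (hmem z).1 hm)]
  simp only [e2]
  rw [integral_indicator measurableSet_Ioi, integral_const_mul]
  set I := ∫ z in Set.Ioi (-H y), (f z ^ 2 + ‖gradient φ (pt y z)‖ ^ 2) with hI
  have hgc : Continuous fun z => f z ^ 2 + ‖gradient φ (pt y z)‖ ^ 2 :=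
    (hfs.continuous.pow 2).add (((continuous_gradient hφ.1).comp
      (continuous_pt.comp (continuous_const.prodMk continuous_id))).norm.pow 2)
  have hgs : HasCompactSupport fun z => f z ^ 2 + ‖gradient φ (pt y z)‖ ^ 2 := by
    refine hasCompactSupport_line (φ := fun ξ => φ ξ ^ 2 + ‖gradient φ ξ‖ ^ 2) ?_ y
    refine hφ.2.1.mono' fun ξ hξ => ?_
    rw [Function.mem_support] at hξ
    by_contra h0
    have h1 : gradient φ ξ = 0 :=
      image_eq_zero_of_notMem_tsupport (mt (fun h => tsupport_gradient_subset φ h) h0)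
    exact hξ (by simp [h1, image_eq_zero_of_notMem_tsupport h0])
  -- On each vertical line the function is bounded by the energy of that line.
  have hb : ∀ t ∈ Set.Ioo (-H y) (-H y + σ), f t ^ 2 ≤ I := fun t ht => by
    refine (sq_le_integral_Ioi hfs hfc ht.1.le).trans ?_
    refine setIntegral_mono ?_ (hgc.integrable_of_hasCompactSupport hgs).integrableOn fun z => ?_
    · have hdc : Continuous (deriv f) := hfs.continuous_deriv (by simp)
      refine (Continuous.integrable_of_hasCompactSupport ((hfs.continuous.pow 2).add (hdc.pow 2))
        (hfc.mono' fun ξ hξ => ?_)).integrableOn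
      rw [Function.mem_support] at hξ
      by_contra h0
      have h1 : deriv f ξ = 0 :=
        image_eq_zero_of_notMem_tsupport (mt (fun h => tsupport_deriv_subset h) h0)
      exact hξ (by simp [h1, image_eq_zero_of_notMem_tsupport h0])
    · have h1 : deriv f z = (gradient φ (pt y z)).snd := (hasDerivAt_vert hφ.1 y z).deriv
      have h2 := norm_snd_le (gradient φ (pt y z))
      simp only [h1]
      have h3 := pow_le_pow_left₀ (abs_nonneg _) h2 2
      rw [sq_abs] at h3
      linarith
  have hI0 : 0 ≤ I := integral_nonneg fun z => by positivity
  -- The line meets the layer in a segment of length at most `σ`.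
  calc ∫ z, Λ.indicator (fun ξ => φ ξ ^ 2) (pt y z)
      ≤ ∫ z, (Set.Ioo (-H y) (-H y + σ)).indicator (fun _ => I) z := by
        refine integral_mono_of_nonneg
          (Eventually.of_forall fun z => Set.indicator_nonneg (fun _ _ => by positivity) _)
          ?_ (Eventually.of_forall fun z => ?_)
        · exact (integrable_indicator_iff measurableSet_Ioo).2 (integrableOn_const (by simp))
        · by_cases hm : pt y z ∈ Λ
          · have h1 := hΛ _ hm
            have h2 : z ∈ Set.Ioo (-H y) (-H y + σ) := ⟨h1.1.2, h1.2⟩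
            simp only [Set.indicator_of_mem hm, Set.indicator_of_mem h2]
            exact hb z h2
          · simp only [Set.indicator_of_notMem hm]
            exact Set.indicator_nonneg (fun _ _ => hI0) _
    _ = σ * I := by
        rw [integral_indicator measurableSet_Ioo, setIntegral_const]
        simp [measureReal_def, hσ.le]

end SemiGap

/-! ### Compactness below the threshold in a semi-infinite cylinder -/

section Cutoff

variable {F : Type*} [NormedAddCommGroup F] [InnerProductSpace ℝ F] [FiniteDimensional ℝ F]

open scoped Manifold in
lemma exists_smooth_cutoff {s t : Set F} (hs : IsClosed s) (ht : IsClosed t) (hd : Disjoint s t)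
    {R : ℝ} (hR : ∀ x, R ≤ ‖x‖ → x ∈ s) :
    ∃ θ : F → ℝ, ContDiff ℝ (⊤ : ℕ∞) θ ∧ HasCompactSupport θ ∧ Disjoint (tsupport θ) s ∧
      (∀ x ∈ t, θ x = 1) ∧ ∀ x, θ x ∈ Set.Icc (0 : ℝ) 1 := by
  obtain ⟨f, h0, h1, hf⟩ := exists_contMDiffMap_zero_one_nhds_of_isClosed 𝓘(ℝ, F) hs ht hd
    (n := ⊤)
  have hts : Disjoint (tsupport f) s := Set.disjoint_left.2 fun x hx hxs => by
    have h2 : ∀ᶠ y in 𝓝 x, f y = 0 := (eventually_nhdsSet_iff_forall.1 h0) x hxs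
    exact notMem_tsupport_iff_eventuallyEq.2 h2 hx
  refine ⟨f, f.contMDiff.contDiff, ?_, hts, fun x hx => h1.self_of_nhdsSet x hx, hf⟩
  refine HasCompactSupport.of_support_subset_isCompact (isCompact_closedBall 0 R) fun x hx => ?_
  rw [mem_closedBall_zero_iff]
  by_contra! h
  exact Set.disjoint_left.1 hts (subset_tsupport _ hx) (hR x h.le)

lemma exists_bound_of_hasCompactSupport {θ : F → ℝ} (hθ : ContDiff ℝ (⊤ : ℕ∞) θ)
    (hc : HasCompactSupport θ) : ∃ C, (∀ x, |θ x| ≤ C) ∧ ∀ x, ‖gradient θ x‖ ≤ C := by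
  obtain ⟨C₁, h₁⟩ := hc.exists_bound_of_continuous hθ.continuous
  obtain ⟨C₂, h₂⟩ := (hasCompactSupport_gradient hc).exists_bound_of_continuous
    (continuous_gradient hθ)
  exact ⟨max C₁ C₂, fun x => (h₁ x).trans (le_max_left _ _),
    fun x => (h₂ x).trans (le_max_right _ _)⟩

variable [MeasurableSpace F] [BorelSpace F]
variable {V W W' : Type*} [NormedAddCommGroup V] [InnerProductSpace ℝ V]
  [NormedAddCommGroup W] [InnerProductSpace ℝ W] [NormedAddCommGroup W'] [InnerProductSpace ℝ W']

lemma inner_mulL2 {g : F → ℝ} (hg : Measurable g) {C : ℝ} (hC : ∀ x, |g x| ≤ C)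
    (a b : Lp V 2 (volume : Measure F)) : ⟪mulL2 g a, b⟫ = ⟪a, mulL2 g b⟫ := by
  rw [L2.inner_def, L2.inner_def]
  refine integral_congr_ae ?_
  filter_upwards [mulL2_coe hg hC a, mulL2_coe hg hC b] with x h1 h2
  rw [h1, h2, real_inner_smul_left, real_inner_smul_right]

lemma one_of_mem {A : Set F} {z : F} (hz : z ∈ A) : one A z = 1 := Set.indicator_of_mem hz _

lemma one_of_notMem {A : Set F} {z : F} (hz : z ∉ A) : one A z = 0 := Set.indicator_of_notMem hz _

lemma norm_sq_le_of_ae₃ {V' : Type*} [NormedAddCommGroup V'] [InnerProductSpace ℝ V']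
    {f : Lp V 2 (volume : Measure F)} {g : Lp W 2 (volume : Measure F)}
    {k : Lp W' 2 (volume : Measure F)} {l : Lp V' 2 (volume : Measure F)}
    (h : ∀ᵐ x, ‖f x‖ ^ 2 ≤ ‖g x‖ ^ 2 + ‖k x‖ ^ 2 + ‖l x‖ ^ 2) :
    ‖f‖ ^ 2 ≤ ‖g‖ ^ 2 + ‖k‖ ^ 2 + ‖l‖ ^ 2 := by
  have i1 : Integrable fun x => ‖g x‖ ^ 2 + ‖k x‖ ^ 2 :=
    (L2_integrable_sq g).add (L2_integrable_sq k)
  rw [L2_norm_sq, L2_norm_sq, L2_norm_sq, L2_norm_sq,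
    ← integral_add (L2_integrable_sq g) (L2_integrable_sq k),
    ← integral_add i1 (L2_integrable_sq l)]
  exact integral_mono_ae (L2_integrable_sq f) (i1.add (L2_integrable_sq l)) h

/-- The product rule for a cut-off function bounds the form of a localized function. -/
lemma norm_sq_product_le {θ : F → ℝ} {C h : ℝ} (hC : ∀ x, |θ x| ≤ C)
    (hC' : ∀ x, ‖gradient θ x‖ ≤ C) {x y : L2 F × L2V F}
    (hy : y.2 =ᵐ[volume] fun z => θ z • x.2 z + (h * x.1 z) • gradient θ z) :
    ‖y.2‖ ^ 2 ≤ 2 * C ^ 2 * ‖x.2‖ ^ 2 + 2 * h ^ 2 * C ^ 2 * ‖x.1‖ ^ 2 := by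
  refine norm_sq_le_of_ae ?_
  filter_upwards [hy] with z hz
  rw [hz]
  have h1 : ‖θ z • x.2 z‖ ≤ C * ‖x.2 z‖ := by
    rw [norm_smul]; exact mul_le_mul_of_nonneg_right (hC z) (norm_nonneg _)
  have h2 : ‖(h * x.1 z) • gradient θ z‖ ≤ |h| * ‖x.1 z‖ * C := by
    rw [norm_smul, norm_mul, Real.norm_eq_abs]
    exact mul_le_mul_of_nonneg_left (hC' z) (by positivity)
  have h3 : ‖θ z • x.2 z + (h * x.1 z) • gradient θ z‖ ≤ C * ‖x.2 z‖ + |h| * ‖x.1 z‖ * C :=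
    (norm_add_le _ _).trans (add_le_add h1 h2)
  have h4 := pow_le_pow_left₀ (norm_nonneg _) h3 2
  have h5 : (|h| * ‖x.1 z‖ * C) ^ 2 = h ^ 2 * C ^ 2 * ‖x.1 z‖ ^ 2 := by
    rw [mul_pow, mul_pow, sq_abs]; ring
  nlinarith [sq_nonneg (C * ‖x.2 z‖ - |h| * ‖x.1 z‖ * C)]

end Cutoff

section SemiGap

variable {d : ℕ} {ω : Set (EuclideanSpace ℝ (Fin d))} {H : EuclideanSpace ℝ (Fin d) → ℝ}

/-- In the high part of the semi-infinite cylinder the Poincaré inequality of the cross-section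
holds. -/
lemma semi_poincare (hω : IsOpen ω) (hb : Bornology.IsBounded ω)
    (hH : ContinuousOn H (closure ω)) {R₀ : ℝ} (hR : ∀ η ∈ closure ω, |H η| ≤ R₀) {mu1 : ℝ}
    (hmu : IsFirstDirichletEigenvalue ω mu1) :
    ∀ x ∈ formDomain 1 (semiCyl ω H) (semiLat ω H),
      mu1 * ‖mulL2 (one {ξ : Space d | R₀ < ξ.snd}) x.1‖ ^ 2
        ≤ ‖mulL2 (one {ξ : Space d | R₀ < ξ.snd}) x.2‖ ^ 2 := by
  have key := slice_poincare hω hb hmu one_pos (Ω := semiCyl ω H) (S := semiLat ω H)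
    (A := Set.Ioi R₀) (w := (Set.Ioi R₀).indicator fun _ => 1) (C := 1)
    (fun z hz y => ?_) (fun z hz η hη => ?_) (measurable_const.indicator measurableSet_Ioi)
    (fun z => by by_cases h : z ∈ Set.Ioi R₀ <;> simp [h])
    (fun z hz => Set.indicator_of_notMem hz _)
  · exact key
  · rw [inv_one, one_smul]
    refine ⟨fun h => h.1, fun h => ⟨h, ?_⟩⟩
    have := abs_le.1 (hR y (subset_closure h))
    change -H y < z
    have hz' : R₀ < z := hz
    linarith
  · rw [one_smul, mem_closure_semiLat hω hH]
    refine ⟨hη, ?_⟩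
    have := abs_le.1 (hR η hη.1)
    change -H η ≤ z
    have hz' : R₀ < z := hz
    linarith

/-- The arithmetic of `semi_gap`: `q` collects the constants of the three regions. -/
lemma gap_of_bound {M M' ε q C T a b : ℝ} (hq : 0 < q) (hM : M' * q ≤ 1 - 2 * ε) (hMM : M ≤ M')
    (ha : 0 ≤ a) (h : (1 - 2 * ε) * a ≤ q * b + C * T) : M * a - C / q * T ≤ b := by
  have h1 : q * (M' * a) ≤ q * (b + C / q * T) := by
    have e : q * (C / q * T) = C * T := by field_simp
    rw [mul_add, e]
    nlinarith [mul_le_mul_of_nonneg_right hM ha]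
  have h2 := le_of_mul_le_mul_left h1 hq
  nlinarith [mul_le_mul_of_nonneg_right hMM ha]

/-- The essential spectrum of the limit problem lies above the first eigenvalue of the
cross-section: below it, the form is positive up to finitely many functionals. -/
lemma semi_gap (hω : IsOpen ω) (hb : Bornology.IsBounded ω)
    (hH : ContinuousOn H (closure ω)) {R₀ : ℝ} (hR : ∀ η ∈ closure ω, |H η| ≤ R₀) {mu1 : ℝ}
    (hmu : IsFirstDirichletEigenvalue ω mu1) (hmu0 : 0 < mu1) {M : ℝ} (hM : M < mu1) :
    ∃ (ι : Type) (_ : Fintype ι) (ψ : ι → L2 (Space d)) (C : ℝ),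
      ∀ x ∈ formDomain 1 (semiCyl ω H) (semiLat ω H),
        M * ‖x.1‖ ^ 2 - C * ∑ i, ⟪ψ i, x.1⟫ ^ 2 ≤ ‖x.2‖ ^ 2 := by
  set M' := max M 0 with hM'
  have hM0 : 0 ≤ M' := le_max_right _ _
  have hMm : M' < mu1 := max_lt hM hmu0
  -- This choice of `ε` makes `M' * (mu1⁻¹ + 2 * ε) ≤ 1 - 2 * ε`.
  set ε := (1 - M' / mu1) / (2 * (M' + 1)) with hε
  have hε0 : 0 < ε := div_pos (by rw [sub_pos, div_lt_one hmu0]; exact hMm) (by positivity)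
  have hεe : 2 * ε * (M' + 1) = 1 - M' / mu1 := by
    rw [hε]; field_simp
  obtain ⟨r, hr⟩ := hb.closure.exists_norm_le
  set Ω := semiCyl ω H with hΩ
  have hΩo : IsOpen Ω := isOpen_semiCyl hω hH
  -- The thin layer along the curved end.
  set Λ : Set (Space d) := Ω ∩ {x | x.snd < -H x.fst + ε} with hΛ
  have hΛm : MeasurableSet Λ := by
    have h2 : ContinuousOn (fun x : Space d => -H x.fst + ε - x.snd) Ω := by
      refine ContinuousOn.sub (ContinuousOn.add (ContinuousOn.neg (hH.comp
        continuous_fst'.continuousOn fun x hx => subset_closure hx.1)) continuousOn_const)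
        continuous_snd'.continuousOn
    have h3 := h2.isOpen_inter_preimage hΩo isOpen_Ioi (t := Set.Ioi 0)
    have h4 : Λ = Ω ∩ (fun x : Space d => -H x.fst + ε - x.snd) ⁻¹' Set.Ioi 0 := by
      ext x
      simp only [hΛ, hΩ, Set.mem_inter_iff, Set.mem_ofPred_eq, Set.mem_preimage, Set.mem_Ioi,
        sub_pos]
    rw [h4]
    exact h3.measurableSet
  have hcl : IsClosed ((fun x : Space d => x.fst) ⁻¹' closure ω) :=
    isClosed_closure.preimage continuous_fst'
  have hHf : ContinuousOn (fun x : Space d => x.snd + H x.fst)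
      ((fun x : Space d => x.fst) ⁻¹' closure ω) :=
    continuous_snd'.continuousOn.add (hH.comp continuous_fst'.continuousOn fun x hx => hx)
  -- The cut-off vanishes near the curved end and far away, and is `1` on the rest of the lower
  -- part.
  set s : Set (Space d) := {x | r + R₀ + 1 ≤ ‖x‖} ∪
    ((fun x : Space d => x.fst) ⁻¹' closure ω ∩
      (fun x : Space d => x.snd + H x.fst) ⁻¹' Set.Iic 0) with hs
  set t : Set (Space d) := ((fun x : Space d => x.fst) ⁻¹' closure ω ∩
      (fun x : Space d => x.snd + H x.fst) ⁻¹' Set.Ici ε) ∩ {x | x.snd ≤ R₀} with ht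
  have htn : ∀ x ∈ t, ‖x‖ ≤ r + R₀ := fun x hx => by
    have h1 := hr _ hx.1.1
    have h2 := abs_le.1 (hR _ hx.1.1)
    have h3 : ε ≤ x.snd + H x.fst := hx.1.2
    have h4 : x.snd ≤ R₀ := hx.2
    have h5 : |x.snd| ≤ R₀ := abs_le.2 ⟨by linarith, h4⟩
    have h6 : 0 ≤ R₀ := (abs_nonneg _).trans h5
    have h7 : 0 ≤ r := (norm_nonneg _).trans h1
    rw [WithLp.prod_norm_eq_of_L2]
    refine Real.sqrt_le_iff.2 ⟨by positivity, ?_⟩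
    rw [Real.norm_eq_abs]
    nlinarith [norm_nonneg x.fst, abs_nonneg x.snd, mul_nonneg h7 h6]
  obtain ⟨θ, hθ, hθc, hθs, hθt, hθ01⟩ := exists_smooth_cutoff (s := s) (t := t)
    ((isClosed_le continuous_const continuous_norm).union
      (hHf.preimage_isClosed_of_isClosed hcl isClosed_Iic))
    ((hHf.preimage_isClosed_of_isClosed hcl isClosed_Ici).inter
      (isClosed_le continuous_snd' continuous_const))
    (Set.disjoint_left.2 fun x hx hxt => by
      rcases hx with hx | hx
      · have h1 := htn x hxt
        have h2 : r + R₀ + 1 ≤ ‖x‖ := hx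
        linarith
      · have h1 : x.snd + H x.fst ≤ 0 := hx.2
        have h2 : ε ≤ x.snd + H x.fst := hxt.1.2
        linarith) (R := r + R₀ + 1) (fun x hx => Or.inl hx)
  obtain ⟨C, hC, hC'⟩ := exists_bound_of_hasCompactSupport hθ hθc
  obtain ⟨ι, hι, ψ, C₁, hψ⟩ := exists_rellich_formDomain (F := Space d) (r + R₀)
    (ε := ε / (2 * C ^ 2 + 1)) (by positivity) hΩo
  set q := mu1⁻¹ + 2 * ε with hq
  have hq0 : 0 < q := by positivity
  have hMq : M' * q ≤ 1 - 2 * ε := by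
    have : M' / mu1 = M' * mu1⁻¹ := div_eq_mul_inv _ _
    rw [hq]; nlinarith
  refine ⟨ι, hι, fun i => mulL2 θ (ψ i), C₁ / q, fun x hx => ?_⟩
  -- The localized function satisfies the Dirichlet condition on the whole boundary.
  obtain ⟨y, hy, hy1, hy2⟩ := mul_mem_formDomain hθ hC hC' (S' := frontier Ω)
    (S := semiLat ω H) (fun z hz hzS => by
      rw [isClosed_frontier.closure_eq] at hzS
      have h1 : z ∉ s := Set.disjoint_left.1 hθs hz
      have hsub : Ω ⊆ (fun x : Space d => x.fst) ⁻¹' closure ω := fun w hw => subset_closure hw.1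
      have h2 : z.fst ∈ closure ω := closure_minimal hsub hcl hzS.1
      have h3 : 0 < z.snd + H z.fst := by
        by_contra! h
        exact h1 (Or.inr ⟨h2, h⟩)
      rw [mem_closure_semiLat hω hH]
      refine ⟨⟨h2, fun h4 => ?_⟩, by linarith⟩
      rw [hω.interior_eq] at h4
      have h5 := hzS.2
      rw [hΩo.interior_eq] at h5
      exact h5 ⟨h4, by linarith⟩) hx
  have e1 : ∀ i, ⟪mulL2 θ (ψ i), x.1⟫ = ⟪ψ i, y.1⟫ := fun i => by
    rw [inner_mulL2 hθ.continuous.measurable hC]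
    congr 1
    refine Lp.ext ?_
    filter_upwards [hy1, mulL2_coe hθ.continuous.measurable hC x.1] with z a b
    rw [a, b, smul_eq_mul]
  have h1 := hψ y hy
  have h2 : ‖y.2‖ ^ 2 ≤ 2 * C ^ 2 * ‖x.2‖ ^ 2 + 2 * C ^ 2 * ‖x.1‖ ^ 2 := by
    simpa using norm_sq_product_le hC hC' hy2
  have h3 := semi_poincare hω hb hH hR hmu x hx
  have hSm : MeasurableSet {ξ : Space d | R₀ < ξ.snd} :=
    measurableSet_lt measurable_const measurable_snd'
  have h4 := norm_mulL2_one_le hSm x.2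
  have h5 := layer_estimate hω hH (semiLat ω H) hε0 hΛm (fun z hz => hz) x hx
  set B := Metric.closedBall (0 : Space d) (r + R₀) with hB
  -- The cylinder is covered by the high part, the layer at the end and the bounded set `t`.
  have h6 : ‖x.1‖ ^ 2 ≤ ‖mulL2 (one {ξ : Space d | R₀ < ξ.snd}) x.1‖ ^ 2
      + ‖mulL2 (one Λ) x.1‖ ^ 2 + ‖mulL2 (one B) y.1‖ ^ 2 := by
    refine norm_sq_le_of_ae₃ ?_
    filter_upwards [mulL2_one_coe hSm x.1, mulL2_one_coe hΛm x.1,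
      mulL2_one_coe (A := B) measurableSet_closedBall y.1, hy1,
      (ae_eq_indicator_of_mem hΩo.measurableSet hx).1] with z a1 a2 a3 a4 a5
    rw [a1, a2, a3, a4]
    by_cases hz : z ∈ Ω
    swap
    · rw [a5, Set.indicator_of_notMem hz]; simp
    by_cases hz1 : z ∈ {ξ : Space d | R₀ < ξ.snd}
    · rw [one_of_mem hz1, one_smul]
      have : 0 ≤ ‖one Λ z • x.1 z‖ ^ 2 + ‖one B z • (θ z * x.1 z)‖ ^ 2 := by positivity
      linarith
    by_cases hz2 : z ∈ Λ
    · rw [one_of_mem hz2, one_smul]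
      have : 0 ≤ ‖one {ξ : Space d | R₀ < ξ.snd} z • x.1 z‖ ^ 2
        + ‖one B z • (θ z * x.1 z)‖ ^ 2 := by positivity
      linarith
    have hzt : z ∈ t := by
      have hz3 : z.snd ≤ R₀ := not_lt.1 hz1
      refine ⟨⟨subset_closure hz.1, ?_⟩, hz3⟩
      have : ¬ z.snd < -H z.fst + ε := fun h => hz2 ⟨hz, h⟩
      change ε ≤ z.snd + H z.fst
      linarith
    have hzB : z ∈ B := mem_closedBall_zero_iff.2 (htn z hzt)
    rw [one_of_mem hzB, one_smul, hθt z hzt, one_mul]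
    have : 0 ≤ ‖one {ξ : Space d | R₀ < ξ.snd} z • x.1 z‖ ^ 2 + ‖one Λ z • x.1 z‖ ^ 2 := by
      positivity
    linarith
  simp only [e1]
  have h7 : ε / (2 * C ^ 2 + 1) * ‖y.2‖ ^ 2 ≤ ε * (‖x.1‖ ^ 2 + ‖x.2‖ ^ 2) := by
    rw [div_mul_eq_mul_div, div_le_iff₀ (by positivity), mul_assoc]
    refine mul_le_mul_of_nonneg_left ?_ hε0.le
    nlinarith [sq_nonneg ‖x.1‖, sq_nonneg ‖x.2‖]
  have h8 : ‖mulL2 (one {ξ : Space d | R₀ < ξ.snd}) x.1‖ ^ 2 ≤ mu1⁻¹ * ‖x.2‖ ^ 2 := by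
    rw [inv_mul_eq_div, le_div_iff₀ hmu0]; linarith
  refine gap_of_bound hq0 hMq (le_max_left _ _) (sq_nonneg _) ?_
  rw [hq]
  linarith

end SemiGap

/-! ### The spectral gap of the limit problems -/

section AbstractGap

variable {L M : Type*} [NormedAddCommGroup L] [InnerProductSpace ℝ L]
  [NormedAddCommGroup M] [InnerProductSpace ℝ M]

/-- A lower bound of the form on the orthogonal complement of finitely many eigenvectors extends to
the whole space at the cost of the projection onto these eigenvectors. -/
lemma gap_of_orthogonal {K : Submodule ℝ (L × M)} {J : Type*} [Fintype J] [DecidableEq J]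
    {e : J → L × M} {l : J → ℝ} (he : ∀ j, IsWeakEig K (l j) (e j))
    (ho : ∀ i j, ⟪(e i).1, (e j).1⟫ = if i = j then (1 : ℝ) else 0) {c : ℝ}
    (h : ∀ x ∈ K, (∀ j, ⟪(e j).1, x.1⟫ = 0) → c * ‖x.1‖ ^ 2 ≤ ‖x.2‖ ^ 2) :
    ∀ x ∈ K, c * ‖x.1‖ ^ 2 - c * ∑ j, ⟪(e j).1, x.1⟫ ^ 2 ≤ ‖x.2‖ ^ 2 := by
  intro x hx
  set a : J → ℝ := fun j => ⟪(e j).1, x.1⟫ with ha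
  set S : L × M := ∑ j, a j • e j with hS
  have hSK : S ∈ K := K.sum_mem fun j _ => K.smul_mem _ (he j).mem
  set r := x - S with hr
  have hrK : r ∈ K := K.sub_mem hx hSK
  have hr0 : ∀ j, ⟪(e j).1, r.1⟫ = 0 := fun j => by
    rw [hr, Prod.fst_sub, inner_sub_right, hS, fst_sum_smul, inner_sum]
    simp [real_inner_smul_right, ho, ha]
  have hS1 : ⟪S.1, r.1⟫ = 0 := by
    rw [hS, fst_sum_smul, sum_inner]
    exact Finset.sum_eq_zero fun j _ => by rw [real_inner_smul_left, hr0, mul_zero]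
  have hS2 : ⟪S.2, r.2⟫ = 0 := by
    rw [hS, snd_sum_smul, sum_inner]
    exact Finset.sum_eq_zero fun j _ => by
      rw [real_inner_smul_left, (he j).eq r hrK, hr0, mul_zero, mul_zero]
  have hx1 : x.1 = S.1 + r.1 := by rw [hr, Prod.fst_sub]; abel
  have hx2 : x.2 = S.2 + r.2 := by rw [hr, Prod.snd_sub]; abel
  have n1 : ‖x.1‖ ^ 2 = ‖S.1‖ ^ 2 + ‖r.1‖ ^ 2 := by
    rw [hx1, norm_add_sq_real, hS1]; ring
  have n2 : ‖x.2‖ ^ 2 = ‖S.2‖ ^ 2 + ‖r.2‖ ^ 2 := by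
    rw [hx2, norm_add_sq_real, hS2]; ring
  have n3 : ‖S.1‖ ^ 2 = ∑ j, a j ^ 2 := (snd_norm_sq_sum Finset.univ he ho a).1
  have h1 := h r hrK hr0
  rw [← n3, n1, n2]
  nlinarith [sq_nonneg ‖S.2‖]

end AbstractGap

section EigenSum

variable {F : Type*} [NormedAddCommGroup F] [InnerProductSpace ℝ F] [FiniteDimensional ℝ F]
  [MeasurableSpace F] [BorelSpace F]

lemma coeFn_sum_smul {V ι : Type*} [NormedAddCommGroup V] [InnerProductSpace ℝ V] (J : Finset ι)
    (a : ι → ℝ) (f : ι → Lp V 2 (volume : Measure F)) :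
    (∑ j ∈ J, a j • f j : Lp V 2 (volume : Measure F)) =ᵐ[volume] fun z => ∑ j ∈ J, a j • f j z := by
  classical
  induction J using Finset.induction_on with
  | empty =>
    simp only [Finset.sum_empty]
    exact Lp.coeFn_zero _ _ _
  | insert j J hj ih =>
    rw [Finset.sum_insert hj]
    filter_upwards [ih, Lp.coeFn_add (a j • f j) (∑ j ∈ J, a j • f j),
      Lp.coeFn_smul (a j) (f j)] with z h1 h2 h3
    rw [h2, Pi.add_apply, h1, h3, Pi.smul_apply, Finset.sum_insert hj]

/-- Linear relations between eigenfunctions, which hold almost everywhere in `Ω`, hold in `L²` after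
extension by zero. -/
lemma fst_eq_sum_lift {h : ℝ} {Ω S : Set F} (hΩ : MeasurableSet Ω) {y : L2 F × L2V F}
    (hy : y ∈ formDomain h Ω S) {ι : Type*} {J : Finset ι} {a : ι → ℝ} {u : ι → F → ℝ}
    (hu : ∀ j ∈ J, MemH1 Ω (u j))
    (hW : y.1 =ᵐ[volume.restrict Ω] fun x => ∑ j ∈ J, a j * u j x) :
    y.1 = ∑ j ∈ J, a j • (lift h Ω (u j)).1 := by
  refine Lp.ext ?_
  have h1 : ∀ᵐ z, ∀ j ∈ J, (lift h Ω (u j)).1 z = Ω.indicator (u j) z :=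
    (ae_ball_iff J.countable_toSet).2 fun j hj => lift_fst_coe hΩ (hu j hj)
  filter_upwards [coeFn_sum_smul J a fun j => (lift h Ω (u j)).1, h1,
    (ae_eq_indicator_of_mem hΩ hy).1, (ae_restrict_iff' hΩ).1 hW] with z e1 e2 e3 e4
  rw [e1, Finset.sum_congr rfl fun j hj => by rw [e2 j hj]]
  by_cases hz : z ∈ Ω
  · simp [hz, e4 hz]
  · rw [e3]; simp [hz]

end EigenSum

section LimitGap

variable {d : ℕ} {ω : Set (EuclideanSpace ℝ (Fin d))} {H : Side → EuclideanSpace ℝ (Fin d) → ℝ}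

/-- Above the eigenvalue `Lam p` the form of a limit problem has a gap, modulo the eigenfunctions
with the numbers below `n`. -/
lemma semi_limit_gap (hω : IsOpen ω) (hb : Bornology.IsBounded ω)
    (hH : ∀ s, ContinuousOn (H s) (closure ω)) {R₀ : ℝ} (hR : ∀ s, ∀ η ∈ closure ω, |H s η| ≤ R₀)
    {mu1 : ℝ} (hmu : IsFirstDirichletEigenvalue ω mu1) {δ : ℝ} (hδ : 0 < δ) {N : ℕ} {Lam : ℕ → ℝ}
    {side : ℕ → Side} {U : ℕ → Space d → ℝ} (hU : IsLimitEigenList ω H mu1 δ N Lam side U)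
    {p n : ℕ} (hpN : p < N) (hnN : n ≤ N) (hgt : ∀ k, n ≤ k → k < N → Lam p < Lam k) (s : Side) :
    ∃ g > 0, ∃ C : ℝ, 0 ≤ C ∧ ∀ x ∈ formDomain 1 (semiCyl ω (H s)) (semiLat ω (H s)),
      (Lam p + g) * ‖x.1‖ ^ 2 - C * ∑ k : Fin n, (if side k = s then
        ⟪(lift 1 (semiCyl ω (H s)) (U k)).1, x.1⟫ ^ 2 else 0) ≤ ‖x.2‖ ^ 2 := by
  have hmu0 : 0 < mu1 := by have := hU.pos p hpN; have := hU.le p hpN; linarith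
  set Ω := semiCyl ω (H s) with hΩ
  have hΩo : IsOpen Ω := isOpen_semiCyl hω (hH s)
  have hLm : Lam p < mu1 := by have := hU.le p hpN; linarith
  obtain ⟨ι, hι, ψ, C, hgap⟩ := semi_gap hω hb (hH s) (hR s) hmu hmu0
    (M := (Lam p + mu1) / 2) (by linarith)
  let J := {k : Fin n // side k = s}
  let e : J → L2 (Space d) × L2V (Space d) := fun j => lift 1 Ω (U j.1)
  let l : J → ℝ := fun j => Lam j.1
  have hN : ∀ j : J, (j.1 : ℕ) < N := fun j => j.1.2.trans_le hnN
  have hpair : ∀ j : J, IsEigenpair Ω (semiLat ω (H s)) (Lam j.1) (U j.1) := fun j => by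
    have := hU.eigenpair j.1 (hN j)
    rwa [j.2] at this
  have he : ∀ j, IsWeakEig (formDomain 1 Ω (semiLat ω (H s))) (l j) (e j) := fun j => by
    have := isWeakEig_lift (h := 1) hΩo one_ne_zero (hpair j)
    rwa [one_pow, one_mul] at this
  have ho : ∀ i j, ⟪(e i).1, (e j).1⟫ = if i = j then (1 : ℝ) else 0 := fun i j => by
    have h1 := hU.orthonormal i.1 (hN i) j.1 (hN j) (i.2.trans j.2.symm)
    rw [j.2] at h1
    rw [inner_lift_fst hΩo.measurableSet (hpair i).1.1 (hpair j).1.1, h1]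
    refine if_congr ⟨fun h => Subtype.ext (Fin.ext h), fun h => by rw [h]⟩ rfl rfl
  have hsum : ∀ x : L2 (Space d), ∑ k : Fin n, (if side k = s then
      ⟪(lift 1 Ω (U k)).1, x⟫ ^ 2 else 0) = ∑ j, ⟪(e j).1, x⟫ ^ 2 := fun x => by
    rw [← Finset.sum_filter]
    exact (Finset.sum_subtype _ (by simp) fun k : Fin n => ⟪(lift 1 Ω (U k)).1, x⟫ ^ 2)
  rcases exists_isWeakEig_or_gap (isClosed_formDomain 1 Ω (semiLat ω (H s))) hgap
    (show Lam p < (Lam p + mu1) / 2 by linarith) he ho with ⟨μ, hμ, y, hy, hye⟩ | ⟨g, hg, h⟩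
  · exfalso
    have h1 := (isEigenpair_of_isWeakEig hΩo one_ne_zero hy).1
    rw [one_pow, inv_one, one_mul] at h1
    -- The new eigenvector would be a combination of listed eigenfunctions with an eigenvalue at
    -- most `Lam p`; their numbers are below `n`, so it is orthogonal to itself.
    obtain ⟨I, a, hI, hW⟩ := hU.complete s μ y.1 h1 (hμ.trans (hU.le p hpN))
    have h2 := fst_eq_sum_lift (h := 1) hΩo.measurableSet hy.mem (J := I) (a := a) (u := U)
      (fun j hj => by
        have := hU.eigenpair j (hI j hj).1
        rw [(hI j hj).2.1] at this
        exact this.1.1) hW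
    refine hy.ne_zero (inner_self_eq_zero (𝕜 := ℝ).1 ?_)
    nth_rewrite 1 [h2]
    rw [sum_inner]
    refine Finset.sum_eq_zero fun j hj => ?_
    have hjn : j < n := by
      by_contra! hc
      have := hgt j hc (hI j hj).1
      rw [(hI j hj).2.2] at this
      linarith
    rw [real_inner_smul_left]
    have := hye ⟨⟨j, hjn⟩, (hI j hj).2.1⟩
    rw [show ⟪(lift 1 Ω (U j)).1, y.1⟫ = 0 from this, mul_zero]
  · refine ⟨g, hg, Lam p + g, by have := hU.pos p hpN; linarith, fun x hx => ?_⟩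
    rw [hsum]
    exact gap_of_orthogonal he ho h x hx

end LimitGap

/-! ### Exponential decay of eigenfunctions -/

section Weight

variable {F : Type*} [NormedAddCommGroup F] [InnerProductSpace ℝ F] [FiniteDimensional ℝ F]
  [MeasurableSpace F] [BorelSpace F] {E : F → ℝ} {B : Set F} {D a h : ℝ} {x y : L2 F × L2V F}

/-- Eigenvectors of the form of a mixed boundary value problem. -/
abbrev IsFormEig (h : ℝ) (Ω S : Set F) (lam : ℝ) (x : L2 F × L2V F) : Prop :=
  IsWeakEig (formDomain h Ω S) lam x

lemma inner_gradient_comp (ℓ : F →L[ℝ] ℝ) {f : ℝ → ℝ} {f' : ℝ} {x : F}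
    (hf : HasDerivAt f f' (ℓ x)) (v : F) : ⟪gradient (fun x => f (ℓ x)) x, v⟫ = f' * ℓ v := by
  have h1 : HasFDerivAt (fun x => f (ℓ x)) (f' • (ℓ : F →L[ℝ] ℝ)) x :=
    hf.comp_hasFDerivAt x ℓ.hasFDerivAt
  rw [inner_gradient_left, h1.fderiv]
  simp

/-- Where the weight `E` is at least `1 / D`, the function is bounded by `D` times the weighted
function `y = E x`. -/
lemma norm_fst_le_of_weight (hE0 : ∀ ξ, 0 ≤ E ξ) (hBm : MeasurableSet B)
    (hBE : ∀ ξ ∈ B, 1 ≤ D * E ξ) (hy1 : y.1 =ᵐ[volume] fun z => E z * x.1 z) :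
    ‖mulL2 (one B) x.1‖ ^ 2 ≤ D ^ 2 * ‖y.1‖ ^ 2 := by
  have := norm_sq_le_of_ae (f := mulL2 (one B) x.1) (g := y.1)
    (k := y.1) (a := D ^ 2) (b := 0) (by
      filter_upwards [mulL2_one_coe hBm x.1, hy1] with ξ e1 e2
      rw [e1, e2, zero_mul, add_zero]
      by_cases hξ : ξ ∈ B
      · rw [one_of_mem hξ, one_smul, ← mul_pow]
        refine pow_le_pow_left₀ (norm_nonneg _) ?_ 2
        rw [norm_mul, Real.norm_of_nonneg (hE0 ξ), ← mul_assoc]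
        exact le_mul_of_one_le_left (norm_nonneg _) (hBE ξ hξ)
      · rw [one_of_notMem hξ, zero_smul, norm_zero, zero_pow two_ne_zero]; positivity)
  simpa using this

/-- The analogue of `norm_fst_le_of_weight` for the gradient; the derivative of the weight is
controlled by its logarithmic slope `a`. -/
lemma norm_snd_le_of_weight (h0 : 0 < h) (hE0 : ∀ ξ, 0 ≤ E ξ)
    (hgn : ∀ ξ, h * ‖gradient E ξ‖ ≤ a * E ξ) (hBm : MeasurableSet B)
    (hBE : ∀ ξ ∈ B, 1 ≤ D * E ξ) (hD : 0 ≤ D) (hy1 : y.1 =ᵐ[volume] fun z => E z * x.1 z)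
    (hy2 : y.2 =ᵐ[volume] fun z => E z • x.2 z + (h * x.1 z) • gradient E z) :
    ‖mulL2 (one B) x.2‖ ^ 2 ≤ 2 * D ^ 2 * ‖y.2‖ ^ 2 + 2 * D ^ 2 * a ^ 2 * ‖y.1‖ ^ 2 := by
  refine norm_sq_le_of_ae ?_
  filter_upwards [mulL2_one_coe hBm x.2, hy1, hy2] with ξ e1 e2 e3
  rw [e1]
  by_cases hξ : ξ ∈ B
  · rw [one_of_mem hξ, one_smul]
    have h2 : E ξ • x.2 ξ = y.2 ξ - (h * x.1 ξ) • gradient E ξ := by rw [e3]; abel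
    have h3 : ‖(h * x.1 ξ) • gradient E ξ‖ ≤ a * ‖y.1 ξ‖ := by
      rw [norm_smul, norm_mul, Real.norm_of_nonneg h0.le, e2, norm_mul,
        Real.norm_of_nonneg (hE0 ξ)]
      have := mul_le_mul_of_nonneg_right (hgn ξ) (norm_nonneg (x.1 ξ))
      linarith
    have h4 : E ξ * ‖x.2 ξ‖ ≤ ‖y.2 ξ‖ + a * ‖y.1 ξ‖ := by
      calc E ξ * ‖x.2 ξ‖ = ‖E ξ • x.2 ξ‖ := by
            rw [norm_smul, Real.norm_of_nonneg (hE0 ξ)]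
        _ ≤ ‖y.2 ξ‖ + ‖(h * x.1 ξ) • gradient E ξ‖ := by rw [h2]; exact norm_sub_le _ _
        _ ≤ _ := by linarith
    have h5 : ‖x.2 ξ‖ ≤ D * (‖y.2 ξ‖ + a * ‖y.1 ξ‖) := by
      calc ‖x.2 ξ‖ ≤ D * E ξ * ‖x.2 ξ‖ := le_mul_of_one_le_left (norm_nonneg _) (hBE ξ hξ)
        _ = D * (E ξ * ‖x.2 ξ‖) := by ring
        _ ≤ _ := mul_le_mul_of_nonneg_left h4 hD
    have h6 := pow_le_pow_left₀ (norm_nonneg _) h5 2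
    nlinarith [mul_nonneg (sq_nonneg D) (sq_nonneg (‖y.2 ξ‖ - a * ‖y.1 ξ‖))]
  · rw [one_of_notMem hξ, zero_smul, norm_zero, zero_pow two_ne_zero]
    positivity

end Weight

section Decay

variable {d : ℕ}

lemma contDiff_snd' : ContDiff ℝ (⊤ : ℕ∞) fun x : Space d => x.snd :=
  (WithLp.sndL 2 ℝ (EuclideanSpace ℝ (Fin d)) ℝ).contDiff

lemma gradient_comp_snd {f : ℝ → ℝ} {f' : ℝ} {x : Space d} (hf : HasDerivAt f f' x.snd) :
    gradient (fun x : Space d => f x.snd) x = pt 0 f' := by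
  refine ext_inner_right ℝ fun v => ?_
  refine (inner_gradient_comp (WithLp.sndL 2 ℝ (EuclideanSpace ℝ (Fin d)) ℝ) hf v).trans ?_
  rw [WithLp.prod_inner_apply]
  simp [mul_comm]

lemma norm_pt_zero (t : ℝ) : ‖(pt 0 t : Space d)‖ = |t| := by
  rw [WithLp.prod_norm_eq_of_L2]
  simp [Real.sqrt_sq_eq_abs]

lemma hasDerivAt_exp_mul (a b t : ℝ) :
    HasDerivAt (fun t => Real.exp (a * t + b)) (a * Real.exp (a * t + b)) t := by
  have h1 : HasDerivAt (fun t : ℝ => a * t + b) a t := by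
    simpa using ((hasDerivAt_id t).const_mul a).add_const b
  simpa [mul_comm] using h1.exp

/-- Exponential decay: an eigenvector of a form which satisfies the Poincaré inequality at the
heights in `A` is small where the weight `D` is small, compared with its size outside `A`. -/
lemma decay_of_weight {h lam m a : ℝ} {Ω S : Set (Space d)} (h0 : 0 < h)
    {x : L2 (Space d) × L2V (Space d)} (hx : IsFormEig h Ω S lam x)
    {A B : Set ℝ} (hA : MeasurableSet A) (hB : MeasurableSet B)
    (hP : ∀ y ∈ formDomain h Ω S, m * ‖mulL2 (one {ξ : Space d | ξ.snd ∈ A}) y.1‖ ^ 2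
      ≤ ‖mulL2 (one {ξ : Space d | ξ.snd ∈ A}) y.2‖ ^ 2)
    (hm : 0 < m - lam - a ^ 2) (hm0 : 0 ≤ m) (ha : 0 ≤ a) (hlam : 0 ≤ lam)
    {D D' : ℝ → ℝ} (hD : ContDiff ℝ (⊤ : ℕ∞) D) (hDD : ∀ z, HasDerivAt D (D' z) z)
    {c d₀ d₁ : ℝ} (hc : 0 < c) (hDc : ∀ z, c ≤ D z) (hDa : ∀ z, h * |D' z| ≤ a * D z)
    (hd0 : 0 < d₀) (hd : ∀ z ∉ A, d₀ ≤ D z) (hd1 : ∀ z ∈ B, D z ≤ d₁) (hd10 : 0 ≤ d₁) :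
    ‖mulL2 (one {ξ : Space d | ξ.snd ∈ B}) x.1‖ ^ 2
        + ‖mulL2 (one {ξ : Space d | ξ.snd ∈ B}) x.2‖ ^ 2
      ≤ (1 + 2 * lam + 4 * a ^ 2) * (m / (m - lam - a ^ 2)) * (d₁ / d₀) ^ 2 * ‖x.1‖ ^ 2 := by
  have hDp : ∀ z, 0 < D z := fun z => hc.trans_le (hDc z)
  -- Agmon's estimate is applied to the bounded weight `1 / D`.
  set E : Space d → ℝ := fun ξ => (D ξ.snd)⁻¹ with hE
  have hEs : ContDiff ℝ (⊤ : ℕ∞) E :=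
    (hD.comp contDiff_snd').inv fun ξ => (hDp _).ne'
  have hg : ∀ ξ, gradient E ξ = pt 0 (-D' ξ.snd / D ξ.snd ^ 2) := fun ξ =>
    gradient_comp_snd ((hDD ξ.snd).fun_inv (hDp _).ne')
  have hgn : ∀ ξ, h * ‖gradient E ξ‖ ≤ a * E ξ := fun ξ => by
    rw [hg, norm_pt_zero, abs_div, abs_neg, abs_of_pos (pow_pos (hDp _) 2)]
    have h1 := hDa ξ.snd
    have h2 := hDp ξ.snd
    simp only [hE]
    rw [← mul_div_assoc, div_le_iff₀ (by positivity)]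
    calc h * |D' ξ.snd| ≤ a * D ξ.snd := h1
      _ = a * (D ξ.snd)⁻¹ * D ξ.snd ^ 2 := by field_simp
  have hE0 : ∀ ξ, 0 ≤ E ξ := fun ξ => (inv_pos.2 (hDp _)).le
  have hEc : ∀ ξ, E ξ ≤ c⁻¹ := fun ξ => inv_anti₀ hc (hDc _)
  have hAm : MeasurableSet {ξ : Space d | ξ.snd ∈ A} := measurable_snd' hA
  have hBm : MeasurableSet {ξ : Space d | ξ.snd ∈ B} := measurable_snd' hB
  obtain ⟨y, hy, hy1, hy2, hn1, hn2⟩ := agmon_estimate (C := max c⁻¹ (a * c⁻¹ / h)) (C₀ := d₀⁻¹)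
    h0.le hx hEs hE0
    (fun ξ => by rw [abs_of_nonneg (hE0 ξ)]; exact (hEc ξ).trans (le_max_left _ _))
    (fun ξ => by
      refine le_trans ?_ (le_max_right _ _)
      rw [le_div_iff₀ h0, mul_comm]
      exact (hgn ξ).trans (mul_le_mul_of_nonneg_left (hEc ξ) ha))
    hgn hAm hP hm hm0 (fun ξ hξ => inv_anti₀ hd0 (hd _ hξ))
  have hBE : ∀ ξ ∈ {ξ : Space d | ξ.snd ∈ B}, 1 ≤ d₁ * E ξ := fun ξ hξ => by
    simp only [hE]
    rw [← div_eq_mul_inv, one_le_div (hDp _)]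
    exact hd1 _ hξ
  have k1 := norm_fst_le_of_weight hE0 hBm hBE hy1
  have k2 := norm_snd_le_of_weight h0 hE0 hgn hBm hBE hd10 hy1 hy2
  have k3 : ‖y.1‖ ^ 2 ≤ m / (m - lam - a ^ 2) * (d₀⁻¹) ^ 2 * ‖x.1‖ ^ 2 := by
    refine hn1.trans (le_of_eq ?_)
    ring
  have k4 : 0 ≤ d₁ ^ 2 := sq_nonneg _
  calc _ ≤ d₁ ^ 2 * ‖y.1‖ ^ 2 + (2 * d₁ ^ 2 * ((lam + a ^ 2) * ‖y.1‖ ^ 2)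
        + 2 * d₁ ^ 2 * a ^ 2 * ‖y.1‖ ^ 2) := by
        refine add_le_add k1 (k2.trans ?_)
        have := mul_le_mul_of_nonneg_left hn2 (by positivity : 0 ≤ 2 * d₁ ^ 2)
        linarith
    _ = (1 + 2 * lam + 4 * a ^ 2) * d₁ ^ 2 * ‖y.1‖ ^ 2 := by ring
    _ ≤ (1 + 2 * lam + 4 * a ^ 2) * d₁ ^ 2 * (m / (m - lam - a ^ 2) * (d₀⁻¹) ^ 2 * ‖x.1‖ ^ 2) :=
        mul_le_mul_of_nonneg_left k3 (by positivity)
    _ = _ := by rw [div_pow, inv_pow]; ring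

variable {ω : Set (EuclideanSpace ℝ (Fin d))}

/-- The trapped modes decay exponentially along the semi-infinite cylinder. -/
lemma semi_decay {H : EuclideanSpace ℝ (Fin d) → ℝ} (hω : IsOpen ω) (hb : Bornology.IsBounded ω)
    (hH : ContinuousOn H (closure ω)) {R₀ : ℝ} (hR : ∀ η ∈ closure ω, |H η| ≤ R₀) {mu1 : ℝ}
    (hmu : IsFirstDirichletEigenvalue ω mu1) {lam τ : ℝ} (hlam : 0 ≤ lam) (hτ : 0 ≤ τ)
    (hlt : lam + τ ^ 2 < mu1) {x : L2 (Space d) × L2V (Space d)}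
    (hx : IsFormEig 1 (semiCyl ω H) (semiLat ω H) lam x) :
    ∃ C, 0 ≤ C ∧ ∀ T : ℝ, ‖mulL2 (one {ξ : Space d | ξ.snd ∈ Set.Ioi T}) x.1‖ ^ 2
        + ‖mulL2 (one {ξ : Space d | ξ.snd ∈ Set.Ioi T}) x.2‖ ^ 2
      ≤ (C * Real.exp (-(τ * T))) ^ 2 := by
  set C := Real.sqrt ((1 + 2 * lam + 4 * τ ^ 2) * (mu1 / (mu1 - lam - τ ^ 2)) * ‖x.1‖ ^ 2)
    * (2 * Real.exp (τ * R₀)) with hC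
  have hmu0 : 0 ≤ mu1 := by nlinarith [sq_nonneg τ]
  have hm : 0 < mu1 - lam - τ ^ 2 := by linarith
  refine ⟨C, by positivity, fun T => ?_⟩
  -- The constant `exp (-τ T)` bounds the weight from below; it does not matter below the height
  -- `T`.
  have hD : ∀ z, HasDerivAt (fun z => Real.exp (-τ * z + 0) + Real.exp (-τ * T))
      (-τ * Real.exp (-τ * z + 0)) z := fun z => (hasDerivAt_exp_mul (-τ) 0 z).add_const _
  refine (decay_of_weight one_pos hx (A := Set.Ioi R₀) (B := Set.Ioi T) measurableSet_Ioi
    measurableSet_Ioi (semi_poincare hω hb hH hR hmu) hm hmu0 hτ hlam (by fun_prop) hD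
    (c := Real.exp (-τ * T)) (d₀ := Real.exp (-τ * R₀)) (d₁ := 2 * Real.exp (-τ * T))
    (Real.exp_pos _) (fun z => le_add_of_nonneg_left (Real.exp_pos _).le) (fun z => ?_)
    (Real.exp_pos _) (fun z hz => ?_) (fun z hz => ?_) (by positivity)).trans (le_of_eq ?_)
  · rw [one_mul, abs_mul, abs_neg, abs_of_nonneg hτ, Real.abs_exp]
    exact mul_le_mul_of_nonneg_left (le_add_of_nonneg_right (Real.exp_pos _).le) hτ
  · have hz' : z ≤ R₀ := not_lt.1 hz
    refine le_trans ?_ (le_add_of_nonneg_right (Real.exp_pos _).le)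
    exact Real.exp_le_exp.2 (by nlinarith)
  · have hz' : T < z := hz
    have : Real.exp (-τ * z + 0) ≤ Real.exp (-τ * T) := Real.exp_le_exp.2 (by nlinarith)
    linarith
  · rw [hC, mul_pow, mul_pow, Real.sq_sqrt (by positivity)]
    have e1 : 2 * Real.exp (-τ * T) / Real.exp (-τ * R₀)
        = 2 * Real.exp (τ * R₀) * Real.exp (-(τ * T)) := by
      rw [neg_mul, neg_mul, Real.exp_neg (τ * R₀)]; field_simp
    rw [e1, mul_pow]
    ring

variable {H : Side → EuclideanSpace ℝ (Fin d) → ℝ}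

/-- Where the thin cylinder has full cross-sections the Poincaré inequality holds. -/
lemma thin_poincare (hω : IsOpen ω) (hb : Bornology.IsBounded ω)
    (hH : ∀ s, ContinuousOn (H s) (closure ω)) {R₀ : ℝ}
    (hR : ∀ s, ∀ η ∈ closure ω, |H s η| ≤ R₀) {mu1 : ℝ}
    (hmu : IsFirstDirichletEigenvalue ω mu1) {h : ℝ} (h0 : 0 < h) (hhR : h * R₀ < 1)
    {w : ℝ → ℝ} (hw : Measurable w) {C : ℝ} (hC : ∀ z, |w z| ≤ C)
    (hwA : ∀ z, 1 - h * R₀ ≤ |z| → w z = 0) :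
    ∀ x ∈ formDomain h (thinCyl ω H h) (thinLat ω H h),
      mu1 * ‖mulL2 (fun ξ : Space d => w ξ.snd) x.1‖ ^ 2
        ≤ ‖mulL2 (fun ξ : Space d => w ξ.snd) x.2‖ ^ 2 := by
  have hb2 : ∀ s : Side, ∀ z : ℝ, |z| < 1 - h * R₀ → ∀ η ∈ closure ω,
      s.sgn * z < 1 + h * H s η := fun s z hz η hη => by
    have h1 := (abs_le.1 (hR s η hη)).1
    have h2 : s.sgn * z ≤ |z| := (le_abs_self _).trans (by rw [abs_mul, s.abs_sgn, one_mul])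
    nlinarith
  have hpos : ∀ s, ∀ η ∈ closure ω, 0 < 1 + h * H s η := fun s η hη => by
    have h1 := (abs_le.1 (hR s η hη)).1
    nlinarith
  refine slice_poincare hω hb hmu h0 (A := {z | |z| < 1 - h * R₀})
    (fun z hz y => Iff.intro (fun hm => hm.1)
      (fun hm => And.intro hm fun s => hb2 s z hz _ (subset_closure hm)))
    (fun z hz η hη => ?_) hw hC (fun z hz => hwA z (not_lt.1 hz))
  rw [mem_closure_thinLat hω h0.ne' hH hpos]
  have e : h⁻¹ • (pt (h • η) z).fst = η := inv_smul_smul₀ h0.ne' η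
  rw [e]
  exact ⟨hη, fun s => (hb2 s z hz η hη.1).le⟩

/-- The eigenfunctions of the thin cylinder decay exponentially away from the ends. -/
lemma thin_decay (hω : IsOpen ω) (hb : Bornology.IsBounded ω)
    (hH : ∀ s, ContinuousOn (H s) (closure ω)) {R₀ : ℝ}
    (hR : ∀ s, ∀ η ∈ closure ω, |H s η| ≤ R₀) {mu1 : ℝ}
    (hmu : IsFirstDirichletEigenvalue ω mu1) {h : ℝ} (h0 : 0 < h) (hhR : h * R₀ < 1)
    {lam τ : ℝ} (hlam : 0 ≤ lam) (hτ : 0 ≤ τ)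
    (hlt : lam + τ ^ 2 < mu1) {x : L2 (Space d) × L2V (Space d)}
    (hx : IsFormEig h (thinCyl ω H h) (thinLat ω H h) lam x) (t : ℝ) :
    ‖mulL2 (one {ξ : Space d | ξ.snd ∈ {z : ℝ | |z| < 1 - t}}) x.1‖ ^ 2
        + ‖mulL2 (one {ξ : Space d | ξ.snd ∈ {z : ℝ | |z| < 1 - t}}) x.2‖ ^ 2
      ≤ (1 + 2 * lam + 4 * τ ^ 2) * (mu1 / (mu1 - lam - τ ^ 2)) *
        (3 * Real.exp (τ * R₀) * Real.exp (-(τ * t / h))) ^ 2 * ‖x.1‖ ^ 2 := by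
  have hmu0 : 0 ≤ mu1 := by nlinarith [sq_nonneg τ]
  have hm : 0 < mu1 - lam - τ ^ 2 := by linarith
  set k := τ / h with hk
  have hk0 : 0 ≤ k := by positivity
  have hhk : h * k = τ := by rw [hk]; field_simp
  have hAm : ∀ c : ℝ, MeasurableSet {z : ℝ | |z| < 1 - c} := fun c =>
    (isOpen_lt continuous_abs continuous_const).measurableSet
  -- The weight is `exp (-k dist)` for both ends `z = ± 1`; the last summand bounds it from below
  -- and is of the same size on the boundary of the set `|z| < 1 - t`.
  have hD : ∀ z, HasDerivAt (fun z => Real.exp (k * z + -k) + Real.exp (-k * z + -k)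
      + Real.exp (-k * t)) (k * Real.exp (k * z + -k) + -k * Real.exp (-k * z + -k)) z := fun z =>
    ((hasDerivAt_exp_mul k (-k) z).add (hasDerivAt_exp_mul (-k) (-k) z)).add_const _
  refine (decay_of_weight h0 hx (A := {z : ℝ | |z| < 1 - h * R₀}) (B := {z : ℝ | |z| < 1 - t})
    (hAm _) (hAm _) ?_ hm hmu0 hτ hlam (by fun_prop) hD
    (c := Real.exp (-k * t)) (d₀ := Real.exp (-τ * R₀)) (d₁ := 3 * Real.exp (-k * t))
    (Real.exp_pos _) (fun z => le_add_of_nonneg_left (by positivity)) (fun z => ?_)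
    (Real.exp_pos _) (fun z hz => ?_) (fun z hz => ?_) (by positivity)).trans (le_of_eq ?_)
  · refine thin_poincare hω hb hH hR hmu h0 hhR
      (w := ({z : ℝ | |z| < 1 - h * R₀}).indicator fun _ => 1)
      (measurable_const.indicator (hAm _)) (C := 1) (fun z => ?_) (fun z hz => ?_)
    · exact abs_one_le _ z
    · exact Set.indicator_of_notMem (s := {z : ℝ | |z| < 1 - h * R₀}) (not_lt.2 hz) _
  · have h1 : |k * Real.exp (k * z + -k) + -k * Real.exp (-k * z + -k)|
        ≤ k * Real.exp (k * z + -k) + k * Real.exp (-k * z + -k) := by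
      refine (abs_add_le _ _).trans (le_of_eq ?_)
      rw [abs_mul, abs_mul, abs_neg, abs_of_nonneg hk0, Real.abs_exp, Real.abs_exp]
    have h2 := mul_le_mul_of_nonneg_left h1 h0.le
    refine h2.trans ?_
    have h3 := Real.exp_pos (-k * t)
    calc _ = τ * (Real.exp (k * z + -k) + Real.exp (-k * z + -k)) := by rw [← hhk]; ring
      _ ≤ _ := mul_le_mul_of_nonneg_left (by linarith) hτ
  · have hz' : 1 - h * R₀ ≤ |z| := not_lt.1 hz
    have h3 := Real.exp_pos (-k * t)
    have h4 : -τ * R₀ ≤ k * |z| + -k := by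
      have := mul_le_mul_of_nonneg_left hz' hk0
      have e : k * (1 - h * R₀) = k - τ * R₀ := by rw [← hhk]; ring
      linarith
    have h5 := Real.exp_le_exp.2 h4
    rcases abs_cases z with ⟨e, -⟩ | ⟨e, -⟩
    · rw [e] at h5
      have := Real.exp_pos (-k * z + -k)
      linarith
    · rw [e, mul_neg, ← neg_mul] at h5
      have := Real.exp_pos (k * z + -k)
      linarith
  · have hz' : |z| < 1 - t := hz
    obtain ⟨h1, h2⟩ := abs_lt.1 hz'
    have h3 : Real.exp (k * z + -k) ≤ Real.exp (-k * t) := Real.exp_le_exp.2 (by nlinarith)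
    have h4 : Real.exp (-k * z + -k) ≤ Real.exp (-k * t) := Real.exp_le_exp.2 (by nlinarith)
    linarith
  · have e1 : 3 * Real.exp (-k * t) / Real.exp (-τ * R₀)
        = 3 * Real.exp (τ * R₀) * Real.exp (-(τ * t / h)) := by
      have e2 : -k * t = -(τ * t / h) := by rw [hk]; ring
      rw [e2, neg_mul, Real.exp_neg (τ * R₀)]; field_simp
    rw [e1]

end Decay

/-! ### Cutting off and rescaling -/

section Pullback

variable {F : Type*} [NormedAddCommGroup F] [InnerProductSpace ℝ F] [FiniteDimensional ℝ F]
  [MeasurableSpace F] [BorelSpace F]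
variable {V : Type*} [NormedAddCommGroup V] [InnerProductSpace ℝ V]

/-- The factor which makes the composition with a similarity of ratio `h` an isometry of `L²`. -/
def pullFactor (F : Type*) [NormedAddCommGroup F] [InnerProductSpace ℝ F] (h : ℝ) : ℝ :=
  Real.sqrt (h ^ Module.finrank ℝ F)

lemma pullFactor_pos {h : ℝ} (h0 : 0 < h) : 0 < pullFactor F h :=
  Real.sqrt_pos.2 (pow_pos h0 _)

/-- Composition with the similarity `x ↦ c + h R x`, normalized to be an isometry of `L²`; the
isometry `A` acts on the values. -/
def pull (h : ℝ) (R : F ≃ₗᵢ[ℝ] F) (c : F) (A : V ≃ₗᵢ[ℝ] V) (f : Lp V 2 (volume : Measure F)) :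
    Lp V 2 (volume : Measure F) :=
  toL2 fun x => pullFactor F h • A (f (c + h • R x))

variable {h : ℝ} {R : F ≃ₗᵢ[ℝ] F} {c : F} {A : V ≃ₗᵢ[ℝ] V}

lemma pull_coe (h0 : 0 < h) (f : Lp V 2 (volume : Measure F)) :
    pull h R c A f =ᵐ[volume] fun x => pullFactor F h • A (f (c + h • R x)) := by
  refine toL2_coe ?_
  exact (memLp_weighted_comp (W := V) ENNReal.ofReal_ne_top
    (measurePreserving_similarity h0.ne' R c)
    (A := fun _ => (A.toContinuousLinearEquiv : V →L[ℝ] V)) stronglyMeasurable_const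
    (C := ‖(A.toContinuousLinearEquiv : V →L[ℝ] V)‖) (fun _ => le_rfl) f).const_smul _

lemma comp_ae_eq (h0 : 0 < h) (R : F ≃ₗᵢ[ℝ] F) (c : F) {W : Type*} {f g : F → W}
    (hfg : f =ᵐ[volume] g) :
    (fun x => f (c + h • R x)) =ᵐ[volume] fun x => g (c + h • R x) :=
  (measurePreserving_similarity h0.ne' R c).quasiMeasurePreserving.ae_eq_comp
    (Measure.ae_smul_measure hfg _)

lemma inner_pull (h0 : 0 < h) (f g : Lp V 2 (volume : Measure F)) :
    ⟪pull h R c A f, pull h R c A g⟫ = ⟪f, g⟫ := by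
  have hΨ := measurePreserving_similarity h0.ne' R c
  rw [L2.inner_def, L2.inner_def]
  have h1 : ∫ x, ⟪pull h R c A f x, pull h R c A g x⟫
      = ∫ x, pullFactor F h ^ 2 * ⟪f (c + h • R x), g (c + h • R x)⟫ := by
    refine integral_congr_ae ?_
    filter_upwards [pull_coe (R := R) (c := c) (A := A) h0 f,
      pull_coe (R := R) (c := c) (A := A) h0 g] with x e1 e2
    rw [e1, e2, real_inner_smul_left, real_inner_smul_right, A.inner_map_map]
    ring
  have h2 : AEStronglyMeasurable (fun x => ⟪f x, g x⟫) (volume : Measure F) :=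
    (Lp.aestronglyMeasurable f).inner (Lp.aestronglyMeasurable g)
  have h3 : ∫ x, ⟪f (c + h • R x), g (c + h • R x)⟫
      = ∫ x, ⟪f x, g x⟫ ∂(Measure.map (fun x => c + h • R x) volume) :=
    (integral_map hΨ.aemeasurable (by rw [hΨ.map_eq]; exact h2.smul_measure _)).symm
  rw [h1, integral_const_mul, h3, hΨ.map_eq, integral_smul_measure, pullFactor,
    Real.sq_sqrt (by positivity), ENNReal.toReal_ofReal (abs_nonneg _),
    abs_of_pos (inv_pos.2 (pow_pos h0 _)), smul_eq_mul, ← mul_assoc,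
    mul_inv_cancel₀ (pow_pos h0 _).ne', one_mul]

lemma norm_pull (h0 : 0 < h) (f : Lp V 2 (volume : Measure F)) : ‖pull h R c A f‖ = ‖f‖ := by
  have := inner_pull (R := R) (c := c) (A := A) h0 f f
  rw [real_inner_self_eq_norm_sq, real_inner_self_eq_norm_sq] at this
  exact (pow_left_inj₀ (norm_nonneg _) (norm_nonneg _) two_ne_zero).1 this

/-- The pull-back of functions. -/
abbrev pullS (h : ℝ) (R : F ≃ₗᵢ[ℝ] F) (c : F) (f : L2 F) : L2 F :=
  pull h R c (LinearIsometryEquiv.refl ℝ ℝ) f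

/-- The pull-back of vector fields. -/
abbrev pullV (h : ℝ) (R : F ≃ₗᵢ[ℝ] F) (c : F) (f : L2V F) : L2V F := pull h R c R.symm f

variable {Ω₁ S₁ Ω₂ S₂ : Set F} {θ : F → ℝ} {C : ℝ}

/-- A function on the small domain `Ω₁`, cut off and stretched to the model domain `Ω₂`. -/
lemma exists_localized (h0 : 0 < h) (hθ : ContDiff ℝ (⊤ : ℕ∞) θ) (hC : ∀ x, |θ x| ≤ C)
    (hC' : ∀ x, ‖gradient θ x‖ ≤ C) (hΩ : ∀ x ∈ tsupport θ, x ∈ Ω₂ ↔ c + h • R x ∈ Ω₁)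
    (hS : ∀ x ∈ tsupport θ, x ∈ closure S₂ ↔ c + h • R x ∈ closure S₁)
    {x : L2 F × L2V F} (hx : x ∈ formDomain h Ω₁ S₁) :
    ∃ y ∈ formDomain 1 Ω₂ S₂, (y.1 =ᵐ[volume] fun z => θ z * pullS h R c x.1 z) ∧
      (y.2 =ᵐ[volume] fun z => θ z • pullV h R c x.2 z + pullS h R c x.1 z • gradient θ z) := by
  obtain ⟨y, hy, hy1, hy2⟩ := transfer_mem (h₁ := h) (h₂ := 1) h0.ne' (one_mul h) R c hθ hC hC' hΩ
    (fun z hz h1 => (hS z hz).1 h1) hx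
  refine ⟨pullFactor F h • y, Submodule.smul_mem _ _ hy, ?_, ?_⟩
  · filter_upwards [hy1, Lp.coeFn_smul (pullFactor F h) y.1,
      pull_coe (R := R) (c := c) (A := LinearIsometryEquiv.refl ℝ ℝ) h0 x.1] with z e1 e2 e3
    rw [Prod.smul_fst, e2, Pi.smul_apply, e1, e3]
    simp only [LinearIsometryEquiv.coe_refl, id_eq, smul_eq_mul]
    ring
  · filter_upwards [hy2, Lp.coeFn_smul (pullFactor F h) y.2,
      pull_coe (R := R) (c := c) (A := LinearIsometryEquiv.refl ℝ ℝ) h0 x.1,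
      pull_coe (R := R) (c := c) (A := R.symm) h0 x.2] with z e1 e2 e3 e4
    rw [Prod.smul_snd, e2, Pi.smul_apply, e1, e3, e4]
    simp only [LinearIsometryEquiv.coe_refl, id_eq, smul_eq_mul, smul_add, smul_smul, one_mul]
    rw [mul_comm (θ z)]

/-- A function on the model domain `Ω₂`, cut off and shrunk to the small domain `Ω₁`. -/
lemma exists_transplanted (h0 : 0 < h) (hθ : ContDiff ℝ (⊤ : ℕ∞) θ) (hC : ∀ x, |θ x| ≤ C)
    (hC' : ∀ x, ‖gradient θ x‖ ≤ C) (hΩ : ∀ x ∈ tsupport θ, x ∈ Ω₂ ↔ c + h • R x ∈ Ω₁)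
    (hS : ∀ x ∈ tsupport θ, x ∈ closure S₂ ↔ c + h • R x ∈ closure S₁)
    {u : L2 F × L2V F} (hu : u ∈ formDomain 1 Ω₂ S₂) :
    ∃ y ∈ formDomain h Ω₁ S₁, (pullS h R c y.1 =ᵐ[volume] fun z => θ z * u.1 z) ∧
      (pullV h R c y.2 =ᵐ[volume] fun z => θ z • u.2 z + u.1 z • gradient θ z) ∧
      (y.1 =ᵐ[volume] fun x => (pullFactor F h)⁻¹ *
        (θ (R.symm (h⁻¹ • (x - c))) * u.1 (R.symm (h⁻¹ • (x - c))))) := by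
  -- The inverse of the similarity `x ↦ c + h R x` is `x ↦ c' + h⁻¹ R⁻¹ x`.
  set c' : F := -(h⁻¹ • R.symm c) with hc'
  have hΨ : ∀ x, c' + h⁻¹ • R.symm x = R.symm (h⁻¹ • (x - c)) := fun x => by
    rw [hc', map_smul, map_sub, smul_sub]; abel
  have hinv : ∀ x, c + h • R (c' + h⁻¹ • R.symm x) = x := fun x => by
    rw [hΨ, R.apply_symm_apply, smul_inv_smul₀ h0.ne']; abel
  have hinv' : ∀ x, c' + h⁻¹ • R.symm (c + h • R x) = x := fun x => by
    rw [hΨ, add_sub_cancel_left, inv_smul_smul₀ h0.ne', R.symm_apply_apply]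
  have hcont : Continuous fun x => c' + h⁻¹ • R.symm x := by fun_prop
  have hts : ∀ x ∈ tsupport fun x => θ (c' + h⁻¹ • R.symm x), c' + h⁻¹ • R.symm x ∈ tsupport θ := by
    intro x hx
    have hsub : Function.support (fun x => θ (c' + h⁻¹ • R.symm x))
        ⊆ (fun x => c' + h⁻¹ • R.symm x) ⁻¹' tsupport θ := fun y hy => subset_tsupport θ hy
    exact closure_minimal hsub ((isClosed_tsupport θ).preimage hcont) hx
  have hgr : ∀ x, gradient (fun x => θ (c' + h⁻¹ • R.symm x)) x
      = h⁻¹ • R (gradient θ (c' + h⁻¹ • R.symm x)) := fun x =>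
    gradient_comp_similarity (hθ.differentiable (by simp)) R.symm c' x
  have hsm : ContDiff ℝ (⊤ : ℕ∞) fun x => c' + h⁻¹ • R.symm x :=
    contDiff_const.add (R.symm.toContinuousLinearEquiv.contDiff.const_smul _)
  obtain ⟨y, hy, hy1, hy2⟩ := transfer_mem (h₁ := 1) (h₂ := h) (ρ := h⁻¹) (inv_ne_zero h0.ne')
    (mul_inv_cancel₀ h0.ne') R.symm c' (θ := fun x => θ (c' + h⁻¹ • R.symm x))
    (C := max C (h⁻¹ * C)) (hθ.comp hsm) (fun x => (hC _).trans (le_max_left _ _))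
    (fun x => by
      rw [hgr, norm_smul, R.norm_map, Real.norm_of_nonneg (inv_pos.2 h0).le]
      exact (mul_le_mul_of_nonneg_left (hC' _) (inv_pos.2 h0).le).trans (le_max_right _ _))
    (Ω₂ := Ω₁) (S₂ := S₁)
    (fun x hx => by
      have := hΩ _ (hts x hx)
      rw [hinv] at this
      exact this.symm)
    (fun x hx h1 => by
      have := hS _ (hts x hx)
      rw [hinv] at this
      exact this.2 h1) hu
  have hα : pullFactor F h ≠ 0 := (pullFactor_pos h0).ne'
  refine ⟨(pullFactor F h)⁻¹ • y, Submodule.smul_mem _ _ hy, ?_, ?_, ?_⟩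
  · filter_upwards [pull_coe (R := R) (c := c) (A := LinearIsometryEquiv.refl ℝ ℝ) h0
      ((pullFactor F h)⁻¹ • y).1, comp_ae_eq h0 R c hy1,
      comp_ae_eq h0 R c (Lp.coeFn_smul (pullFactor F h)⁻¹ y.1)] with z e1 e2 e3
    rw [e1, Prod.smul_fst, e3, Pi.smul_apply, e2, hinv']
    simp only [LinearIsometryEquiv.coe_refl, id_eq]
    rw [smul_inv_smul₀ hα]
  · filter_upwards [pull_coe (R := R) (c := c) (A := R.symm) h0
      ((pullFactor F h)⁻¹ • y).2, comp_ae_eq h0 R c hy2,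
      comp_ae_eq h0 R c (Lp.coeFn_smul (pullFactor F h)⁻¹ y.2)] with z e1 e2 e3
    rw [e1, Prod.smul_snd, e3, Pi.smul_apply, e2, hgr, hinv', map_smul, smul_inv_smul₀ hα]
    simp only [LinearIsometryEquiv.symm_symm, map_add, map_smul, R.symm_apply_apply, smul_smul]
    rw [mul_right_comm, mul_inv_cancel₀ h0.ne', one_mul]
  · filter_upwards [hy1, Lp.coeFn_smul (pullFactor F h)⁻¹ y.1] with z e1 e2
    rw [Prod.smul_fst, e2, Pi.smul_apply, e1, hΨ, smul_eq_mul]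

end Pullback

section Commutator

variable {F : Type*} [NormedAddCommGroup F] [InnerProductSpace ℝ F] [FiniteDimensional ℝ F]
  [MeasurableSpace F] [BorelSpace F] {V W : Type*} [NormedAddCommGroup V] [InnerProductSpace ℝ V]
  [NormedAddCommGroup W] [InnerProductSpace ℝ W]
  {θ θ' : F → ℝ} {B : Set F} {C G h : ℝ} {R : F ≃ₗᵢ[ℝ] F} {c : F}

lemma norm_le_of_ae {f : Lp V 2 (volume : Measure F)} {g : Lp W 2 (volume : Measure F)} {D : ℝ}
    (hfg : ∀ᵐ z, ‖f z‖ ≤ D * ‖g z‖) : ‖f‖ ≤ D * ‖g‖ :=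
  Lp.norm_le_mul_norm_of_ae_le_mul hfg

lemma eq_mulL2_of_ae (hθ : Measurable θ) (hC : ∀ x, |θ x| ≤ C)
    {f g : Lp V 2 (volume : Measure F)} (hf : f =ᵐ[volume] fun z => θ z • g z) :
    f = mulL2 θ g := by
  refine Lp.ext ?_
  filter_upwards [hf, mulL2_coe hθ hC g] with z e1 e2
  rw [e1, e2]

/-- Pulling back intertwines the multiplication by a function `θ'` with that by its composition `θ`
with the similarity. -/
lemma pull_mulL2 (h0 : 0 < h) (A : V ≃ₗᵢ[ℝ] V) (hθ : Measurable θ) (hC : ∀ x, |θ x| ≤ C)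
    (hθ' : Measurable θ') (hC' : ∀ x, |θ' x| ≤ C) (hθθ : ∀ x, θ' (c + h • R x) = θ x)
    (f : Lp V 2 (volume : Measure F)) :
    pull h R c A (mulL2 θ' f) = mulL2 θ (pull h R c A f) := by
  refine Lp.ext ?_
  filter_upwards [pull_coe (R := R) (c := c) (A := A) h0 (mulL2 θ' f),
    mulL2_coe hθ hC (pull h R c A f), pull_coe (R := R) (c := c) (A := A) h0 f,
    comp_ae_eq h0 R c (mulL2_coe hθ' hC' f)] with z e1 e2 e3 e4
  rw [e1, e2, e3, e4, hθθ, map_smul, smul_comm]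

/-- A product with the gradient of a cut-off function, as an element of `L²`. -/
lemma norm_smul_gradient_le (hG : ∀ z, ‖gradient θ z‖ ≤ G) (hBm : MeasurableSet B)
    (hB : ∀ z ∉ B, gradient θ z = 0) {X : L2V F} {f : L2 F}
    (hX : X =ᵐ[volume] fun z => f z • gradient θ z) :
    ‖X‖ ≤ G * ‖mulL2 (one B) f‖ ∧ ‖X‖ ≤ G * ‖f‖ ∧ mulL2 (one B) X = X := by
  have hG0 : 0 ≤ G := (norm_nonneg _).trans (hG 0)
  refine ⟨norm_le_of_ae ?_, norm_le_of_ae ?_,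
    (eq_mulL2_of_ae (measurable_one hBm) (abs_one_le B) ?_).symm⟩
  · filter_upwards [hX, mulL2_one_coe hBm f] with z e1 e2
    rw [e1, e2, norm_smul]
    by_cases hz : z ∈ B
    · rw [one_of_mem hz, one_smul, mul_comm]
      exact mul_le_mul_of_nonneg_right (hG z) (norm_nonneg _)
    · rw [hB z hz, norm_zero, mul_zero]; positivity
  · filter_upwards [hX] with z e1
    rw [e1, norm_smul, mul_comm]
    exact mul_le_mul_of_nonneg_right (hG z) (norm_nonneg _)
  · filter_upwards [hX] with z e1
    by_cases hz : z ∈ B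
    · rw [one_of_mem hz, one_smul]
    · rw [e1, hB z hz, smul_zero, smul_zero]

variable {x y u Φ : L2 F × L2V F}

/-- Cutting off and stretching, and cutting off and shrinking, are adjoint to each other. -/
lemma inner_transplanted (h0 : 0 < h) (hθ : Measurable θ) (hC : ∀ x, |θ x| ≤ C)
    (hy1 : y.1 =ᵐ[volume] fun z => θ z * pullS h R c x.1 z)
    (hp1 : pullS h R c Φ.1 =ᵐ[volume] fun z => θ z * u.1 z) : ⟪Φ.1, x.1⟫ = ⟪u.1, y.1⟫ := by
  rw [← inner_pull (R := R) (c := c) (A := LinearIsometryEquiv.refl ℝ ℝ) h0 Φ.1 x.1,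
    eq_mulL2_of_ae hθ hC (f := pull h R c (LinearIsometryEquiv.refl ℝ ℝ) Φ.1) hp1,
    eq_mulL2_of_ae hθ hC hy1, inner_mulL2 hθ hC]

/-- The residual of a transplanted eigenvector is produced by the gradient of the cut-off
function only. -/
lemma residual_transplanted {lam : ℝ} {Ω₂ S₂ : Set F} (h0 : 0 < h) (hθ : Measurable θ)
    (hC : ∀ x, |θ x| ≤ C) (hG : ∀ z, ‖gradient θ z‖ ≤ G) (hBm : MeasurableSet B)
    (hB : ∀ z ∉ B, gradient θ z = 0) (hu : IsFormEig 1 Ω₂ S₂ lam u) (hy : y ∈ formDomain 1 Ω₂ S₂)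
    (hy1 : y.1 =ᵐ[volume] fun z => θ z * pullS h R c x.1 z)
    (hy2 : y.2 =ᵐ[volume] fun z =>
      θ z • pullV h R c x.2 z + pullS h R c x.1 z • gradient θ z)
    (hp1 : pullS h R c Φ.1 =ᵐ[volume] fun z => θ z * u.1 z)
    (hp2 : pullV h R c Φ.2 =ᵐ[volume] fun z => θ z • u.2 z + u.1 z • gradient θ z) :
    |⟪Φ.2, x.2⟫ - lam * ⟪Φ.1, x.1⟫|
      ≤ G * (‖mulL2 (one B) u.1‖ * ‖x.2‖ + ‖mulL2 (one B) u.2‖ * ‖x.1‖) := by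
  set a := pullS h R c x.1 with ha
  set b := pullV h R c x.2 with hb
  have hna : ‖a‖ = ‖x.1‖ := norm_pull h0 _
  have hnb : ‖b‖ = ‖x.2‖ := norm_pull h0 _
  -- `X` and `Y` are the commutator terms of the transplanted eigenvector and of the localized test
  -- vector.
  obtain ⟨X, hX, hpX⟩ : ∃ X : L2V F, (X =ᵐ[volume] fun z => u.1 z • gradient θ z) ∧
      pullV h R c Φ.2 = mulL2 θ u.2 + X := by
    refine ⟨pullV h R c Φ.2 - mulL2 θ u.2, ?_, by abel⟩
    filter_upwards [Lp.coeFn_sub (pullV h R c Φ.2) (mulL2 θ u.2), hp2,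
      mulL2_coe hθ hC u.2] with z e1 e2 e3
    rw [e1, Pi.sub_apply, e2, e3]; abel
  obtain ⟨Y, hY, hpY⟩ : ∃ Y : L2V F, (Y =ᵐ[volume] fun z => a z • gradient θ z) ∧
      y.2 = mulL2 θ b + Y := by
    refine ⟨y.2 - mulL2 θ b, ?_, by abel⟩
    filter_upwards [Lp.coeFn_sub y.2 (mulL2 θ b), hy2, mulL2_coe hθ hC b] with z e1 e2 e3
    rw [e1, Pi.sub_apply, e2, e3]; abel
  obtain ⟨hX1, -, -⟩ := norm_smul_gradient_le hG hBm hB hX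
  obtain ⟨-, hY1, hY2⟩ := norm_smul_gradient_le hG hBm hB hY
  have e1 : ⟪Φ.2, x.2⟫ = ⟪u.2, mulL2 θ b⟫ + ⟪X, b⟫ := by
    rw [← inner_pull (R := R) (c := c) (A := R.symm) h0 Φ.2 x.2]
    change ⟪pullV h R c Φ.2, b⟫ = _
    rw [hpX, inner_add_left, inner_mulL2 hθ hC]
  -- Test the eigenvalue equation of `u` with the localized vector `y`.
  have e2 : lam * ⟪Φ.1, x.1⟫ = ⟪u.2, mulL2 θ b⟫ + ⟪mulL2 (one B) u.2, Y⟫ := by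
    rw [inner_transplanted h0 hθ hC hy1 hp1, ← hu.eq y hy, hpY, inner_add_right,
      inner_mulL2 (measurable_one hBm) (abs_one_le B), hY2]
  rw [e1, e2, add_sub_add_left_eq_sub]
  have h1 : |⟪X, b⟫| ≤ G * ‖mulL2 (one B) u.1‖ * ‖x.2‖ := by
    rw [← hnb]
    exact (abs_real_inner_le_norm _ _).trans (mul_le_mul_of_nonneg_right hX1 (norm_nonneg _))
  have h2 : |⟪mulL2 (one B) u.2, Y⟫| ≤ ‖mulL2 (one B) u.2‖ * (G * ‖x.1‖) := by
    rw [← hna]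
    exact (abs_real_inner_le_norm _ _).trans (mul_le_mul_of_nonneg_left hY1 (norm_nonneg _))
  refine (abs_sub _ _).trans ?_
  linarith

/-- Transplantation nearly preserves inner products of functions which are small on `B`. -/
lemma inner_transplanted_sub_le {u' Φ' : L2 F × L2V F} (h0 : 0 < h) (hθ : Measurable θ)
    (h01 : ∀ x, θ x ∈ Set.Icc (0 : ℝ) 1) (hBm : MeasurableSet B) (hB : ∀ z ∉ B, θ z = 1)
    (hp1 : pullS h R c Φ.1 =ᵐ[volume] fun z => θ z * u.1 z)
    (hp1' : pullS h R c Φ'.1 =ᵐ[volume] fun z => θ z * u'.1 z) :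
    |⟪Φ.1, Φ'.1⟫ - ⟪u.1, u'.1⟫| ≤ ‖mulL2 (one B) u.1‖ * ‖mulL2 (one B) u'.1‖ := by
  have hC : ∀ x, |θ x| ≤ 1 := fun x => abs_le.2 ⟨by linarith [(h01 x).1], (h01 x).2⟩
  obtain ⟨X, hX, hXu⟩ : ∃ X : L2 F, (X =ᵐ[volume] fun z => (1 - θ z ^ 2) • u.1 z) ∧
      mulL2 θ (mulL2 θ u.1) = u.1 - X := by
    refine ⟨u.1 - mulL2 θ (mulL2 θ u.1), ?_, by abel⟩
    filter_upwards [Lp.coeFn_sub u.1 (mulL2 θ (mulL2 θ u.1)), mulL2_coe hθ hC u.1,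
      mulL2_coe hθ hC (mulL2 θ u.1)] with z e1 e2 e3
    rw [e1, Pi.sub_apply, e3, e2]
    simp only [smul_eq_mul]; ring
  have hX1 : mulL2 (one B) X = X := by
    refine (eq_mulL2_of_ae (measurable_one hBm) (abs_one_le B) ?_).symm
    filter_upwards [hX] with z e1
    by_cases hz : z ∈ B
    · rw [one_of_mem hz, one_smul]
    · rw [e1, hB z hz]; simp
  have hX2 : ‖X‖ ≤ 1 * ‖mulL2 (one B) u.1‖ := by
    refine norm_le_of_ae ?_
    filter_upwards [hX, mulL2_one_coe hBm u.1] with z e1 e2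
    rw [e1, e2, one_mul]
    by_cases hz : z ∈ B
    · rw [one_of_mem hz, one_smul, norm_smul, Real.norm_eq_abs, abs_of_nonneg]
      · exact mul_le_of_le_one_left (norm_nonneg _) (by nlinarith [sq_nonneg (θ z)])
      · nlinarith [(h01 z).1, (h01 z).2]
    · rw [hB z hz, one_pow, sub_self, zero_smul, norm_zero]
      exact norm_nonneg _
  have e1 : ⟪Φ.1, Φ'.1⟫ = ⟪u.1, u'.1⟫ - ⟪X, mulL2 (one B) u'.1⟫ := by
    rw [← inner_pull (R := R) (c := c) (A := LinearIsometryEquiv.refl ℝ ℝ) h0 Φ.1 Φ'.1,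
      eq_mulL2_of_ae hθ hC (f := pull h R c (LinearIsometryEquiv.refl ℝ ℝ) Φ.1) hp1,
      eq_mulL2_of_ae hθ hC (f := pull h R c (LinearIsometryEquiv.refl ℝ ℝ) Φ'.1) hp1',
      ← inner_mulL2 hθ hC, hXu, inner_sub_left,
      ← inner_mulL2 (measurable_one hBm) (abs_one_le B), hX1]
  rw [e1, sub_sub_cancel_left, abs_neg]
  refine (abs_real_inner_le_norm _ _).trans ?_
  rw [one_mul] at hX2
  exact mul_le_mul_of_nonneg_right hX2 (norm_nonneg _)

lemma norm_localized_fst (h0 : 0 < h) (hθ : Measurable θ) (hC : ∀ x, |θ x| ≤ C)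
    (hθ' : Measurable θ') (hC' : ∀ x, |θ' x| ≤ C) (hθθ : ∀ x, θ' (c + h • R x) = θ x)
    (hy1 : y.1 =ᵐ[volume] fun z => θ z * pullS h R c x.1 z) : ‖y.1‖ = ‖mulL2 θ' x.1‖ := by
  rw [eq_mulL2_of_ae hθ hC hy1, ← pull_mulL2 h0 _ hθ hC hθ' hC' hθθ, norm_pull h0]

/-- The energy of a localized function. The parameter `t` of Young's inequality separates the
product `θ ∇x` from the commutator `x ∇θ`, at the expense of a factor `1 + t⁻¹` on the latter. -/
lemma norm_localized_snd_le (h0 : 0 < h) (hθ : Measurable θ) (hC : ∀ x, |θ x| ≤ C)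
    (hθ' : Measurable θ') (hC' : ∀ x, |θ' x| ≤ C) (hθθ : ∀ x, θ' (c + h • R x) = θ x)
    (hG : ∀ z, ‖gradient θ z‖ ≤ G) {t : ℝ} (ht : 0 < t)
    (hy2 : y.2 =ᵐ[volume] fun z =>
      θ z • pullV h R c x.2 z + pullS h R c x.1 z • gradient θ z) :
    ‖y.2‖ ^ 2 ≤ (1 + t) * ‖mulL2 θ' x.2‖ ^ 2 + (1 + t⁻¹) * G ^ 2 * ‖x.1‖ ^ 2 := by
  rw [← norm_pull (R := R) (c := c) (A := R.symm) h0 (mulL2 θ' x.2),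
    pull_mulL2 h0 _ hθ hC hθ' hC' hθθ,
    ← norm_pull (R := R) (c := c) (A := LinearIsometryEquiv.refl ℝ ℝ) h0 x.1]
  refine norm_sq_le_of_ae ?_
  filter_upwards [hy2, mulL2_coe hθ hC (pull h R c R.symm x.2)] with z e1 e2
  rw [e1, e2]
  have h1 : ‖pullS h R c x.1 z • gradient θ z‖ ≤ G * ‖pullS h R c x.1 z‖ := by
    rw [norm_smul, mul_comm]
    exact mul_le_mul_of_nonneg_right (hG z) (norm_nonneg _)
  have h2 := (norm_add_le (θ z • pullV h R c x.2 z) (pullS h R c x.1 z • gradient θ z)).trans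
    (add_le_add_right h1 _)
  have h3 := pow_le_pow_left₀ (norm_nonneg _) h2 2
  set p := ‖θ z • pullV h R c x.2 z‖
  set q := G * ‖pullS h R c x.1 z‖ with hq
  refine h3.trans ?_
  have h4 : 2 * p * q ≤ t * p ^ 2 + t⁻¹ * q ^ 2 := by
    have h5 : 0 ≤ t⁻¹ * (t * p - q) ^ 2 := by positivity
    have h6 : t⁻¹ * (t * p - q) ^ 2 = t * p ^ 2 - 2 * p * q + t⁻¹ * q ^ 2 := by
      field_simp; ring
    linarith
  have h7 : (1 + t⁻¹) * G ^ 2 * ‖pullS h R c x.1 z‖ ^ 2 = (1 + t⁻¹) * q ^ 2 := by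
    rw [hq]; ring
  change _ ≤ (1 + t) * p ^ 2 + (1 + t⁻¹) * G ^ 2 * ‖pullS h R c x.1 z‖ ^ 2
  rw [h7]
  linarith

end Commutator

/-! ### The ends of the thin cylinder -/

section Ends

variable {d : ℕ}

/-- The isometry `(η, ζ) ↦ (η, ∓ζ)`. -/
def flip (s : Side) : Space d ≃ₗᵢ[ℝ] Space d :=
  LinearIsometryEquiv.withLpProdCongr 2 (LinearIsometryEquiv.refl ℝ (EuclideanSpace ℝ (Fin d)))
    (match s with
      | Side.plus => LinearIsometryEquiv.neg ℝ
      | Side.minus => LinearIsometryEquiv.refl ℝ ℝ)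

lemma flip_apply (s : Side) (x : Space d) : flip s x = pt x.fst (-s.sgn * x.snd) := by
  cases s
  · change pt x.fst (-x.snd) = pt x.fst (-1 * x.snd)
    rw [neg_one_mul]
  · change pt x.fst x.snd = pt x.fst (- -1 * x.snd)
    rw [neg_neg, one_mul]

lemma flip_symm_apply (s : Side) (x : Space d) : (flip s).symm x = pt x.fst (-s.sgn * x.snd) := by
  rw [LinearIsometryEquiv.symm_apply_eq, flip_apply]
  change x = pt x.fst (-s.sgn * (-s.sgn * x.snd))
  rw [← mul_assoc, neg_mul_neg, s.sgn_mul_self, one_mul]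
  rfl

/-- The change of variables from the semi-infinite cylinder to the end of the thin cylinder. -/
lemma endMap_apply (s : Side) (h : ℝ) (ξ : Space d) :
    pt 0 s.sgn + h • flip s ξ = pt (h • ξ.fst) (s.sgn * (1 - h * ξ.snd)) := by
  rw [flip_apply, ← WithLp.toLp_smul, ← WithLp.toLp_add]
  congr 1
  refine Prod.ext ?_ ?_
  · simp
  · simp only [Prod.snd_add, Prod.smul_snd, smul_eq_mul]; ring

lemma endMap_symm_apply (s : Side) (h : ℝ) (x : Space d) :
    (flip s).symm (h⁻¹ • (x - pt 0 s.sgn)) = pt (h⁻¹ • x.fst) (h⁻¹ * (1 - s.sgn * x.snd)) := by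
  rw [flip_symm_apply]
  refine congrArg (WithLp.toLp 2) (Prod.ext ?_ ?_)
  · simp
  · simp only [WithLp.smul_snd, WithLp.sub_snd, smul_eq_mul]
    have e : (pt (0 : EuclideanSpace ℝ (Fin d)) s.sgn).snd = s.sgn := rfl
    rw [e]
    linear_combination h⁻¹ * s.sgn_mul_self

variable {ω : Set (EuclideanSpace ℝ (Fin d))} {H : Side → EuclideanSpace ℝ (Fin d) → ℝ}

lemma Side.eq_or_sgn (s t : Side) : s = t ∨ s.sgn = -t.sgn := by
  cases s <;> cases t <;> simp [Side.sgn]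

lemma one_add_pos {R₀ h : ℝ} (hR : ∀ s, ∀ η ∈ closure ω, |H s η| ≤ R₀) (h0 : 0 < h)
    (hhR : h * R₀ ≤ 1 / 3) (s : Side) {η : EuclideanSpace ℝ (Fin d)} (hη : η ∈ closure ω) :
    2 / 3 ≤ 1 + h * H s η := by
  have := (abs_le.1 (hR s η hη)).1
  nlinarith

/-- Below the height `2 / (3 h)`, beyond which the cut-off vanishes, the similarity maps the
semi-infinite cylinder to the thin one: since `h R₀ ≤ 1 / 3`, the condition at the opposite end is
void. -/
lemma endMap_mem_iff {R₀ h : ℝ} (hR : ∀ s, ∀ η ∈ closure ω, |H s η| ≤ R₀) (h0 : 0 < h)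
    (hhR : h * R₀ ≤ 1 / 3) (s : Side) {ξ : Space d} (hξ : h * ξ.snd ≤ 2 / 3) :
    ξ ∈ semiCyl ω (H s) ↔ pt 0 s.sgn + h • flip s ξ ∈ thinCyl ω H h := by
  rw [endMap_apply]
  have e : h⁻¹ • (h • ξ.fst) = ξ.fst := inv_smul_smul₀ h0.ne' _
  constructor
  · rintro ⟨h1, h2⟩
    refine ⟨by change h⁻¹ • (h • ξ.fst) ∈ ω; rwa [e], fun t => ?_⟩
    change t.sgn * (s.sgn * (1 - h * ξ.snd)) < 1 + h * H t (h⁻¹ • (h • ξ.fst))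
    rw [e]
    rcases t.eq_or_sgn s with rfl | ht
    · rw [← mul_assoc, t.sgn_mul_self]; nlinarith
    · rw [ht, ← mul_assoc, neg_mul, s.sgn_mul_self]
      have := one_add_pos hR h0 hhR t (subset_closure h1)
      linarith
  · rintro ⟨h1, h2⟩
    change h⁻¹ • (h • ξ.fst) ∈ ω at h1
    have h3 := h2 s
    change s.sgn * (s.sgn * (1 - h * ξ.snd)) < 1 + h * H s (h⁻¹ • (h • ξ.fst)) at h3
    rw [e] at h1 h3
    rw [← mul_assoc, s.sgn_mul_self] at h3
    refine ⟨h1, ?_⟩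
    by_contra! hc
    nlinarith

/-- The lateral surfaces correspond to each other in the same range as in `endMap_mem_iff`. -/
lemma endMap_mem_closure_iff {R₀ h : ℝ} (hω : IsOpen ω) (hH : ∀ s, ContinuousOn (H s) (closure ω))
    (hR : ∀ s, ∀ η ∈ closure ω, |H s η| ≤ R₀) (h0 : 0 < h)
    (hhR : h * R₀ ≤ 1 / 3) (s : Side) {ξ : Space d} (hξ : h * ξ.snd ≤ 2 / 3) :
    ξ ∈ closure (semiLat ω (H s)) ↔ pt 0 s.sgn + h • flip s ξ ∈ closure (thinLat ω H h) := by
  have hpos : ∀ s, ∀ η ∈ closure ω, 0 < 1 + h * H s η := fun s η hη => by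
    have := one_add_pos hR h0 hhR s hη
    linarith
  rw [mem_closure_semiLat hω (hH s), mem_closure_thinLat hω h0.ne' hH hpos, endMap_apply]
  have e : h⁻¹ • (h • ξ.fst) = ξ.fst := inv_smul_smul₀ h0.ne' _
  change _ ↔ h⁻¹ • (h • ξ.fst) ∈ frontier ω ∧ ∀ t : Side,
    t.sgn * (s.sgn * (1 - h * ξ.snd)) ≤ 1 + h * H t (h⁻¹ • (h • ξ.fst))
  rw [e]
  constructor
  · rintro ⟨h1, h2⟩
    refine ⟨h1, fun t => ?_⟩
    rcases t.eq_or_sgn s with rfl | ht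
    · rw [← mul_assoc, t.sgn_mul_self]; nlinarith
    · rw [ht, ← mul_assoc, neg_mul, s.sgn_mul_self]
      have := one_add_pos hR h0 hhR t h1.1
      linarith
  · rintro ⟨h1, h2⟩
    have h3 := h2 s
    rw [← mul_assoc, s.sgn_mul_self] at h3
    refine ⟨h1, ?_⟩
    by_contra! hc
    nlinarith

end Ends

section Cut

variable {d : ℕ} {χ : ℝ → ℝ}

lemma IsCutoff.abs_le_one (hχ : IsCutoff χ) (t : ℝ) : |χ t| ≤ 1 :=
  abs_le.2 ⟨by linarith [hχ.nonneg t], hχ.le_one t⟩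

lemma IsCutoff.deriv_eq_zero (hχ : IsCutoff χ) {t : ℝ} (ht : t ≤ 1 / 3 ∨ 2 / 3 ≤ t) :
    deriv χ t = 0 := by
  rcases ht with ht | ht
  · refine IsLocalMax.deriv_eq_zero (Eventually.of_forall fun x => ?_)
    rw [hχ.eq_one t ht]; exact hχ.le_one x
  · refine IsLocalMin.deriv_eq_zero (Eventually.of_forall fun x => ?_)
    rw [hχ.eq_zero t ht]; exact hχ.nonneg x

lemma IsCutoff.exists_bound (hχ : IsCutoff χ) : ∃ C, 0 ≤ C ∧ ∀ t, |deriv χ t| ≤ C := by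
  obtain ⟨C, hC⟩ := (isCompact_Icc (a := (1 / 3 : ℝ)) (b := 2 / 3)).exists_bound_of_continuousOn
    (hχ.smooth.continuous_deriv (by simp)).continuousOn
  refine ⟨max C 0, le_max_right _ _, fun t => ?_⟩
  by_cases ht : t ∈ Set.Icc (1 / 3 : ℝ) (2 / 3)
  · exact (hC t ht).trans (le_max_left _ _)
  · rw [hχ.deriv_eq_zero, abs_zero]
    · exact le_max_right _ _
    · by_contra! h
      exact ht ⟨h.1.le, h.2.le⟩

lemma contDiff_cut (hχ : IsCutoff χ) (h : ℝ) :
    ContDiff ℝ (⊤ : ℕ∞) fun ξ : Space d => χ (h * ξ.snd) :=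
  hχ.smooth.comp (contDiff_const.mul contDiff_snd')

lemma gradient_cut (hχ : IsCutoff χ) (h : ℝ) (ξ : Space d) :
    gradient (fun ξ : Space d => χ (h * ξ.snd)) ξ = pt 0 (deriv χ (h * ξ.snd) * h) := by
  refine gradient_comp_snd (f := fun z => χ (h * z)) ?_
  have h1 : HasDerivAt (fun z : ℝ => h * z) h ξ.snd := by
    simpa using (hasDerivAt_id ξ.snd).const_mul h
  exact ((hχ.smooth.differentiable (by simp)) _).hasDerivAt.comp ξ.snd h1

lemma norm_gradient_cut_le (hχ : IsCutoff χ) {h C : ℝ} (h0 : 0 < h) (hC : ∀ t, |deriv χ t| ≤ C)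
    (ξ : Space d) : ‖gradient (fun ξ : Space d => χ (h * ξ.snd)) ξ‖ ≤ h * C := by
  rw [gradient_cut hχ, norm_pt_zero, abs_mul, abs_of_pos h0, mul_comm]
  exact mul_le_mul_of_nonneg_left (hC _) h0.le

lemma gradient_cut_eq_zero (hχ : IsCutoff χ) {h : ℝ} (h0 : 0 < h) {ξ : Space d}
    (hξ : ξ ∉ {ξ : Space d | ξ.snd ∈ Set.Ioi (1 / (3 * h))}) :
    gradient (fun ξ : Space d => χ (h * ξ.snd)) ξ = 0 ∧ χ (h * ξ.snd) = 1 := by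
  have h1 : ξ.snd ≤ 1 / (3 * h) := not_lt.1 hξ
  have h2 : h * ξ.snd ≤ 1 / 3 := by
    have := mul_le_mul_of_nonneg_left h1 h0.le
    have e : h * (1 / (3 * h)) = 1 / 3 := by field_simp
    linarith
  refine ⟨?_, hχ.eq_one _ h2⟩
  rw [gradient_cut hχ, hχ.deriv_eq_zero (Or.inl h2), zero_mul]
  rfl

lemma le_of_mem_tsupport_cut (hχ : IsCutoff χ) {h : ℝ} {ξ : Space d}
    (hξ : ξ ∈ tsupport fun ξ : Space d => χ (h * ξ.snd)) : h * ξ.snd ≤ 2 / 3 := by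
  have hcl : IsClosed {ξ : Space d | h * ξ.snd ≤ 2 / 3} :=
    isClosed_le (continuous_const.mul continuous_snd') continuous_const
  have hsub : Function.support (fun ξ : Space d => χ (h * ξ.snd))
      ⊆ {ξ : Space d | h * ξ.snd ≤ 2 / 3} := fun z hz => by
    by_contra hc
    exact hz (hχ.eq_zero _ (not_le.1 hc).le)
  exact closure_minimal hsub hcl hξ

end Cut

section Thin

variable {d : ℕ} {χ : ℝ → ℝ} {ω : Set (EuclideanSpace ℝ (Fin d))}
  {H : Side → EuclideanSpace ℝ (Fin d) → ℝ} {R₀ h C : ℝ}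

/-- A function on the thin cylinder, cut off near an end and stretched to the semi-infinite
cylinder. -/
lemma exists_localized_end (hχ : IsCutoff χ) (hC : ∀ t, |deriv χ t| ≤ C) (hω : IsOpen ω)
    (hH : ∀ s, ContinuousOn (H s) (closure ω)) (hR : ∀ s, ∀ η ∈ closure ω, |H s η| ≤ R₀)
    (h0 : 0 < h) (hhR : h * R₀ ≤ 1 / 3) (s : Side) {x : L2 (Space d) × L2V (Space d)}
    (hx : x ∈ formDomain h (thinCyl ω H h) (thinLat ω H h)) :
    ∃ y ∈ formDomain 1 (semiCyl ω (H s)) (semiLat ω (H s)),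
      (y.1 =ᵐ[volume] fun z => χ (h * z.snd) * pullS h (flip s) (pt 0 s.sgn) x.1 z) ∧
      (y.2 =ᵐ[volume] fun z => χ (h * z.snd) • pullV h (flip s) (pt 0 s.sgn) x.2 z
        + pullS h (flip s) (pt 0 s.sgn) x.1 z • gradient (fun z : Space d => χ (h * z.snd)) z) :=
  exists_localized h0 (contDiff_cut hχ h) (C := max 1 (h * C))
    (fun _ => (hχ.abs_le_one _).trans (le_max_left _ _))
    (fun z => (norm_gradient_cut_le hχ h0 hC z).trans (le_max_right _ _))
    (fun _ hz => endMap_mem_iff hR h0 hhR s (le_of_mem_tsupport_cut hχ hz))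
    (fun _ hz => endMap_mem_closure_iff hω hH hR h0 hhR s (le_of_mem_tsupport_cut hχ hz)) hx

/-- A function on the semi-infinite cylinder, cut off and shrunk to an end of the thin cylinder. -/
lemma exists_transplanted_end (hχ : IsCutoff χ) (hC : ∀ t, |deriv χ t| ≤ C) (hω : IsOpen ω)
    (hH : ∀ s, ContinuousOn (H s) (closure ω)) (hR : ∀ s, ∀ η ∈ closure ω, |H s η| ≤ R₀)
    (h0 : 0 < h) (hhR : h * R₀ ≤ 1 / 3) (s : Side) {u : L2 (Space d) × L2V (Space d)}
    (hu : u ∈ formDomain 1 (semiCyl ω (H s)) (semiLat ω (H s))) :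
    ∃ y ∈ formDomain h (thinCyl ω H h) (thinLat ω H h),
      (pullS h (flip s) (pt 0 s.sgn) y.1 =ᵐ[volume] fun z => χ (h * z.snd) * u.1 z) ∧
      (pullV h (flip s) (pt 0 s.sgn) y.2 =ᵐ[volume] fun z => χ (h * z.snd) • u.2 z
        + u.1 z • gradient (fun z : Space d => χ (h * z.snd)) z) ∧
      (y.1 =ᵐ[volume] fun x => (pullFactor (Space d) h)⁻¹ * (χ (1 - s.sgn * x.snd) *
        u.1 (pt (h⁻¹ • x.fst) (h⁻¹ * (1 - s.sgn * x.snd))))) := by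
  obtain ⟨y, hy, h1, h2, h3⟩ := exists_transplanted h0 (contDiff_cut hχ h) (C := max 1 (h * C))
    (fun _ => (hχ.abs_le_one _).trans (le_max_left _ _))
    (fun z => (norm_gradient_cut_le hχ h0 hC z).trans (le_max_right _ _))
    (fun _ hz => endMap_mem_iff hR h0 hhR s (le_of_mem_tsupport_cut hχ hz))
    (fun _ hz => endMap_mem_closure_iff hω hH hR h0 hhR s (le_of_mem_tsupport_cut hχ hz)) hu
  refine ⟨y, hy, h1, h2, h3.trans (Eventually.of_forall fun x => ?_)⟩
  simp only [endMap_symm_apply]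
  have e : h * (h⁻¹ * (1 - s.sgn * x.snd)) = 1 - s.sgn * x.snd := mul_inv_cancel_left₀ h0.ne' _
  change (pullFactor (Space d) h)⁻¹ * (χ (h * (h⁻¹ * (1 - s.sgn * x.snd))) * _) = _
  rw [e]

lemma finrank_space : Module.finrank ℝ (Space d) = d + 1 := by
  rw [(WithLp.linearEquiv 2 ℝ (EuclideanSpace ℝ (Fin d) × ℝ)).finrank_eq, Module.finrank_prod]
  simp

lemma inv_pullFactor (h0 : 0 < h) :
    (pullFactor (Space d) h)⁻¹ = h ^ (-(d : ℝ) / 2) * h ^ (-(1 / 2) : ℝ) := by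
  rw [pullFactor, finrank_space, Real.sqrt_eq_rpow, ← Real.rpow_natCast, ← Real.rpow_mul h0.le,
    ← Real.rpow_neg h0.le, ← Real.rpow_add h0]
  congr 1
  push_cast
  ring

/-- The transplanted eigenfunction is the cut-off mode of the limit problem. -/
lemma transplanted_eq_cutMode (hχ : IsCutoff χ) (hω : IsOpen ω)
    (hH : ∀ s, ContinuousOn (H s) (closure ω)) (hR : ∀ s, ∀ η ∈ closure ω, |H s η| ≤ R₀)
    (h0 : 0 < h) (hhR : h * R₀ ≤ 1 / 3) (s : Side) {u : L2 (Space d)} {U : Space d → ℝ}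
    (hu : u =ᵐ[volume] (semiCyl ω (H s)).indicator U) {y : L2 (Space d)}
    (hy : y =ᵐ[volume] fun x => (pullFactor (Space d) h)⁻¹ * (χ (1 - s.sgn * x.snd) *
        u (pt (h⁻¹ • x.fst) (h⁻¹ * (1 - s.sgn * x.snd))))) :
    y =ᵐ[volume.restrict (thinCyl ω H h)] fun x => h ^ (-(d : ℝ) / 2) * cutMode χ h s U x := by
  have hinv : ∀ x : Space d, -(h⁻¹ • (flip s).symm (pt 0 s.sgn)) + h⁻¹ • (flip s).symm x
      = pt (h⁻¹ • x.fst) (h⁻¹ * (1 - s.sgn * x.snd)) := fun x => by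
    rw [← endMap_symm_apply, map_smul, map_sub, smul_sub]; abel
  have h1 := comp_ae_eq (inv_pos.2 h0) (flip s).symm (-(h⁻¹ • (flip s).symm (pt 0 s.sgn))) hu
  simp only [hinv] at h1
  refine (ae_restrict_iff' (isOpen_thinCyl hω h0.ne' hH).measurableSet).2 ?_
  filter_upwards [hy, h1] with x e1 e2 hx
  rw [e1, e2, inv_pullFactor h0, cutMode]
  by_cases hχ0 : χ (1 - s.sgn * x.snd) = 0
  · rw [hχ0]; simp
  have hle : 1 - s.sgn * x.snd ≤ 2 / 3 := by
    by_contra! hc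
    exact hχ0 (hχ.eq_zero _ hc.le)
  set ξ : Space d := pt (h⁻¹ • x.fst) (h⁻¹ * (1 - s.sgn * x.snd)) with hξ
  have hξx : pt 0 s.sgn + h • flip s ξ = x := by
    rw [hξ, ← endMap_symm_apply, LinearIsometryEquiv.apply_symm_apply, smul_inv_smul₀ h0.ne']
    abel
  have hmem : ξ ∈ semiCyl ω (H s) := by
    rw [endMap_mem_iff hR h0 hhR s, hξx]
    · exact hx
    · change h * (h⁻¹ * (1 - s.sgn * x.snd)) ≤ 2 / 3
      rwa [mul_inv_cancel_left₀ h0.ne']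
  rw [Set.indicator_of_mem hmem]
  ring

end Thin

/-! ### The spectral gap of the thin cylinder -/

section Partition

variable {χ : ℝ → ℝ}

lemma IsCutoff.eq_zero_or (hχ : IsCutoff χ) (z : ℝ) : χ (1 - z) = 0 ∨ χ (1 + z) = 0 := by
  rcases le_total 0 z with h | h
  · exact Or.inr (hχ.eq_zero _ (by linarith))
  · exact Or.inl (hχ.eq_zero _ (by linarith))

/-- The square root of what the cut-offs at the two ends leave of a partition of unity. -/
def midCut (χ : ℝ → ℝ) (z : ℝ) : ℝ := Real.sqrt (1 - χ (1 - z) ^ 2 - χ (1 + z) ^ 2)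

lemma midCut_sq (hχ : IsCutoff χ) (z : ℝ) :
    midCut χ z ^ 2 = 1 - χ (1 - z) ^ 2 - χ (1 + z) ^ 2 := by
  refine Real.sq_sqrt ?_
  have h1 : χ (1 - z) ^ 2 ≤ 1 := (sq_le_one_iff_abs_le_one _).2 (hχ.abs_le_one _)
  have h2 : χ (1 + z) ^ 2 ≤ 1 := (sq_le_one_iff_abs_le_one _).2 (hχ.abs_le_one _)
  rcases hχ.eq_zero_or z with h | h <;> rw [h] <;> linarith

lemma abs_midCut_le (hχ : IsCutoff χ) (z : ℝ) : |midCut χ z| ≤ 1 := by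
  rw [← sq_le_one_iff_abs_le_one, midCut_sq hχ]
  linarith [sq_nonneg (χ (1 - z)), sq_nonneg (χ (1 + z))]

lemma measurable_midCut (hχ : IsCutoff χ) : Measurable (midCut χ) := by
  have h1 := hχ.smooth.continuous
  have : Continuous (midCut χ) := by unfold midCut; fun_prop
  exact this.measurable

lemma midCut_eq_zero (hχ : IsCutoff χ) {z : ℝ} (hz : 2 / 3 ≤ |z|) : midCut χ z = 0 := by
  refine pow_eq_zero_iff (two_ne_zero) |>.1 ?_
  rw [midCut_sq hχ]
  rcases abs_cases z with ⟨e, -⟩ | ⟨e, -⟩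
  · rw [hχ.eq_one (1 - z) (by linarith), hχ.eq_zero (1 + z) (by linarith)]; norm_num
  · rw [hχ.eq_zero (1 - z) (by linarith), hχ.eq_one (1 + z) (by linarith)]; norm_num

variable {d : ℕ} {V : Type*} [NormedAddCommGroup V] [InnerProductSpace ℝ V]

lemma measurable_endCut (hχ : IsCutoff χ) (s : Side) :
    Measurable fun x : Space d => χ (1 - s.sgn * x.snd) :=
  (hχ.smooth.continuous.comp
    (continuous_const.sub (continuous_const.mul continuous_snd'))).measurable

/-- The squares of the two end cut-offs and of `midCut` form a partition of unity. -/
lemma norm_sq_partition (hχ : IsCutoff χ) (f : Lp V 2 (volume : Measure (Space d))) :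
    ‖f‖ ^ 2 = ‖mulL2 (fun x : Space d => midCut χ x.snd) f‖ ^ 2
      + ∑ s : Side, ‖mulL2 (fun x : Space d => χ (1 - s.sgn * x.snd)) f‖ ^ 2 := by
  have hm : Measurable fun x : Space d => midCut χ x.snd :=
    (measurable_midCut hχ).comp measurable_snd'
  have hmC : ∀ x : Space d, |midCut χ x.snd| ≤ 1 := fun x => abs_midCut_le hχ _
  have hs := fun s => measurable_endCut (d := d) hχ s
  have hsC : ∀ (s : Side) (x : Space d), |χ (1 - s.sgn * x.snd)| ≤ 1 := fun s x =>
    hχ.abs_le_one _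
  have hf : f = mulL2 (fun x : Space d => midCut χ x.snd)
        (mulL2 (fun x : Space d => midCut χ x.snd) f)
      + (mulL2 (fun x : Space d => χ (1 - Side.plus.sgn * x.snd))
          (mulL2 (fun x : Space d => χ (1 - Side.plus.sgn * x.snd)) f)
        + mulL2 (fun x : Space d => χ (1 - Side.minus.sgn * x.snd))
          (mulL2 (fun x : Space d => χ (1 - Side.minus.sgn * x.snd)) f)) := by
    refine Lp.ext ?_
    refine EventuallyEq.symm ((Lp.coeFn_add _ _).trans ?_)
    filter_upwards [Lp.coeFn_add (mulL2 (fun x : Space d => χ (1 - Side.plus.sgn * x.snd))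
          (mulL2 (fun x : Space d => χ (1 - Side.plus.sgn * x.snd)) f))
        (mulL2 (fun x : Space d => χ (1 - Side.minus.sgn * x.snd))
          (mulL2 (fun x : Space d => χ (1 - Side.minus.sgn * x.snd)) f)),
      mulL2_coe hm hmC f, mulL2_coe hm hmC (mulL2 (fun x : Space d => midCut χ x.snd) f),
      mulL2_coe (hs .plus) (hsC .plus) f,
      mulL2_coe (hs .plus) (hsC .plus) (mulL2 (fun x : Space d => χ (1 - Side.plus.sgn * x.snd)) f),
      mulL2_coe (hs .minus) (hsC .minus) f,
      mulL2_coe (hs .minus) (hsC .minus)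
        (mulL2 (fun x : Space d => χ (1 - Side.minus.sgn * x.snd)) f)] with x a b b' c c' e e'
    rw [Pi.add_apply, a, Pi.add_apply, b', b, c', c, e', e, smul_smul, smul_smul, smul_smul,
      ← add_smul, ← add_smul]
    have h1 := midCut_sq hχ x.snd
    have e1 : Side.plus.sgn = 1 := rfl
    have e2 : Side.minus.sgn = -1 := rfl
    rw [e1, e2, one_mul, neg_one_mul, sub_neg_eq_add]
    have : midCut χ x.snd * midCut χ x.snd + (χ (1 - x.snd) * χ (1 - x.snd)
        + χ (1 + x.snd) * χ (1 + x.snd)) = 1 := by linear_combination h1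
    rw [this, one_smul]
  have hu : (Finset.univ : Finset Side) = {Side.plus, Side.minus} := by
    ext s; cases s <;> simp
  rw [hu, Finset.sum_pair (by simp)]
  have hn : ∀ {g : Space d → ℝ}, Measurable g → (∀ x, |g x| ≤ 1) →
      ⟪mulL2 g (mulL2 g f), f⟫ = ‖mulL2 g f‖ ^ 2 := fun hg hC => by
    rw [inner_mulL2 hg hC, real_inner_self_eq_norm_sq]
  have key := congrArg (fun a => ⟪a, f⟫) hf
  rw [inner_add_left, inner_add_left, hn hm hmC, hn (hs _) (hsC _), hn (hs _) (hsC _),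
    real_inner_self_eq_norm_sq] at key
  exact key

end Partition

section Gap

variable {d : ℕ} {χ : ℝ → ℝ} {ω : Set (EuclideanSpace ℝ (Fin d))}
  {H : Side → EuclideanSpace ℝ (Fin d) → ℝ} {R₀ h C : ℝ}

lemma endCut_endMap (s : Side) (z : Space d) :
    χ (1 - s.sgn * (pt 0 s.sgn + h • flip s z).snd) = χ (h * z.snd) := by
  rw [endMap_apply]
  change χ (1 - s.sgn * (s.sgn * (1 - h * z.snd))) = _
  rw [← mul_assoc, s.sgn_mul_self, one_mul, sub_sub_cancel]

/-- Young's inequality with the parameter `h` turns the commutator with the cut-off, of size `h G`,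
into a term of order `h` in the energy. -/
lemma localized_gap {M A P Q X Y G : ℝ} (h0 : 0 < h) (hg : M * P - A ≤ Q)
    (hQ : Q ≤ (1 + h) * Y + (1 + h⁻¹) * (h * G) ^ 2 * X) :
    M * P - A ≤ (1 + h) * Y + (1 + h) * h * G ^ 2 * X := by
  have e : (1 + h⁻¹) * (h * G) ^ 2 = (1 + h) * h * G ^ 2 := by field_simp; ring
  rw [e] at hQ
  exact hg.trans hQ

/-- Adding up the localized inequalities: `a` and `b` are the contributions of the middle part,
which satisfy the Poincaré inequality, and the losses of order `h` are absorbed by half of the gap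
`g`. -/
lemma gap_arith {L g mu a b S X Y C : ℝ} (h0 : 0 < h) (h1 : h ≤ 1) (hg : 0 < g)
    (hmu : L + g ≤ mu) (hS : 0 ≤ S) (ha : 0 ≤ a) (hX : 0 ≤ X) (hb : 0 ≤ b)
    (hC : h * (L + g + 4 * C ^ 2) ≤ g / 2)
    (hab : mu * a ≤ b) (h2 : (L + g) * (X - a) - S ≤ (1 + h) * (Y - b)
      + 2 * ((1 + h) * h * C ^ 2 * X)) :
    (L + g / 2) * X - S ≤ Y := by
  have k1 : (L + g) * a ≤ b := (mul_le_mul_of_nonneg_right hmu ha).trans hab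
  have k2 : (L + g) * X - S ≤ (1 + h) * Y + 2 * ((1 + h) * h * C ^ 2 * X) := by nlinarith
  have k3 : (1 + h) * (L + g / 2) + 2 * ((1 + h) * h * C ^ 2) ≤ L + g := by
    nlinarith [mul_nonneg h0.le (sq_nonneg C), mul_nonneg h0.le hg.le]
  have k4 := mul_le_mul_of_nonneg_right k3 hX
  have k5 : 0 ≤ h * S := by positivity
  refine le_of_mul_le_mul_left (a := 1 + h) ?_ (by linarith)
  linarith

/-- The spectral gap of the thin cylinder above the limit eigenvalue: localization to the two ends
and to the middle part reduces it to the gaps of the semi-infinite cylinders and to the Poincaré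
inequality on cross-sections. -/
lemma thin_gap (hχ : IsCutoff χ) (hC : ∀ t, |deriv χ t| ≤ C) (hω : IsOpen ω)
    (hb : Bornology.IsBounded ω)
    (hH : ∀ s, ContinuousOn (H s) (closure ω)) (hR : ∀ s, ∀ η ∈ closure ω, |H s η| ≤ R₀)
    {mu1 : ℝ} (hmu : IsFirstDirichletEigenvalue ω mu1) (h0 : 0 < h) (h1 : h ≤ 1)
    (hhR : h * R₀ ≤ 1 / 3) {L g D : ℝ} (hg : 0 < g) (hLg : L + g ≤ mu1)
    (hD : 0 ≤ D) (hhC : h * (L + g + 4 * C ^ 2) ≤ g / 2) {n : ℕ} {side : ℕ → Side}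
    {v Φ : ℕ → L2 (Space d) × L2V (Space d)}
    (hgap : ∀ s, ∀ x ∈ formDomain 1 (semiCyl ω (H s)) (semiLat ω (H s)),
      (L + g) * ‖x.1‖ ^ 2 - D * ∑ k : Fin n, (if side k = s then ⟪(v k).1, x.1⟫ ^ 2 else 0)
        ≤ ‖x.2‖ ^ 2)
    (hp1 : ∀ k < n, pullS h (flip (side k)) (pt 0 (side k).sgn) (Φ k).1
      =ᵐ[volume] fun z => χ (h * z.snd) * (v k).1 z)
    {x : L2 (Space d) × L2V (Space d)} (hx : x ∈ formDomain h (thinCyl ω H h) (thinLat ω H h)) :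
    (L + g / 2) * ‖x.1‖ ^ 2 - D * ∑ k : Fin n, ⟪(Φ k).1, x.1⟫ ^ 2 ≤ ‖x.2‖ ^ 2 := by
  have hθ : Measurable fun z : Space d => χ (h * z.snd) := (contDiff_cut hχ h).continuous.measurable
  have hθC : ∀ z : Space d, |χ (h * z.snd)| ≤ 1 := fun z => hχ.abs_le_one _
  choose y hy hy1 hy2 using fun s => exists_localized_end hχ hC hω hH hR h0 hhR s hx
  -- The gap of each semi-infinite cylinder, applied to the part of `x` localized at its end.
  have hloc : ∀ s : Side, (L + g) * ‖mulL2 (fun x : Space d => χ (1 - s.sgn * x.snd)) x.1‖ ^ 2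
      - D * ∑ k : Fin n, (if side k = s then ⟪(Φ k).1, x.1⟫ ^ 2 else 0)
      ≤ (1 + h) * ‖mulL2 (fun x : Space d => χ (1 - s.sgn * x.snd)) x.2‖ ^ 2
        + (1 + h) * h * C ^ 2 * ‖x.1‖ ^ 2 := fun s => by
    have e1 := norm_localized_fst (x := x) h0 hθ hθC (measurable_endCut hχ s)
      (fun x => hχ.abs_le_one _) (fun z => endCut_endMap s z) (hy1 s)
    have e2 := norm_localized_snd_le (x := x) h0 hθ hθC (measurable_endCut hχ s)
      (fun x => hχ.abs_le_one _) (fun z => endCut_endMap s z)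
      (fun z => norm_gradient_cut_le hχ h0 hC z) h0 (hy2 s)
    refine localized_gap h0 ?_ e2
    have e3 := hgap s _ (hy s)
    rw [e1] at e3
    refine le_trans (le_of_eq ?_) e3
    congr 2
    refine Finset.sum_congr rfl fun k _ => ?_
    by_cases hk : side k = s
    · rw [if_pos hk, if_pos hk]
      have hpk := hp1 k k.2
      rw [hk] at hpk
      rw [inner_transplanted h0 hθ hθC (hy1 s) hpk]
    · rw [if_neg hk, if_neg hk]
  have hsum := Finset.sum_le_sum fun (s : Side) (_ : s ∈ Finset.univ) => hloc s
  rw [Finset.sum_sub_distrib, ← Finset.mul_sum, ← Finset.mul_sum, Finset.sum_comm,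
    Finset.sum_add_distrib, ← Finset.mul_sum, Finset.sum_const] at hsum
  simp only [Finset.sum_ite_eq, Finset.mem_univ, if_true] at hsum
  have hcard : Finset.card (Finset.univ : Finset Side) = 2 := rfl
  rw [hcard, two_nsmul, ← two_mul] at hsum
  refine gap_arith (a := ‖mulL2 (fun x : Space d => midCut χ x.snd) x.1‖ ^ 2)
    (b := ‖mulL2 (fun x : Space d => midCut χ x.snd) x.2‖ ^ 2) (C := C) h0 h1 hg hLg
    (mul_nonneg hD (Finset.sum_nonneg fun _ _ => sq_nonneg _)) (sq_nonneg _) (sq_nonneg _)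
    (sq_nonneg _) hhC ?_ ?_
  · refine thin_poincare hω hb hH hR hmu h0 (by linarith) (measurable_midCut hχ)
      (abs_midCut_le hχ) (fun z hz => midCut_eq_zero hχ (by linarith)) x hx
  · rw [norm_sq_partition hχ x.2, add_sub_cancel_left]
    refine le_trans (le_of_eq ?_) hsum
    rw [norm_sq_partition hχ x.1, add_sub_cancel_left]

end Gap

/-! ### Quasimodes from trapped modes -/

section Quasimodes

variable {d : ℕ} {χ : ℝ → ℝ} {ω : Set (EuclideanSpace ℝ (Fin d))}
  {H : Side → EuclideanSpace ℝ (Fin d) → ℝ} {R₀ h C : ℝ}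

/-- Quasimodes attached to different ends have disjoint supports. -/
lemma inner_eq_zero_of_ends (hχ : IsCutoff χ) {a b : ℝ} {f g : Space d → ℝ} {s t : Side}
    (hst : s ≠ t) {y z : L2 (Space d)}
    (hy : y =ᵐ[volume] fun x => a * (χ (1 - s.sgn * x.snd) * f x))
    (hz : z =ᵐ[volume] fun x => b * (χ (1 - t.sgn * x.snd) * g x)) : ⟪y, z⟫ = 0 := by
  rw [L2.inner_def]
  refine integral_eq_zero_of_ae ?_
  filter_upwards [hy, hz] with x e1 e2
  rw [e1, e2]
  have hs : s.sgn = -t.sgn := (s.eq_or_sgn t).resolve_left hst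
  have h0 : χ (1 - s.sgn * x.snd) = 0 ∨ χ (1 - t.sgn * x.snd) = 0 := by
    rw [hs, neg_mul, sub_neg_eq_add]
    exact (hχ.eq_zero_or _).symm
  rcases h0 with h0 | h0 <;> rw [h0] <;> simp

lemma norm_le_of_sq_add_le {A B c : ℝ} (hc : 0 ≤ c)
    (h : A ^ 2 + B ^ 2 ≤ c ^ 2) : A ≤ c ∧ B ≤ c := by
  exact ⟨le_of_abs_le (abs_le_of_sq_le_sq (by nlinarith) hc),
    le_of_abs_le (abs_le_of_sq_le_sq (by nlinarith [sq_nonneg A]) hc)⟩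

/-- The list of limit eigenfunctions decays uniformly. -/
lemma exists_uniform_decay (hω : IsOpen ω) (hb : Bornology.IsBounded ω)
    (hH : ∀ s, ContinuousOn (H s) (closure ω)) (hR : ∀ s, ∀ η ∈ closure ω, |H s η| ≤ R₀)
    {mu1 : ℝ} (hmu : IsFirstDirichletEigenvalue ω mu1) {Lam : ℕ → ℝ} {side : ℕ → Side}
    {v : ℕ → L2 (Space d) × L2V (Space d)} {n : ℕ} {τ : ℝ} (hτ : 0 ≤ τ)
    (h0 : ∀ k < n, 0 ≤ Lam k) (hlt : ∀ k < n, Lam k + τ ^ 2 < mu1)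
    (hv : ∀ k < n, IsFormEig 1 (semiCyl ω (H (side k))) (semiLat ω (H (side k))) (Lam k) (v k)) :
    ∃ D, 0 ≤ D ∧ ∀ k < n, ∀ T : ℝ,
      ‖mulL2 (one {ξ : Space d | ξ.snd ∈ Set.Ioi T}) (v k).1‖ ≤ D * Real.exp (-(τ * T)) ∧
      ‖mulL2 (one {ξ : Space d | ξ.snd ∈ Set.Ioi T}) (v k).2‖ ≤ D * Real.exp (-(τ * T)) := by
  have h1 : ∀ k, ∃ C, 0 ≤ C ∧ (k < n → ∀ T : ℝ,
      ‖mulL2 (one {ξ : Space d | ξ.snd ∈ Set.Ioi T}) (v k).1‖ ^ 2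
        + ‖mulL2 (one {ξ : Space d | ξ.snd ∈ Set.Ioi T}) (v k).2‖ ^ 2
      ≤ (C * Real.exp (-(τ * T))) ^ 2) := fun k => by
    by_cases hk : k < n
    · obtain ⟨C, hC, h2⟩ := semi_decay hω hb (hH (side k)) (hR (side k)) hmu (h0 k hk) hτ
        (hlt k hk) (hv k hk)
      exact ⟨C, hC, fun _ => h2⟩
    · exact ⟨0, le_rfl, fun h => absurd h hk⟩
  choose D hD hdec using h1
  refine ⟨∑ k ∈ Finset.range n, D k, Finset.sum_nonneg fun k _ => hD k, fun k hk T => ?_⟩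
  have hle : D k ≤ ∑ k ∈ Finset.range n, D k :=
    Finset.single_le_sum (fun i _ => hD i) (Finset.mem_range.2 hk)
  have h3 := mul_le_mul_of_nonneg_right hle (Real.exp_pos (-(τ * T))).le
  obtain ⟨h4, h5⟩ := norm_le_of_sq_add_le
    (mul_nonneg (hD k) (Real.exp_pos _).le) (hdec k hk T)
  exact ⟨h4.trans h3, h5.trans h3⟩

lemma near_arith {A B D e : ℝ} (hB : 0 ≤ B) (hD : 0 ≤ D) (he : 0 ≤ e)
    (he1 : e ≤ 1) (h1 : A ≤ D * e) (h2 : B ≤ D * e) : A * B ≤ D ^ 2 * e := by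
  have h3 : A * B ≤ (D * e) * (D * e) := mul_le_mul h1 h2 hB (mul_nonneg hD he)
  have h4 : D ^ 2 * e * e ≤ D ^ 2 * e * 1 := mul_le_mul_of_nonneg_left he1 (by positivity)
  nlinarith

lemma residual_arith {A B D e X Y : ℝ} (h0 : 0 < h) (h1 : h ≤ 1) (hC : 0 ≤ C) (hX : 0 ≤ X)
    (hY : 0 ≤ Y) (hD : 0 ≤ D) (he : 0 ≤ e) (hA : A ≤ D * e) (hB : B ≤ D * e) :
    h * C * (A * Y + B * X) ≤ C * D * e * (X + Y) := by
  have h2 : A * Y + B * X ≤ D * e * (X + Y) := by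
    have := mul_le_mul_of_nonneg_right hA hY
    have := mul_le_mul_of_nonneg_right hB hX
    linarith
  have h3 : h * C ≤ C := by nlinarith
  calc h * C * (A * Y + B * X) ≤ h * C * (D * e * (X + Y)) :=
        mul_le_mul_of_nonneg_left h2 (by positivity)
    _ ≤ C * (D * e * (X + Y)) := mul_le_mul_of_nonneg_right h3 (by positivity)
    _ = _ := by ring

/-- The cut-off trapped modes are almost orthonormal and almost eigenfunctions, with an
exponentially small error. -/
lemma exists_quasimodes (hχ : IsCutoff χ) (hω : IsOpen ω) (hb : Bornology.IsBounded ω)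
    (hH : ∀ s, ContinuousOn (H s) (closure ω)) (hR : ∀ s, ∀ η ∈ closure ω, |H s η| ≤ R₀)
    {mu1 : ℝ} (hmu : IsFirstDirichletEigenvalue ω mu1) {δ : ℝ} {N : ℕ} {Lam : ℕ → ℝ}
    {side : ℕ → Side} {U : ℕ → Space d → ℝ} (hU : IsLimitEigenList ω H mu1 δ N Lam side U)
    {n : ℕ} (hn : n ≤ N) {τ : ℝ} (hτ : 0 ≤ τ) (hlt : ∀ k < n, Lam k + τ ^ 2 < mu1) :
    ∃ D, 0 ≤ D ∧ ∀ h : ℝ, 0 < h → h ≤ 1 → h * R₀ ≤ 1 / 3 →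
      ∃ Φ : ℕ → L2 (Space d) × L2V (Space d),
      (∀ k < n, Φ k ∈ formDomain h (thinCyl ω H h) (thinLat ω H h)) ∧
      (∀ k < n, pullS h (flip (side k)) (pt 0 (side k).sgn) (Φ k).1
        =ᵐ[volume] fun z => χ (h * z.snd) * (lift 1 (semiCyl ω (H (side k))) (U k)).1 z) ∧
      (∀ k < n, (Φ k).1 =ᵐ[volume.restrict (thinCyl ω H h)]
        fun x => h ^ (-(d : ℝ) / 2) * cutMode χ h (side k) (U k) x) ∧
      (∀ j < n, ∀ k < n, |⟪(Φ j).1, (Φ k).1⟫ - if j = k then (1 : ℝ) else 0|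
        ≤ D * Real.exp (-(τ / (3 * h)))) ∧
      (∀ k < n, ∀ x ∈ formDomain h (thinCyl ω H h) (thinLat ω H h),
        |⟪(Φ k).2, x.2⟫ - Lam k * ⟪(Φ k).1, x.1⟫|
          ≤ D * Real.exp (-(τ / (3 * h))) * (‖x.1‖ + ‖x.2‖)) := by
  obtain ⟨C, hC0, hC⟩ := hχ.exists_bound
  have hopen : ∀ s, IsOpen (semiCyl ω (H s)) := fun s => isOpen_semiCyl hω (hH s)
  let v : ℕ → L2 (Space d) × L2V (Space d) := fun k => lift 1 (semiCyl ω (H (side k))) (U k)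
  have hv : ∀ k < n, IsFormEig 1 (semiCyl ω (H (side k))) (semiLat ω (H (side k))) (Lam k) (v k) :=
    fun k hk => by
      have := isWeakEig_lift (hopen (side k)) (one_ne_zero (α := ℝ)) (hU.eigenpair k (hk.trans_le hn))
      rwa [one_pow, one_mul] at this
  obtain ⟨D, hD, hdec⟩ := exists_uniform_decay hω hb hH hR hmu hτ
    (fun k hk => (hU.pos k (hk.trans_le hn)).le) hlt hv
  refine ⟨D ^ 2 + C * D, by positivity, fun h h0 h1 hhR => ?_⟩
  have hθ : Measurable fun z : Space d => χ (h * z.snd) := (contDiff_cut hχ h).continuous.measurable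
  have hθC : ∀ z : Space d, |χ (h * z.snd)| ≤ 1 := fun z => hχ.abs_le_one _
  have hB : MeasurableSet {ξ : Space d | ξ.snd ∈ Set.Ioi (1 / (3 * h))} :=
    measurable_snd' measurableSet_Ioi
  have hex : ∀ k, ∃ y : L2 (Space d) × L2V (Space d), k < n →
      y ∈ formDomain h (thinCyl ω H h) (thinLat ω H h) ∧
      (pullS h (flip (side k)) (pt 0 (side k).sgn) y.1
        =ᵐ[volume] fun z => χ (h * z.snd) * (v k).1 z) ∧
      (pullV h (flip (side k)) (pt 0 (side k).sgn) y.2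
        =ᵐ[volume] fun z => χ (h * z.snd) • (v k).2 z
          + (v k).1 z • gradient (fun z : Space d => χ (h * z.snd)) z) ∧
      (y.1 =ᵐ[volume] fun x => (pullFactor (Space d) h)⁻¹ * (χ (1 - (side k).sgn * x.snd) *
        (v k).1 (pt (h⁻¹ • x.fst) (h⁻¹ * (1 - (side k).sgn * x.snd))))) := fun k => by
    by_cases hk : k < n
    · obtain ⟨y, hy⟩ := exists_transplanted_end hχ hC hω hH hR h0 hhR (side k) (hv k hk).mem
      exact ⟨y, fun _ => hy⟩
    · exact ⟨0, fun h => absurd h hk⟩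
  choose Φ hΦ using hex
  -- The cut-off is constant up to the height `1 / (3 * h)`, hence the errors come from beyond it.
  have hT : τ * (1 / (3 * h)) = τ / (3 * h) := by ring
  have hdecT := fun k hk => hdec k hk (1 / (3 * h))
  rw [hT] at hdecT
  have he0 := (Real.exp_pos (-(τ / (3 * h)))).le
  have he1 : Real.exp (-(τ / (3 * h))) ≤ 1 := Real.exp_le_one_iff.2 (by
    have : 0 ≤ τ / (3 * h) := by positivity
    linarith)
  refine ⟨Φ, fun k hk => (hΦ k hk).1, fun k hk => (hΦ k hk).2.1, fun k hk => ?_,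
    fun j hj k hk => ?_, fun k hk x hx => ?_⟩
  · exact transplanted_eq_cutMode hχ hω hH hR h0 hhR (side k)
      (lift_fst_coe (hopen _).measurableSet (hU.eigenpair k (hk.trans_le hn)).1.1)
      (hΦ k hk).2.2.2
  · by_cases hs : side j = side k
    · have hj1 := (hΦ j hj).2.1
      rw [hs] at hj1
      have hE := hU.eigenpair j (hj.trans_le hn)
      rw [hs] at hE
      have hin : ⟪(v j).1, (v k).1⟫ = if j = k then (1 : ℝ) else 0 := by
        rw [← hU.orthonormal j (hj.trans_le hn) k (hk.trans_le hn) hs,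
          ← inner_lift_fst (h := 1) (hopen _).measurableSet hE.1.1
            (hU.eigenpair k (hk.trans_le hn)).1.1]
        simp only [v, hs]
      have h2 := inner_transplanted_sub_le h0 hθ (fun z => ⟨hχ.nonneg _, hχ.le_one _⟩) hB
        (fun z hz => (gradient_cut_eq_zero hχ h0 hz).2) hj1 (hΦ k hk).2.1
      rw [hin] at h2
      refine h2.trans ((near_arith (norm_nonneg _) hD he0 he1 (hdecT j hj).1
        (hdecT k hk).1).trans ?_)
      exact mul_le_mul_of_nonneg_right (by linarith [mul_nonneg hC0 hD]) he0
    · rw [inner_eq_zero_of_ends hχ hs (hΦ j hj).2.2.2 (hΦ k hk).2.2.2,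
        if_neg (fun h => hs (congrArg side h)), sub_zero, abs_zero]
      positivity
  · obtain ⟨y, hy, hy1, hy2⟩ := exists_localized_end hχ hC hω hH hR h0 hhR (side k) hx
    refine (residual_transplanted h0 hθ hθC (fun z => norm_gradient_cut_le hχ h0 hC z) hB
      (fun z hz => (gradient_cut_eq_zero hχ h0 hz).1) (hv k hk) hy hy1 hy2 (hΦ k hk).2.1
      (hΦ k hk).2.2.1).trans ?_
    refine (residual_arith h0 h1 hC0 (norm_nonneg _) (norm_nonneg _) hD he0 (hdecT k hk).1
      (hdecT k hk).2).trans ?_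
    have h3 : C * D ≤ D ^ 2 + C * D := by linarith [sq_nonneg D]
    exact mul_le_mul_of_nonneg_right (mul_le_mul_of_nonneg_right h3 he0) (by positivity)

end Quasimodes

/-! ### Norms and eigenvalue systems -/

section Norms

variable {F : Type*} [NormedAddCommGroup F] [InnerProductSpace ℝ F] [FiniteDimensional ℝ F]
  [MeasurableSpace F] [BorelSpace F] {h : ℝ} {Ω S : Set F} {w : F → ℝ}

lemma hNorm_eq (hΩ : MeasurableSet Ω) (h0 : 0 < h) (hw : MemH1 Ω w) :
    hNorm h Ω w = h⁻¹ * Real.sqrt (‖(lift h Ω w).1‖ ^ 2 + ‖(lift h Ω w).2‖ ^ 2) := by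
  rw [← real_inner_self_eq_norm_sq, ← real_inner_self_eq_norm_sq, inner_lift_fst hΩ hw hw,
    inner_lift_snd hΩ hw hw, hNorm]
  conv_rhs => rw [← Real.sqrt_sq (inv_pos.2 h0).le, ← Real.sqrt_mul (sq_nonneg _)]
  congr 1
  field_simp
  ring

lemma inv_le_zpow (h0 : 0 < h) (h1 : h ≤ 1) : h⁻¹ ≤ h ^ (-2 : ℤ) := by
  rw [zpow_neg, show ((2 : ℤ)) = ((2 : ℕ) : ℤ) from rfl, zpow_natCast]
  exact inv_anti₀ (by positivity) (by nlinarith)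

lemma hNorm_le (hΩ : MeasurableSet Ω) (h0 : 0 < h) (h1 : h ≤ 1) (hw : MemH1 Ω w) {A : ℝ}
    (hA : 0 ≤ A) (hle : ‖(lift h Ω w).1‖ ^ 2 + ‖(lift h Ω w).2‖ ^ 2 ≤ A ^ 2) :
    hNorm h Ω w ≤ h ^ (-2 : ℤ) * A := by
  rw [hNorm_eq hΩ h0 hw]
  exact mul_le_mul (inv_le_zpow h0 h1) ((Real.sqrt_le_left hA).2 hle) (Real.sqrt_nonneg _)
    (by positivity)

/-- Restricting a function of class `H¹` to a smaller open set amounts to multiplying the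
corresponding pair by an indicator function. -/
lemma lift_inter (hΩ : IsOpen Ω) {B : Set F} (hB : IsOpen B) (hw : MemH1 Ω w) :
    MemH1 (Ω ∩ B) w ∧ lift h (Ω ∩ B) w
      = (mulL2 (one B) (lift h Ω w).1, mulL2 (one B) (lift h Ω w).2) := by
  have hsub : Ω ∩ B ⊆ Ω := Set.inter_subset_left
  have hm : MeasurableSet (Ω ∩ B) := (hΩ.inter hB).measurableSet
  have hgrad := (weakGrad_spec hw.2).mono hΩ.measurableSet hsub
  have hw' : MemH1 (Ω ∩ B) w :=
    ⟨hw.1.mono_measure (Measure.restrict_mono hsub le_rfl), _, hgrad⟩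
  refine ⟨hw', Prod.ext (Lp.ext ?_) (Lp.ext ?_)⟩
  · filter_upwards [lift_fst_coe (h := h) hm hw', lift_fst_coe (h := h) hΩ.measurableSet hw,
      mulL2_coe (measurable_one hB.measurableSet) (abs_one_le B) (lift h Ω w).1] with x e1 e2 e3
    rw [e1, e3, e2]
    by_cases hx : x ∈ B <;> by_cases hx' : x ∈ Ω <;> simp [hx, hx', one]
  · have hae := (weakGrad_spec hw'.2).ae_eq (hΩ.inter hB) hgrad
    filter_upwards [lift_snd_coe (h := h) hm hw', lift_snd_coe (h := h) hΩ.measurableSet hw,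
      mulL2_coe (measurable_one hB.measurableSet) (abs_one_le B) (lift h Ω w).2,
      (ae_restrict_iff' hm).1 hae] with x e1 e2 e3 e4
    rw [e1, e3, e2]
    by_cases hx : x ∈ B <;> by_cases hx' : x ∈ Ω <;> simp [hx, hx', one]
    rw [e4 ⟨hx', hx⟩]

end Norms

section Systems

variable {F : Type*} [NormedAddCommGroup F] [InnerProductSpace ℝ F] [FiniteDimensional ℝ F]
  [MeasurableSpace F] [BorelSpace F] {h : ℝ} {Ω S : Set F} {lam : ℕ → ℝ} {u : ℕ → F → ℝ}

lemma IsEigenSystem.inner_lift (hu : IsEigenSystem Ω S lam u) (hΩ : IsOpen Ω) (i j : ℕ) :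
    ⟪(lift h Ω (u i)).1, (lift h Ω (u j)).1⟫ = if i = j then (1 : ℝ) else 0 := by
  rw [inner_lift_fst hΩ.measurableSet (hu.eigenpair i).1.1 (hu.eigenpair j).1.1,
    hu.orthonormal i j]

lemma IsEigenSystem.norm_lift (hu : IsEigenSystem Ω S lam u) (hΩ : IsOpen Ω) (j : ℕ) :
    ‖(lift h Ω (u j)).1‖ ^ 2 = 1 := by
  rw [← real_inner_self_eq_norm_sq, hu.inner_lift hΩ, if_pos rfl]

lemma IsEigenSystem.eigenvalue_nonneg (hu : IsEigenSystem Ω S lam u) (hΩ : IsOpen Ω) (h0 : h ≠ 0)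
    (j : ℕ) : 0 ≤ h ^ 2 * lam j := by
  have hE := isWeakEig_lift hΩ h0 (hu.eigenpair j)
  have h1 := hE.eq _ hE.mem
  rw [hu.inner_lift hΩ, if_pos rfl, mul_one, real_inner_self_eq_norm_sq] at h1
  rw [← h1]
  exact sq_nonneg _

/-- Completeness of the system of eigenfunctions: every eigenvector is detected by a member of the
system with the same eigenvalue. -/
lemma IsEigenSystem.exists_inner_ne_zero (hu : IsEigenSystem Ω S lam u) (hΩ : IsOpen Ω)
    (h0 : h ≠ 0) {μ : ℝ} {y : L2 F × L2V F} (hy : IsWeakEig (formDomain h Ω S) μ y) :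
    ∃ j, h ^ 2 * lam j = μ ∧ ⟪(lift h Ω (u j)).1, y.1⟫ ≠ 0 := by
  obtain ⟨J, a, hJ, hW⟩ := hu.complete _ _ (isEigenpair_of_isWeakEig hΩ h0 hy).1
  have hsum := fst_eq_sum_lift hΩ.measurableSet hy.mem (fun j _ => (hu.eigenpair j).1.1) hW
  by_contra! hc
  refine hy.ne_zero ?_
  rw [← inner_self_eq_zero (𝕜 := ℝ), congrArg (fun f => ⟪f, y.1⟫) hsum, sum_inner]
  refine Finset.sum_eq_zero fun j hj => ?_
  rw [real_inner_smul_left, hc j ?_, mul_zero]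
  rw [hJ j hj]
  field_simp

variable (F) in
/-- The abstract approximation result for the form domains of mixed boundary value problems. -/
lemma exists_orthogonal_combinations (p κ : ℕ) {Ls g : ℝ} (hg : 0 < g) (hLs : 0 ≤ Ls) :
    ∃ C₀ > 0, ∃ ε₀ > 0, ∀ (h : ℝ) (Ω S : Set F) (lam : ℕ → ℝ) (u : ℕ → F → ℝ), 0 < h → IsOpen Ω →
    IsEigenSystem Ω S lam u → ∀ (Φ : ℕ → L2 F × L2V F) (Lam : ℕ → ℝ) (C : ℝ),
    (∀ x ∈ formDomain h Ω S,
      (Ls + g) * ‖x.1‖ ^ 2 - C * ∑ i : Fin (p + κ), ⟪(Φ i).1, x.1⟫ ^ 2 ≤ ‖x.2‖ ^ 2) →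
    (∀ k < p + κ, Φ k ∈ formDomain h Ω S) → (∀ k < p + κ, 0 ≤ Lam k) →
    (∀ k < p, Lam k ≤ Ls - g) → (∀ k, p ≤ k → k < p + κ → Lam k = Ls) →
    ∀ ε, 0 ≤ ε → ε ≤ ε₀ →
    (∀ j < p + κ, ∀ k < p + κ, |⟪(Φ j).1, (Φ k).1⟫ - if j = k then (1 : ℝ) else 0| ≤ ε) →
    (∀ k < p + κ, ∀ v ∈ formDomain h Ω S,
      |⟪(Φ k).2, v.2⟫ - Lam k * ⟪(Φ k).1, v.1⟫| ≤ ε * (‖v.1‖ + ‖v.2‖)) →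
    (∀ k < p + κ, h ^ 2 * lam k ≤ Ls + g / 2) ∧
      ∃ b ∈ Matrix.orthogonalGroup (Fin κ) ℝ, ∀ i : Fin κ,
      ‖(lift h Ω (u (p + i)) - ∑ r : Fin κ, b i r • Φ (p + r)).1‖ ≤ C₀ * ε ∧
      ‖(lift h Ω (u (p + i)) - ∑ r : Fin κ, b i r • Φ (p + r)).2‖ ≤ C₀ * ε := by
  obtain ⟨C₀, hC₀, ε₀, hε₀, key⟩ := exists_orthogonal_quasimodes
    (L := L2 F) (M := L2V F) p κ hg hLs
  refine ⟨C₀, hC₀, ε₀, hε₀, fun h Ω S lam u h0 hΩ hu => ?_⟩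
  exact key (formDomain h Ω S) (isClosed_formDomain _ _ _) (fun j => h ^ 2 * lam j)
    (fun j => lift h Ω (u j))
    (fun i j hij => mul_le_mul_of_nonneg_left (hu.mono hij) (sq_nonneg h))
    (fun j => isWeakEig_lift hΩ h0.ne' (hu.eigenpair j)) (fun i j => hu.inner_lift hΩ i j)
    (fun μ y hy => hu.exists_inner_ne_zero hΩ h0.ne' hy)

end Systems

section Final

variable {d : ℕ} {χ : ℝ → ℝ} {ω : Set (EuclideanSpace ℝ (Fin d))}
  {H : Side → EuclideanSpace ℝ (Fin d) → ℝ} {R₀ h C : ℝ}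

lemma exists_height_bound (hb : Bornology.IsBounded ω)
    (hH : ∀ s, ContinuousOn (H s) (closure ω)) : ∃ R₀, ∀ s, ∀ η ∈ closure ω, |H s η| ≤ R₀ := by
  choose R hR using fun s => hb.isCompact_closure.exists_bound_of_continuousOn (hH s)
  refine ⟨max (R .plus) (R .minus), fun s η hη => (hR s η hη).trans ?_⟩
  cases s
  · exact le_max_left _ _
  · exact le_max_right _ _

lemma exists_small_mul_le (A : ℝ) {B : ℝ} (hB : 0 < B) :
    ∃ h₀ > 0, ∀ h : ℝ, 0 < h → h ≤ h₀ → h * A ≤ B := by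
  refine ⟨B / (|A| + 1), by positivity, fun h h0 hh => ?_⟩
  rw [le_div_iff₀ (by positivity)] at hh
  nlinarith [le_abs_self A]

/-- The exponential error is small for small `h`, by `exp (-x) ≤ 1 / x`. -/
lemma mul_exp_le {D ε τ : ℝ} (hD : 0 ≤ D) (hτ : 0 < τ) (h0 : 0 < h)
    (hh : h * (3 * D / τ) ≤ ε) : D * Real.exp (-(τ / (3 * h))) ≤ ε := by
  refine le_trans ?_ hh
  have h1 : 0 < τ / (3 * h) := by positivity
  have h2 : Real.exp (-(τ / (3 * h))) ≤ (τ / (3 * h))⁻¹ := by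
    rw [Real.exp_neg]
    exact inv_anti₀ h1 (by linarith [Real.add_one_le_exp (τ / (3 * h))])
  refine (mul_le_mul_of_nonneg_left h2 hD).trans (le_of_eq ?_)
  field_simp

lemma exists_lower_gap {Lam : ℕ → ℝ} {p N : ℕ} (hp : p < N)
    (hmono : ∀ j k, j ≤ k → k < N → Lam j ≤ Lam k) (hlt : ∀ k < p, Lam k < Lam p) :
    ∃ g > 0, ∀ k < p, Lam k ≤ Lam p - g := by
  rcases Nat.eq_zero_or_pos p with rfl | h0
  · exact ⟨1, one_pos, fun k hk => absurd hk (Nat.not_lt_zero k)⟩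
  · refine ⟨Lam p - Lam (p - 1), sub_pos.2 (hlt _ (by omega)), fun k hk => ?_⟩
    rw [sub_sub_cancel]
    exact hmono k (p - 1) (by omega) (by omega)

/-- A gap above and below the limit eigenvalue, in both semi-infinite cylinders. -/
lemma exists_common_gap (hω : IsOpen ω) (hb : Bornology.IsBounded ω)
    (hH : ∀ s, ContinuousOn (H s) (closure ω)) (hR : ∀ s, ∀ η ∈ closure ω, |H s η| ≤ R₀)
    {mu1 : ℝ} (hmu : IsFirstDirichletEigenvalue ω mu1) {δ : ℝ} (hδ : 0 < δ) {N : ℕ} {Lam : ℕ → ℝ}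
    {side : ℕ → Side} {U : ℕ → Space d → ℝ} (hU : IsLimitEigenList ω H mu1 δ N Lam side U)
    {p n : ℕ} (hpN : p < N) (hnN : n ≤ N) (hlt : ∀ k < p, Lam k < Lam p)
    (hgt : ∀ k, n ≤ k → k < N → Lam p < Lam k) {M : ℝ} (hM : Lam p < M) :
    ∃ g > 0, Lam p + g ≤ M ∧ (∀ k < p, Lam k ≤ Lam p - g) ∧ ∃ C : ℝ, 0 ≤ C ∧
      ∀ s, ∀ x ∈ formDomain 1 (semiCyl ω (H s)) (semiLat ω (H s)),
      (Lam p + g) * ‖x.1‖ ^ 2 - C * ∑ k : Fin n, (if side k = s then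
        ⟪(lift 1 (semiCyl ω (H (side k))) (U k)).1, x.1⟫ ^ 2 else 0) ≤ ‖x.2‖ ^ 2 := by
  -- The minimum of the gaps at the two ends and of the gap below the eigenvalue, limited by the
  -- threshold `M`.
  choose g hg C hC hgap using fun s => semi_limit_gap hω hb hH hR hmu hδ hU hpN hnN hgt s
  obtain ⟨g', hg', hlow⟩ := exists_lower_gap hpN hU.mono hlt
  have hm1 : min (min (g .plus) (g .minus)) (min g' (M - Lam p)) ≤ min g' (M - Lam p) :=
    min_le_right _ _
  refine ⟨min (min (g .plus) (g .minus)) (min g' (M - Lam p)),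
    lt_min (lt_min (hg _) (hg _)) (lt_min hg' (sub_pos.2 hM)), ?_, fun k hk => ?_,
    C .plus + C .minus, add_nonneg (hC _) (hC _), fun s x hx => ?_⟩
  · linarith [min_le_right g' (M - Lam p)]
  · linarith [min_le_left g' (M - Lam p), hlow k hk]
  · have hgs : min (min (g .plus) (g .minus)) (min g' (M - Lam p)) ≤ g s :=
      (min_le_left _ _).trans (by cases s; exacts [min_le_left _ _, min_le_right _ _])
    have hCs : C s ≤ C .plus + C .minus := by
      cases s <;> linarith [hC .plus, hC .minus]
    have e : ∑ k : Fin n, (if side k = s then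
        ⟪(lift 1 (semiCyl ω (H (side k))) (U k)).1, x.1⟫ ^ 2 else 0)
        = ∑ k : Fin n, (if side k = s then
        ⟪(lift 1 (semiCyl ω (H s)) (U k)).1, x.1⟫ ^ 2 else 0) := by
      refine Finset.sum_congr rfl fun k _ => ?_
      by_cases hk : side k = s
      · rw [if_pos hk, if_pos hk, hk]
      · rw [if_neg hk, if_neg hk]
    rw [e]
    have hS : 0 ≤ ∑ k : Fin n, (if side k = s then
        ⟪(lift 1 (semiCyl ω (H s)) (U k)).1, x.1⟫ ^ 2 else 0) :=
      Finset.sum_nonneg fun k _ => by positivity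
    have h1 := mul_le_mul_of_nonneg_right hgs (sq_nonneg ‖x.1‖)
    have h2 := mul_le_mul_of_nonneg_right hCs hS
    linarith [hgap s x hx]

end Final

/-! ### Approximation and localization of eigenfunctions -/

section Localization

variable {d : ℕ} {χ : ℝ → ℝ} {ω : Set (EuclideanSpace ℝ (Fin d))}
  {H : Side → EuclideanSpace ℝ (Fin d) → ℝ} {R₀ h : ℝ}

/-- The constant in `thin_decay` is uniform in the eigenvalue as long as a margin `m` is left below
the threshold. -/
lemma decay_factor_le {lam τ mu1 m : ℝ} (hlam : 0 ≤ lam) (hm : 0 < m)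
    (hlt : lam + τ ^ 2 + m ≤ mu1) :
    (1 + 2 * lam + 4 * τ ^ 2) * (mu1 / (mu1 - lam - τ ^ 2))
      ≤ (1 + 2 * mu1 + 4 * τ ^ 2) * (mu1 / m) := by
  have h1 : lam ≤ mu1 := by nlinarith [sq_nonneg τ]
  have h2 : mu1 / (mu1 - lam - τ ^ 2) ≤ mu1 / m :=
    div_le_div_of_nonneg_left (hlam.trans h1) hm (by linarith)
  refine mul_le_mul (by linarith) h2 (div_nonneg (hlam.trans h1) (by linarith)) ?_
  nlinarith [sq_nonneg τ]

/-- Exponential localization near the ends of an eigenfunction with an eigenvalue below the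
threshold. -/
lemma hNorm_middle_le (hω : IsOpen ω) (hb : Bornology.IsBounded ω)
    (hH : ∀ s, ContinuousOn (H s) (closure ω)) (hR : ∀ s, ∀ η ∈ closure ω, |H s η| ≤ R₀)
    {mu1 : ℝ} (hmu : IsFirstDirichletEigenvalue ω mu1) (h0 : 0 < h) (h1 : h ≤ 1)
    (hhR : h * R₀ < 1) {lam : ℕ → ℝ} {u : ℕ → Space d → ℝ}
    (hu : IsEigenSystem (thinCyl ω H h) (thinLat ω H h) lam u) {τ m : ℝ} (hτ : 0 ≤ τ) (hm : 0 < m)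
    {j : ℕ} (hlt : h ^ 2 * lam j + τ ^ 2 + m ≤ mu1) (t : ℝ) :
    hNorm h (thinCyl ω H h ∩ {x | |x.snd| < 1 - t}) (u j)
      ≤ Real.sqrt ((1 + 2 * mu1 + 4 * τ ^ 2) * (mu1 / m)) * (3 * Real.exp (τ * R₀))
        * h ^ (-2 : ℤ) * Real.exp (-(τ * t / h)) := by
  have hΩ := isOpen_thinCyl hω h0.ne' hH
  have hB : IsOpen {x : Space d | |x.snd| < 1 - t} :=
    isOpen_lt (continuous_abs.comp continuous_snd') continuous_const
  have hl0 := hu.eigenvalue_nonneg hΩ h0.ne' j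
  obtain ⟨hmem, hlift⟩ := lift_inter (h := h) hΩ hB (hu.eigenpair j).1.1
  have hmu0 : 0 ≤ mu1 := by nlinarith [sq_nonneg τ]
  have hA : 0 ≤ (1 + 2 * mu1 + 4 * τ ^ 2) * (mu1 / m) := by positivity
  have hdec := thin_decay hω hb hH hR hmu h0 hhR hl0 hτ (by linarith)
    (isWeakEig_lift hΩ h0.ne' (hu.eigenpair j)) t
  rw [hu.norm_lift hΩ, mul_one] at hdec
  refine (hNorm_le (hΩ.inter hB).measurableSet h0 h1 hmem
    (A := Real.sqrt ((1 + 2 * mu1 + 4 * τ ^ 2) * (mu1 / m))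
      * (3 * Real.exp (τ * R₀) * Real.exp (-(τ * t / h)))) (by positivity) ?_).trans
    (le_of_eq (by ring))
  rw [hlift, mul_pow, Real.sq_sqrt hA]
  exact hdec.trans (mul_le_mul_of_nonneg_right (decay_factor_le hl0 hm hlt) (sq_nonneg _))

/-- The norm of the difference of an eigenfunction and a combination of quasimodes. -/
lemma hNorm_sub_le (hω : IsOpen ω) (hH : ∀ s, ContinuousOn (H s) (closure ω))
    (h0 : 0 < h) (h1 : h ≤ 1) {lam : ℕ → ℝ} {u : ℕ → Space d → ℝ}
    (hu : IsEigenSystem (thinCyl ω H h) (thinLat ω H h) lam u) (j : ℕ) {κ : ℕ} {a : ℝ}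
    {b : Fin κ → ℝ} {V : Fin κ → Space d → ℝ} {Φ : Fin κ → L2 (Space d) × L2V (Space d)}
    (hΦ : ∀ r, Φ r ∈ formDomain h (thinCyl ω H h) (thinLat ω H h))
    (hV : ∀ r, (Φ r).1 =ᵐ[volume.restrict (thinCyl ω H h)] fun x => a * V r x) {A : ℝ}
    (hA1 : ‖(lift h (thinCyl ω H h) (u j) - ∑ r, b r • Φ r).1‖ ≤ A)
    (hA2 : ‖(lift h (thinCyl ω H h) (u j) - ∑ r, b r • Φ r).2‖ ≤ A) :
    MemH10 (thinCyl ω H h) (thinLat ω H h) (fun x => u j x - a * ∑ r, b r * V r x) ∧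
      hNorm h (thinCyl ω H h) (fun x => u j x - a * ∑ r, b r * V r x)
        ≤ h ^ (-2 : ℤ) * (2 * A) := by
  have hΩ := isOpen_thinCyl hω h0.ne' hH
  have hA0 : 0 ≤ A := (norm_nonneg _).trans hA1
  have hmem : lift h (thinCyl ω H h) (u j) - ∑ r, b r • Φ r
      ∈ formDomain h (thinCyl ω H h) (thinLat ω H h) :=
    Submodule.sub_mem _ (lift_mem_formDomain hΩ.measurableSet h0.ne' (hu.eigenpair j).1)
      (Submodule.sum_mem _ fun r _ => Submodule.smul_mem _ _ (hΦ r))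
  have hae : (fun x => u j x - a * ∑ r, b r * V r x) =ᵐ[volume.restrict (thinCyl ω H h)]
      (lift h (thinCyl ω H h) (u j) - ∑ r, b r • Φ r).1 := by
    rw [Prod.fst_sub, fst_sum_smul]
    have hVall : ∀ᵐ x ∂(volume.restrict (thinCyl ω H h)), ∀ r, (Φ r).1 x = a * V r x :=
      ae_all_iff.2 hV
    filter_upwards [ae_restrict_of_ae (Lp.coeFn_sub (lift h (thinCyl ω H h) (u j)).1
        (∑ r, b r • (Φ r).1)),
      ae_restrict_of_ae (coeFn_sum_smul Finset.univ b fun r => (Φ r).1), hVall,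
      ae_restrict_of_ae (lift_fst_coe (h := h) hΩ.measurableSet (hu.eigenpair j).1.1),
      ae_restrict_mem hΩ.measurableSet] with x e1 e2 e3 e4 hx
    rw [e1, Pi.sub_apply, e2, e4, Set.indicator_of_mem hx, Finset.mul_sum]
    congr 1
    refine Finset.sum_congr rfl fun r _ => ?_
    rw [e3 r]
    ring
  obtain ⟨hH10, hlift⟩ := memH10_of_mem hΩ h0.ne' hmem hae
  refine ⟨hH10, hNorm_le hΩ.measurableSet h0 h1 hH10.1 (by positivity) ?_⟩
  rw [hlift]
  have h2 := pow_le_pow_left₀ (norm_nonneg _) hA1 2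
  have h3 := pow_le_pow_left₀ (norm_nonneg _) hA2 2
  nlinarith

end Localization

end ThinCylinder

end

theorem mainTheorem2 (d : ℕ) (hd : 1 ≤ d)
    (ω : Set (EuclideanSpace ℝ (Fin d)))
    (hω_open : IsOpen ω) (hω_conn : IsConnected ω) (hω_bdd : Bornology.IsBounded ω)
    (H : ThinCylinder.Side → EuclideanSpace ℝ (Fin d) → ℝ)
    (hH : ∀ s, ∃ K, LipschitzOnWith K (H s) (closure ω))
    (χ : ℝ → ℝ) (hχ : ThinCylinder.IsCutoff χ)
    (mu1 : ℝ) (hmu1 : ThinCylinder.IsFirstDirichletEigenvalue ω mu1)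
    (δ : ℝ) (hδ : 0 < δ) (N : ℕ)
    (Lam : ℕ → ℝ) (side : ℕ → ThinCylinder.Side) (U : ℕ → ThinCylinder.Space d → ℝ)
    (hU : ThinCylinder.IsLimitEigenList ω H mu1 δ N Lam side U)
    (p κ : ℕ) (hκ : 1 ≤ κ) (hpκ : p + κ ≤ N)
    (hlt : ∀ k < p, Lam k < Lam p)
    (heq : ∀ k, p ≤ k → k < p + κ → Lam k = Lam p)
    (hgt : ∀ k, p + κ ≤ k → k < N → Lam p < Lam k)
    (τ : ℝ) (hτ : 0 < τ) (hτ' : τ < Real.sqrt (mu1 - Lam p)) :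
    ∃ c : ℝ, 0 < c ∧ ∃ h₀ : ℝ, 0 < h₀ ∧ ∀ h : ℝ, 0 < h → h ≤ h₀ →
      ∀ (lam : ℕ → ℝ) (u : ℕ → ThinCylinder.Space d → ℝ),
        ThinCylinder.IsEigenSystem (ThinCylinder.thinCyl ω H h) (ThinCylinder.thinLat ω H h)
          lam u →
        (∃ b ∈ Matrix.orthogonalGroup (Fin κ) ℝ, ∀ l : Fin κ,
          ThinCylinder.MemH10 (ThinCylinder.thinCyl ω H h) (ThinCylinder.thinLat ω H h)
            (fun x => u (p + l) x - h ^ (-(d : ℝ) / 2) *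
              ∑ r : Fin κ, b l r * ThinCylinder.cutMode χ h (side (p + r)) (U (p + r)) x) ∧
          ThinCylinder.hNorm h (ThinCylinder.thinCyl ω H h)
            (fun x => u (p + l) x - h ^ (-(d : ℝ) / 2) *
              ∑ r : Fin κ, b l r * ThinCylinder.cutMode χ h (side (p + r)) (U (p + r)) x)
            ≤ c * h ^ (-2 : ℤ) * Real.exp (-(τ / (3 * h)))) ∧
        ∀ l : Fin κ, ∀ t : ℝ, 0 < t → t ≤ 1 / 3 →
          ThinCylinder.hNorm h (ThinCylinder.thinCyl ω H h ∩ {x | |x.snd| < 1 - t}) (u (p + l))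
            ≤ c * h ^ (-2 : ℤ) * Real.exp (-(τ * t / h)) := by
  open ThinCylinder in
  have hHc : ∀ s, ContinuousOn (H s) (closure ω) := fun s =>
    let ⟨_, hK⟩ := hH s
    hK.continuousOn
  obtain ⟨R₀, hR⟩ := exists_height_bound hω_bdd hHc
  have hpN : p < N := by omega
  have hτ2 : Lam p + τ ^ 2 < mu1 := by
    have := (Real.lt_sqrt hτ.le).1 hτ'
    linarith
  have hLam0 : 0 ≤ Lam p := (hU.pos p hpN).le
  have hLamp : ∀ k < p + κ, Lam k ≤ Lam p := fun k hk => by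
    rcases lt_or_ge k p with h1 | h1
    · exact (hlt k h1).le
    · exact (heq k h1 hk).le
  obtain ⟨C, hC0, hC⟩ := hχ.exists_bound
  -- The gap `g` also stays below `mu1 - τ²`, so that the eigenvalues of the cluster leave the
  -- margin `g / 2` which the decay estimate needs.
  obtain ⟨g, hg, hgM, hlow, D₁, hD₁, hgap⟩ := exists_common_gap hω_open hω_bdd hHc hR hmu1 hδ hU
    hpN hpκ hlt hgt (M := mu1 - τ ^ 2) (by linarith)
  obtain ⟨C₀, hC₀, ε₀, hε₀, hquasi⟩ := exists_orthogonal_combinations (Space d) p κ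
    (half_pos hg) hLam0
  obtain ⟨D, hD, hmodes⟩ := exists_quasimodes hχ hω_open hω_bdd hHc hR hmu1 hU hpκ hτ.le
    fun k hk => by linarith [hLamp k hk]
  -- Conditions on `h`: the ends do not interact, the losses of localization fit into the gap, and
  -- the errors of the quasimodes are small enough.
  obtain ⟨h₁, h₁0, hh₁⟩ := exists_small_mul_le R₀ (B := 1 / 3) (by norm_num)
  obtain ⟨h₂, h₂0, hh₂⟩ := exists_small_mul_le (Lam p + g + 4 * C ^ 2) (half_pos hg)
  obtain ⟨h₃, h₃0, hh₃⟩ := exists_small_mul_le (3 * D / τ) hε₀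
  set c₂ : ℝ := Real.sqrt ((1 + 2 * mu1 + 4 * τ ^ 2) * (mu1 / (g / 2))) *
    (3 * Real.exp (τ * R₀)) with hc₂
  have hc₂0 : 0 ≤ c₂ := by positivity
  refine ⟨2 * (C₀ * D) + c₂ + 1, by positivity, min (min 1 h₁) (min h₂ h₃),
    lt_min (lt_min one_pos h₁0) (lt_min h₂0 h₃0), fun h h0 hh lam u hu => ?_⟩
  have hh1 : h ≤ 1 := hh.trans ((min_le_left _ _).trans (min_le_left _ _))
  have hhR : h * R₀ ≤ 1 / 3 := hh₁ h h0 (hh.trans ((min_le_left _ _).trans (min_le_right _ _)))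
  have hhC := hh₂ h h0 (hh.trans ((min_le_right _ _).trans (min_le_left _ _)))
  have hhε := mul_exp_le hD hτ h0
    (hh₃ h h0 (hh.trans ((min_le_right _ _).trans (min_le_right _ _))))
  have hz : (0 : ℝ) < h ^ (-2 : ℤ) := by positivity
  have hΩ := isOpen_thinCyl hω_open h0.ne' hHc
  obtain ⟨Φ, hΦ, hΦ1, hΦ2, hnear, hres⟩ := hmodes h h0 hh1 hhR
  obtain ⟨hl, b, hb, hclose⟩ := hquasi h _ _ lam u h0 hΩ hu Φ Lam D₁
    (fun x hx => thin_gap (v := fun k => lift 1 (semiCyl ω (H (side k))) (U k)) hχ hC hω_open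
      hω_bdd hHc hR hmu1 h0 hh1 hhR hg (by linarith [sq_nonneg τ]) hD₁ hhC hgap hΦ1 hx)
    hΦ (fun k hk => (hU.pos k (hk.trans_le hpκ)).le) (fun k hk => by linarith [hlow k hk]) heq
    _ (by positivity) hhε hnear hres
  refine ⟨⟨b, hb, fun l => ?_⟩, fun l t _ _ => ?_⟩
  · obtain ⟨h1, h2⟩ := hNorm_sub_le hω_open hHc h0 hh1 hu (p + l) (b := b l)
      (Φ := fun r => Φ (p + r)) (V := fun r => cutMode χ h (side (p + r)) (U (p + r)))
      (fun r => hΦ _ (by omega)) (fun r => hΦ2 _ (by omega)) (hclose l).1 (hclose l).2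
    refine ⟨h1, h2.trans ?_⟩
    have h3 : 0 ≤ h ^ (-2 : ℤ) * Real.exp (-(τ / (3 * h))) * (c₂ + 1) := by positivity
    linarith
  · refine (hNorm_middle_le hω_open hω_bdd hHc hR hmu1 h0 hh1 (by linarith) hu hτ.le (half_pos hg)
      (j := p + l) (by linarith [hl (p + l) (by omega)]) t).trans ?_
    rw [mul_assoc, mul_assoc _ (h ^ (-2 : ℤ))]
    refine mul_le_mul_of_nonneg_right ?_ (by positivity)
    linarith [mul_nonneg hC₀.le hD]
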